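/- **Theorem 1.** Let $r>\frac52$, let $f:\mathbb R\to\mathbb R$ be of class $C^3$, and let $q(\xi,v;\varepsilon)$ be a real function defined for $\xi,v\in\mathbb R$ and $0\le\varepsilon<\varepsilon_1$ (some $\varepsilon_1>0$) that is $2\pi$-periodic in $\xi$, of class $C^1$ in $(\xi,v,\varepsilon)$ up to $\varepsilon=0$, and of class $C^3$ in $(\xi,v)$ for each $\varepsilon$. Consider for $\varepsilon>0$ $$\ddot x=f(x)+\varepsilon^r\,q\Big(\frac x\varepsilon,\dot x;\varepsilon\Big)\cos\frac t\varepsilon ,$$ or, in the phase plane $z=(x,\dot x)$, the corresponding $2\pi\varepsilon$-periodic first-order system. Suppose that the unperturbed system $\ddot x=f(x)$, i.e. $\dot z=X_f(z):=(\dot x,f(x))$, has a hyperbolic equilibrium $e$ and a homoclinic connection to it, i.e. a nonconstant integral curve $z_0=(x_0,\dot x_0)$ with $z_0(t)\to e$ as $t\to\pm\infty$. For $k\in\mathbb Z\setminus\{0\}$ put $$\mathcal C_k:=\{t^*\in\mathbb R:\ \dot x_0(t^*)=1/k\},\qquad q_k(v):=\frac1{2\pi}\int_0^{2\pi}q(\xi,v;0)\,e^{-ik\xi}\,d\xi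 ,$$ and assume that $f(x_0(t^*))\ne0$ for all $k\neq 0$ and all $t^*\in\mathcal C_k$. *Displacement function.* For small $\delta>0$ let $\Sigma=\{Z+s(-f(x_0(0)),\dot x_0(0)):|s|\le\delta\}$, $Z=z_0(0)$, be the segment normal to the separatrix at $Z$. For $t_0\in\mathbb R$ let $p$ be the hyperbolic fixed point, $\delta$-close to $e$, of the return map of the section $\{t=t_0\}$ of the perturbed system. Let $Z^{s}$ be the first intersection with $\Sigma$ of the branch of the stable manifold of $p$ close to the separatrix: $Z^{s}\in\Sigma$ lies on the stable manifold of $p$, and the integral curve $z^{s}(t)$ with $z^{s}(t_0)=Z^{s}$ satisfies $|z^{s}(t)-z_0(t-t_0)|\le\delta$ and $z^{s}(t)\notin\Sigma$ for all $t>t_0$. Let $Z^{u}$ be the analogous point for the unstable manifold (with $t<t_0$). Then $$\mathcal D(t_0):=X_f(Z)\times(Z^{u}-Z^{s}),\qquad X\times Y:=X_1Y_2-X_2Y_1 ,$$ that is, $|X_f(Z)|$ times the signed distance along $\Sigma$ from $Z^s$ to $Z^u$. *Conclusion.* The cardinality of $\mathcal C_k$ is bounded uniformly in $k\ne0$. For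 every sufficiently small $\delta$ the displacement function is well defined (its value exists and is unique) for all sufficiently small $\varepsilon>0$ and all $t_0\in\mathbb R$; and, uniformly in $t_0\in\mathbb R$, as $\varepsilon\to0^+$, $$\mathcal D(t_0)=\varepsilon^{r+\frac12}\Big(\mathcal A_\varepsilon\cos\frac{t_0}\varepsilon+\mathcal B_\varepsilon\sin\frac{t_0}\varepsilon\Big)+O\big(\varepsilon^{r+1}+\varepsilon^{2r-2}\big),$$ where $$\mathcal A_\varepsilon:=\sqrt{2\pi}\;\mathrm{Re}\,S_\varepsilon,\qquad \mathcal B_\varepsilon:=\sqrt{2\pi}\;\mathrm{Im}\,S_\varepsilon,\qquad S_\varepsilon:=\sum_{k\in\mathbb Z\setminus\{0\}}\ \sum_{t^*\in\mathcal C_k}\frac{q_k(k^{-1})\,e^{i\left(\frac{k x_0(t^*)-t^*}{\varepsilon}+\sigma^*\frac\pi4\right)}}{k\,|k|^{1/2}\,|f(x_0(t^*))|^{1/2}},$$ $\sigma^*:=kf(x_0(t^*))/|kf(x_0(t^*))|=\pm1$, and the series over $k$ converges absolutely. -/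

import Mathlib

open Set Filter Topology

noncomputable section

namespace Melnikov

/-- The phase plane, with coordinates `z = (x, ẋ)`. -/
abbrev Plane : Type := ℝ × ℝ

/-- `u` solves the (non-autonomous) system `ż = F t z` on the interval `I`. -/
def IsSolOn (F : ℝ → Plane → Plane) (u : ℝ → Plane) (I : Set ℝ) : Prop :=
  ∀ t ∈ I, HasDerivWithinAt u (F t (u t)) I t

/-- The first-order form `X_f (x, ẋ) = (ẋ, f x)` of the unperturbed equation `ẍ = f x`. -/
def unperturbed (f : ℝ → ℝ) (z : Plane) : Plane := (z.2, f z.1)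

/-- The first-order form of `ẍ = f x + ε ^ r * q (x / ε, ẋ; ε) * cos (t / ε)`. -/
def perturbed (f : ℝ → ℝ) (q : ℝ → ℝ → ℝ → ℝ) (r ε : ℝ) (t : ℝ) (z : Plane) : Plane :=
  (z.2, f z.1 + ε ^ r * (q (z.1 / ε) z.2 ε * Real.cos (t / ε)))

/-- `p` is a hyperbolic equilibrium of the autonomous system `ż = X z`: the linearization at `p`
has no eigenvalue on the imaginary axis. -/
def IsHyperbolicEquilibrium (X : Plane → Plane) (p : Plane) : Prop :=
  X p = 0 ∧ ∃ A : Plane →L[ℝ] Plane, HasFDerivAt X A p ∧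
    ∀ μ : ℂ, μ.re = 0 → Polynomial.aeval μ (A : Plane →ₗ[ℝ] Plane).charpoly ≠ 0

/-- `z₀` is a homoclinic connection of the point `e` for `ż = X z`. -/
def IsHomoclinic (X : Plane → Plane) (e : Plane) (z₀ : ℝ → Plane) : Prop :=
  (∀ t, HasDerivAt z₀ (X (z₀ t)) t) ∧ (∃ t, z₀ t ≠ e) ∧
    Tendsto z₀ atTop (𝓝 e) ∧ Tendsto z₀ atBot (𝓝 e)

/-- On `U`, the map `P` sends the state at time `t₀` to the state at time `t₀ + T`.  If `F` is
`T`-periodic in time, this is the return map of the section `{t = t₀}`. -/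
def IsReturnMapOn (F : ℝ → Plane → Plane) (T t₀ : ℝ) (P : Plane → Plane) (U : Set Plane) : Prop :=
  ∀ z ∈ U, ∃ u : ℝ → Plane, IsSolOn F u (Icc t₀ (t₀ + T)) ∧ u t₀ = z ∧ u (t₀ + T) = P z

/-- `p` is a hyperbolic fixed point of the return map of the section `{t = t₀}`: the derivative of
the return map at `p` has no eigenvalue on the unit circle. -/
def IsHyperbolicFixedPoint (F : ℝ → Plane → Plane) (T t₀ : ℝ) (p : Plane) : Prop :=
  ∃ (P : Plane → Plane) (A : Plane →L[ℝ] Plane), (∃ U ∈ 𝓝 p, IsReturnMapOn F T t₀ P U) ∧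
    P p = p ∧ HasFDerivAt P A p ∧
    ∀ μ : ℂ, ‖μ‖ = 1 → Polynomial.aeval μ (A : Plane →ₗ[ℝ] Plane).charpoly ≠ 0

/-- The stable manifold of a fixed point `p` of the return map of `{t = t₀}`: the points whose
forward iterates are all defined and converge to `p`. -/
def stableManifold (F : ℝ → Plane → Plane) (T t₀ : ℝ) (p : Plane) : Set Plane :=
  {w | ∃ u : ℝ → Plane, IsSolOn F u (Ici t₀) ∧ u t₀ = w ∧
    Tendsto (fun n : ℕ => u (t₀ + n * T)) atTop (𝓝 p)}

/-- The unstable manifold: the same with backward iterates. -/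
def unstableManifold (F : ℝ → Plane → Plane) (T t₀ : ℝ) (p : Plane) : Set Plane :=
  {w | ∃ u : ℝ → Plane, IsSolOn F u (Iic t₀) ∧ u t₀ = w ∧
    Tendsto (fun n : ℕ => u (t₀ - n * T)) atTop (𝓝 p)}

/-- The segment through `Z` normal to the vector `X Z = (a, b)`, i.e. parallel to `(-b, a)`. -/
def normalSegment (X : Plane → Plane) (Z : Plane) (δ : ℝ) : Set Plane :=
  {w | ∃ s : ℝ, |s| ≤ δ ∧ w = Z + s • (-(X Z).2, (X Z).1)}

/-- `w` is the first intersection with the segment `S`, counted from `p` in time of flight, of the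
branch of the stable manifold of `p` that is `δ`-close to the separatrix `z₀`: the integral curve
through `w` at time `t₀` follows `z₀ (t - t₀)` and does not meet `S` at any later time. -/
def IsFirstStablePoint (F : ℝ → Plane → Plane) (T : ℝ) (z₀ : ℝ → Plane) (S : Set Plane)
    (δ t₀ : ℝ) (p w : Plane) : Prop :=
  w ∈ S ∧ w ∈ stableManifold F T t₀ p ∧ ∃ u : ℝ → Plane, IsSolOn F u (Ici t₀) ∧ u t₀ = w ∧
    ∀ t, t₀ < t → ‖u t - z₀ (t - t₀)‖ ≤ δ ∧ u t ∉ S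

/-- The analogue for the unstable manifold, with time reversed. -/
def IsFirstUnstablePoint (F : ℝ → Plane → Plane) (T : ℝ) (z₀ : ℝ → Plane) (S : Set Plane)
    (δ t₀ : ℝ) (p w : Plane) : Prop :=
  w ∈ S ∧ w ∈ unstableManifold F T t₀ p ∧ ∃ u : ℝ → Plane, IsSolOn F u (Iic t₀) ∧ u t₀ = w ∧
    ∀ t, t < t₀ → ‖u t - z₀ (t - t₀)‖ ≤ δ ∧ u t ∉ S

/-- The cross product in the plane. -/
def cross (X Y : Plane) : ℝ := X.1 * Y.2 - X.2 * Y.1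

/-- `d` is the value at `t₀` of the displacement function of the perturbed system: the signed
distance along the segment normal to the separatrix at `Z = z₀ 0`, multiplied by the constant
`|X_f Z|`, from the first point of the stable manifold to that of the unstable manifold.  All of
this refers to a hyperbolic fixed point `p` of the return map `δ`-close to the equilibrium `e`. -/
def IsDisplacement (f : ℝ → ℝ) (q : ℝ → ℝ → ℝ → ℝ) (r : ℝ) (e : Plane) (z₀ : ℝ → Plane)
    (δ ε t₀ d : ℝ) : Prop :=
  let F := perturbed f q r ε
  let T := 2 * Real.pi * ε
  let S := normalSegment (unperturbed f) (z₀ 0) δ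
  ∃ p zs zu : Plane, IsHyperbolicFixedPoint F T t₀ p ∧ ‖p - e‖ ≤ δ ∧
    IsFirstStablePoint F T z₀ S δ t₀ p zs ∧ IsFirstUnstablePoint F T z₀ S δ t₀ p zu ∧
    d = cross (unperturbed f (z₀ 0)) (zu - zs)

/-- The Fourier coefficient `q_k v` of `ξ ↦ q (ξ, v; 0)`. -/
def fourierCoeffAt (q : ℝ → ℝ → ℝ → ℝ) (k : ℤ) (v : ℝ) : ℂ :=
  (1 / (2 * Real.pi) : ℂ) *
    ∫ ξ in (0 : ℝ)..(2 * Real.pi), (q ξ v 0 : ℂ) * Complex.exp (-(Complex.I * k * ξ))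

/-- The set `C_k = {t : ẋ₀ t = 1 / k}` (used only for `k ≠ 0`). -/
def criticalSet (z₀ : ℝ → Plane) (k : ℤ) : Set ℝ := {t | (z₀ t).2 = 1 / (k : ℝ)}

/-- The contribution of the critical point `t ∈ C_k`. -/
def phaseTerm (f : ℝ → ℝ) (q : ℝ → ℝ → ℝ → ℝ) (z₀ : ℝ → Plane) (ε : ℝ) (k : ℤ) (t : ℝ) : ℂ :=
  let x : ℝ := (z₀ t).1
  let σ : ℝ := k * f x / |k * f x|
  fourierCoeffAt q k (1 / (k : ℝ)) *
      Complex.exp (Complex.I * (((k * x - t) / ε + σ * (Real.pi / 4) : ℝ) : ℂ)) /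
    ((k * Real.sqrt |(k : ℝ)| * Real.sqrt |f x| : ℝ) : ℂ)

/-- The contribution of all critical points in `C_k`. -/
def phaseSum (f : ℝ → ℝ) (q : ℝ → ℝ → ℝ → ℝ) (z₀ : ℝ → Plane) (ε : ℝ) (k : ℤ) : ℂ :=
  ∑ᶠ t ∈ criticalSet z₀ k, phaseTerm f q z₀ ε k t

/-- The coefficient `A` of `cos (t₀ / ε)`. -/
def coeffA (f : ℝ → ℝ) (q : ℝ → ℝ → ℝ → ℝ) (z₀ : ℝ → Plane) (ε : ℝ) : ℝ :=
  Real.sqrt (2 * Real.pi) * (∑' k : {k : ℤ // k ≠ 0}, phaseSum f q z₀ ε k).re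

/-- The coefficient `B` of `sin (t₀ / ε)`. -/
def coeffB (f : ℝ → ℝ) (q : ℝ → ℝ → ℝ → ℝ) (z₀ : ℝ → Plane) (ε : ℝ) : ℝ :=
  Real.sqrt (2 * Real.pi) * (∑' k : {k : ℤ // k ≠ 0}, phaseSum f q z₀ ε k).im

end Melnikov

end

open MeasureTheory

namespace Melnikov

/-- A solution `(x, v)` of `ẋ = v`, `v̇ = f x` that is homoclinic to the saddle `(a, 0)`, where
`f' a = lam ^ 2`. -/
structure ScalarHomoclinic (f : ℝ → ℝ) (a lam : ℝ) (x v : ℝ → ℝ) : Prop where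
  contDiff : ContDiff ℝ 3 f
  pos : 0 < lam
  zero : f a = 0
  deriv_eq : deriv f a = lam ^ 2
  hx : ∀ t, HasDerivAt x (v t) t
  hv : ∀ t, HasDerivAt v (f (x t)) t
  x_top : Tendsto x atTop (𝓝 a)
  x_bot : Tendsto x atBot (𝓝 a)
  v_top : Tendsto v atTop (𝓝 0)
  v_bot : Tendsto v atBot (𝓝 0)
  nonconst : ∃ t, ¬ (x t = a ∧ v t = 0)

/-- A positive continuous function on the line with positive limit at infinity is bounded below. -/
theorem exists_pos_forall_le_of_tendsto {φ : ℝ → ℝ} (hc : Continuous φ) (hp : ∀ t, 0 < φ t)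
    {l l' : ℝ} (hl : 0 < l) (hl' : 0 < l') (htop : Tendsto φ atTop (𝓝 l))
    (hbot : Tendsto φ atBot (𝓝 l')) : ∃ m > 0, ∀ t, m ≤ φ t := by
  obtain ⟨R, hR⟩ := eventually_atTop.1 (htop.eventually (lt_mem_nhds (half_lt_self hl)))
  obtain ⟨S, hS⟩ := eventually_atBot.1 (hbot.eventually (lt_mem_nhds (half_lt_self hl')))
  rcases (Icc S R).eq_empty_or_nonempty with he | hne
  · refine ⟨min (l / 2) (l' / 2), by positivity, fun t => ?_⟩
    rcases le_total t S with h | h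
    · exact (min_le_right _ _).trans (hS t h).le
    · rcases le_total R t with h' | h'
      · exact (min_le_left _ _).trans (hR t h').le
      · exact absurd (he ▸ ⟨h, h'⟩ : t ∈ (∅ : Set ℝ)) (Set.notMem_empty t)
  obtain ⟨τ, -, hτ⟩ := isCompact_Icc.exists_isMinOn hne hc.continuousOn
  refine ⟨min (min (l / 2) (l' / 2)) (φ τ), lt_min (by positivity) (hp τ), fun t => ?_⟩
  rcases le_total t S with h | h
  · exact (min_le_left _ _).trans ((min_le_right _ _).trans (hS t h).le)
  · rcases le_total R t with h' | h'
    · exact (min_le_left _ _).trans ((min_le_left _ _).trans (hR t h').le)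
    · exact (min_le_right _ _).trans (hτ ⟨h, h'⟩)

/-- Two solutions of `ẍ = f x` with the same state at one time coincide. -/
theorem eq_of_state_eq {f x v x' v' : ℝ → ℝ} (hf : ContDiff ℝ 1 f)
    (hx : ∀ t, HasDerivAt x (v t) t) (hv : ∀ t, HasDerivAt v (f (x t)) t)
    (hx' : ∀ t, HasDerivAt x' (v' t) t) (hv' : ∀ t, HasDerivAt v' (f (x' t)) t) {τ : ℝ}
    (hxτ : x τ = x' τ) (hvτ : v τ = v' τ) (t : ℝ) : x t = x' t ∧ v t = v' t := by
  obtain ⟨A, B, hA, hB⟩ : ∃ A B, t ∈ Ioo A B ∧ τ ∈ Ioo A B :=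
    ⟨min t τ - 1, max t τ + 1, ⟨by linarith [min_le_left t τ], by linarith [le_max_left t τ]⟩,
      ⟨by linarith [min_le_right t τ], by linarith [le_max_right t τ]⟩⟩
  have hz : ∀ x v : ℝ → ℝ, (∀ t, HasDerivAt x (v t) t) → (∀ t, HasDerivAt v (f (x t)) t) →
      ∃ ρ, (fun t => (x t, v t)) '' Icc A B ⊆ Metric.closedBall (0 : ℝ × ℝ) ρ := by
    intro x v hx hv
    have hxc : Continuous x := continuous_iff_continuousAt.2 fun t => (hx t).continuousAt
    have hvc : Continuous v := continuous_iff_continuousAt.2 fun t => (hv t).continuousAt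
    exact ((isCompact_Icc (a := A) (b := B)).image
      (hxc.prodMk hvc)).isBounded.subset_closedBall (0 : ℝ × ℝ)
  obtain ⟨ρ, hρ⟩ := hz x v hx hv
  obtain ⟨ρ', hρ'⟩ := hz x' v' hx' hv'
  have hF : ContDiff ℝ 1 fun z : ℝ × ℝ => (z.2, f z.1) := by fun_prop
  obtain ⟨K, hK⟩ := hF.contDiffOn.exists_lipschitzOnWith one_ne_zero
    (convex_closedBall (0 : ℝ × ℝ) (max ρ ρ')) (isCompact_closedBall _ _)
  have := ODE_solution_unique_of_mem_Ioo (v := fun (_ : ℝ) (z : ℝ × ℝ) => (z.2, f z.1))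
    (s := fun _ => Metric.closedBall (0 : ℝ × ℝ) (max ρ ρ')) (K := K)
    (f := fun t => (x t, v t)) (g := fun t => (x' t, v' t)) (a := A) (b := B) (t₀ := τ)
    (fun _ _ => hK) hB
    (fun s hs => ⟨(hx s).prodMk (hv s), Metric.closedBall_subset_closedBall (le_max_left _ _)
      (hρ ⟨s, Ioo_subset_Icc_self hs, rfl⟩)⟩)
    (fun s hs => ⟨(hx' s).prodMk (hv' s), Metric.closedBall_subset_closedBall (le_max_right _ _)
      (hρ' ⟨s, Ioo_subset_Icc_self hs, rfl⟩)⟩) (by simp [hxτ, hvτ])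
  have h := this hA
  simpa using h

namespace ScalarHomoclinic

variable {f : ℝ → ℝ} {a lam : ℝ} {x v : ℝ → ℝ}

theorem reverse (h : ScalarHomoclinic f a lam x v) :
    ScalarHomoclinic f a lam (fun t => x (-t)) (fun t => -v (-t)) where
  contDiff := h.contDiff
  pos := h.pos
  zero := h.zero
  deriv_eq := h.deriv_eq
  hx t := by
    have := (h.hx (-t)).comp t (hasDerivAt_neg t)
    rwa [mul_neg_one] at this
  hv t := by
    have := ((h.hv (-t)).comp t (hasDerivAt_neg t)).neg
    rwa [mul_neg_one, neg_neg] at this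
  x_top := h.x_bot.comp tendsto_neg_atTop_atBot
  x_bot := h.x_top.comp tendsto_neg_atBot_atTop
  v_top := by simpa using (h.v_bot.comp tendsto_neg_atTop_atBot).neg
  v_bot := by simpa using (h.v_top.comp tendsto_neg_atBot_atTop).neg
  nonconst := by
    obtain ⟨t, ht⟩ := h.nonconst
    exact ⟨-t, by simpa using ht⟩

theorem cont_x (h : ScalarHomoclinic f a lam x v) : Continuous x :=
  continuous_iff_continuousAt.2 fun t => (h.hx t).continuousAt

theorem cont_v (h : ScalarHomoclinic f a lam x v) : Continuous v :=
  continuous_iff_continuousAt.2 fun t => (h.hv t).continuousAt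

theorem cont_f (h : ScalarHomoclinic f a lam x v) : Continuous f := h.contDiff.continuous

theorem cont_fx (h : ScalarHomoclinic f a lam x v) : Continuous fun t => f (x t) :=
  h.cont_f.comp h.cont_x

theorem energy (h : ScalarHomoclinic f a lam x v) (t : ℝ) :
    v t ^ 2 = 2 * ∫ s in a..x t, f s := by
  have hF : ∀ z, HasDerivAt (fun z => ∫ s in a..z, f s) (f z) z := fun z =>
    intervalIntegral.integral_hasDerivAt_right (h.cont_f.intervalIntegrable _ _)
      (h.cont_f.stronglyMeasurableAtFilter _ _) h.cont_f.continuousAt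
  have hd : ∀ t, HasDerivAt (fun t => v t ^ 2 - 2 * ∫ s in a..x t, f s) 0 t := by
    intro t
    have h1 := ((h.hv t).pow 2).sub (((hF (x t)).comp t (h.hx t)).const_mul 2)
    exact h1.congr_deriv (by push_cast; ring)
  have hconst : ∀ t s, (fun t => v t ^ 2 - 2 * ∫ s in a..x t, f s) t
      = (fun t => v t ^ 2 - 2 * ∫ s in a..x t, f s) s :=
    is_const_of_deriv_eq_zero (fun t => (hd t).differentiableAt) fun t => (hd t).deriv
  have hFc : Continuous fun z => ∫ s in a..z, f s :=
    continuous_iff_continuousAt.2 fun z => (hF z).continuousAt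
  have hlim : Tendsto (fun t => v t ^ 2 - 2 * ∫ s in a..x t, f s) atTop (𝓝 0) := by
    have := (h.v_top.pow 2).sub (((hFc.tendsto a).comp h.x_top).const_mul 2)
    simpa using this
  have : (fun s : ℝ => v t ^ 2 - 2 * ∫ s in a..x t, f s)
      = fun t => v t ^ 2 - 2 * ∫ s in a..x t, f s := funext fun s => hconst t s
  rw [← this] at hlim
  have := tendsto_nhds_unique hlim tendsto_const_nhds
  linarith

theorem speed_pos (h : ScalarHomoclinic f a lam x v) (t : ℝ) : 0 < v t ^ 2 + f (x t) ^ 2 := by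
  by_contra hn
  have h1 : v t = 0 := by nlinarith [sq_nonneg (v t), sq_nonneg (f (x t))]
  have h2 : f (x t) = 0 := by nlinarith [sq_nonneg (v t), sq_nonneg (f (x t))]
  have hall := eq_of_state_eq (h.contDiff.of_le (by norm_num)) h.hx h.hv
    (x' := fun _ => x t) (v' := fun _ => 0) (τ := t) (fun s => hasDerivAt_const s _)
    (fun s => (hasDerivAt_const s _).congr_deriv h2.symm) rfl h1
  have : x t = a := by
    have hx : x = fun _ => x t := funext fun s => (hall s).1
    have := h.x_top
    rw [hx] at this
    exact tendsto_nhds_unique tendsto_const_nhds this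
  obtain ⟨s, hs⟩ := h.nonconst
  exact hs ⟨(hall s).1.trans this, (hall s).2⟩

theorem ne (h : ScalarHomoclinic f a lam x v) (t : ℝ) : x t ≠ a := by
  intro hxa
  have h1 := h.energy t
  have h2 := h.speed_pos t
  rw [hxa] at h1 h2
  rw [h1, h.zero] at h2
  simp at h2

theorem local_bounds (h : ScalarHomoclinic f a lam x v) :
    ∃ ρ > 0, ∀ t, |x t - a| ≤ ρ → |f (x t) - lam ^ 2 * (x t - a)| ≤ lam ^ 2 / 4 * |x t - a| ∧
      |v t ^ 2 - lam ^ 2 * (x t - a) ^ 2| ≤ lam ^ 2 / 2 * (x t - a) ^ 2 := by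
  have hlam := h.pos
  have hd : HasDerivAt f (lam ^ 2) a := by
    rw [← h.deriv_eq]
    exact (h.contDiff.differentiable (by norm_num) a).hasDerivAt
  have ho := (hasDerivAt_iff_isLittleO.1 hd).bound (show 0 < lam ^ 2 / 4 by positivity)
  obtain ⟨ρ, hρ, hball⟩ := Metric.eventually_nhds_iff_ball.1 ho
  have hb : ∀ z, |z - a| ≤ ρ / 2 → |f z - lam ^ 2 * (z - a)| ≤ lam ^ 2 / 4 * |z - a| := by
    intro z hz
    have := hball z (by rw [Metric.mem_ball, Real.dist_eq]; linarith)
    simpa [h.zero, mul_comm] using this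
  refine ⟨ρ / 2, by positivity, fun t ht => ⟨hb _ ht, ?_⟩⟩
  have hint : ∫ s in a..x t, (f s - lam ^ 2 * (s - a))
      = (∫ s in a..x t, f s) - lam ^ 2 * (x t - a) ^ 2 / 2 := by
    rw [intervalIntegral.integral_sub (h.cont_f.intervalIntegrable _ _)
      (Continuous.intervalIntegrable (by fun_prop) _ _)]
    congr 1
    rw [intervalIntegral.integral_const_mul, intervalIntegral.integral_comp_sub_right
      (fun s => s)]
    simp; ring
  have hle := intervalIntegral.norm_integral_le_of_norm_le_const (a := a) (b := x t)
    (f := fun s => f s - lam ^ 2 * (s - a)) (C := lam ^ 2 / 4 * |x t - a|) (by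
      intro s hs
      have hsa : |s - a| ≤ |x t - a| := by
        rcases le_total a (x t) with hle | hle
        · rw [uIoc_of_le hle] at hs
          rw [abs_of_nonneg (by linarith [hs.1]), abs_of_nonneg (by linarith)]; linarith [hs.2]
        · rw [uIoc_of_ge hle] at hs
          rw [abs_of_nonpos (by linarith [hs.2]), abs_of_nonpos (by linarith)]; linarith [hs.1]
      refine (hb s (hsa.trans ht)).trans ?_
      gcongr)
  rw [hint, Real.norm_eq_abs, mul_assoc, abs_mul_abs_self] at hle
  rw [h.energy t]
  calc |2 * (∫ s in a..x t, f s) - lam ^ 2 * (x t - a) ^ 2|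
      = 2 * |(∫ s in a..x t, f s) - lam ^ 2 * (x t - a) ^ 2 / 2| := by
        rw [← abs_two (α := ℝ), ← abs_mul, abs_two]; congr 1; ring
    _ ≤ _ := by linarith

/-- Estimates along the tail of the homoclinic orbit. -/
theorem tail (h : ScalarHomoclinic f a lam x v) :
    ∃ R, 0 ≤ R ∧ ∀ t, R ≤ t → lam / 2 * |x t - a| ≤ |v t| ∧ |v t| ≤ 2 * lam * |x t - a| ∧
      lam ^ 2 / 2 * |x t - a| ≤ |f (x t)| ∧ |f (x t)| ≤ 2 * lam ^ 2 * |x t - a| ∧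
      (x t - a) * v t ≤ -(lam / 2) * (x t - a) ^ 2 := by
  have hlam := h.pos
  obtain ⟨ρ, hρ, hb⟩ := h.local_bounds
  have hev : ∀ᶠ t in atTop, |x t - a| ≤ ρ := by
    have := h.x_top.eventually (Metric.closedBall_mem_nhds a hρ)
    filter_upwards [this] with t ht
    simpa [Real.dist_eq] using ht
  obtain ⟨R, hR⟩ := eventually_atTop.1 hev
  have h1 : ∀ t, R ≤ t → lam / 2 * |x t - a| ≤ |v t| ∧ |v t| ≤ 2 * lam * |x t - a| ∧
      lam ^ 2 / 2 * |x t - a| ≤ |f (x t)| ∧ |f (x t)| ≤ 2 * lam ^ 2 * |x t - a| ∧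
      0 ≤ (x t - a) * f (x t) := by
    intro t ht
    obtain ⟨hb1, hb2⟩ := hb t (hR t ht)
    have e1 := abs_le.1 hb1
    have e2 := abs_le.1 hb2
    have hy := abs_nonneg (x t - a)
    have hl2 : 0 < lam ^ 2 := by positivity
    refine ⟨?_, ?_, ?_, ?_, ?_⟩
    · apply abs_le_of_sq_le_sq' _ (abs_nonneg _) |>.2
      rw [sq_abs, mul_pow, sq_abs]; nlinarith [sq_nonneg (x t - a)]
    · apply abs_le_of_sq_le_sq' _ (by positivity) |>.2
      rw [sq_abs, mul_pow, sq_abs]; nlinarith [sq_nonneg (x t - a)]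
    · have := abs_sub_abs_le_abs_sub (lam ^ 2 * (x t - a)) (f (x t))
      rw [abs_sub_comm, abs_mul, abs_of_pos hl2] at this
      nlinarith
    · have := abs_sub_abs_le_abs_sub (f (x t)) (lam ^ 2 * (x t - a))
      rw [abs_mul, abs_of_pos hl2] at this
      nlinarith
    · rcases le_total 0 (x t - a) with hy0 | hy0
      · rw [abs_of_nonneg hy0] at e1
        apply mul_nonneg hy0; nlinarith
      · rw [abs_of_nonpos hy0] at e1
        apply mul_nonneg_of_nonpos_of_nonpos hy0; nlinarith
  have hder : ∀ t, HasDerivAt (fun t => (x t - a) * v t) (v t * v t + (x t - a) * f (x t)) t :=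
    fun t => ((h.hx t).sub_const a).mul (h.hv t)
  have hmono : MonotoneOn (fun t => (x t - a) * v t) (Ici R) := by
    apply monotoneOn_of_deriv_nonneg (convex_Ici R)
    · exact ((h.cont_x.sub continuous_const).mul h.cont_v).continuousOn
    · exact fun t _ => (hder t).differentiableAt.differentiableWithinAt
    · intro t ht
      rw [interior_Ici] at ht
      rw [(hder t).deriv]
      have := (h1 t ht.le).2.2.2.2
      nlinarith [mul_self_nonneg (v t)]
  have hlim : Tendsto (fun t => (x t - a) * v t) atTop (𝓝 0) := by
    simpa using (h.x_top.sub_const a).mul h.v_top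
  have hneg : ∀ t, R ≤ t → (x t - a) * v t ≤ 0 := by
    intro t ht
    refine ge_of_tendsto hlim ?_
    filter_upwards [eventually_ge_atTop t] with s hs
    exact hmono ht (ht.trans hs) hs
  refine ⟨max R 0, le_max_right _ _, fun t ht => ?_⟩
  have ht' := (le_max_left R 0).trans ht
  obtain ⟨q1, q2, q3, q4, -⟩ := h1 t ht'
  refine ⟨q1, q2, q3, q4, ?_⟩
  have : (x t - a) * v t = -(|x t - a| * |v t|) := by
    rw [← abs_mul, abs_of_nonpos (hneg t ht')]; ring
  rw [this, ← sq_abs (x t - a)]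
  nlinarith [abs_nonneg (x t - a)]

/-- Exponential decay of the squared speed along the forward half of the orbit. -/
theorem speed_decay (h : ScalarHomoclinic f a lam x v) :
    ∃ C > 0, ∀ t s, 0 ≤ t → t ≤ s →
      v s ^ 2 + f (x s) ^ 2 ≤ C * Real.exp (-lam * (s - t)) * (v t ^ 2 + f (x t) ^ 2) := by
  have hlam := h.pos
  obtain ⟨R, hR0, hR⟩ := h.tail
  set w : ℝ → ℝ := fun t => Real.exp (lam * t) * (x t - a) ^ 2 with hw
  have hwpos : ∀ t, 0 < w t := fun t => by
    have := sub_ne_zero.2 (h.ne t)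
    positivity
  have hwc : Continuous w := by
    have := h.cont_x
    fun_prop
  have hwd : ∀ t, HasDerivAt w (lam * Real.exp (lam * t) * (x t - a) ^ 2
      + Real.exp (lam * t) * (2 * (x t - a) * v t)) t := by
    intro t
    have h1 : HasDerivAt (fun t => Real.exp (lam * t)) (lam * Real.exp (lam * t)) t := by
      have := ((hasDerivAt_id t).const_mul lam).exp
      exact this.congr_deriv (by simp only [id]; ring)
    exact (h1.mul (((h.hx t).sub_const a).pow 2)).congr_deriv
      (by simp only [Pi.pow_apply]; push_cast; ring)
  have hanti : AntitoneOn w (Ici R) := by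
    apply antitoneOn_of_deriv_nonpos (convex_Ici R) hwc.continuousOn
    · exact fun t _ => (hwd t).differentiableAt.differentiableWithinAt
    · intro t ht
      rw [interior_Ici] at ht
      rw [(hwd t).deriv]
      have h2 := (hR t (le_of_lt ht)).2.2.2.2
      have h3 := Real.exp_pos (lam * t)
      nlinarith
  obtain ⟨τ, hτ, hmin⟩ := isCompact_Icc.exists_isMinOn (nonempty_Icc.2 hR0) hwc.continuousOn
  obtain ⟨σ, hσ, hmax⟩ := isCompact_Icc.exists_isMaxOn (nonempty_Icc.2 hR0) hwc.continuousOn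
  have hratio : ∀ t s, 0 ≤ t → t ≤ s → w s ≤ w σ / w τ * w t := by
    intro t s ht hts
    have hone : 1 ≤ w σ / w τ := (one_le_div (hwpos τ)).2 (hmin hσ)
    rcases le_total R t with hRt | hRt
    · calc w s ≤ w t := hanti hRt (hRt.trans hts) hts
        _ ≤ _ := le_mul_of_one_le_left (hwpos t).le hone
    · have hs : w s ≤ w σ := by
        rcases le_total R s with hRs | hRs
        · exact (hanti self_mem_Ici hRs hRs).trans (hmax ⟨hR0, le_rfl⟩)
        · exact hmax ⟨ht.trans hts, hRs⟩
      have ht2 : w τ ≤ w t := hmin ⟨ht, hRt⟩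
      rw [div_mul_eq_mul_div, le_div_iff₀ (hwpos τ)]
      exact mul_le_mul hs ht2 (hwpos τ).le (hwpos σ).le
  have hexp : ∀ t s, 0 ≤ t → t ≤ s → (x s - a) ^ 2
      ≤ w σ / w τ * Real.exp (-lam * (s - t)) * (x t - a) ^ 2 := by
    intro t s ht hts
    have h1 := hratio t s ht hts
    have h2 : Real.exp (-lam * (s - t)) = Real.exp (lam * t) * (Real.exp (lam * s))⁻¹ := by
      rw [← Real.exp_neg, ← Real.exp_add]; congr 1; ring
    rw [h2]
    simp only [hw] at h1 ⊢
    have h3 := Real.exp_pos (lam * s)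
    have h4 : (x s - a) ^ 2 = (Real.exp (lam * s))⁻¹ * (Real.exp (lam * s) * (x s - a) ^ 2) := by
      field_simp
    rw [h4]
    calc _ ≤ (Real.exp (lam * s))⁻¹ * _ := mul_le_mul_of_nonneg_left h1 (by positivity)
      _ = _ := by ring
  set g : ℝ → ℝ := fun t => (v t ^ 2 + f (x t) ^ 2) / (x t - a) ^ 2 with hg
  have hypos : ∀ t, 0 < (x t - a) ^ 2 := fun t => by
    have := sub_ne_zero.2 (h.ne t)
    positivity
  have hgc : Continuous g := by
    have h1 := h.cont_x
    have h2 := h.cont_v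
    have h3 := h.cont_fx
    exact Continuous.div ((h2.pow 2).add (h3.pow 2)) (by fun_prop) fun t => (hypos t).ne'
  obtain ⟨τ', -, hmin'⟩ := isCompact_Icc.exists_isMinOn (nonempty_Icc.2 hR0) hgc.continuousOn
  obtain ⟨σ', -, hmax'⟩ := isCompact_Icc.exists_isMaxOn (nonempty_Icc.2 hR0) hgc.continuousOn
  have hgpos : ∀ t, 0 < g t := fun t => div_pos (h.speed_pos t) (hypos t)
  have hlow : ∃ c > 0, ∀ t, 0 ≤ t → c * (x t - a) ^ 2 ≤ v t ^ 2 + f (x t) ^ 2 := by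
    refine ⟨min (lam ^ 2 / 4) (g τ'), lt_min (by positivity) (hgpos _), fun t ht => ?_⟩
    rcases le_total R t with hRt | hRt
    · have h1 := (hR t hRt).1
      have h2 : (lam / 2 * |x t - a|) ^ 2 ≤ |v t| ^ 2 := by gcongr
      rw [mul_pow, sq_abs, sq_abs] at h2
      have := mul_le_mul_of_nonneg_right (min_le_left (lam ^ 2 / 4) (g τ')) (hypos t).le
      nlinarith [sq_nonneg (f (x t))]
    · have h1 : g τ' ≤ g t := hmin' ⟨ht, hRt⟩
      have := mul_le_mul_of_nonneg_right ((min_le_right (lam ^ 2 / 4) (g τ')).trans h1)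
        (hypos t).le
      rwa [hg, div_mul_cancel₀ _ (hypos t).ne'] at this
  have hup : ∃ C > 0, ∀ t, 0 ≤ t → v t ^ 2 + f (x t) ^ 2 ≤ C * (x t - a) ^ 2 := by
    refine ⟨max ((2 * lam) ^ 2 + (2 * lam ^ 2) ^ 2) (g σ'), lt_max_of_lt_right (hgpos _),
      fun t ht => ?_⟩
    rcases le_total R t with hRt | hRt
    · have h1 := (hR t hRt).2.1
      have h2 := (hR t hRt).2.2.2.1
      have h3 : |v t| ^ 2 ≤ (2 * lam * |x t - a|) ^ 2 := by gcongr
      have h4 : |f (x t)| ^ 2 ≤ (2 * lam ^ 2 * |x t - a|) ^ 2 := by gcongr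
      rw [mul_pow, sq_abs, sq_abs] at h3 h4
      have := mul_le_mul_of_nonneg_right
        (le_max_left ((2 * lam) ^ 2 + (2 * lam ^ 2) ^ 2) (g σ')) (hypos t).le
      linarith
    · have h1 : g t ≤ g σ' := hmax' ⟨ht, hRt⟩
      have := mul_le_mul_of_nonneg_right (h1.trans (le_max_right
        ((2 * lam) ^ 2 + (2 * lam ^ 2) ^ 2) (g σ'))) (hypos t).le
      rwa [hg, div_mul_cancel₀ _ (hypos t).ne'] at this
  obtain ⟨c, hc, hlow⟩ := hlow
  obtain ⟨C, hC, hup⟩ := hup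
  refine ⟨C * (w σ / w τ) / c, by have := hwpos σ; have := hwpos τ; positivity,
    fun t s ht hts => ?_⟩
  have e1 := hup s (ht.trans hts)
  have e2 := hexp t s ht hts
  have e3 := hlow t ht
  have hwr : 0 < w σ / w τ := div_pos (hwpos _) (hwpos _)
  calc v s ^ 2 + f (x s) ^ 2 ≤ C * (w σ / w τ * Real.exp (-lam * (s - t)) * (x t - a) ^ 2) :=
        e1.trans (by gcongr)
    _ = C * (w σ / w τ) / c * Real.exp (-lam * (s - t)) * (c * (x t - a) ^ 2) := by
        field_simp
    _ ≤ _ := by gcongr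

end ScalarHomoclinic
namespace ScalarHomoclinic

variable {f : ℝ → ℝ} {a lam : ℝ} {x v : ℝ → ℝ}

theorem decay_half (h : ScalarHomoclinic f a lam x v) :
    ∃ C > 0, ∀ t, 0 ≤ t → |v t| ≤ C * Real.exp (-(lam / 2) * t) ∧
      |f (x t)| ≤ C * Real.exp (-(lam / 2) * t) := by
  obtain ⟨C, hC, hd⟩ := h.speed_decay
  have hs := h.speed_pos 0
  refine ⟨√(C * (v 0 ^ 2 + f (x 0) ^ 2)), by positivity, fun t ht => ?_⟩
  have h1 := hd 0 t le_rfl ht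
  have h2 : (√(C * (v 0 ^ 2 + f (x 0) ^ 2)) * Real.exp (-(lam / 2) * t)) ^ 2
      = C * Real.exp (-lam * (t - 0)) * (v 0 ^ 2 + f (x 0) ^ 2) := by
    rw [mul_pow, Real.sq_sqrt (by positivity), ← Real.exp_nat_mul]
    have : ((2 : ℕ) : ℝ) * (-(lam / 2) * t) = -lam * (t - 0) := by push_cast; ring
    rw [this]; ring
  constructor
  · apply abs_le_of_sq_le_sq _ (by positivity)
    rw [h2]; nlinarith [sq_nonneg (f (x t))]
  · apply abs_le_of_sq_le_sq _ (by positivity)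
    rw [h2]; nlinarith [sq_nonneg (v t)]

theorem decay (h : ScalarHomoclinic f a lam x v) :
    ∃ C > 0, ∀ t, |v t| ≤ C * Real.exp (-(lam / 2) * |t|) ∧
      |f (x t)| ≤ C * Real.exp (-(lam / 2) * |t|) := by
  obtain ⟨C, hC, h1⟩ := h.decay_half
  obtain ⟨D, hD, h2⟩ := h.reverse.decay_half
  refine ⟨max C D, lt_max_of_lt_left hC, fun t => ?_⟩
  rcases le_total 0 t with ht | ht
  · rw [abs_of_nonneg ht]
    obtain ⟨p, q⟩ := h1 t ht
    exact ⟨p.trans (by gcongr; exact le_max_left _ _), q.trans (by gcongr; exact le_max_left _ _)⟩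
  · rw [abs_of_nonpos ht]
    obtain ⟨p, q⟩ := h2 (-t) (by linarith)
    simp only [neg_neg, abs_neg] at p q
    exact ⟨p.trans (by gcongr; exact le_max_right _ _),
      q.trans (by gcongr; exact le_max_right _ _)⟩

theorem _root_.Melnikov.integrable_exp_neg_mul_abs {c : ℝ} (hc : 0 < c) :
    Integrable fun t : ℝ => Real.exp (-c * |t|) := by
  have h1 : IntegrableOn (fun t : ℝ => Real.exp (-c * |t|)) (Ioi 0) :=
    (exp_neg_integrableOn_Ioi 0 hc).congr_fun (fun t ht => by
      simp only [abs_of_pos (mem_Ioi.1 ht)]) measurableSet_Ioi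
  have h2 : IntegrableOn (fun t : ℝ => Real.exp (-c * |t|)) (Iic 0) := by
    have := integrableOn_Iic_iff_integrableOn_Iio (f := fun t : ℝ => Real.exp (-c * |t|))
      (b := 0) (μ := volume)
    rw [this]
    have h3 := h1.comp_neg
    simpa using h3
  rw [← integrableOn_univ, ← Iic_union_Ioi (a := (0 : ℝ))]
  exact h2.union h1

theorem integrable_v (h : ScalarHomoclinic f a lam x v) : Integrable v := by
  obtain ⟨C, -, hC⟩ := h.decay
  exact ((integrable_exp_neg_mul_abs (half_pos h.pos)).const_mul C).mono'
    h.cont_v.aestronglyMeasurable (Eventually.of_forall fun t => (hC t).1)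

theorem integrable_fx (h : ScalarHomoclinic f a lam x v) : Integrable fun t => f (x t) := by
  obtain ⟨C, -, hC⟩ := h.decay
  exact ((integrable_exp_neg_mul_abs (half_pos h.pos)).const_mul C).mono'
    h.cont_fx.aestronglyMeasurable (Eventually.of_forall fun t => (hC t).2)

theorem _root_.Melnikov.exists_forall_abs_le_of_tendsto {φ : ℝ → ℝ} (hc : Continuous φ)
    {l l' : ℝ} (htop : Tendsto φ atTop (𝓝 l)) (hbot : Tendsto φ atBot (𝓝 l')) :
    ∃ M > 0, ∀ t, |φ t| ≤ M := by
  obtain ⟨R, hR⟩ := eventually_atTop.1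
    (htop.abs.eventually (gt_mem_nhds (show |l| < |l| + 1 by linarith)))
  obtain ⟨S, hS⟩ := eventually_atBot.1
    (hbot.abs.eventually (gt_mem_nhds (show |l'| < |l'| + 1 by linarith)))
  obtain ⟨B, hB⟩ := isCompact_Icc.exists_bound_of_continuousOn (s := Icc S R) hc.continuousOn
  refine ⟨max B (max (|l| + 1) (|l'| + 1)), lt_max_of_lt_right (lt_max_of_lt_left
    (by positivity)), fun t => ?_⟩
  rcases le_total t S with h | h
  · exact (hS t h).le.trans ((le_max_right _ _).trans (le_max_right _ _))
  · rcases le_total R t with h' | h'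
    · exact (hR t h').le.trans ((le_max_left _ _).trans (le_max_right _ _))
    · exact (hB t ⟨h, h'⟩).trans (le_max_left _ _)

theorem bounded_x (h : ScalarHomoclinic f a lam x v) : ∃ M > 0, ∀ t, |x t| ≤ M :=
  exists_forall_abs_le_of_tendsto h.cont_x h.x_top h.x_bot

theorem bounded_v (h : ScalarHomoclinic f a lam x v) : ∃ M > 0, ∀ t, |v t| ≤ M :=
  exists_forall_abs_le_of_tendsto h.cont_v h.v_top h.v_bot

/-- Where the velocity is small, the acceleration dominates it. -/
theorem exists_mul_abs_le_abs (h : ScalarHomoclinic f a lam x v) :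
    ∃ η > 0, ∃ μ > 0, ∀ t, |v t| ≤ η → μ * |v t| ≤ |f (x t)| := by
  have hlam := h.pos
  obtain ⟨R, hR0, hR⟩ := h.tail
  obtain ⟨S, hS0, hS⟩ := h.reverse.tail
  have hcont : Continuous fun t => v t ^ 2 + f (x t) ^ 2 := (h.cont_v.pow 2).add (h.cont_fx.pow 2)
  obtain ⟨τ, -, hτ⟩ := isCompact_Icc.exists_isMinOn
    (nonempty_Icc.2 (show -S ≤ R by linarith)) hcont.continuousOn
  set c := v τ ^ 2 + f (x τ) ^ 2 with hc
  have hcpos : 0 < c := h.speed_pos τ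
  have key : ∀ y V F : ℝ, V ≤ 2 * lam * y → lam ^ 2 / 2 * y ≤ F →
      lam / 4 * V ≤ F := by
    intro y V F h1 h2
    nlinarith
  refine ⟨√(c / 2), by positivity, min (lam / 4) 1, by positivity, fun t ht => ?_⟩
  rcases le_total R t with h1 | h1
  · obtain ⟨-, q2, q3, -⟩ := hR t h1
    exact (mul_le_mul_of_nonneg_right (min_le_left _ _) (abs_nonneg _)).trans (key _ _ _ q2 q3)
  rcases le_total S (-t) with h2 | h2
  · obtain ⟨-, q2, q3, -⟩ := hS (-t) h2
    simp only [neg_neg, abs_neg] at q2 q3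
    exact (mul_le_mul_of_nonneg_right (min_le_left _ _) (abs_nonneg _)).trans (key _ _ _ q2 q3)
  have h3 : c ≤ v t ^ 2 + f (x t) ^ 2 := hτ ⟨by linarith, h1⟩
  have h4 : v t ^ 2 ≤ c / 2 := by
    have := Real.sq_sqrt (show 0 ≤ c / 2 by positivity)
    rw [← this, ← sq_abs (v t)]
    gcongr
  refine (mul_le_mul_of_nonneg_right (min_le_right _ _) (abs_nonneg _)).trans ?_
  rw [one_mul]
  apply sq_le_sq.1
  linarith

/-- The critical points of the phases `k x - t` are uniformly nondegenerate. -/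
theorem exists_uniform_nondegenerate (h : ScalarHomoclinic f a lam x v)
    (hnd : ∀ k : ℤ, k ≠ 0 → ∀ t, v t = 1 / (k : ℝ) → f (x t) ≠ 0) :
    ∃ c > 0, ∃ m > 0, ∀ k : ℤ, k ≠ 0 → ∀ t, |k * v t - 1| ≤ c → m ≤ |k * f (x t)| := by
  obtain ⟨η, hη, μ, hμ, hsmall⟩ := h.exists_mul_abs_le_abs
  have hfin : ∀ k ∈ Icc (-⌈2 / η⌉) ⌈2 / η⌉, ∀ᶠ m : ℝ in 𝓝[>] 0, k ≠ 0 →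
      ∀ t, m ≤ |k * v t - 1| + |k * f (x t)| := by
    intro k _
    by_cases hk : k = 0
    · exact Eventually.of_forall fun _ h' => absurd hk h'
    have hf1 : f a = 0 := h.zero
    obtain ⟨m, hm, hle⟩ := exists_pos_forall_le_of_tendsto (l := 1) (l' := 1)
      (φ := fun t => |k * v t - 1| + |k * f (x t)|)
      (by have h1 := h.cont_v; have h2 := h.cont_fx
          exact ((h1.const_mul _).sub continuous_const).abs.add (h2.const_mul _).abs)
      (by
        intro t
        by_contra hn
        have e1 : |k * v t - 1| = 0 := by
          linarith [abs_nonneg (k * v t - 1), abs_nonneg (k * f (x t))]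
        have e2 : |k * f (x t)| = 0 := by
          linarith [abs_nonneg (k * v t - 1), abs_nonneg (k * f (x t))]
        have hk' : (k : ℝ) ≠ 0 := Int.cast_ne_zero.2 hk
        refine hnd k hk t ?_ ?_
        · rw [abs_eq_zero] at e1
          field_simp; linarith
        · rw [abs_eq_zero] at e2
          exact (mul_eq_zero.1 e2).resolve_left hk') one_pos one_pos
      (by
        have := (((h.v_top.const_mul (k : ℝ)).sub_const 1).abs).add
          (((h.cont_f.tendsto a).comp h.x_top).const_mul (k : ℝ)).abs
        simpa [hf1] using this)
      (by
        have := (((h.v_bot.const_mul (k : ℝ)).sub_const 1).abs).add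
          (((h.cont_f.tendsto a).comp h.x_bot).const_mul (k : ℝ)).abs
        simpa [hf1] using this)
    filter_upwards [Ioc_mem_nhdsGT hm] with m' hm' _ t using hm'.2.trans (hle t)
  have hall := (eventually_all_finite (Set.finite_Icc _ _)).2 hfin
  obtain ⟨m, hm, hm0⟩ := (hall.and self_mem_nhdsWithin).exists
  have hm0 : 0 < m := hm0
  refine ⟨min (m / 2) (1 / 2), by positivity, min (m / 2) (μ / 2), by positivity,
    fun k hk t ht => ?_⟩
  by_cases hkI : k ∈ Icc (-⌈2 / η⌉) ⌈2 / η⌉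
  · have h1 := hm k hkI hk t
    have h2 := ht.trans (min_le_left _ _)
    exact (min_le_left _ _).trans (by linarith)
  · have hkbig : 2 / η < |(k : ℝ)| := by
      rw [mem_Icc, ← abs_le, not_le] at hkI
      have h1 : ((⌈2 / η⌉ : ℤ) : ℝ) < ((|k| : ℤ) : ℝ) := by exact_mod_cast hkI
      rw [Int.cast_abs] at h1
      exact (Int.le_ceil _).trans_lt h1
    have h2 := ht.trans (min_le_right _ _)
    have h3 : |(k : ℝ)| * |v t| ≤ 3 / 2 := by
      rw [← abs_mul]
      have := abs_sub_abs_le_abs_sub (k * v t) 1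
      rw [abs_one] at this; linarith
    have h4 : 1 / 2 ≤ |(k : ℝ)| * |v t| := by
      rw [← abs_mul]
      have := abs_sub_abs_le_abs_sub 1 (k * v t)
      rw [abs_one, abs_sub_comm] at this; linarith
    have h5 : |v t| ≤ η := by
      rw [div_lt_iff₀ hη] at hkbig
      by_contra hn
      push Not at hn
      have := abs_nonneg (k : ℝ)
      nlinarith
    have h6 := hsmall t h5
    rw [abs_mul]
    refine (min_le_right _ _).trans ?_
    nlinarith [abs_nonneg (k : ℝ)]

end ScalarHomoclinic

/-- A fundamental system `ξ, η` of `ẅ = c w` with Wronskian `1`, where `ξ` decays, `η` grows, and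
the corresponding Green function is integrable uniformly on the half-line. -/
structure Dichotomy (c : ℝ → ℝ) (ξ η : ℝ → ℝ × ℝ) (K : ℝ) : Prop where
  derivξ : ∀ t, HasDerivAt ξ ((ξ t).2, c t * (ξ t).1) t
  derivη : ∀ t, HasDerivAt η ((η t).2, c t * (η t).1) t
  wronskian : ∀ t, (ξ t).1 * (η t).2 - (ξ t).2 * (η t).1 = 1
  integrable : IntegrableOn (fun t => (ξ t).1) (Ioi 0)
  lim : Tendsto ξ atTop (𝓝 0)
  pos : 0 < K
  forward : ∀ t, 0 ≤ t → ‖η t‖ * ∫ s in Ioi t, |(ξ s).1| ≤ K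
  backward : ∀ t, 0 ≤ t → ‖ξ t‖ * ∫ s in (0 : ℝ)..t, |(η s).1| ≤ K

theorem hasDerivAt_fst {u : ℝ → ℝ × ℝ} {u' : ℝ × ℝ} {t : ℝ} (h : HasDerivAt u u' t) :
    HasDerivAt (fun s => (u s).1) u'.1 t :=
  (ContinuousLinearMap.fst ℝ ℝ ℝ).hasFDerivAt.comp_hasDerivAt t h

theorem hasDerivAt_snd {u : ℝ → ℝ × ℝ} {u' : ℝ × ℝ} {t : ℝ} (h : HasDerivAt u u' t) :
    HasDerivAt (fun s => (u s).2) u'.2 t :=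
  (ContinuousLinearMap.snd ℝ ℝ ℝ).hasFDerivAt.comp_hasDerivAt t h

namespace Dichotomy

variable {c : ℝ → ℝ} {ξ η : ℝ → ℝ × ℝ} {K : ℝ}

/-- The bounded solution of `ẅ = c w + n` on the half-line with initial value parallel to `η`. -/
noncomputable def green (ξ η : ℝ → ℝ × ℝ) (n : ℝ → ℝ) (t : ℝ) : ℝ × ℝ :=
  -((∫ s in Ioi 0, (ξ s).1 * n s) - ∫ s in (0 : ℝ)..t, (ξ s).1 * n s) • η t
    - (∫ s in (0 : ℝ)..t, (η s).1 * n s) • ξ t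

theorem contξ (h : Dichotomy c ξ η K) : Continuous ξ :=
  continuous_iff_continuousAt.2 fun t => (h.derivξ t).continuousAt

theorem contη (h : Dichotomy c ξ η K) : Continuous η :=
  continuous_iff_continuousAt.2 fun t => (h.derivη t).continuousAt

theorem green_zero (n : ℝ → ℝ) :
    green ξ η n 0 = -(∫ s in Ioi 0, (ξ s).1 * n s) • η 0 := by
  simp [green]

theorem hasDerivAt_green (h : Dichotomy c ξ η K) {n : ℝ → ℝ} (hn : Continuous n) (t : ℝ) :
    HasDerivAt (green ξ η n)
      ((green ξ η n t).2, c t * (green ξ η n t).1 + n t) t := by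
  have hprim : ∀ g : ℝ → ℝ, Continuous g → HasDerivAt (fun t => ∫ s in (0 : ℝ)..t, g s) (g t) t :=
    fun g hg => intervalIntegral.integral_hasDerivAt_right (hg.intervalIntegrable _ _)
      (hg.stronglyMeasurableAtFilter _ _) hg.continuousAt
  have hP := hprim _ (h.contξ.fst.mul hn)
  have hQ := hprim _ (h.contη.fst.mul hn)
  have := (((hP.const_sub (∫ s in Ioi 0, (ξ s).1 * n s)).neg).smul (h.derivη t)).sub
    (hQ.smul (h.derivξ t))
  refine this.congr_deriv ?_
  have hw := h.wronskian t
  ext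
  · simp [green]; ring
  · simp [green]
    linear_combination (n t) * hw

theorem integrableOn_mul (h : Dichotomy c ξ η K) {n : ℝ → ℝ} {t M : ℝ} (ht : 0 ≤ t)
    (hn : ContinuousOn n (Ici 0)) (hM : ∀ s, 0 ≤ s → |n s| ≤ M) :
    IntegrableOn (fun s => (ξ s).1 * n s) (Ioi t) := by
  have h1 := (h.integrable.mono_set (Ioi_subset_Ioi ht))
  have h2 : AEStronglyMeasurable n (volume.restrict (Ioi t)) :=
    (hn.mono (Ioi_subset_Ici ht)).aestronglyMeasurable measurableSet_Ioi
  refine (h1.mul_const M).mono (h1.aestronglyMeasurable.mul h2) ?_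
  refine (ae_restrict_iff' measurableSet_Ioi).2 (Eventually.of_forall fun s hs => ?_)
  rw [norm_mul, norm_mul]
  gcongr
  exact (hM s (ht.trans (le_of_lt hs))).trans (le_abs_self M)

theorem integral_Ioi_bound (h : Dichotomy c ξ η K) {n : ℝ → ℝ} {t M : ℝ} (ht : 0 ≤ t)
    (hM : ∀ s, 0 ≤ s → |n s| ≤ M) :
    ‖η t‖ * |∫ s in Ioi t, (ξ s).1 * n s| ≤ K * M := by
  have hM0 : 0 ≤ M := (abs_nonneg _).trans (hM 0 le_rfl)
  have h1 := (h.integrable.mono_set (Ioi_subset_Ioi ht))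
  have : |∫ s in Ioi t, (ξ s).1 * n s| ≤ ∫ s in Ioi t, |(ξ s).1| * M := by
    rw [← Real.norm_eq_abs]
    refine norm_integral_le_of_norm_le (h1.abs.mul_const M) ?_
    refine (ae_restrict_iff' measurableSet_Ioi).2 (Eventually.of_forall fun s hs => ?_)
    rw [norm_mul]
    exact mul_le_mul_of_nonneg_left (hM s (ht.trans (le_of_lt hs))) (norm_nonneg _)
  rw [integral_mul_const] at this
  calc _ ≤ ‖η t‖ * ((∫ s in Ioi t, |(ξ s).1|) * M) := by gcongr
    _ = (‖η t‖ * ∫ s in Ioi t, |(ξ s).1|) * M := by ring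
    _ ≤ _ := by gcongr; exact h.forward t ht

theorem integral_interval_bound (h : Dichotomy c ξ η K) {n : ℝ → ℝ} {t M : ℝ} (ht : 0 ≤ t)
    (hM : ∀ s, 0 ≤ s → |n s| ≤ M) :
    ‖ξ t‖ * |∫ s in (0 : ℝ)..t, (η s).1 * n s| ≤ K * M := by
  have hM0 : 0 ≤ M := (abs_nonneg _).trans (hM 0 le_rfl)
  have : |∫ s in (0 : ℝ)..t, (η s).1 * n s| ≤ ∫ s in (0 : ℝ)..t, |(η s).1| * M := by
    rw [← Real.norm_eq_abs]
    refine intervalIntegral.norm_integral_le_of_norm_le ht ?_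
      ((h.contη.fst.abs.mul continuous_const).intervalIntegrable _ _)
    refine Eventually.of_forall fun s hs => ?_
    rw [norm_mul]
    exact mul_le_mul_of_nonneg_left (hM s hs.1.le) (norm_nonneg _)
  rw [intervalIntegral.integral_mul_const] at this
  calc _ ≤ ‖ξ t‖ * ((∫ s in (0 : ℝ)..t, |(η s).1|) * M) := by gcongr
    _ = (‖ξ t‖ * ∫ s in (0 : ℝ)..t, |(η s).1|) * M := by ring
    _ ≤ _ := by gcongr; exact h.backward t ht

theorem green_eq (h : Dichotomy c ξ η K) {n : ℝ → ℝ} {t M : ℝ} (ht : 0 ≤ t)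
    (hn : ContinuousOn n (Ici 0)) (hM : ∀ s, 0 ≤ s → |n s| ≤ M) :
    green ξ η n t = -(∫ s in Ioi t, (ξ s).1 * n s) • η t
      - (∫ s in (0 : ℝ)..t, (η s).1 * n s) • ξ t := by
  have := intervalIntegral.integral_interval_add_Ioi (h.integrableOn_mul le_rfl hn hM)
    (h.integrableOn_mul ht hn hM)
  rw [green, ← this, add_sub_cancel_left]

theorem norm_green_le (h : Dichotomy c ξ η K) {n : ℝ → ℝ} {t M : ℝ} (ht : 0 ≤ t)
    (hn : ContinuousOn n (Ici 0)) (hM : ∀ s, 0 ≤ s → |n s| ≤ M) :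
    ‖green ξ η n t‖ ≤ 2 * K * M := by
  rw [h.green_eq ht hn hM]
  refine (norm_sub_le _ _).trans ?_
  rw [norm_smul, norm_smul, norm_neg, Real.norm_eq_abs, Real.norm_eq_abs, mul_comm |_|,
    mul_comm |_|]
  have := h.integral_Ioi_bound ht hM
  have := h.integral_interval_bound ht hM
  linarith

theorem green_sub (h : Dichotomy c ξ η K) {n n' : ℝ → ℝ} {t M M' : ℝ}
    (hn : Continuous n) (hM : ∀ s, 0 ≤ s → |n s| ≤ M)
    (hn' : Continuous n') (hM' : ∀ s, 0 ≤ s → |n' s| ≤ M') :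
    green ξ η n t - green ξ η n' t = green ξ η (fun s => n s - n' s) t := by
  have e1 : ∀ s, (ξ s).1 * (n s - n' s) = (ξ s).1 * n s - (ξ s).1 * n' s := fun s => by ring
  have e2 : ∀ s, (η s).1 * (n s - n' s) = (η s).1 * n s - (η s).1 * n' s := fun s => by ring
  have hint : ∀ u : ℝ → ℝ × ℝ, Continuous u → ∀ g : ℝ → ℝ, Continuous g →
      IntervalIntegrable (fun s => (u s).1 * g s) volume 0 t := fun u hu g hg =>
    (hu.fst.mul hg).intervalIntegrable _ _
  simp only [green, e1, e2]
  rw [integral_sub (h.integrableOn_mul le_rfl hn.continuousOn hM)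
    (h.integrableOn_mul le_rfl hn'.continuousOn hM'),
    intervalIntegral.integral_sub (hint _ h.contξ _ hn) (hint _ h.contξ _ hn'),
    intervalIntegral.integral_sub (hint _ h.contη _ hn) (hint _ h.contη _ hn')]
  module

/-- A bounded solution on the half-line with initial value parallel to `η` is given by the Green
function. -/
theorem eq_green (h : Dichotomy c ξ η K) {n : ℝ → ℝ} {w : ℝ → ℝ × ℝ} {M B σ : ℝ}
    (hn : ContinuousOn n (Ici 0)) (hM : ∀ s, 0 ≤ s → |n s| ≤ M)
    (hw : ∀ t, 0 ≤ t → HasDerivWithinAt w ((w t).2, c t * (w t).1 + n t) (Ici 0) t)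
    (hB : ∀ t, 0 ≤ t → ‖w t‖ ≤ B) (h0 : w 0 = σ • η 0) {t : ℝ} (ht : 0 ≤ t) :
    w t = green ξ η n t := by
  have hwc : ContinuousOn w (Ici 0) := fun t ht => (hw t ht).continuousWithinAt
  have hw' : ∀ t, 0 < t → HasDerivAt w ((w t).2, c t * (w t).1 + n t) t := fun t ht =>
    (hw t ht.le).hasDerivAt (Ici_mem_nhds ht)
  have hcross : ∀ t, 0 < t → HasDerivAt (fun t => (ξ t).1 * (w t).2 - (ξ t).2 * (w t).1)
      ((ξ t).1 * n t) t := by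
    intro t ht
    have := ((hasDerivAt_fst (h.derivξ t)).mul (hasDerivAt_snd (hw' t ht))).sub
      ((hasDerivAt_snd (h.derivξ t)).mul (hasDerivAt_fst (hw' t ht)))
    exact this.congr_deriv (by simp; ring)
  have hcross2 : ∀ t, 0 < t → HasDerivAt (fun t => (η t).1 * (w t).2 - (η t).2 * (w t).1)
      ((η t).1 * n t) t := by
    intro t ht
    have := ((hasDerivAt_fst (h.derivη t)).mul (hasDerivAt_snd (hw' t ht))).sub
      ((hasDerivAt_snd (h.derivη t)).mul (hasDerivAt_fst (hw' t ht)))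
    exact this.congr_deriv (by simp; ring)
  have hlim : Tendsto (fun t => (ξ t).1 * (w t).2 - (ξ t).2 * (w t).1) atTop (𝓝 0) := by
    have hb : Tendsto (fun t => 2 * (‖ξ t‖ * B)) atTop (𝓝 0) := by
      simpa using ((h.lim.norm).mul_const B).const_mul 2
    refine squeeze_zero_norm' ?_ hb
    filter_upwards [eventually_ge_atTop 0] with t ht
    have e1 : ‖(ξ t).1‖ ≤ ‖ξ t‖ := norm_fst_le _
    have e2 : ‖(ξ t).2‖ ≤ ‖ξ t‖ := norm_snd_le _
    have e3 : ‖(w t).1‖ ≤ B := (norm_fst_le _).trans (hB t ht)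
    have e4 : ‖(w t).2‖ ≤ B := (norm_snd_le _).trans (hB t ht)
    refine (norm_sub_le _ _).trans ?_
    rw [norm_mul, norm_mul, two_mul]
    gcongr
  have hc1 : ContinuousOn (fun t => (ξ t).1 * (w t).2 - (ξ t).2 * (w t).1) (Ici 0) := by
    have := h.contξ
    fun_prop
  have hc2 : ContinuousOn (fun t => (η t).1 * (w t).2 - (η t).2 * (w t).1) (Ici 0) := by
    have := h.contη
    fun_prop
  have i1 := integral_Ioi_of_hasDerivAt_of_tendsto (a := t)
    ((hc1 t ht).mono (Ici_subset_Ici.2 ht)) (fun s hs => hcross s (ht.trans_lt hs))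
    (h.integrableOn_mul ht hn hM) hlim
  have i2 := intervalIntegral.integral_eq_sub_of_hasDerivAt_of_le ht
    (hc2.mono Icc_subset_Ici_self) (fun s hs => hcross2 s hs.1)
    (ContinuousOn.intervalIntegrable (by
      rw [uIcc_of_le ht]
      exact h.contη.fst.continuousOn.mul (hn.mono Icc_subset_Ici_self)))
  rw [h.green_eq ht hn hM, i1, i2, h0]
  have hwr := h.wronskian t
  ext
  · simp
    linear_combination (w t).1 * (-hwr)
  · simp
    linear_combination (w t).2 * (-hwr)

/-- Uniqueness of bounded solutions of a Lipschitz perturbation. -/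
theorem eq_of_bounded (h : Dichotomy c ξ η K) {N : ℝ → ℝ × ℝ → ℝ} {ℓ : ℝ} (hℓ : 4 * K * ℓ ≤ 1)
    {D : ℝ → Set (ℝ × ℝ)}
    (hN : ∀ t, 0 ≤ t → ∀ z ∈ D t, ∀ z' ∈ D t, |N t z - N t z'| ≤ ℓ * ‖z - z'‖)
    {w w' : ℝ → ℝ × ℝ} {B σ σ' : ℝ}
    (hNw : ContinuousOn (fun t => N t (w t)) (Ici 0))
    (hNw' : ContinuousOn (fun t => N t (w' t)) (Ici 0))
    (hw : ∀ t, 0 ≤ t → HasDerivWithinAt w ((w t).2, c t * (w t).1 + N t (w t)) (Ici 0) t)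
    (hw' : ∀ t, 0 ≤ t → HasDerivWithinAt w' ((w' t).2, c t * (w' t).1 + N t (w' t)) (Ici 0) t)
    (hD : ∀ t, 0 ≤ t → w t ∈ D t) (hD' : ∀ t, 0 ≤ t → w' t ∈ D t)
    (hB : ∀ t, 0 ≤ t → ‖w t - w' t‖ ≤ B)
    (h0 : w 0 = σ • η 0) (h0' : w' 0 = σ' • η 0) {t : ℝ} (ht : 0 ≤ t) : w t = w' t := by
  have hd : ∀ t, 0 ≤ t → HasDerivWithinAt (fun t => w t - w' t) ((w t - w' t).2,
      c t * (w t - w' t).1 + (N t (w t) - N t (w' t))) (Ici 0) t := by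
    intro t ht
    refine ((hw t ht).sub (hw' t ht)).congr_deriv ?_
    ext <;> simp; ring
  have key : ∀ B, (∀ t, 0 ≤ t → ‖w t - w' t‖ ≤ B) → ∀ t, 0 ≤ t → ‖w t - w' t‖ ≤ B / 2 := by
    intro B hB t ht
    have hB0 : 0 ≤ B := (norm_nonneg _).trans (hB 0 le_rfl)
    have hM : ∀ s, 0 ≤ s → |N s (w s) - N s (w' s)| ≤ |ℓ| * B := fun s hs =>
      (hN s hs _ (hD s hs) _ (hD' s hs)).trans (by
        gcongr
        · exact le_abs_self _
        · exact hB s hs)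
    have hK := h.pos
    rcases le_total 0 ℓ with hl | hl
    · rw [h.eq_green (hNw.sub hNw') hM hd hB (σ := σ - σ') (by rw [h0, h0', sub_smul]) ht]
      refine (h.norm_green_le ht (hNw.sub hNw') hM).trans ?_
      rw [abs_of_nonneg hl]; nlinarith
    · have hM : ∀ s, 0 ≤ s → |N s (w s) - N s (w' s)| ≤ 0 := fun s hs =>
        (hN s hs _ (hD s hs) _ (hD' s hs)).trans (mul_nonpos_of_nonpos_of_nonneg hl (norm_nonneg _))
      rw [h.eq_green (hNw.sub hNw') hM hd hB (σ := σ - σ') (by rw [h0, h0', sub_smul]) ht]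
      refine (h.norm_green_le ht (hNw.sub hNw') hM).trans ?_
      linarith
  have hall : ∀ j : ℕ, ∀ t, 0 ≤ t → ‖w t - w' t‖ ≤ B * (1 / 2) ^ j := by
    intro j
    induction j with
    | zero => simpa using hB
    | succ j ih =>
      intro t ht
      refine (key _ ih t ht).trans (le_of_eq ?_)
      ring
  have hlim : Tendsto (fun j : ℕ => B * (1 / 2 : ℝ) ^ j) atTop (𝓝 0) := by
    simpa using (tendsto_pow_atTop_nhds_zero_of_lt_one (by norm_num : (0 : ℝ) ≤ 1 / 2)
      (by norm_num)).const_mul B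
  have := ge_of_tendsto' hlim fun j => hall j t ht
  exact sub_eq_zero.1 (norm_le_zero_iff.1 this)

/-- Existence of a bounded solution of a globally Lipschitz perturbation. -/
theorem exists_bounded (h : Dichotomy c ξ η K) {N : ℝ → ℝ × ℝ → ℝ} {ℓ m : ℝ} (hℓ0 : 0 ≤ ℓ)
    (hℓ : 4 * K * ℓ ≤ 1) (hc : Continuous fun p : ℝ × ℝ × ℝ => N p.1 p.2)
    (hN : ∀ t z z', |N t z - N t z'| ≤ ℓ * ‖z - z'‖) (hm : ∀ t, |N t 0| ≤ m) :
    ∃ w : ℝ → ℝ × ℝ, (∀ t, 0 ≤ t → HasDerivAt w ((w t).2, c t * (w t).1 + N t (w t)) t) ∧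
      (∀ t, 0 ≤ t → ‖w t‖ ≤ 4 * K * m) ∧
      w 0 = -(∫ s in Ioi 0, (ξ s).1 * N s (w s)) • η 0 := by
  have hK := h.pos
  have hm0 : 0 ≤ m := (abs_nonneg _).trans (hm 0)
  have hNb : ∀ t z, |N t z| ≤ m + ℓ * ‖z‖ := by
    intro t z
    have h1 := abs_sub_abs_le_abs_sub (N t z) (N t 0)
    have h2 := hN t z 0
    rw [sub_zero] at h2
    have := hm t
    linarith
  have hcomp : ∀ ζ : BoundedContinuousFunction ℝ (ℝ × ℝ), Continuous fun t => N t (ζ t) :=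
    fun ζ => hc.comp (continuous_id.prodMk ζ.continuous)
  have hbd : ∀ ζ : BoundedContinuousFunction ℝ (ℝ × ℝ), ∀ s, 0 ≤ s → |N s (ζ s)| ≤ m + ℓ * ‖ζ‖ :=
    fun ζ s _ => (hNb s (ζ s)).trans (by gcongr; exact ζ.norm_coe_le_norm s)
  let T : BoundedContinuousFunction ℝ (ℝ × ℝ) → BoundedContinuousFunction ℝ (ℝ × ℝ) := fun ζ =>
    BoundedContinuousFunction.ofNormedAddCommGroup
      (fun t => green ξ η (fun s => N s (ζ s)) (max t 0))
      (by
        have : Continuous (green ξ η fun s => N s (ζ s)) :=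
          continuous_iff_continuousAt.2 fun t => (h.hasDerivAt_green (hcomp ζ) t).continuousAt
        exact this.comp (continuous_id.max continuous_const))
      (2 * K * (m + ℓ * ‖ζ‖))
      (fun t => h.norm_green_le (le_max_right _ _) (hcomp ζ).continuousOn (hbd ζ))
  have hT : ContractingWith (1 / 2) T := by
    refine ⟨by norm_num, LipschitzWith.of_dist_le_mul fun ζ ζ' => ?_⟩
    refine (BoundedContinuousFunction.dist_le (by positivity)).2 fun t => ?_
    change dist (green ξ η (fun s => N s (ζ s)) (max t 0))
      (green ξ η (fun s => N s (ζ' s)) (max t 0)) ≤ _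
    rw [dist_eq_norm, h.green_sub (hcomp ζ) (hbd ζ) (hcomp ζ') (hbd ζ')]
    refine (h.norm_green_le (M := ℓ * dist ζ ζ') (le_max_right _ _)
      ((hcomp ζ).sub (hcomp ζ')).continuousOn fun s _ => ?_).trans ?_
    · refine (hN _ _ _).trans ?_
      rw [← dist_eq_norm]
      gcongr
      exact BoundedContinuousFunction.dist_coe_le_dist s
    · have : 0 ≤ dist ζ ζ' := dist_nonneg
      push_cast
      nlinarith
  obtain ⟨ζ, hζ⟩ : ∃ ζ, T ζ = ζ := ⟨_, hT.fixedPoint_isFixedPt⟩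
  have hval : ∀ t, 0 ≤ t → ζ t = green ξ η (fun s => N s (ζ s)) t := by
    intro t ht
    conv_lhs => rw [← hζ]
    change green ξ η (fun s => N s (ζ s)) (max t 0) = _
    rw [max_eq_left ht]
  refine ⟨green ξ η fun s => N s (ζ s), fun t ht => ?_, fun t ht => ?_, ?_⟩
  · rw [← hval t ht]
    have := h.hasDerivAt_green (hcomp ζ) t
    rwa [← hval t ht] at this
  · rw [← hval t ht]
    have h1 : ‖ζ‖ ≤ 2 * K * (m + ℓ * ‖ζ‖) := by
      conv_lhs => rw [← hζ]
      exact (BoundedContinuousFunction.norm_le (by positivity)).2 fun t =>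
        h.norm_green_le (le_max_right _ _) (hcomp ζ).continuousOn (hbd ζ)
    have h2 := ζ.norm_coe_le_norm t
    nlinarith [norm_nonneg ζ]
  · rw [green_zero]
    congr 2
    refine setIntegral_congr_fun measurableSet_Ioi fun s hs => ?_
    simp only [← hval s (le_of_lt hs)]

end Dichotomy
namespace ScalarHomoclinic

variable {f : ℝ → ℝ} {a lam : ℝ} {x v : ℝ → ℝ}

theorem differentiable_f (h : ScalarHomoclinic f a lam x v) : Differentiable ℝ f :=
  h.contDiff.differentiable (by norm_num)

theorem continuous_deriv_f (h : ScalarHomoclinic f a lam x v) : Continuous (deriv f) :=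
  h.contDiff.continuous_deriv (by norm_num)

theorem hasDerivAt_fx (h : ScalarHomoclinic f a lam x v) (t : ℝ) :
    HasDerivAt (fun t => f (x t)) (deriv f (x t) * v t) t :=
  (h.differentiable_f (x t)).hasDerivAt.comp t (h.hx t)

/-- The coefficient in the reduction of order for the variational equation along the orbit. -/
noncomputable def shear (f x v : ℝ → ℝ) (t : ℝ) : ℝ :=
  ∫ s in (0 : ℝ)..t, (1 + deriv f (x s)) * (v s ^ 2 - f (x s) ^ 2) / (v s ^ 2 + f (x s) ^ 2) ^ 2

/-- The growing solution of the variational equation along the orbit. -/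
noncomputable def growing (f x v : ℝ → ℝ) (t : ℝ) : ℝ × ℝ :=
  (shear f x v t * v t - f (x t) / (v t ^ 2 + f (x t) ^ 2),
    shear f x v t * f (x t) + v t / (v t ^ 2 + f (x t) ^ 2))

theorem growing_zero : growing f x v 0
    = (1 / (v 0 ^ 2 + f (x 0) ^ 2)) • ((-f (x 0), v 0) : ℝ × ℝ) := by
  ext <;> simp [growing, shear] <;> ring

theorem continuous_shear_integrand (h : ScalarHomoclinic f a lam x v) : Continuous fun s =>
    (1 + deriv f (x s)) * (v s ^ 2 - f (x s) ^ 2) / (v s ^ 2 + f (x s) ^ 2) ^ 2 := by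
  have h1 := h.cont_v
  have h2 := h.cont_fx
  have h3 := h.continuous_deriv_f.comp h.cont_x
  refine Continuous.div ((continuous_const.add h3).mul ((h1.pow 2).sub (h2.pow 2)))
    (((h1.pow 2).add (h2.pow 2)).pow 2) fun t => ?_
  have := h.speed_pos t
  positivity

theorem hasDerivAt_growing (h : ScalarHomoclinic f a lam x v) (t : ℝ) :
    HasDerivAt (growing f x v) ((growing f x v t).2, deriv f (x t) * (growing f x v t).1) t := by
  have hb : HasDerivAt (shear f x v) _ t :=
    intervalIntegral.integral_hasDerivAt_right (h.continuous_shear_integrand.intervalIntegrable _ _)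
      (h.continuous_shear_integrand.stronglyMeasurableAtFilter _ _)
      h.continuous_shear_integrand.continuousAt
  have hv := h.hv t
  have hF := h.hasDerivAt_fx t
  have hρ := (hv.pow 2).add (hF.pow 2)
  have hp := h.speed_pos t
  have h1 := (hb.mul hv).sub (hF.div hρ hp.ne')
  have h2 := (hb.mul hF).add (hv.div hρ hp.ne')
  refine (h1.prodMk h2).congr_deriv ?_
  simp only [growing, Pi.add_apply, Pi.pow_apply]
  have hp' := hp.ne'
  ext
  · simp only
    field_simp
    push_cast
    ring
  · simp only
    field_simp
    push_cast
    ring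

theorem exists_dichotomy (h : ScalarHomoclinic f a lam x v) :
    ∃ K, Dichotomy (fun t => deriv f (x t)) (fun t => (v t, f (x t))) (growing f x v) K := by
  have hlam := h.pos
  obtain ⟨C, hC, hdec⟩ := h.speed_decay
  obtain ⟨L, hL, hLb⟩ := exists_forall_abs_le_of_tendsto (φ := fun t => 1 + deriv f (x t))
    (continuous_const.add (h.continuous_deriv_f.comp h.cont_x))
    (((h.continuous_deriv_f.tendsto a).comp h.x_top).const_add 1)
    (((h.continuous_deriv_f.tendsto a).comp h.x_bot).const_add 1)
  set ρ : ℝ → ℝ := fun t => v t ^ 2 + f (x t) ^ 2 with hρ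
  have hρc : Continuous ρ := (h.cont_v.pow 2).add (h.cont_fx.pow 2)
  have hρp : ∀ t, 0 < ρ t := h.speed_pos
  have hexpint : ∀ μ : ℝ, 0 < μ → ∀ t, 0 ≤ t →
      ∫ s in (0 : ℝ)..t, Real.exp (-μ * (t - s)) ≤ 1 / μ := by
    intro μ hμ t ht
    have : ∀ s, HasDerivAt (fun s => Real.exp (-μ * (t - s)) / μ) (Real.exp (-μ * (t - s))) s := by
      intro s
      have := ((((hasDerivAt_id s).const_sub t).const_mul (-μ)).exp).div_const μ
      exact this.congr_deriv (by simp only [id]; field_simp)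
    rw [intervalIntegral.integral_eq_sub_of_hasDerivAt (fun s _ => this s)
      (Continuous.intervalIntegrable (by fun_prop) _ _)]
    have h2 := Real.exp_pos (-μ * (t - 0))
    rw [← sub_div]
    gcongr
    simp only [sub_self, mul_zero, Real.exp_zero]; linarith
  have hshear : ∀ t, 0 ≤ t → |shear f x v t| * ρ t ≤ L * C / lam := by
    intro t ht
    have h1 : |shear f x v t| ≤ ∫ s in (0 : ℝ)..t,
        L * C * Real.exp (-lam * (t - s)) / ρ t := by
      rw [← Real.norm_eq_abs]
      refine intervalIntegral.norm_integral_le_of_norm_le ht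
        (Eventually.of_forall fun s hs => ?_) (Continuous.intervalIntegrable (by fun_prop) _ _)
      have h2 := hdec s t hs.1.le hs.2
      have h3 : |v s ^ 2 - f (x s) ^ 2| ≤ ρ s :=
        abs_le.2 ⟨by simp only [hρ]; nlinarith [sq_nonneg (v s)],
          by simp only [hρ]; nlinarith [sq_nonneg (f (x s))]⟩
      rw [norm_div, norm_mul, norm_pow, Real.norm_eq_abs, Real.norm_eq_abs, Real.norm_eq_abs]
      have h4 : |v s ^ 2 + f (x s) ^ 2| = ρ s := abs_of_pos (hρp s)
      rw [h4, div_le_div_iff₀ (by have := hρp s; positivity) (hρp t)]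
      calc |1 + deriv f (x s)| * |v s ^ 2 - f (x s) ^ 2| * ρ t
          ≤ L * ρ s * (C * Real.exp (-lam * (t - s)) * ρ s) := by
            gcongr
            exact hLb s
        _ = _ := by ring
    have h5 : ∀ s, L * C * Real.exp (-lam * (t - s)) / ρ t
        = (L * C / ρ t) * Real.exp (-lam * (t - s)) := fun s => by ring
    simp only [h5] at h1
    rw [intervalIntegral.integral_const_mul] at h1
    have hp := hρp t
    calc |shear f x v t| * ρ t ≤ (L * C / ρ t * (1 / lam)) * ρ t := by
          gcongr
          exact h1.trans (by gcongr; exact hexpint lam hlam t ht)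
      _ = _ := by field_simp
  have hvσ : ∀ t, |v t| ≤ √(ρ t) := fun t => Real.abs_le_sqrt (by
    simp only [hρ]; nlinarith [sq_nonneg (f (x t))])
  have hfσ : ∀ t, |f (x t)| ≤ √(ρ t) := fun t => Real.abs_le_sqrt (by
    simp only [hρ]; nlinarith [sq_nonneg (v t)])
  have hσp : ∀ t, 0 < √(ρ t) := fun t => Real.sqrt_pos.2 (hρp t)
  set K₁ := L * C / lam + 1 with hK₁
  have hK₁p : 0 < K₁ := by positivity
  have hcomp : ∀ t, 0 ≤ t → ∀ p q : ℝ, |p| ≤ √(ρ t) → |q| ≤ √(ρ t) →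
      |shear f x v t * p| + |q / ρ t| ≤ K₁ / √(ρ t) := by
    intro t ht p q hp hq
    have hs := hσp t
    rw [le_div_iff₀ hs, abs_mul, abs_div, abs_of_pos (hρp t)]
    have h1 := hshear t ht
    have h2 : ρ t = √(ρ t) * √(ρ t) := (Real.mul_self_sqrt (hρp t).le).symm
    have h3 : |q| / ρ t * √(ρ t) ≤ 1 := by
      rw [div_mul_eq_mul_div, div_le_one (hρp t)]
      calc |q| * √(ρ t) ≤ √(ρ t) * √(ρ t) := by gcongr
        _ = ρ t := h2.symm
    have h4 : |shear f x v t| * |p| * √(ρ t) ≤ |shear f x v t| * ρ t := by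
      calc _ ≤ |shear f x v t| * √(ρ t) * √(ρ t) := by gcongr
        _ = |shear f x v t| * ρ t := by rw [mul_assoc, ← h2]
    rw [add_mul]
    linarith
  have hη1 : ∀ t, 0 ≤ t → |(growing f x v t).1| ≤ K₁ / √(ρ t) := by
    intro t ht
    exact (abs_sub _ _).trans (hcomp t ht _ _ (hvσ t) (hfσ t))
  have hη2 : ∀ t, 0 ≤ t → |(growing f x v t).2| ≤ K₁ / √(ρ t) := by
    intro t ht
    exact (abs_add_le _ _).trans (hcomp t ht _ _ (hfσ t) (hvσ t))
  have hσdec : ∀ t s, 0 ≤ t → t ≤ s →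
      √(ρ s) ≤ √C * Real.exp (-(lam / 2) * (s - t)) * √(ρ t) := by
    intro t s ht hts
    apply Real.sqrt_le_iff.2 ⟨by positivity, ?_⟩
    rw [mul_pow, mul_pow, Real.sq_sqrt hC.le, Real.sq_sqrt (hρp t).le, ← Real.exp_nat_mul]
    have : ((2 : ℕ) : ℝ) * (-(lam / 2) * (s - t)) = -lam * (s - t) := by push_cast; ring
    rw [this]
    exact hdec t s ht hts
  refine ⟨K₁ * √C * (2 / lam), ?_⟩
  refine ⟨fun t => (h.hv t).prodMk (h.hasDerivAt_fx t) , h.hasDerivAt_growing, fun t => ?_,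
    h.integrable_v.integrableOn, ?_, by positivity, fun t ht => ?_, fun t ht => ?_⟩
  · have := (h.speed_pos t).ne'
    simp only [growing]
    field_simp
    ring
  · have := h.v_top.prodMk_nhds ((h.cont_f.tendsto a).comp h.x_top)
    rw [h.zero] at this
    exact this
  · have h1 : ∫ s in Ioi t, |v s| ≤ ∫ s in Ioi t,
        √C * √(ρ t) * Real.exp ((lam / 2) * t) * Real.exp (-(lam / 2) * s) := by
      refine setIntegral_mono_on h.integrable_v.abs.integrableOn
        ((integrableOn_exp_mul_Ioi (by linarith) t).const_mul _) measurableSet_Ioi fun s hs => ?_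
      refine (hvσ s).trans ((hσdec t s ht (le_of_lt hs)).trans (le_of_eq ?_))
      have : Real.exp (-(lam / 2) * (s - t)) = Real.exp (lam / 2 * t) * Real.exp (-(lam / 2) * s) := by
        rw [← Real.exp_add]; congr 1; ring
      rw [this]; ring
    rw [integral_const_mul, integral_exp_mul_Ioi (by linarith)] at h1
    have h2 : √C * √(ρ t) * Real.exp (lam / 2 * t) * (-Real.exp (-(lam / 2) * t) / -(lam / 2))
        = √C * √(ρ t) * (2 / lam) := by
      have : Real.exp (lam / 2 * t) * Real.exp (-(lam / 2) * t) = 1 := by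
        rw [← Real.exp_add]; simp
      have e : -Real.exp (-(lam / 2) * t) / -(lam / 2) = Real.exp (-(lam / 2) * t) * (2 / lam) := by
        field_simp
      rw [e]
      linear_combination √C * √(ρ t) * (2 / lam) * this
    rw [h2] at h1
    have hn : ‖growing f x v t‖ ≤ K₁ / √(ρ t) := max_le (hη1 t ht) (hη2 t ht)
    have hs := hσp t
    calc _ ≤ K₁ / √(ρ t) * (√C * √(ρ t) * (2 / lam)) := by
          gcongr
      _ = _ := by field_simp
  · have hs := hσp t
    have hn : ‖((v t, f (x t)) : ℝ × ℝ)‖ ≤ √(ρ t) := max_le (hvσ t) (hfσ t)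
    have h1 : ∫ s in (0 : ℝ)..t, |(growing f x v s).1| ≤ ∫ s in (0 : ℝ)..t,
        K₁ * √C / √(ρ t) * Real.exp (-(lam / 2) * (t - s)) := by
      refine intervalIntegral.integral_mono_on ht ?_
        (Continuous.intervalIntegrable (by fun_prop) _ _) fun s hs' => ?_
      · have : Continuous (growing f x v) :=
          continuous_iff_continuousAt.2 fun t => (h.hasDerivAt_growing t).continuousAt
        exact this.fst.abs.intervalIntegrable _ _
      · refine (hη1 s hs'.1).trans ?_
        rw [div_mul_eq_mul_div, div_le_div_iff₀ (hσp s) hs]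
        have := hσdec s t hs'.1 hs'.2
        calc K₁ * √(ρ t) ≤ K₁ * (√C * Real.exp (-(lam / 2) * (t - s)) * √(ρ s)) := by gcongr
          _ = _ := by ring
    rw [intervalIntegral.integral_const_mul] at h1
    have h2 := hexpint (lam / 2) (by positivity) t ht
    calc _ ≤ √(ρ t) * (K₁ * √C / √(ρ t) * (1 / (lam / 2))) := by
          refine mul_le_mul hn (h1.trans ?_) (intervalIntegral.integral_nonneg ht
            fun _ _ => abs_nonneg _) hs.le
          gcongr
      _ = _ := by field_simp

end ScalarHomoclinic

/-- Uniform first-order Taylor estimate on a bounded set. -/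
theorem exists_taylor_bound {f : ℝ → ℝ} (hf : ContDiff ℝ 3 f) (B : ℝ) :
    ∃ M > 0, ∀ p y y' d, |p| ≤ B → |y| ≤ d → |y'| ≤ d → d ≤ 1 →
      |f (p + y) - f (p + y') - deriv f p * (y - y')| ≤ M * d * |y - y'| := by
  have hf2 : ContDiff ℝ 2 (deriv f) := by
    have : ContDiff ℝ (2 + 1) f := by norm_num; exact hf
    exact (contDiff_succ_iff_deriv.1 this).2.2
  obtain ⟨M, hM⟩ := (isCompact_Icc (a := -(B + 1)) (b := B + 1)).exists_bound_of_continuousOn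
    (hf2.continuous_deriv (by norm_num)).continuousOn
  have hd1 : Differentiable ℝ f := hf.differentiable (by norm_num)
  have hd2 : Differentiable ℝ (deriv f) := hf2.differentiable (by norm_num)
  refine ⟨|M| + 1, by positivity, fun p y y' d hp hy hy' hd => ?_⟩
  have hd0 : 0 ≤ d := (abs_nonneg _).trans hy
  have hp' := abs_le.1 hp
  have h1 : ∀ z ∈ Icc (-d) d, |deriv f (p + z) - deriv f p| ≤ (|M| + 1) * d := by
    intro z hz
    have := (convex_Icc (-(B + 1)) (B + 1)).norm_image_sub_le_of_norm_deriv_le (f := deriv f)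
      (C := |M|) (x := p) (y := p + z) (fun s _ => hd2 s)
      (fun s hs => (hM s hs).trans (le_abs_self M)) ⟨by linarith, by linarith⟩
      ⟨by linarith [hz.1], by linarith [hz.2]⟩
    rw [Real.norm_eq_abs] at this
    refine this.trans ?_
    have hz' : |z| ≤ d := abs_le.2 hz
    rw [add_sub_cancel_left, Real.norm_eq_abs]
    have := abs_nonneg M
    nlinarith [abs_nonneg z]
  have hder : ∀ z, HasDerivAt (fun z => f (p + z) - deriv f p * z) (deriv f (p + z) - deriv f p) z := by
    intro z
    have e1 := (hd1 (p + z)).hasDerivAt.comp z ((hasDerivAt_id z).const_add p)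
    exact (e1.sub ((hasDerivAt_id z).const_mul (deriv f p))).congr_deriv (by simp)
  have := (convex_Icc (-d) d).norm_image_sub_le_of_norm_hasDerivWithin_le
    (f := fun z => f (p + z) - deriv f p * z) (C := (|M| + 1) * d) (x := y') (y := y)
    (fun z _ => (hder z).hasDerivWithinAt) h1 (abs_le.1 hy') (abs_le.1 hy)
  simp only [Real.norm_eq_abs] at this
  refine le_trans (le_of_eq ?_) this
  congr 1
  ring

/-- Truncation of both coordinates to `[-d, d]`. -/
noncomputable def clamp (d : ℝ) (z : ℝ × ℝ) : ℝ × ℝ :=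
  (max (-d) (min z.1 d), max (-d) (min z.2 d))

theorem norm_clamp_le {d : ℝ} (hd : 0 ≤ d) (z : ℝ × ℝ) : ‖clamp d z‖ ≤ d := by
  have : ∀ y : ℝ, ‖max (-d) (min y d)‖ ≤ d := fun y =>
    abs_le.2 ⟨le_max_left _ _, max_le (by linarith) (min_le_right _ _)⟩
  exact max_le (this _) (this _)

theorem clamp_of_norm_le {d : ℝ} {z : ℝ × ℝ} (hz : ‖z‖ ≤ d) : clamp d z = z := by
  have h1 := abs_le.1 ((norm_fst_le z).trans hz)
  have h2 := abs_le.1 ((norm_snd_le z).trans hz)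
  ext
  · simp only [clamp]; rw [min_eq_left h1.2, max_eq_right h1.1]
  · simp only [clamp]; rw [min_eq_left h2.2, max_eq_right h2.1]

theorem norm_clamp_sub_le (d : ℝ) (z z' : ℝ × ℝ) : ‖clamp d z - clamp d z'‖ ≤ ‖z - z'‖ := by
  have : ∀ y y' : ℝ, |max (-d) (min y d) - max (-d) (min y' d)| ≤ |y - y'| := by
    intro y y'
    refine (abs_max_sub_max_le_max _ _ _ _).trans ?_
    refine max_le (by simp) ((abs_min_sub_min_le_max _ _ _ _).trans ?_)
    exact max_le le_rfl (by simp)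
  exact max_le_max (this _ _) (this _ _)

theorem continuous_clamp (d : ℝ) : Continuous (clamp d) := by
  unfold clamp; fun_prop

namespace ScalarHomoclinic

variable {f : ℝ → ℝ} {a lam : ℝ} {x v : ℝ → ℝ}

/-- Existence, uniqueness and first-order expansion of the solution of `ẍ = f x + g` that shadows
the forward half of the homoclinic orbit and starts on the normal line. -/
theorem exists_stable (h : ScalarHomoclinic f a lam x v) :
    ∃ δ₀ > 0, ∃ ℓ₀ > 0, ∃ C > 0, ∀ (g : ℝ → ℝ × ℝ → ℝ) (ℓ m : ℝ),
      Continuous (fun p : ℝ × ℝ × ℝ => g p.1 p.2) → 0 ≤ ℓ → ℓ ≤ ℓ₀ →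
      (∀ t z z', ‖z - (x t, v t)‖ ≤ δ₀ → ‖z' - (x t, v t)‖ ≤ δ₀ →
        |g t z - g t z'| ≤ ℓ * ‖z - z'‖) →
      (∀ t, |g t (x t, v t)| ≤ m) → C * m ≤ δ₀ →
      ∃ u : ℝ → ℝ × ℝ, (∀ t, 0 ≤ t → HasDerivAt u ((u t).2, f (u t).1 + g t (u t)) t) ∧
        (∀ t, 0 ≤ t → ‖u t - (x t, v t)‖ ≤ C * m) ∧
        (∃ s : ℝ, u 0 - (x 0, v 0) = s • (-f (x 0), v 0)) ∧
        |(v 0 * (u 0 - (x 0, v 0)).2 - f (x 0) * (u 0 - (x 0, v 0)).1)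
          + ∫ t in Ioi 0, v t * g t (x t, v t)| ≤ C * (m ^ 2 + ℓ * m) ∧
        ∀ u' : ℝ → ℝ × ℝ,
          (∀ t, 0 ≤ t → HasDerivWithinAt u' ((u' t).2, f (u' t).1 + g t (u' t)) (Ici 0) t) →
          (∀ t, 0 ≤ t → ‖u' t - (x t, v t)‖ ≤ δ₀) →
          (∃ s : ℝ, u' 0 - (x 0, v 0) = s • (-f (x 0), v 0)) → ∀ t, 0 ≤ t → u' t = u t := by
  obtain ⟨K, hK⟩ := h.exists_dichotomy
  have hKp := hK.pos
  obtain ⟨B, hB, hxB⟩ := h.bounded_x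
  obtain ⟨M, hM, hT⟩ := exists_taylor_bound h.contDiff B
  have hρ0 := h.speed_pos 0
  set I := ∫ t in Ioi 0, |v t| with hI
  have hI0 : 0 ≤ I := integral_nonneg fun _ => abs_nonneg _
  refine ⟨min 1 (1 / (8 * K * M)), by positivity, 1 / (8 * K), by positivity,
    4 * K + I * (M * (4 * K) ^ 2 + 4 * K), by positivity, ?_⟩
  set δ := min 1 (1 / (8 * K * M)) with hδ
  have hδp : 0 < δ := by positivity
  have hδ1 : δ ≤ 1 := min_le_left _ _
  intro g ℓ m hgc hℓ0 hℓ hgL hgm hCm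
  have hm0 : 0 ≤ m := (abs_nonneg _).trans (hgm 0)
  set C := 4 * K + I * (M * (4 * K) ^ 2 + 4 * K) with hC
  have hKC : 4 * K ≤ C := by rw [hC]; nlinarith [mul_nonneg hI0 (by positivity :
    0 ≤ M * (4 * K) ^ 2 + 4 * K)]
  have h4Km : 4 * K * m ≤ C * m := by gcongr
  set N₀ : ℝ → ℝ × ℝ → ℝ := fun t z =>
    f (x t + z.1) - f (x t) - deriv f (x t) * z.1 + g t ((x t, v t) + z) with hN₀
  have hN₀c : Continuous fun p : ℝ × ℝ × ℝ => N₀ p.1 p.2 := by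
    have h1 := h.cont_x
    have h2 := h.cont_v
    have h3 := h.cont_f
    have h4 := h.continuous_deriv_f
    have h5 : Continuous fun p : ℝ × ℝ × ℝ => g p.1 ((x p.1, v p.1) + p.2) :=
      hgc.comp (by fun_prop : Continuous fun p : ℝ × ℝ × ℝ => (p.1, (x p.1, v p.1) + p.2))
    exact Continuous.add (by fun_prop) h5
  have hN₀L : ∀ t z z', ‖z‖ ≤ δ → ‖z'‖ ≤ δ → |N₀ t z - N₀ t z'| ≤ (M * δ + ℓ) * ‖z - z'‖ := by
    intro t z z' hz hz'
    have e1 := hT (x t) z.1 z'.1 δ (hxB t) ((norm_fst_le z).trans hz)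
      ((norm_fst_le z').trans hz') hδ1
    have e2 := hgL t ((x t, v t) + z) ((x t, v t) + z') (by simpa using hz) (by simpa using hz')
    rw [add_sub_add_left_eq_sub] at e2
    have e3 : |z.1 - z'.1| ≤ ‖z - z'‖ := norm_fst_le (z - z')
    have e4 : N₀ t z - N₀ t z' = (f (x t + z.1) - f (x t + z'.1) - deriv f (x t) * (z.1 - z'.1))
        + (g t ((x t, v t) + z) - g t ((x t, v t) + z')) := by
      simp only [hN₀]; ring
    rw [e4, add_mul]
    refine (abs_add_le _ _).trans (add_le_add (e1.trans ?_) e2)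
    gcongr
  have hℓ' : 4 * K * (M * δ + ℓ) ≤ 1 := by
    have h1 : M * δ ≤ 1 / (8 * K) := by
      calc M * δ ≤ M * (1 / (8 * K * M)) := by gcongr; exact min_le_right _ _
        _ = _ := by field_simp
    calc 4 * K * (M * δ + ℓ) ≤ 4 * K * (1 / (8 * K) + 1 / (8 * K)) := by gcongr
      _ = 1 := by field_simp; norm_num
  obtain ⟨w, hw, hwb, hw0⟩ := hK.exists_bounded (N := fun t z => N₀ t (clamp δ z))
    (ℓ := M * δ + ℓ) (m := m) (by positivity) hℓ'
    (hN₀c.comp (continuous_fst.prodMk ((continuous_clamp δ).comp continuous_snd)))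
    (fun t z z' => (hN₀L t _ _ (norm_clamp_le hδp.le z) (norm_clamp_le hδp.le z')).trans (by
      gcongr; exact norm_clamp_sub_le δ z z'))
    (fun t => by
      have : clamp δ 0 = 0 := clamp_of_norm_le (by simpa using hδp.le)
      simpa [this, hN₀] using hgm t)
  have hwδ : ∀ t, 0 ≤ t → ‖w t‖ ≤ δ := fun t ht => (hwb t ht).trans (h4Km.trans hCm)
  have hwN : ∀ t, 0 ≤ t → N₀ t (clamp δ (w t)) = N₀ t (w t) := fun t ht => by
    rw [clamp_of_norm_le (hwδ t ht)]
  have hzd : ∀ t, HasDerivAt (fun t => ((x t, v t) : ℝ × ℝ)) (v t, f (x t)) t := fun t =>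
    (h.hx t).prodMk (h.hv t)
  have hw0' : ∃ σ : ℝ, w 0 = σ • (-f (x 0), v 0) := by
    rw [hw0, growing_zero, smul_smul]
    exact ⟨_, rfl⟩
  refine ⟨fun t => (x t, v t) + w t, fun t ht => ?_, fun t ht => ?_, ?_, ?_, ?_⟩
  · refine ((hzd t).add (hw t ht)).congr_deriv ?_
    rw [hwN t ht]
    ext
    · simp
    · simp [hN₀]; ring
  · simpa using (hwb t ht).trans h4Km
  · simpa using hw0'
  · have hNcont : ContinuousOn (fun t => N₀ t (w t)) (Ici 0) := by
      refine hN₀c.comp_continuousOn (continuousOn_id.prodMk fun t ht => ?_)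
      exact (hw t ht).continuousAt.continuousWithinAt
    have hQ : ∀ t, 0 ≤ t → |N₀ t (w t) - g t (x t, v t)| ≤
        M * (4 * K * m) ^ 2 + ℓ * (4 * K * m) := by
      intro t ht
      have hb := hwb t ht
      have e1 := hT (x t) (w t).1 0 (4 * K * m) (hxB t) ((norm_fst_le _).trans hb)
        (by simpa using by positivity) ((h4Km.trans hCm).trans hδ1)
      have e2 := hgL t ((x t, v t) + w t) (x t, v t) (by simpa using hwδ t ht)
        (by simpa using hδp.le)
      simp only [add_zero, sub_zero, add_sub_cancel_left] at e1 e2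
      have e4 : N₀ t (w t) - g t (x t, v t) = (f (x t + (w t).1) - f (x t)
          - deriv f (x t) * (w t).1) + (g t ((x t, v t) + w t) - g t (x t, v t)) := by
        simp only [hN₀]; ring
      rw [e4]
      refine (abs_add_le _ _).trans (add_le_add (e1.trans ?_) (e2.trans ?_))
      · have : |(w t).1| ≤ 4 * K * m := (norm_fst_le _).trans hb
        calc _ ≤ M * (4 * K * m) * (4 * K * m) := by gcongr
          _ = _ := by ring
      · gcongr
    have hgcont : Continuous fun t => g t (x t, v t) :=
      hgc.comp (continuous_id.prodMk (h.cont_x.prodMk h.cont_v))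
    have hbdN : ∀ s, 0 ≤ s → |N₀ s (w s)| ≤ m + (M * (4 * K * m) ^ 2 + ℓ * (4 * K * m)) := by
      intro s hs
      have h1 := hQ s hs
      have h2 := hgm s
      have h3 := abs_sub_abs_le_abs_sub (N₀ s (w s)) (g s (x s, v s))
      linarith
    have i1 := hK.integrableOn_mul le_rfl hNcont hbdN
    have i2 := hK.integrableOn_mul le_rfl hgcont.continuousOn (fun s _ => hgm s)
    have hcr : v 0 * (w 0).2 - f (x 0) * (w 0).1 = -∫ t in Ioi 0, v t * N₀ t (w t) := by
      have : ∫ t in Ioi 0, v t * N₀ t (w t) = ∫ t in Ioi 0, v t * N₀ t (clamp δ (w t)) :=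
        setIntegral_congr_fun measurableSet_Ioi fun t ht => by
          simp only [hwN t (le_of_lt ht)]
      rw [this, hw0, growing_zero]
      simp
      field_simp
      ring
    simp only [add_sub_cancel_left]
    rw [hcr, neg_add_eq_sub, ← integral_sub i2 i1]
    have hle : |∫ t in Ioi 0, (v t * g t (x t, v t) - v t * N₀ t (w t))| ≤
        ∫ t in Ioi 0, |v t| * (M * (4 * K * m) ^ 2 + ℓ * (4 * K * m)) := by
      rw [← Real.norm_eq_abs]
      refine norm_integral_le_of_norm_le (h.integrable_v.integrableOn.abs.mul_const _) ?_
      refine (ae_restrict_iff' measurableSet_Ioi).2 (Eventually.of_forall fun t ht => ?_)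
      rw [← mul_sub, norm_mul, Real.norm_eq_abs, Real.norm_eq_abs, abs_sub_comm]
      exact mul_le_mul_of_nonneg_left (hQ t (le_of_lt ht)) (abs_nonneg _)
    refine hle.trans ?_
    rw [integral_mul_const, ← hI]
    have e : C * (m ^ 2 + ℓ * m) - I * (M * (4 * K * m) ^ 2 + ℓ * (4 * K * m))
        = 4 * K * (m ^ 2 + ℓ * m) + I * (M * (4 * K) ^ 2) * (ℓ * m) + I * (4 * K) * m ^ 2 := by
      rw [hC]; ring
    have : 0 ≤ 4 * K * (m ^ 2 + ℓ * m) + I * (M * (4 * K) ^ 2) * (ℓ * m) + I * (4 * K) * m ^ 2 := by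
      positivity
    linarith
  · intro u' hu' hu'b hu'0 t ht
    obtain ⟨s, hs⟩ := hu'0
    obtain ⟨σ, hσ⟩ := hw0'
    have hscale : ∀ s : ℝ, s • ((-f (x 0), v 0) : ℝ × ℝ)
        = (s * (v 0 ^ 2 + f (x 0) ^ 2)) • growing f x v 0 := by
      intro s
      rw [growing_zero, smul_smul]
      congr 1
      field_simp
    have hcont' : ContinuousOn (fun t => u' t - (x t, v t)) (Ici 0) := fun t ht =>
      (hu' t ht).continuousWithinAt.sub (hzd t).continuousAt.continuousWithinAt
    have := hK.eq_of_bounded (N := N₀) (ℓ := M * δ + ℓ) hℓ' (D := fun _ => {z | ‖z‖ ≤ δ})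
      (fun t _ z hz z' hz' => hN₀L t z z' hz hz')
      (w := fun t => u' t - (x t, v t)) (w' := w) (B := δ + δ)
      (hN₀c.comp_continuousOn (continuousOn_id.prodMk hcont'))
      (hN₀c.comp_continuousOn (continuousOn_id.prodMk fun t ht =>
        (hw t ht).continuousAt.continuousWithinAt))
      (fun t ht => by
        refine ((hu' t ht).sub (hzd t).hasDerivWithinAt).congr_deriv ?_
        ext
        · simp
        · simp [hN₀]; ring)
      (fun t ht => by rw [← hwN t ht]; exact (hw t ht).hasDerivWithinAt)
      (fun t ht => hu'b t ht) hwδ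
      (fun t ht => (norm_sub_le _ _).trans (add_le_add (hu'b t ht) (hwδ t ht)))
      (hs.trans (hscale s)) (hσ.trans (hscale σ)) ht
    change u' t = (x t, v t) + w t
    rw [← this]
    abel

/-- Solutions shadowing the forward half of the homoclinic orbit do not return to a short normal
segment. -/
theorem exists_notMem_segment (h : ScalarHomoclinic f a lam x v) :
    ∃ δ₁ > 0, ∃ m₁ > 0, ∀ (g : ℝ → ℝ × ℝ → ℝ) (u : ℝ → ℝ × ℝ) (δ : ℝ), 0 ≤ δ → δ ≤ δ₁ →
      (∀ t, 0 ≤ t → HasDerivAt u ((u t).2, f (u t).1 + g t (u t)) t) →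
      (∀ t, 0 ≤ t → |g t (u t)| ≤ m₁) → (∀ t, 0 ≤ t → ‖u t - (x t, v t)‖ ≤ δ) →
      (∃ s : ℝ, u 0 - (x 0, v 0) = s • (-f (x 0), v 0)) → ∀ t, 0 < t →
      ∀ s : ℝ, |s| ≤ δ → u t - (x 0, v 0) ≠ s • (-f (x 0), v 0) := by
  have hρ := h.speed_pos 0
  set ρ := v 0 ^ 2 + f (x 0) ^ 2 with hρdef
  have hz : Continuous fun t => ((x t, v t) : ℝ × ℝ) := h.cont_x.prodMk h.cont_v
  have hG : ContinuousAt (fun z : ℝ × ℝ => v 0 * z.2 + 0 + f (x 0) * f z.1) (x 0, v 0) := by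
    have := h.cont_f
    fun_prop
  obtain ⟨η, hη, hGη⟩ := Metric.continuousAt_iff.1 hG (ρ / 4) (by positivity)
  obtain ⟨τ, hτ, hτη⟩ := Metric.continuousAt_iff.1 (hz.continuousAt (x := 0)) (η / 2) (by positivity)
  set Nn := ‖((-f (x 0), v 0) : ℝ × ℝ)‖ with hNn
  have hinj : ∀ t, 0 < t → ((x t, v t) : ℝ × ℝ) ≠ (x 0, v 0) := by
    intro t ht heq
    rw [Prod.mk.injEq] at heq
    have hall : ∀ s, x (s + t) = x s := fun s =>
      (eq_of_state_eq (h.contDiff.of_le (by norm_num)) (x := fun s => x (s + t))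
        (v := fun s => v (s + t)) (fun s => (h.hx (s + t)).comp_add_const s t)
        (fun s => (h.hv (s + t)).comp_add_const s t) h.hx h.hv (τ := 0)
        (by simpa using heq.1) (by simpa using heq.2) s).1
    have hn : ∀ n : ℕ, x (n * t) = x 0 := by
      intro n
      induction n with
      | zero => simp
      | succ n ih => rw [← ih, ← hall (n * t)]; congr 1; push_cast; ring
    have hlim : Tendsto (fun n : ℕ => x (n * t)) atTop (𝓝 a) :=
      h.x_top.comp ((tendsto_natCast_atTop_atTop (R := ℝ)).atTop_mul_const ht)
    simp only [hn] at hlim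
    exact h.ne 0 (tendsto_nhds_unique tendsto_const_nhds hlim)
  have hfar : ∃ c > 0, ∀ t, τ / 2 ≤ t → c ≤ ‖((x t, v t) : ℝ × ℝ) - (x 0, v 0)‖ := by
    have hpos : ∀ t, τ / 2 ≤ t → 0 < ‖((x t, v t) : ℝ × ℝ) - (x 0, v 0)‖ := fun t ht =>
      norm_pos_iff.2 (sub_ne_zero.2 (hinj t (by linarith)))
    have hlim : Tendsto (fun t => ‖((x t, v t) : ℝ × ℝ) - (x 0, v 0)‖) atTop
        (𝓝 ‖((a, 0) : ℝ × ℝ) - (x 0, v 0)‖) :=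
      ((h.x_top.prodMk_nhds h.v_top).sub_const _).norm
    have hla : 0 < ‖((a, 0) : ℝ × ℝ) - (x 0, v 0)‖ := norm_pos_iff.2 (sub_ne_zero.2 fun e => by
      rw [Prod.mk.injEq] at e
      exact h.ne 0 e.1.symm)
    obtain ⟨c, hc, hle⟩ := exists_pos_forall_le_of_tendsto
      (φ := fun t => ‖((x (max t (τ / 2)), v (max t (τ / 2))) : ℝ × ℝ) - (x 0, v 0)‖)
      (by have h1 := h.cont_x; have h2 := h.cont_v; fun_prop)
      (fun t => hpos _ (le_max_right _ _)) hla (hpos (τ / 2) le_rfl)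
      (hlim.comp (tendsto_atTop_mono (fun t => le_max_left t _) tendsto_id))
      (tendsto_const_nhds.congr' (by
        filter_upwards [eventually_le_atBot (τ / 2)] with t ht
        rw [max_eq_right ht]))
    exact ⟨c, hc, fun t ht => by simpa [max_eq_left ht] using hle t⟩
  obtain ⟨c, hc, hcle⟩ := hfar
  refine ⟨min (η / 4) (c / (2 * (1 + Nn))), by positivity, ρ / (4 * (1 + |f (x 0)|)), by positivity,
    ?_⟩
  intro g u δ hδ0 hδ hu hg hub hu0 t ht s hs heq
  rcases le_total (τ / 2) t with htτ | htτ
  · have h1 := hcle t htτ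
    have h2 := hub t ht.le
    have h3 : ‖u t - (x 0, v 0)‖ ≤ δ * Nn := by
      rw [heq, norm_smul]; gcongr; exact hs
    have h4 : ‖((x t, v t) : ℝ × ℝ) - (x 0, v 0)‖ ≤ ‖u t - (x 0, v 0)‖ + ‖u t - (x t, v t)‖ := by
      have := norm_sub_le (u t - (x 0, v 0)) (u t - (x t, v t))
      simpa using this
    have h5 : δ * (1 + Nn) ≤ c / 2 := by
      have : 0 < 1 + Nn := by positivity
      calc δ * (1 + Nn) ≤ c / (2 * (1 + Nn)) * (1 + Nn) := by
            gcongr; exact hδ.trans (min_le_right _ _)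
        _ = c / 2 := by field_simp
    linarith
  · set p : ℝ → ℝ := fun t => v 0 * ((u t).1 - x 0) + f (x 0) * ((u t).2 - v 0) with hp
    have hpd : ∀ t, 0 ≤ t → HasDerivAt p (v 0 * (u t).2 + f (x 0) * (f (u t).1 + g t (u t))) t := by
      intro t ht
      exact (((hasDerivAt_fst (hu t ht)).sub_const _).const_mul _).add
        (((hasDerivAt_snd (hu t ht)).sub_const _).const_mul _)
    have hmono : StrictMonoOn p (Icc 0 t) := by
      apply strictMonoOn_of_deriv_pos (convex_Icc 0 t)
      · exact fun s hs => (hpd s hs.1).continuousAt.continuousWithinAt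
      · intro s hs
        rw [interior_Icc] at hs
        rw [(hpd s hs.1.le).deriv]
        have h1 : dist ((x s, v s) : ℝ × ℝ) (x 0, v 0) < η / 2 := hτη (by
          rw [Real.dist_eq, sub_zero, abs_of_pos hs.1]; linarith [hs.2])
        have h2 : dist (u s) (x 0, v 0) < η := by
          have := dist_triangle (u s) (x s, v s) (x 0, v 0)
          have h3 := hub s hs.1.le
          rw [← dist_eq_norm] at h3
          have := hδ.trans (min_le_left _ _)
          linarith
        have h4 := (abs_lt.1 (hGη h2)).1
        have h5 : |f (x 0) * g s (u s)| ≤ ρ / 4 := by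
          rw [abs_mul]
          calc |f (x 0)| * |g s (u s)| ≤ (1 + |f (x 0)|) * (ρ / (4 * (1 + |f (x 0)|))) := by
                gcongr
                · linarith
                · exact hg s hs.1.le
            _ = ρ / 4 := by field_simp
        have h6 := (abs_le.1 h5).1
        have h7 : v 0 * v 0 + 0 + f (x 0) * f (x 0) = ρ := by rw [hρdef]; ring
        simp only at h4
        rw [h7] at h4
        nlinarith
    have h0 : p 0 = 0 := by
      obtain ⟨σ, hσ⟩ := hu0
      have e1 := congrArg Prod.fst hσ
      have e2 := congrArg Prod.snd hσ
      simp at e1 e2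
      simp only [hp]; rw [e1, e2]; ring
    have h1 : p t = 0 := by
      have e1 := congrArg Prod.fst heq
      have e2 := congrArg Prod.snd heq
      simp at e1 e2
      simp only [hp]; rw [e1, e2]; ring
    have := hmono ⟨le_rfl, ht.le⟩ ⟨ht.le, le_rfl⟩ ht
    linarith

end ScalarHomoclinic

section ShortTimeFlow

variable {E : Type*} [NormedAddCommGroup E] [NormedSpace ℝ E]

/-- The Picard-Lindelöf theorem, with the information that the solution stays in the ball. -/
theorem exists_solution_mem_closedBall [CompleteSpace E] {f : ℝ → E → E} {tmin tmax : ℝ}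
    {t₀ : Icc tmin tmax} {x₀ x : E} {a r L K : NNReal} (hf : IsPicardLindelof f t₀ x₀ a r L K)
    (hx : x ∈ Metric.closedBall x₀ r) :
    ∃ α : ℝ → E, α t₀ = x ∧
      (∀ t ∈ Icc tmin tmax, HasDerivWithinAt α (f t (α t)) (Icc tmin tmax) t) ∧
      ∀ t, α t ∈ Metric.closedBall x₀ a := by
  obtain ⟨α, hα⟩ := ODE.FunSpace.exists_isFixedPt_next hf hx
  refine ⟨α.compProj, by rw [ODE.FunSpace.compProj_val, ← hα, ODE.FunSpace.next_apply₀],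
    fun t ht ↦ ?_, fun t => α.compProj_mem_closedBall hf.mul_max_le⟩
  apply ODE.hasDerivWithinAt_picard_Icc t₀.2 hf.continuousOn_uncurry
    α.continuous_compProj.continuousOn (fun _ ht' ↦ α.compProj_mem_closedBall hf.mul_max_le)
    x ht |>.congr_of_mem _ ht
  intro t' ht'
  nth_rw 1 [← hα]
  rw [ODE.FunSpace.compProj_of_mem ht', ODE.FunSpace.next_apply]

/-- On the ball of radius `ρ` about `e`, the vector field `F t` is, up to a map with Lipschitz
constant `κ`, the linear map `A`, and `F t e` is bounded by `m`. -/
structure NearLinear (F : ℝ → E → E) (A : E →L[ℝ] E) (e : E) (ρ κ m : ℝ) : Prop where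
  lin : ∀ t, ∀ z ∈ Metric.closedBall e ρ, ∀ w ∈ Metric.closedBall e ρ,
    ‖F t z - F t w - A (z - w)‖ ≤ κ * ‖z - w‖
  cont : ∀ z, Continuous fun t => F t z
  center : ∀ t, ‖F t e‖ ≤ m
  radius_pos : 0 < ρ
  const_pos : 0 < κ

namespace NearLinear

variable {F : ℝ → E → E} {A : E →L[ℝ] E} {e : E} {ρ κ m : ℝ}

theorem lip (h : NearLinear F A e ρ κ m) (t : ℝ) {z w : E} (hz : z ∈ Metric.closedBall e ρ)
    (hw : w ∈ Metric.closedBall e ρ) : ‖F t z - F t w‖ ≤ (‖A‖ + κ) * ‖z - w‖ := by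
  have h1 := h.lin t z hz w hw
  have h2 := A.le_opNorm (z - w)
  have h3 := norm_add_le (F t z - F t w - A (z - w)) (A (z - w))
  rw [sub_add_cancel] at h3
  linarith

theorem norm_le (h : NearLinear F A e ρ κ m) (t : ℝ) {z : E} (hz : z ∈ Metric.closedBall e ρ) :
    ‖F t z‖ ≤ m + (‖A‖ + κ) * ‖z - e‖ := by
  have h1 := h.lip t hz (Metric.mem_closedBall_self h.radius_pos.le)
  have h2 := h.center t
  have h3 := norm_add_le (F t z - F t e) (F t e)
  rw [sub_add_cancel] at h3
  linarith

theorem exists_solution [CompleteSpace E] (h : NearLinear F A e ρ κ m) {T : ℝ} (hT : 0 ≤ T)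
    (hLT : (‖A‖ + κ) * T ≤ 1 / 4) (hmT : m * T ≤ ρ / 4) (t₀ : ℝ) {z : E}
    (hz : z ∈ Metric.closedBall e (ρ / 2)) :
    ∃ y : ℝ → E, y t₀ = z ∧
      (∀ t ∈ Icc t₀ (t₀ + T), HasDerivWithinAt y (F t (y t)) (Icc t₀ (t₀ + T)) t) ∧
      ∀ t ∈ Icc t₀ (t₀ + T), y t ∈ Metric.closedBall e ρ := by
  have hρ := h.radius_pos
  have hκ := h.const_pos
  have hm : 0 ≤ m := (norm_nonneg _).trans (h.center 0)
  have hL : 0 ≤ ‖A‖ + κ := by positivity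
  have hM : 0 ≤ m + (‖A‖ + κ) * ρ := by positivity
  have hPL : IsPicardLindelof F (tmin := t₀) (tmax := t₀ + T) ⟨t₀, by simp [hT]⟩ e ⟨ρ, hρ.le⟩
      ⟨ρ / 2, by positivity⟩ ⟨m + (‖A‖ + κ) * ρ, hM⟩ ⟨‖A‖ + κ, hL⟩ := by
    refine ⟨fun t _ => LipschitzOnWith.of_dist_le_mul fun z hz w hw => ?_,
      fun z _ => (h.cont z).continuousOn, fun t _ z hz => ?_, ?_⟩
    · rw [dist_eq_norm, dist_eq_norm]
      exact h.lip t hz hw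
    · refine (h.norm_le t hz).trans ?_
      have : ‖z - e‖ ≤ ρ := mem_closedBall_iff_norm.1 hz
      change _ ≤ m + (‖A‖ + κ) * ρ
      gcongr
    · change (m + (‖A‖ + κ) * ρ) * max (t₀ + T - t₀) (t₀ - t₀) ≤ ρ - ρ / 2
      rw [add_sub_cancel_left, sub_self, max_eq_left hT]
      nlinarith
  obtain ⟨α, h0, h1, h2⟩ := exists_solution_mem_closedBall hPL hz
  exact ⟨α, h0, h1, fun t _ => h2 t⟩

theorem _root_.Melnikov.hasDerivWithinAt_Ici_of_Icc {y : ℝ → E} {y' : E} {a b t : ℝ}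
    (h : HasDerivWithinAt y y' (Icc a b) t) (ht : t ∈ Ico a b) :
    HasDerivWithinAt y y' (Ici t) t :=
  h.mono_of_mem_nhdsWithin (Icc_mem_nhdsGE_of_mem ht)

theorem _root_.Melnikov.exp_sub_one_le_two_mul {s : ℝ} (h1 : s ≤ 1 / 2) :
    Real.exp s - 1 ≤ 2 * max s 0 := by
  rcases le_total s 0 with h | h
  · rw [max_eq_right h]
    have := Real.exp_le_one_iff.2 h
    linarith
  · rw [max_eq_left h]
    have h2 := Real.add_one_le_exp (-s)
    rw [Real.exp_neg] at h2
    have h3 := Real.exp_pos s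
    have h4 : (-s + 1) * Real.exp s ≤ 1 := by
      calc _ ≤ (Real.exp s)⁻¹ * Real.exp s := by gcongr
        _ = 1 := inv_mul_cancel₀ h3.ne'
    nlinarith

theorem norm_sub_le_two_mul (h : NearLinear F A e ρ κ m) {T t₀ : ℝ}
    (hLT : (‖A‖ + κ) * T ≤ 1 / 4) {y₁ y₂ : ℝ → E}
    (h₁ : ∀ t ∈ Icc t₀ (t₀ + T), HasDerivWithinAt y₁ (F t (y₁ t)) (Icc t₀ (t₀ + T)) t)
    (h₂ : ∀ t ∈ Icc t₀ (t₀ + T), HasDerivWithinAt y₂ (F t (y₂ t)) (Icc t₀ (t₀ + T)) t)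
    (b₁ : ∀ t ∈ Icc t₀ (t₀ + T), y₁ t ∈ Metric.closedBall e ρ)
    (b₂ : ∀ t ∈ Icc t₀ (t₀ + T), y₂ t ∈ Metric.closedBall e ρ) {t : ℝ}
    (ht : t ∈ Icc t₀ (t₀ + T)) : ‖y₁ t - y₂ t‖ ≤ 2 * ‖y₁ t₀ - y₂ t₀‖ := by
  have hL : 0 ≤ ‖A‖ + κ := by have := h.const_pos; positivity
  have hg := norm_le_gronwallBound_of_norm_deriv_right_le (f := fun t => y₁ t - y₂ t)
    (f' := fun t => F t (y₁ t) - F t (y₂ t)) (δ := ‖y₁ t₀ - y₂ t₀‖) (K := ‖A‖ + κ) (ε := 0)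
    (a := t₀) (b := t₀ + T)
    (fun t ht => ((h₁ t ht).sub (h₂ t ht)).continuousWithinAt)
    (fun t ht => hasDerivWithinAt_Ici_of_Icc
      ((h₁ t (Ico_subset_Icc_self ht)).sub (h₂ t (Ico_subset_Icc_self ht))) ht)
    le_rfl (fun t ht => by
      rw [add_zero]
      exact h.lip t (b₁ t (Ico_subset_Icc_self ht)) (b₂ t (Ico_subset_Icc_self ht))) t ht
  rw [gronwallBound_ε0] at hg
  have h3 : (‖A‖ + κ) * (t - t₀) ≤ 1 / 4 :=
    (mul_le_mul_of_nonneg_left (by linarith [ht.2] : t - t₀ ≤ T) hL).trans hLT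
  have h4 := exp_sub_one_le_two_mul (h3.trans (by norm_num))
  have h5 : max ((‖A‖ + κ) * (t - t₀)) 0 ≤ 1 / 4 := max_le h3 (by norm_num)
  have : Real.exp ((‖A‖ + κ) * (t - t₀)) ≤ 2 := by linarith
  calc _ ≤ _ := hg
    _ ≤ ‖y₁ t₀ - y₂ t₀‖ * 2 := by gcongr
    _ = _ := by ring

/-- The difference of two solutions over a short time is governed by `1 + T A`. -/
theorem norm_sub_linear_le (h : NearLinear F A e ρ κ m) {T t₀ : ℝ} (hT : 0 ≤ T)
    (hLT : (‖A‖ + κ) * T ≤ 1 / 4) {y₁ y₂ : ℝ → E}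
    (h₁ : ∀ t ∈ Icc t₀ (t₀ + T), HasDerivWithinAt y₁ (F t (y₁ t)) (Icc t₀ (t₀ + T)) t)
    (h₂ : ∀ t ∈ Icc t₀ (t₀ + T), HasDerivWithinAt y₂ (F t (y₂ t)) (Icc t₀ (t₀ + T)) t)
    (b₁ : ∀ t ∈ Icc t₀ (t₀ + T), y₁ t ∈ Metric.closedBall e ρ)
    (b₂ : ∀ t ∈ Icc t₀ (t₀ + T), y₂ t ∈ Metric.closedBall e ρ) :
    ‖(y₁ (t₀ + T) - y₂ (t₀ + T)) - (y₁ t₀ - y₂ t₀) - T • A (y₁ t₀ - y₂ t₀)‖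
      ≤ (2 * κ + 2 * ‖A‖ * (‖A‖ + κ) * T) * T * ‖y₁ t₀ - y₂ t₀‖ := by
  have hκ := h.const_pos
  have hL : 0 ≤ ‖A‖ + κ := by positivity
  have hmem : t₀ + T ∈ Icc t₀ (t₀ + T) := ⟨by linarith, le_rfl⟩
  set d₀ := y₁ t₀ - y₂ t₀ with hd₀
  have hd : ∀ t ∈ Icc t₀ (t₀ + T), ‖y₁ t - y₂ t - d₀‖ ≤ (‖A‖ + κ) * (2 * ‖d₀‖) * (t - t₀) := by
    refine norm_image_sub_le_of_norm_deriv_le_segment' (f := fun t => y₁ t - y₂ t)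
      (f' := fun t => F t (y₁ t) - F t (y₂ t)) (fun t ht => (h₁ t ht).sub (h₂ t ht)) fun t ht => ?_
    have ht' := Ico_subset_Icc_self ht
    refine (h.lip t (b₁ t ht') (b₂ t ht')).trans ?_
    gcongr
    exact h.norm_sub_le_two_mul hLT h₁ h₂ b₁ b₂ ht'
  have he := norm_image_sub_le_of_norm_deriv_le_segment'
    (f := fun t => y₁ t - y₂ t - (t - t₀) • A d₀)
    (f' := fun t => F t (y₁ t) - F t (y₂ t) - A d₀) (a := t₀) (b := t₀ + T)
    (C := (2 * κ + 2 * ‖A‖ * (‖A‖ + κ) * T) * ‖d₀‖)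
    (fun t ht => by
      have e1 : HasDerivAt (fun t : ℝ => (t - t₀) • A d₀) (A d₀) t := by
        simpa using ((hasDerivAt_id t).sub_const t₀).smul_const (A d₀)
      exact ((h₁ t ht).sub (h₂ t ht)).sub e1.hasDerivWithinAt)
    (fun t ht => by
      have ht' := Ico_subset_Icc_self ht
      have e1 := h.lin t _ (b₁ t ht') _ (b₂ t ht')
      have e2 := h.norm_sub_le_two_mul hLT h₁ h₂ b₁ b₂ ht'
      have e3 := A.le_opNorm (y₁ t - y₂ t - d₀)
      have e4 := hd t ht'
      have e5 : F t (y₁ t) - F t (y₂ t) - A d₀ = (F t (y₁ t) - F t (y₂ t) - A (y₁ t - y₂ t))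
          + A (y₁ t - y₂ t - d₀) := by rw [map_sub A (y₁ t - y₂ t) d₀]; abel
      rw [e5]
      refine (norm_add_le _ _).trans ((add_le_add e1 e3).trans ?_)
      have e6 : t - t₀ ≤ T := by linarith [ht.2]
      calc κ * ‖y₁ t - y₂ t‖ + ‖A‖ * ‖y₁ t - y₂ t - d₀‖
          ≤ κ * (2 * ‖d₀‖) + ‖A‖ * ((‖A‖ + κ) * (2 * ‖d₀‖) * T) := by
            gcongr
            exact e4.trans (by gcongr)
        _ = _ := by ring) (t₀ + T) hmem
  simp only [sub_self, zero_smul, sub_zero, add_sub_cancel_left] at he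
  rw [← hd₀] at he
  refine le_trans (le_of_eq ?_) (he.trans (le_of_eq (by ring)))
  congr 1
  abel

theorem norm_solution_sub_center_le (h : NearLinear F A e ρ κ m) {T t₀ : ℝ} (hT : 0 ≤ T)
    (hLT : (‖A‖ + κ) * T ≤ 1 / 4) {y : ℝ → E} (hy0 : y t₀ = e)
    (hy : ∀ t ∈ Icc t₀ (t₀ + T), HasDerivWithinAt y (F t (y t)) (Icc t₀ (t₀ + T)) t)
    (hb : ∀ t ∈ Icc t₀ (t₀ + T), y t ∈ Metric.closedBall e ρ) :
    ‖y (t₀ + T) - e‖ ≤ 2 * m * T := by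
  have hL : 0 < ‖A‖ + κ := by have := h.const_pos; positivity
  have hm : 0 ≤ m := (norm_nonneg _).trans (h.center 0)
  have hg := norm_le_gronwallBound_of_norm_deriv_right_le (f := fun t => y t - e)
    (f' := fun t => F t (y t)) (δ := 0) (K := ‖A‖ + κ) (ε := m) (a := t₀) (b := t₀ + T)
    (fun t ht => ((hy t ht).sub_const e).continuousWithinAt)
    (fun t ht => hasDerivWithinAt_Ici_of_Icc ((hy t (Ico_subset_Icc_self ht)).sub_const e) ht)
    (by simp [hy0]) (fun t ht => by
      rw [add_comm]; exact h.norm_le t (hb t (Ico_subset_Icc_self ht)))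
    (t₀ + T) ⟨by linarith, le_rfl⟩
  rw [gronwallBound_of_K_ne_0 hL.ne', add_sub_cancel_left] at hg
  simp only [zero_mul, zero_add] at hg
  have h4 := exp_sub_one_le_two_mul (hLT.trans (by norm_num))
  rw [max_eq_left (by positivity)] at h4
  calc _ ≤ _ := hg
    _ ≤ m / (‖A‖ + κ) * (2 * ((‖A‖ + κ) * T)) := by gcongr
    _ = _ := by field_simp

/-- The time-`T` map of a vector field with quadratic Taylor remainder is differentiable. -/
theorem hasFDerivAt_flow [CompleteSpace E] (h : NearLinear F A e ρ κ m) {T t₀ : ℝ} (hT : 0 ≤ T)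
    (hLT : (‖A‖ + κ) * T ≤ 1 / 4) {Y : E → ℝ → E}
    (hY0 : ∀ z ∈ Metric.closedBall e (ρ / 2), Y z t₀ = z)
    (hY : ∀ z ∈ Metric.closedBall e (ρ / 2), ∀ t ∈ Icc t₀ (t₀ + T),
      HasDerivWithinAt (Y z) (F t (Y z t)) (Icc t₀ (t₀ + T)) t)
    (hYb : ∀ z ∈ Metric.closedBall e (ρ / 2), ∀ t ∈ Icc t₀ (t₀ + T), Y z t ∈ Metric.closedBall e ρ)
    {DF : ℝ → E → E →L[ℝ] E} {M L : ℝ} (hL : 0 < L) (hLT' : 2 * L * T ≤ 1) (hM : 0 ≤ M)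
    (hDF : ∀ t, ∀ z ∈ Metric.closedBall e ρ, ∀ w ∈ Metric.closedBall e ρ,
      ‖F t z - F t w - DF t w (z - w)‖ ≤ M * ‖z - w‖ ^ 2)
    (hDFL : ∀ t, ∀ z ∈ Metric.closedBall e ρ, ‖DF t z‖ ≤ L)
    (hDFc : Continuous fun p : ℝ × E => DF p.1 p.2) {p : E}
    (hp : p ∈ Metric.ball e (ρ / 2)) :
    ∃ D : E →L[ℝ] E, HasFDerivAt (fun z => Y z (t₀ + T)) D p := by
  have hp' := Metric.ball_subset_closedBall hp
  set B : ℝ → E →L[ℝ] E := fun t => DF t (Y p t) with hB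
  have hBc : ContinuousOn B (Icc t₀ (t₀ + T)) := by
    refine hDFc.comp_continuousOn (continuousOn_id.prodMk fun t ht => ?_)
    exact (hY p hp' t ht).continuousWithinAt
  have hBL : ∀ t ∈ Icc t₀ (t₀ + T), ‖B t‖ ≤ L := fun t ht => hDFL t _ (hYb p hp' t ht)
  have hPL : IsPicardLindelof (fun t (W : E →L[ℝ] E) => (B t).comp W) (tmin := t₀)
      (tmax := t₀ + T) ⟨t₀, by simp [hT]⟩ (ContinuousLinearMap.id ℝ E) 1 0 ⟨2 * L, by positivity⟩
      ⟨L, hL.le⟩ := by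
    refine ⟨fun t ht => LipschitzOnWith.of_dist_le_mul fun z _ w _ => ?_,
      fun W _ => hBc.clm_comp continuousOn_const, fun t ht W hW => ?_, ?_⟩
    · rw [dist_eq_norm, dist_eq_norm, ← ContinuousLinearMap.comp_sub]
      refine (ContinuousLinearMap.opNorm_comp_le _ _).trans ?_
      exact mul_le_mul_of_nonneg_right (hBL t ht) (norm_nonneg _)
    · have h1 : ‖W‖ ≤ 2 := by
        have h2 : ‖W - ContinuousLinearMap.id ℝ E‖ ≤ 1 := by simpa [dist_eq_norm] using hW
        have h3 := norm_add_le (W - ContinuousLinearMap.id ℝ E) (ContinuousLinearMap.id ℝ E)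
        rw [sub_add_cancel] at h3
        have h4 := ContinuousLinearMap.norm_id_le (𝕜 := ℝ) (E := E)
        linarith
      refine (ContinuousLinearMap.opNorm_comp_le _ _).trans ?_
      change _ ≤ 2 * L
      nlinarith [hBL t ht, norm_nonneg (B t), norm_nonneg W]
    · change 2 * L * max (t₀ + T - t₀) (t₀ - t₀) ≤ 1 - 0
      rw [add_sub_cancel_left, sub_self, max_eq_left hT, sub_zero]
      exact hLT'
  obtain ⟨W, hW0, hW⟩ := hPL.exists_eq_forall_mem_Icc_hasDerivWithinAt₀
  simp only at hW0
  refine ⟨W (t₀ + T), ?_⟩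
  have hgb : ∃ C, 0 ≤ C ∧ ∀ ε : ℝ, gronwallBound 0 L ε T = C * ε := by
    refine ⟨(Real.exp (L * T) - 1) / L, ?_, fun ε => ?_⟩
    · have : 1 ≤ Real.exp (L * T) := Real.one_le_exp (by positivity)
      exact div_nonneg (by linarith) hL.le
    · rw [gronwallBound_of_K_ne_0 hL.ne']; ring
  obtain ⟨C, hC, hgb⟩ := hgb
  have hquad : ∀ z ∈ Metric.closedBall e (ρ / 2),
      ‖Y z (t₀ + T) - Y p (t₀ + T) - W (t₀ + T) (z - p)‖ ≤ C * (4 * M) * ‖z - p‖ ^ 2 := by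
    intro z hz
    have hWd : ∀ t ∈ Icc t₀ (t₀ + T), HasDerivWithinAt (fun t => W t (z - p))
        (B t (W t (z - p))) (Icc t₀ (t₀ + T)) t := by
      intro t ht
      have := ((ContinuousLinearMap.apply ℝ E (z - p)).hasFDerivAt
        (x := W t)).comp_hasDerivWithinAt t (hW t ht)
      exact this
    have hg := norm_le_gronwallBound_of_norm_deriv_right_le
      (f := fun t => Y z t - Y p t - W t (z - p))
      (f' := fun t => F t (Y z t) - F t (Y p t) - B t (W t (z - p))) (δ := 0) (K := L)
      (ε := M * (2 * ‖z - p‖) ^ 2) (a := t₀) (b := t₀ + T)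
      (fun t ht => (((hY z hz t ht).sub (hY p hp' t ht)).sub (hWd t ht)).continuousWithinAt)
      (fun t ht => hasDerivWithinAt_Ici_of_Icc
        (((hY z hz t (Ico_subset_Icc_self ht)).sub (hY p hp' t (Ico_subset_Icc_self ht))).sub
          (hWd t (Ico_subset_Icc_self ht))) ht)
      (by simp [hY0 z hz, hY0 p hp', hW0]) (fun t ht => by
        have ht' := Ico_subset_Icc_self ht
        have e1 := hDF t _ (hYb z hz t ht') _ (hYb p hp' t ht')
        have e2 := h.norm_sub_le_two_mul hLT (hY z hz) (hY p hp') (hYb z hz) (hYb p hp') ht'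
        rw [hY0 z hz, hY0 p hp'] at e2
        have e3 : F t (Y z t) - F t (Y p t) - B t (W t (z - p))
            = B t (Y z t - Y p t - W t (z - p))
              + (F t (Y z t) - F t (Y p t) - DF t (Y p t) (Y z t - Y p t)) := by
          simp only [hB, map_sub]; abel
        rw [e3]
        refine (norm_add_le _ _).trans (add_le_add ?_ (e1.trans (by gcongr)))
        refine ((B t).le_opNorm _).trans ?_
        gcongr
        exact hBL t ht') (t₀ + T) ⟨by linarith, le_rfl⟩
    rw [add_sub_cancel_left, hgb] at hg
    exact hg.trans (le_of_eq (by ring))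
  rw [hasFDerivAt_iff_isLittleO]
  have hO : (fun z => Y z (t₀ + T) - Y p (t₀ + T) - W (t₀ + T) (z - p))
      =O[𝓝 p] fun z => ‖z - p‖ ^ 2 := by
    refine Asymptotics.IsBigO.of_bound (C * (4 * M)) ?_
    filter_upwards [Metric.isOpen_ball.mem_nhds hp] with z hz
    rw [norm_pow, norm_norm]
    exact hquad z (Metric.ball_subset_closedBall hz)
  have ho : (fun z : E => ‖z - p‖ ^ 2) =o[𝓝 p] fun z => z - p := by
    have h1 := Asymptotics.isLittleO_norm_pow_id (E' := E) (n := 2) (by norm_num)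
    have h2 : Tendsto (fun z : E => z - p) (𝓝 p) (𝓝 0) := by
      have : Continuous fun z : E => z - p := by fun_prop
      simpa using this.tendsto p
    exact h1.comp_tendsto h2
  exact hO.trans_isLittleO ho

end NearLinear

end ShortTimeFlow

/-- The linearization `(x, v) ↦ (v, lam ^ 2 x)` at a saddle. -/
noncomputable def saddle (lam : ℝ) : ℝ × ℝ →L[ℝ] ℝ × ℝ :=
  (ContinuousLinearMap.snd ℝ ℝ ℝ).prod (lam ^ 2 • ContinuousLinearMap.fst ℝ ℝ ℝ)

theorem saddle_apply (lam : ℝ) (z : ℝ × ℝ) : saddle lam z = (z.2, lam ^ 2 * z.1) := rfl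

theorem aeval_charpoly_plane (L : ℝ × ℝ →L[ℝ] ℝ × ℝ) (μ : ℂ) :
    Polynomial.aeval μ (L : ℝ × ℝ →ₗ[ℝ] ℝ × ℝ).charpoly
      = (μ - (L (1, 0)).1) * (μ - (L (0, 1)).2) - (L (0, 1)).1 * (L (1, 0)).2 := by
  rw [← LinearMap.charpoly_toMatrix _ (Module.Basis.finTwoProd ℝ), Matrix.charpoly_fin_two,
    Matrix.trace_fin_two, Matrix.det_fin_two]
  simp [LinearMap.toMatrix_apply]
  ring

set_option maxHeartbeats 400000 in
/-- A matrix close to `1 + T A`, for `A` the saddle matrix, has no eigenvalue of modulus one. -/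
theorem aeval_charpoly_ne_zero_of_near {lam κ T : ℝ} (hlam : 0 < lam) (hT : 0 < T)
    (hκ0 : 0 ≤ κ) (hκ1 : κ ≤ 1 / 2) (hκ2 : κ ≤ lam ^ 2 / 2) (hκ3 : κ ≤ lam / 4)
    (hT1 : T * (2 * lam + 2) ≤ 1) {D : ℝ × ℝ →L[ℝ] ℝ × ℝ}
    (hD : ‖D - (ContinuousLinearMap.id ℝ (ℝ × ℝ) + T • saddle lam)‖ ≤ κ * T) {μ : ℂ}
    (hμ : ‖μ‖ = 1) : Polynomial.aeval μ (D : ℝ × ℝ →ₗ[ℝ] ℝ × ℝ).charpoly ≠ 0 := by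
  rw [aeval_charpoly_plane]
  have h1 : ‖D (1, 0) - ((1 : ℝ), T * lam ^ 2)‖ ≤ κ * T := by
    have := (D - (ContinuousLinearMap.id ℝ (ℝ × ℝ) + T • saddle lam)).le_of_opNorm_le hD (1, 0)
    have e : ‖((1 : ℝ), (0 : ℝ))‖ = 1 := by simp [Prod.norm_def]
    rw [e, mul_one] at this
    simpa [saddle_apply] using this
  have h2 : ‖D (0, 1) - (T, (1 : ℝ))‖ ≤ κ * T := by
    have := (D - (ContinuousLinearMap.id ℝ (ℝ × ℝ) + T • saddle lam)).le_of_opNorm_le hD (0, 1)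
    have e : ‖((0 : ℝ), (1 : ℝ))‖ = 1 := by simp [Prod.norm_def]
    rw [e, mul_one] at this
    simpa [saddle_apply] using this
  have hdiv : ∀ y : ℝ, |y| ≤ κ * T → ∃ α, |α| ≤ κ ∧ y = T * α := by
    intro y hy
    refine ⟨y / T, ?_, by field_simp⟩
    rw [abs_div, abs_of_pos hT, div_le_iff₀ hT]
    exact hy
  obtain ⟨α, hα, hα'⟩ := hdiv _ ((norm_fst_le _).trans h1)
  obtain ⟨γ, hγ, hγ'⟩ := hdiv _ ((norm_snd_le _).trans h1)
  obtain ⟨β, hβ, hβ'⟩ := hdiv _ ((norm_fst_le _).trans h2)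
  obtain ⟨η, hη, hη'⟩ := hdiv _ ((norm_snd_le _).trans h2)
  simp only [Prod.fst_sub, Prod.snd_sub] at hα' hγ' hβ' hη'
  have ea : (D (1, 0)).1 = 1 + T * α := by linarith
  have ec : (D (1, 0)).2 = T * (lam ^ 2 + γ) := by linarith
  have eb : (D (0, 1)).1 = T * (1 + β) := by linarith
  have ed : (D (0, 1)).2 = 1 + T * η := by linarith
  rw [ea, eb, ec, ed]
  intro h0
  obtain ⟨w, hw⟩ : ∃ w : ℂ, μ = 1 + T * (((α + η) / 2 : ℝ) + w) := by
    refine ⟨(μ - 1) / T - ((α + η) / 2 : ℝ), ?_⟩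
    have : (T : ℂ) ≠ 0 := by exact_mod_cast hT.ne'
    field_simp
    ring
  set Q : ℝ := (1 + β) * (lam ^ 2 + γ) + ((α - η) / 2) ^ 2 with hQ
  have hα2 := abs_le.1 hα
  have hβ2 := abs_le.1 hβ
  have hγ2 := abs_le.1 hγ
  have hη2 := abs_le.1 hη
  have hQlow : lam ^ 2 / 4 ≤ Q := by
    have h3 : (1 / 2) * (lam ^ 2 / 2) ≤ (1 + β) * (lam ^ 2 + γ) :=
      mul_le_mul (by linarith) (by linarith) (by positivity) (by linarith)
    have h4 := sq_nonneg ((α - η) / 2)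
    rw [hQ]
    linarith
  have hQup : Q < (2 * lam + 1) ^ 2 := by
    have h3 : (1 + β) * (lam ^ 2 + γ) ≤ (3 / 2) * (3 / 2 * lam ^ 2) := by
      have := sq_nonneg lam
      exact mul_le_mul (by linarith) (by linarith) (by linarith) (by norm_num)
    have h4 : |(α - η) / 2| ≤ 1 / 2 := abs_le.2 ⟨by linarith, by linarith⟩
    have h5 : ((α - η) / 2) ^ 2 ≤ (1 / 2) ^ 2 := by
      rw [← sq_abs]; gcongr
    have h6 : (2 * lam + 1) ^ 2 = 4 * lam ^ 2 + 4 * lam + 1 := by ring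
    have h7 := sq_nonneg lam
    rw [hQ, h6]
    linarith
  have hw2 : w ^ 2 = (Q : ℂ) := by
    have hT2 : (T : ℂ) ^ 2 ≠ 0 := pow_ne_zero _ (by exact_mod_cast hT.ne')
    have : (T : ℂ) ^ 2 * (w ^ 2 - Q) = 0 := by
      rw [← h0, hw, hQ]
      push_cast
      ring
    exact sub_eq_zero.1 ((mul_eq_zero.1 this).resolve_left hT2)
  have hre : w.re ^ 2 - w.im ^ 2 = Q := by
    have := congrArg Complex.re hw2
    simp only [sq, Complex.mul_re, Complex.ofReal_re] at this
    linarith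
  have him : w.re * w.im = 0 := by
    have := congrArg Complex.im hw2
    simp only [sq, Complex.mul_im, Complex.ofReal_im] at this
    linarith
  have hlam2 : 0 < lam ^ 2 := by positivity
  have him0 : w.im = 0 := by
    rcases mul_eq_zero.1 him with h | h
    · rw [h] at hre
      nlinarith [sq_nonneg w.im]
    · exact h
  rw [him0] at hre
  set σ := (α + η) / 2 with hσ
  have hμre : μ = ((1 + T * (σ + w.re) : ℝ) : ℂ) := by
    rw [hw]
    have : w = (w.re : ℂ) := Complex.ext rfl (by simp [him0])
    rw [this]
    push_cast
    simp
  rw [hμre, Complex.norm_real, Real.norm_eq_abs] at hμ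
  have hσ1 : |σ| ≤ κ := abs_le.2 ⟨by rw [hσ]; linarith, by rw [hσ]; linarith⟩
  have hσ2 := abs_le.1 hσ1
  rcases (abs_eq zero_le_one).1 hμ with h | h
  · have : T * (σ + w.re) = 0 := by linarith
    have h3 : w.re = -σ := by
      have := (mul_eq_zero.1 this).resolve_left hT.ne'
      linarith
    rw [h3] at hre
    have h4 : σ ^ 2 ≤ (lam / 4) ^ 2 := by
      rw [← sq_abs]; gcongr; exact hσ1.trans hκ3
    have h5 : (-σ) ^ 2 - 0 ^ 2 = σ ^ 2 := by ring
    have h6 : (lam / 4) ^ 2 = lam ^ 2 / 16 := by ring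
    rw [h5] at hre
    rw [h6] at h4
    linarith
  · have h3 : T * (σ + w.re) = -2 := by linarith
    have h4 : |w.re| < 2 * lam + 1 := abs_lt_of_sq_lt_sq (by linarith) (by positivity)
    have h5 := (abs_lt.1 h4).1
    have h6 : T * -(2 * lam + 2) ≤ T * (σ + w.re) :=
      mul_le_mul_of_nonneg_left (by linarith) hT.le
    linarith

/-- The difference `|a| - |b|` of the unstable and stable coordinates. -/
noncomputable def coneGap (lam : ℝ) (z : ℝ × ℝ) : ℝ :=
  |lam * z.1 + z.2| - |lam * z.1 - z.2|

/-- The sum `|a| + |b|` of the unstable and stable coordinates. -/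
noncomputable def coneNorm (lam : ℝ) (z : ℝ × ℝ) : ℝ :=
  |lam * z.1 + z.2| + |lam * z.1 - z.2|

theorem norm_le_coneNorm {lam : ℝ} (hlam : 0 < lam) (z : ℝ × ℝ) :
    ‖z‖ ≤ (1 / lam + 1) * coneNorm lam z := by
  have h1 : |2 * (lam * z.1)| ≤ coneNorm lam z := by
    have := abs_add_le (lam * z.1 + z.2) (lam * z.1 - z.2)
    rw [show lam * z.1 + z.2 + (lam * z.1 - z.2) = 2 * (lam * z.1) by ring] at this
    exact this
  have h2 : |2 * z.2| ≤ coneNorm lam z := by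
    have := abs_sub (lam * z.1 + z.2) (lam * z.1 - z.2)
    rw [show lam * z.1 + z.2 - (lam * z.1 - z.2) = 2 * z.2 by ring] at this
    exact this
  rw [abs_mul, abs_two] at h1 h2
  rw [abs_mul, abs_of_pos hlam] at h1
  have h0 : 0 ≤ coneNorm lam z := add_nonneg (abs_nonneg _) (abs_nonneg _)
  refine max_le ?_ ?_
  · have : ‖z.1‖ ≤ 1 / lam * coneNorm lam z := by
      rw [Real.norm_eq_abs, one_div, inv_mul_eq_div, le_div_iff₀ hlam]
      nlinarith [abs_nonneg z.1]
    nlinarith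
  · have : 0 ≤ 1 / lam * coneNorm lam z := by positivity
    rw [Real.norm_eq_abs]
    nlinarith [abs_nonneg z.2]

theorem abs_coneGap_le {lam : ℝ} (hlam : 0 < lam) (z : ℝ × ℝ) :
    |coneGap lam z| ≤ 2 * (lam + 1) * ‖z‖ := by
  have h1 : |z.1| ≤ ‖z‖ := norm_fst_le z
  have h2 : |z.2| ≤ ‖z‖ := norm_snd_le z
  have h3 : |lam * z.1 + z.2| ≤ (lam + 1) * ‖z‖ := by
    refine (abs_add_le _ _).trans ?_
    rw [abs_mul, abs_of_pos hlam]; nlinarith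
  have h4 : |lam * z.1 - z.2| ≤ (lam + 1) * ‖z‖ := by
    refine (abs_sub _ _).trans ?_
    rw [abs_mul, abs_of_pos hlam]; nlinarith
  refine abs_le.2 ⟨?_, ?_⟩ <;> unfold coneGap <;>
    nlinarith [abs_nonneg (lam * z.1 + z.2), abs_nonneg (lam * z.1 - z.2)]

/-- One step of the perturbed linear map `1 + T A` increases the cone gap. -/
theorem coneGap_step {lam κ T : ℝ} (hlam : 0 < lam) (hT : 0 < T) (hTl : T * lam ≤ 1)
    (hκ0 : 0 ≤ κ) (hκ : 4 * (lam + 1) * (1 / lam + 1) * κ ≤ lam) {z w : ℝ × ℝ}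
    (h : ‖w - z - T • saddle lam z‖ ≤ κ * T * ‖z‖) :
    coneGap lam z + T * (lam / 2) * coneNorm lam z ≤ coneGap lam w := by
  have hS := norm_le_coneNorm hlam z
  set S := coneNorm lam z with hSdef
  set r := w - z - T • saddle lam z with hr
  have h1 : |r.1| ≤ κ * T * ‖z‖ := (norm_fst_le r).trans h
  have h2 : |r.2| ≤ κ * T * ‖z‖ := (norm_snd_le r).trans h
  have e1 : w.1 = z.1 + T * z.2 + r.1 := by simp [hr, saddle_apply]
  have e2 : w.2 = z.2 + T * (lam ^ 2 * z.1) + r.2 := by simp [hr, saddle_apply]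
  have ea : lam * w.1 + w.2 = (1 + T * lam) * (lam * z.1 + z.2) + (lam * r.1 + r.2) := by
    rw [e1, e2]; ring
  have eb : lam * w.1 - w.2 = (1 - T * lam) * (lam * z.1 - z.2) + (lam * r.1 - r.2) := by
    rw [e1, e2]; ring
  have hra : |lam * r.1 + r.2| ≤ (lam + 1) * (κ * T * ‖z‖) := by
    refine (abs_add_le _ _).trans ?_
    rw [abs_mul, abs_of_pos hlam]; nlinarith
  have hrb : |lam * r.1 - r.2| ≤ (lam + 1) * (κ * T * ‖z‖) := by
    refine (abs_sub _ _).trans ?_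
    rw [abs_mul, abs_of_pos hlam]; nlinarith
  have hTl0 : 0 < T * lam := by positivity
  have ha : (1 + T * lam) * |lam * z.1 + z.2| - |lam * r.1 + r.2| ≤ |lam * w.1 + w.2| := by
    rw [ea]
    have := abs_sub_abs_le_abs_sub ((1 + T * lam) * (lam * z.1 + z.2)) (-(lam * r.1 + r.2))
    rw [abs_neg, sub_neg_eq_add, abs_mul, abs_of_pos (by linarith : 0 < 1 + T * lam)] at this
    exact this
  have hb : |lam * w.1 - w.2| ≤ (1 - T * lam) * |lam * z.1 - z.2| + |lam * r.1 - r.2| := by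
    rw [eb]
    refine (abs_add_le _ _).trans ?_
    rw [abs_mul, abs_of_nonneg (by linarith : 0 ≤ 1 - T * lam)]
  have hfin : 2 * ((lam + 1) * (κ * T * ‖z‖)) ≤ T * (lam / 2) * S := by
    calc 2 * ((lam + 1) * (κ * T * ‖z‖)) ≤ 2 * ((lam + 1) * (κ * T * ((1 / lam + 1) * S))) := by
          gcongr
      _ = T / 2 * (4 * (lam + 1) * (1 / lam + 1) * κ) * S := by ring
      _ ≤ T / 2 * lam * S := by
          have : 0 ≤ S := add_nonneg (abs_nonneg _) (abs_nonneg _)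
          gcongr
      _ = _ := by ring
  have hSe : S = |lam * z.1 + z.2| + |lam * z.1 - z.2| := rfl
  unfold coneGap
  nlinarith

/-- A telescoping argument. -/
theorem tendsto_zero_of_telescoping {U S : ℕ → ℝ} {c B : ℝ} (hc : 0 < c) (hS : ∀ n, 0 ≤ S n)
    (hU : ∀ n, U n + c * S n ≤ U (n + 1)) (hB : ∀ n, |U n| ≤ B) : Tendsto S atTop (𝓝 0) := by
  have hsum : ∀ n, ∑ i ∈ Finset.range n, S i ≤ 2 * B / c := by
    intro n
    rw [le_div_iff₀ hc, Finset.sum_mul]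
    have h1 : ∑ i ∈ Finset.range n, S i * c ≤ ∑ i ∈ Finset.range n, (U (i + 1) - U i) :=
      Finset.sum_le_sum fun i _ => by linarith [hU i]
    rw [Finset.sum_range_sub] at h1
    have h2 := abs_le.1 (hB n)
    have h3 := abs_le.1 (hB 0)
    linarith
  exact (summable_of_sum_range_le hS hsum).tendsto_atTop_zero

theorem tendsto_zero_of_forward_orbit {lam κ T B : ℝ} (hlam : 0 < lam) (hT : 0 < T)
    (hTl : T * lam ≤ 1) (hκ0 : 0 ≤ κ) (hκ : 4 * (lam + 1) * (1 / lam + 1) * κ ≤ lam)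
    {w : ℕ → ℝ × ℝ} (hB : ∀ n, ‖w n‖ ≤ B)
    (h : ∀ n, ‖w (n + 1) - w n - T • saddle lam (w n)‖ ≤ κ * T * ‖w n‖) :
    Tendsto w atTop (𝓝 0) := by
  have h0 : Tendsto (fun n => coneNorm lam (w n)) atTop (𝓝 0) :=
    tendsto_zero_of_telescoping (U := fun n => coneGap lam (w n)) (c := T * (lam / 2))
      (B := 2 * (lam + 1) * B) (by positivity) (fun n => add_nonneg (abs_nonneg _) (abs_nonneg _))
      (fun n => coneGap_step hlam hT hTl hκ0 hκ (h n))
      (fun n => (abs_coneGap_le hlam _).trans (by gcongr; exact hB n))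
  exact squeeze_zero_norm (fun n => norm_le_coneNorm hlam (w n)) (by simpa using h0.const_mul _)

theorem tendsto_zero_of_backward_orbit {lam κ T B : ℝ} (hlam : 0 < lam) (hT : 0 < T)
    (hTl : T * lam ≤ 1) (hκ0 : 0 ≤ κ) (hκ : 4 * (lam + 1) * (1 / lam + 1) * κ ≤ lam)
    {w : ℕ → ℝ × ℝ} (hB : ∀ n, ‖w n‖ ≤ B)
    (h : ∀ n, ‖w n - w (n + 1) - T • saddle lam (w (n + 1))‖ ≤ κ * T * ‖w (n + 1)‖) :
    Tendsto w atTop (𝓝 0) := by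
  have h0 : Tendsto (fun n => coneNorm lam (w (n + 1))) atTop (𝓝 0) :=
    tendsto_zero_of_telescoping (U := fun n => -coneGap lam (w n)) (c := T * (lam / 2))
      (B := 2 * (lam + 1) * B) (by positivity) (fun n => add_nonneg (abs_nonneg _) (abs_nonneg _))
      (fun n => by linarith [coneGap_step hlam hT hTl hκ0 hκ (h n)])
      (fun n => by
        rw [abs_neg]
        exact (abs_coneGap_le hlam _).trans (by gcongr; exact hB n))
  rw [← tendsto_add_atTop_iff_nat 1]
  exact squeeze_zero_norm (fun n => norm_le_coneNorm hlam (w (n + 1)))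
    (by simpa using h0.const_mul _)

theorem exists_quadratic_remainder {E : Type*} [NormedAddCommGroup E] [NormedSpace ℝ E]
    [FiniteDimensional ℝ E] {φ : E → ℝ} (hφ : ContDiff ℝ 2 φ) (e : E) (ρ : ℝ) :
    ∃ M, 0 ≤ M ∧ ∀ z ∈ Metric.closedBall e ρ, ∀ w ∈ Metric.closedBall e ρ,
      |φ z - φ w - fderiv ℝ φ w (z - w)| ≤ M * ‖z - w‖ ^ 2 := by
  have h1 : ContDiff ℝ 1 (fderiv ℝ φ) := hφ.fderiv_right (by norm_num)
  obtain ⟨K, hK⟩ := h1.contDiffOn.exists_lipschitzOnWith one_ne_zero (convex_closedBall e ρ)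
    (isCompact_closedBall e ρ)
  refine ⟨K, K.2, fun z hz w hw => ?_⟩
  have hsub : segment ℝ w z ⊆ Metric.closedBall e ρ := (convex_closedBall e ρ).segment_subset hw hz
  have := (convex_segment w z).norm_image_sub_le_of_norm_fderiv_le' (𝕜 := ℝ) (f := φ)
    (φ := fderiv ℝ φ w) (C := K * ‖z - w‖) (x := w) (y := z)
    (fun x _ => (hφ.differentiable (by norm_num)) x)
    (fun x hx => (hK.norm_sub_le (hsub hx) hw).trans (by
      gcongr
      rw [segment_eq_image'] at hx
      obtain ⟨θ, hθ, rfl⟩ := hx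
      rw [add_sub_cancel_left, norm_smul, Real.norm_of_nonneg hθ.1]
      exact mul_le_of_le_one_left (norm_nonneg _) hθ.2))
    (left_mem_segment ℝ w z) (right_mem_segment ℝ w z)
  rw [Real.norm_eq_abs] at this
  linarith [this, (by ring : K * ‖z - w‖ * ‖z - w‖ = K * ‖z - w‖ ^ 2)]

/-- A right inverse of `T A`, for `A` the saddle matrix. -/
noncomputable def saddleInverse {lam T : ℝ} (hlam : 0 < lam) (hT : 0 < T) :
    (T • saddle lam).NonlinearRightInverse where
  toFun w := (T⁻¹ * (w.2 / lam ^ 2), T⁻¹ * w.1)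
  nnnorm := ((1 + 1 / lam ^ 2) / T).toNNReal
  bound' w := by
    have h1 := norm_fst_le w
    have h2 := norm_snd_le w
    rw [Real.coe_toNNReal _ (by positivity), div_mul_eq_mul_div, le_div_iff₀ hT]
    have key : max ‖w.2 / lam ^ 2‖ ‖w.1‖ ≤ (1 + 1 / lam ^ 2) * ‖w‖ := by
      have h3 : 0 ≤ 1 / lam ^ 2 * ‖w‖ := by positivity
      refine max_le ?_ (by linarith)
      rw [norm_div, Real.norm_of_nonneg (by positivity : (0 : ℝ) ≤ lam ^ 2), div_eq_inv_mul,
        ← one_div]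
      have : 1 / lam ^ 2 * ‖w.2‖ ≤ 1 / lam ^ 2 * ‖w‖ := by gcongr
      linarith [norm_nonneg w]
    rw [Prod.norm_mk, norm_mul, norm_mul, Real.norm_of_nonneg (by positivity : 0 ≤ T⁻¹),
      ← mul_max_of_nonneg _ _ (by positivity : 0 ≤ T⁻¹), mul_comm, ← mul_assoc,
      mul_inv_cancel₀ hT.ne', one_mul]
    exact key
  right_inv' w := by
    ext <;> simp [saddle_apply] <;> field_simp

theorem add_nat_mul_of_periodic {α : Type*} {F : ℝ → α} {T : ℝ} (hper : ∀ t, F (t + T) = F t)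
    (n : ℕ) (t : ℝ) : F (t + n * T) = F t :=
  (Function.Periodic.nat_mul hper n) t

theorem IsSolOn.shift {F : ℝ → Plane → Plane} {u : ℝ → Plane} {I : Set ℝ} (hu : IsSolOn F u I)
    {c : ℝ} (hF : ∀ t, F (t + c) = F t) {J : Set ℝ} (hJ : ∀ t ∈ J, t + c ∈ I) :
    IsSolOn F (fun t => u (t + c)) J := by
  intro t ht
  have h1 := hu (t + c) (hJ t ht)
  rw [hF] at h1
  have h2 : HasDerivWithinAt (fun t : ℝ => t + c) 1 J t :=
    ((hasDerivAt_id t).add_const c).hasDerivWithinAt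
  have := HasDerivWithinAt.scomp (h := fun t => t + c) t h1 h2 hJ
  rwa [one_smul] at this

namespace NearLinear

theorem exists_hyperbolicFixedPoint {F : ℝ → Plane → Plane} {e : Plane} {ρ κ m lam K T M : ℝ}
    (hlam : 0 < lam) (h : NearLinear F (saddle lam) e ρ κ m) (hT : 0 < T)
    (hLT : (‖saddle lam‖ + κ) * T ≤ 1 / 4) (hmT : m * T ≤ ρ / 4)
    (hK : 2 * κ + 2 * ‖saddle lam‖ * (‖saddle lam‖ + κ) * T ≤ K) (hK1 : K ≤ 1 / 2)
    (hK2 : K ≤ lam ^ 2 / 2) (hK3 : K ≤ lam / 4) (hK4 : 4 * (lam + 1) * (1 / lam + 1) * K ≤ lam)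
    (hK5 : (1 + 1 / lam ^ 2) * K ≤ 1 / 2) (hT1 : T * (2 * lam + 2) ≤ 1)
    (hm : 4 * (1 + 1 / lam ^ 2) * m < ρ / 2) (hper : ∀ t, F (t + T) = F t)
    {DF : ℝ → Plane → Plane →L[ℝ] Plane} (hM : 0 ≤ M)
    (hDF : ∀ t, ∀ z ∈ Metric.closedBall e ρ, ∀ w ∈ Metric.closedBall e ρ,
      ‖F t z - F t w - DF t w (z - w)‖ ≤ M * ‖z - w‖ ^ 2)
    (hDFL : ∀ t, ∀ z ∈ Metric.closedBall e ρ, ‖DF t z‖ ≤ ‖saddle lam‖ + κ)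
    (hDFc : Continuous fun p : ℝ × Plane => DF p.1 p.2) (t₀ : ℝ) :
    ∃ p, IsHyperbolicFixedPoint F T t₀ p ∧ ‖p - e‖ ≤ 4 * (1 + 1 / lam ^ 2) * m ∧
      (∀ u, IsSolOn F u (Ici t₀) → (∀ᶠ t in atTop, u t ∈ Metric.closedBall e ρ) →
        Tendsto (fun n : ℕ => u (t₀ + n * T)) atTop (𝓝 p)) ∧
      (∀ u, IsSolOn F u (Iic t₀) → (∀ᶠ t in atBot, u t ∈ Metric.closedBall e ρ) →
        Tendsto (fun n : ℕ => u (t₀ - n * T)) atTop (𝓝 p)) := by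
  have hρ := h.radius_pos
  have hκ := h.const_pos
  have hm0 : 0 ≤ m := (norm_nonneg _).trans (h.center 0)
  have hK0 : 0 ≤ K := le_trans (by positivity) hK
  have hTl : T * lam ≤ 1 := by nlinarith
  choose! Y hY0 hY hYb using fun z (hz : z ∈ Metric.closedBall e (ρ / 2)) =>
    h.exists_solution hT.le hLT hmT t₀ hz
  have hP : ∀ z ∈ Metric.closedBall e (ρ / 2), ∀ w ∈ Metric.closedBall e (ρ / 2),
      ‖Y z (t₀ + T) - Y w (t₀ + T) - (z - w) - T • saddle lam (z - w)‖ ≤ K * T * ‖z - w‖ := by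
    intro z hz w hw
    have := h.norm_sub_linear_le hT.le hLT (hY z hz) (hY w hw) (hYb z hz) (hYb w hw)
    rw [hY0 z hz, hY0 w hw] at this
    exact this.trans (by gcongr)
  have hA : ApproximatesLinearOn (fun z => Y z (t₀ + T) - z) (T • saddle lam)
      (Metric.closedBall e (ρ / 2)) (K * T).toNNReal := by
    intro z hz w hw
    rw [Real.coe_toNNReal _ (by positivity)]
    have := hP z hz w hw
    rwa [show Y z (t₀ + T) - Y w (t₀ + T) - (z - w) - T • saddle lam (z - w)
      = Y z (t₀ + T) - z - (Y w (t₀ + T) - w) - (T • saddle lam) (z - w) by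
        rw [smul_apply]; abel] at this
  have hee : e ∈ Metric.closedBall e (ρ / 2) := Metric.mem_closedBall_self (by positivity)
  have hPe : ‖Y e (t₀ + T) - e‖ ≤ 2 * m * T :=
    h.norm_solution_sub_center_le hT.le hLT (hY0 e hee) (hY e hee) (hYb e hee)
  set CA : ℝ := 1 + 1 / lam ^ 2 with hCA
  have hCA0 : 0 < CA := by positivity
  obtain ⟨p, hp, hp0⟩ := hA.surjOn_closedBall_of_nonlinearRightInverse (saddleInverse hlam hT)
    (ε := 4 * CA * m) (b := e) (by positivity) (Metric.closedBall_subset_closedBall hm.le)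
    (a := 0) (by
      rw [mem_closedBall_iff_norm', sub_zero]
      refine hPe.trans ?_
      have e1 : ((saddleInverse hlam hT).nnnorm : ℝ) = CA / T :=
        Real.coe_toNNReal _ (by positivity)
      rw [e1, inv_div, Real.coe_toNNReal _ (by positivity)]
      have h1 : (1 / 2) * (T / CA) ≤ T / CA - K * T := by
        have : K ≤ 1 / 2 / CA := by rw [le_div_iff₀ hCA0]; linarith
        have h2 : K * T ≤ 1 / 2 / CA * T := by gcongr
        have h3 : 1 / 2 / CA * T = 1 / 2 * (T / CA) := by ring
        linarith
      calc 2 * m * T = (1 / 2) * (T / CA) * (4 * CA * m) := by field_simp; ring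
        _ ≤ _ := by gcongr)
  have hpe : ‖p - e‖ ≤ 4 * CA * m := mem_closedBall_iff_norm.1 hp
  have hpb : p ∈ Metric.ball e (ρ / 2) := mem_ball_iff_norm.2 (hpe.trans_lt hm)
  have hpb' := Metric.ball_subset_closedBall hpb
  have hpfix : Y p (t₀ + T) = p := sub_eq_zero.1 hp0
  refine ⟨p, ?_, hpe, fun u hu hub => ?_, fun u hu hub => ?_⟩
  · obtain ⟨D, hD⟩ := h.hasFDerivAt_flow hT.le hLT hY0 hY hYb (L := ‖saddle lam‖ + κ)
      (by positivity) (by linarith) hM hDF hDFL hDFc hpb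
    refine ⟨fun z => Y z (t₀ + T), D, ⟨Metric.ball e (ρ / 2), Metric.isOpen_ball.mem_nhds hpb,
      fun z hz => ⟨Y z, hY z (Metric.ball_subset_closedBall hz),
        hY0 z (Metric.ball_subset_closedBall hz), rfl⟩⟩, hpfix, hD, fun μ hμ => ?_⟩
    refine aeval_charpoly_ne_zero_of_near hlam hT hK0 hK1 hK2 hK3 hT1 (D := D) ?_ hμ
    have hlin := (ContinuousLinearMap.id ℝ Plane + T • saddle lam).hasFDerivAt (x := p)
    refine (hD.sub hlin).le_of_lip' (by positivity) ?_
    filter_upwards [Metric.isOpen_ball.mem_nhds hpb] with z hz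
    have := hP z (Metric.ball_subset_closedBall hz) p hpb'
    rw [Pi.sub_apply, Pi.sub_apply]
    refine (congrArg norm ?_).trans_le this
    rw [add_apply, add_apply, smul_apply, smul_apply, ContinuousLinearMap.id_apply,
      ContinuousLinearMap.id_apply, map_sub, smul_sub]
    abel
  · obtain ⟨τ, hτ⟩ := eventually_atTop.1 hub
    obtain ⟨N, hN⟩ := exists_nat_ge ((τ - t₀) / T)
    rw [div_le_iff₀ hT] at hN
    rw [← tendsto_add_atTop_iff_nat N, ← tendsto_sub_nhds_zero_iff]
    have hball : ∀ n : ℕ, ∀ t, t₀ ≤ t → u (t + ((n + N : ℕ) : ℝ) * T) ∈ Metric.closedBall e ρ := by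
      intro n t ht
      refine hτ _ ?_
      push_cast
      have : 0 ≤ (n : ℝ) * T := by positivity
      linarith
    refine tendsto_zero_of_forward_orbit (B := 2 * ρ) hlam hT hTl hK0 hK4 (fun n => ?_)
      fun n => ?_
    · have h1 := mem_closedBall_iff_norm.1 (hball n t₀ le_rfl)
      have h2 := hpe.trans hm.le
      calc _ ≤ ‖u (t₀ + ((n + N : ℕ) : ℝ) * T) - e‖ + ‖p - e‖ := by
            rw [← sub_sub_sub_cancel_right _ p e]; exact norm_sub_le _ _
        _ ≤ 2 * ρ := by linarith
    · have hs : IsSolOn F (fun t => u (t + ((n + N : ℕ) : ℝ) * T)) (Icc t₀ (t₀ + T)) :=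
        hu.shift (add_nat_mul_of_periodic hper _) fun t ht => by
          have : 0 ≤ ((n + N : ℕ) : ℝ) * T := by positivity
          exact mem_Ici.2 (by linarith [ht.1])
      have := h.norm_sub_linear_le hT.le hLT hs (hY p hpb') (fun t ht => hball n t ht.1)
        (hYb p hpb')
      rw [hY0 p hpb', hpfix] at this
      rw [show t₀ + ((n + 1 + N : ℕ) : ℝ) * T = t₀ + T + ((n + N : ℕ) : ℝ) * T by push_cast; ring]
      exact this.trans (by gcongr)
  · obtain ⟨τ, hτ⟩ := eventually_atBot.1 hub
    obtain ⟨N, hN⟩ := exists_nat_ge ((t₀ - τ) / T)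
    rw [div_le_iff₀ hT] at hN
    rw [← tendsto_add_atTop_iff_nat N, ← tendsto_sub_nhds_zero_iff]
    have hball : ∀ n : ℕ, ∀ t, t ≤ t₀ → u (t + -(((n + N : ℕ) : ℝ) * T))
        ∈ Metric.closedBall e ρ := by
      intro n t ht
      refine hτ _ ?_
      push_cast
      have : 0 ≤ (n : ℝ) * T := by positivity
      linarith
    refine tendsto_zero_of_backward_orbit (B := 2 * ρ) hlam hT hTl hK0 hK4 (fun n => ?_)
      fun n => ?_
    · have h1 := mem_closedBall_iff_norm.1 (hball n t₀ le_rfl)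
      have h2 := hpe.trans hm.le
      calc _ ≤ ‖u (t₀ + -(((n + N : ℕ) : ℝ) * T)) - e‖ + ‖p - e‖ := by
            rw [← sub_sub_sub_cancel_right _ p e]; exact norm_sub_le _ _
        _ ≤ 2 * ρ := by linarith
    · have hs : IsSolOn F (fun t => u (t + -(((n + 1 + N : ℕ) : ℝ) * T))) (Icc t₀ (t₀ + T)) :=
        hu.shift (fun t => by
            have := add_nat_mul_of_periodic hper (n + 1 + N) (t + -(((n + 1 + N : ℕ) : ℝ) * T))
            rw [← this]; congr 1; ring)
          fun t ht => by
            have : 0 ≤ ((n + N : ℕ) : ℝ) * T := by positivity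
            refine mem_Iic.2 ?_
            push_cast at this ⊢
            linarith [ht.2]
      have := h.norm_sub_linear_le hT.le hLT hs (hY p hpb') (fun t ht => by
          have := hball n (t - T) (by linarith [ht.2])
          rwa [show t - T + -(((n + N : ℕ) : ℝ) * T) = t + -(((n + 1 + N : ℕ) : ℝ) * T) by
            push_cast; ring] at this)
        (hYb p hpb')
      rw [hY0 p hpb', hpfix] at this
      rw [show t₀ - ((n + N : ℕ) : ℝ) * T = t₀ + T + -(((n + 1 + N : ℕ) : ℝ) * T) by
        push_cast; ring, sub_eq_add_neg t₀]
      exact this.trans (by gcongr)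

end NearLinear

/-- Hyperbolic fixed points of the return map near a saddle of `ẍ = f x`, under a small periodic
perturbation `γ t * G z`. -/
theorem exists_hyperbolicFixedPoint_near_saddle {f : ℝ → ℝ} (hf : ContDiff ℝ 3 f) {a lam : ℝ}
    (hlam : 0 < lam) (hfa : f a = 0) (hd : deriv f a = lam ^ 2) :
    ∃ ρ > 0, ∃ κ₀ > 0, ∃ T₀ > 0, ∃ C > 0, ∀ (γ : ℝ → ℝ) (G : Plane → ℝ) (T ℓ m : ℝ),
      Continuous γ → (∀ t, |γ t| ≤ 1) → (∀ t, γ (t + T) = γ t) → ContDiff ℝ 2 G →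
      (∀ z ∈ Metric.closedBall ((a, 0) : Plane) ρ, ∀ w ∈ Metric.closedBall ((a, 0) : Plane) ρ,
        |G z - G w| ≤ ℓ * ‖z - w‖) → ℓ ≤ κ₀ → |G (a, 0)| ≤ m → 0 < T → T ≤ T₀ → C * m ≤ ρ →
      ∀ F : ℝ → Plane → Plane, (∀ t z, F t z = (z.2, f z.1 + γ t * G z)) → ∀ t₀ : ℝ,
      ∃ p, IsHyperbolicFixedPoint F T t₀ p ∧ ‖p - (a, 0)‖ ≤ C * m ∧
        (∀ u, IsSolOn F u (Ici t₀) →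
          (∀ᶠ t in atTop, u t ∈ Metric.closedBall ((a, 0) : Plane) (ρ / 2)) →
          Tendsto (fun n : ℕ => u (t₀ + n * T)) atTop (𝓝 p)) ∧
        (∀ u, IsSolOn F u (Iic t₀) →
          (∀ᶠ t in atBot, u t ∈ Metric.closedBall ((a, 0) : Plane) (ρ / 2)) →
          Tendsto (fun n : ℕ => u (t₀ - n * T)) atTop (𝓝 p)) := by
  set CA : ℝ := 1 + 1 / lam ^ 2 with hCA
  have hCA0 : 0 < CA := by positivity
  set nA := ‖saddle lam‖ with hnA
  have hnA0 : 0 ≤ nA := norm_nonneg _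
  obtain ⟨K, hK0, hK1, hK2, hK3, hK4, hK5⟩ : ∃ K : ℝ, 0 < K ∧ K ≤ 1 / 2 ∧ K ≤ lam ^ 2 / 2 ∧
      K ≤ lam / 4 ∧ 4 * (lam + 1) * (1 / lam + 1) * K ≤ lam ∧ CA * K ≤ 1 / 2 := by
    refine ⟨min (min (1 / 2) (lam ^ 2 / 2)) (min (lam / 4)
      (min (lam / (4 * (lam + 1) * (1 / lam + 1))) (1 / 2 / CA))), by positivity,
      (min_le_left _ _).trans (min_le_left _ _), (min_le_left _ _).trans (min_le_right _ _),
      (min_le_right _ _).trans (min_le_left _ _), ?_, ?_⟩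
    · rw [← le_div_iff₀' (by positivity)]
      exact (min_le_right _ _).trans ((min_le_right _ _).trans (min_le_left _ _))
    · rw [← le_div_iff₀' (by positivity)]
      exact (min_le_right _ _).trans ((min_le_right _ _).trans (min_le_right _ _))
  set κ := K / 4 with hκ
  have hκ0 : 0 < κ := by positivity
  obtain ⟨ρ, hρ, hρf⟩ : ∃ ρ > 0, ∀ x ∈ Metric.closedBall a ρ, ‖deriv f x - lam ^ 2‖ ≤ κ / 2 := by
    have hc : ContinuousAt (deriv f) a := (hf.continuous_deriv (by norm_num)).continuousAt
    obtain ⟨ρ, hρ, h⟩ := Metric.continuousAt_iff.1 hc (κ / 2) (by positivity)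
    refine ⟨ρ / 2, by positivity, fun x hx => ?_⟩
    have := h (lt_of_le_of_lt (Metric.mem_closedBall.1 hx) (by linarith))
    rw [dist_eq_norm, hd] at this
    exact this.le
  have hfl : ∀ x ∈ Metric.closedBall a ρ, ∀ y ∈ Metric.closedBall a ρ,
      |f x - f y - lam ^ 2 * (x - y)| ≤ κ / 2 * |x - y| := by
    intro x hx y hy
    have := (convex_closedBall a ρ).norm_image_sub_le_of_norm_hasDerivWithin_le (𝕜 := ℝ)
      (f := fun x => f x - lam ^ 2 * x) (f' := fun x => deriv f x - lam ^ 2) (C := κ / 2)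
      (fun x _ => (((hf.differentiable (by norm_num)) x).hasDerivAt.sub
        (((hasDerivAt_id x).const_mul (lam ^ 2)).congr_deriv (mul_one _))).hasDerivWithinAt)
      hρf hy hx
    rw [Real.norm_eq_abs, Real.norm_eq_abs] at this
    rwa [show f x - f y - lam ^ 2 * (x - y) = f x - lam ^ 2 * x - (f y - lam ^ 2 * y) by ring]
  refine ⟨ρ, hρ, κ / 2, by positivity,
    min (1 / (4 * (nA + κ))) (min (K / 2 / (2 * nA * (nA + κ) + 1)) (min 1 (1 / (2 * lam + 2)))),
    by positivity, 32 * CA + 32, by positivity, ?_⟩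
  intro γ G T ℓ m hγ hγ1 hγT hG hGl hℓ hGe hT hTT hm F hF t₀
  have hm0 : 0 ≤ m := (abs_nonneg _).trans hGe
  have hTa := hTT.trans (min_le_left _ _)
  have hTb := hTT.trans ((min_le_right _ _).trans (min_le_left _ _))
  have hTc := hTT.trans ((min_le_right _ _).trans ((min_le_right _ _).trans (min_le_left _ _)))
  have hTd := hTT.trans ((min_le_right _ _).trans ((min_le_right _ _).trans (min_le_right _ _)))
  rw [le_div_iff₀ (by positivity)] at hTa hTb hTd
  set e : Plane := (a, 0) with he
  have hball : ∀ z ∈ Metric.closedBall e ρ, z.1 ∈ Metric.closedBall a ρ := fun z hz =>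
    mem_closedBall_iff_norm.2 ((norm_fst_le (z - e)).trans (mem_closedBall_iff_norm.1 hz))
  have hN : NearLinear F (saddle lam) e ρ κ m := by
    refine ⟨fun t z hz w hw => ?_, fun z => ?_, fun t => ?_, hρ, hκ0⟩
    · have h1 := hfl _ (hball z hz) _ (hball w hw)
      have h2 := hGl z hz w hw
      have h3 : |z.1 - w.1| ≤ ‖z - w‖ := norm_fst_le (z - w)
      have e1 : F t z - F t w - saddle lam (z - w)
          = (0, (f z.1 - f w.1 - lam ^ 2 * (z.1 - w.1)) + γ t * (G z - G w)) := by
        rw [hF, hF, saddle_apply]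
        ext
        · simp
        · simp only [Prod.snd_sub, Prod.fst_sub]; ring
      rw [e1, Prod.norm_mk, norm_zero]
      refine max_le (by positivity) ?_
      rw [Real.norm_eq_abs]
      refine (abs_add_le _ _).trans ?_
      have h4 : |γ t * (G z - G w)| ≤ κ / 2 * ‖z - w‖ := by
        rw [abs_mul]
        calc _ ≤ 1 * (κ / 2 * ‖z - w‖) :=
              mul_le_mul (hγ1 t) (h2.trans (by gcongr)) (abs_nonneg _) zero_le_one
          _ = _ := one_mul _
      have h5 : κ / 2 * |z.1 - w.1| ≤ κ / 2 * ‖z - w‖ := by gcongr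
      linarith
    · simp only [hF]
      fun_prop
    · have e1 : F t e = (0, γ t * G e) := by rw [hF, he]; simp [hfa]
      rw [e1, Prod.norm_mk, norm_zero]
      refine max_le hm0 ?_
      rw [Real.norm_eq_abs, abs_mul]
      calc _ ≤ 1 * m := mul_le_mul (hγ1 t) hGe (abs_nonneg _) zero_le_one
        _ = m := one_mul _
  have hφ : ContDiff ℝ 2 (fun z : Plane => f z.1) := (hf.of_le (by norm_num)).comp contDiff_fst
  obtain ⟨M₁, hM₁, hM₁'⟩ := exists_quadratic_remainder hφ e (ρ / 2)
  obtain ⟨M₂, hM₂, hM₂'⟩ := exists_quadratic_remainder hG e (ρ / 2)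
  set DF : ℝ → Plane → Plane →L[ℝ] Plane := fun t z => (ContinuousLinearMap.snd ℝ ℝ ℝ).prod
    (fderiv ℝ (fun z : Plane => f z.1) z + γ t • fderiv ℝ G z) with hDF
  have hDFd : ∀ t z, HasFDerivAt (F t) (DF t z) z := by
    intro t z
    have h1 := ((hφ.differentiable (by norm_num)) z).hasFDerivAt
    have h2 := (((hG.differentiable (by norm_num)) z).hasFDerivAt).const_smul (γ t)
    have h3 := (hasFDerivAt_snd (𝕜 := ℝ) (p := z)).prodMk (h1.add h2)
    refine h3.congr_of_eventuallyEq (Eventually.of_forall fun w => ?_)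
    rw [hF]; rfl
  have hsub : Metric.closedBall e (ρ / 2) ⊆ Metric.closedBall e ρ :=
    Metric.closedBall_subset_closedBall (by linarith)
  have hN2 : NearLinear F (saddle lam) e (ρ / 2) κ m :=
    ⟨fun t z hz w hw => hN.lin t z (hsub hz) w (hsub hw), hN.cont, hN.center, by positivity, hκ0⟩
  have hmC : 32 * CA * m + 32 * m ≤ ρ := by linarith
  have hCm : 0 ≤ CA * m := by positivity
  obtain ⟨p, h1, h2, h3, h4⟩ := hN2.exists_hyperbolicFixedPoint (K := K) (T := T) (M := M₁ + M₂)
    hlam hT (by linarith) (by nlinarith) (by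
      rw [← hnA]; nlinarith) hK1 hK2 hK3 hK4 hK5 hTd (by rw [← hCA]; linarith)
    (fun t => by ext z <;> simp [hF, hγT]) (DF := DF) (by positivity)
    (fun t z hz w hw => by
      have e1 : F t z - F t w - DF t w (z - w)
          = (0, (f z.1 - f w.1 - fderiv ℝ (fun z : Plane => f z.1) w (z - w))
              + γ t * (G z - G w - fderiv ℝ G w (z - w))) := by
        rw [hF, hF, hDF]
        ext
        · simp
        · simp only [ContinuousLinearMap.prod_apply, add_apply, smul_apply, Prod.snd_sub,
            smul_eq_mul]
          ring
      rw [e1, Prod.norm_mk, norm_zero]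
      refine max_le (by positivity) ?_
      rw [Real.norm_eq_abs]
      refine (abs_add_le _ _).trans ?_
      have h5 := hM₁' z hz w hw
      have h6 : |γ t * (G z - G w - fderiv ℝ G w (z - w))| ≤ M₂ * ‖z - w‖ ^ 2 := by
        rw [abs_mul]
        calc _ ≤ 1 * (M₂ * ‖z - w‖ ^ 2) :=
              mul_le_mul (hγ1 t) (hM₂' z hz w hw) (abs_nonneg _) zero_le_one
          _ = _ := one_mul _
      linarith)
    (fun t z hz => by
      have hL : 0 ≤ nA + κ := by positivity
      have := (hDFd t z).le_of_lipschitzOn (s := Metric.closedBall e ρ) (C := (nA + κ).toNNReal)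
        (mem_of_superset (Metric.isOpen_ball.mem_nhds
          (Metric.closedBall_subset_ball (by linarith : ρ / 2 < ρ) hz))
          Metric.ball_subset_closedBall)
        (LipschitzOnWith.of_dist_le_mul fun z hz w hw => by
          rw [dist_eq_norm, dist_eq_norm, Real.coe_toNNReal _ hL]
          exact hN.lip t hz hw)
      rwa [Real.coe_toNNReal _ hL] at this)
    (by
      have c1 : Continuous (fderiv ℝ (fun z : Plane => f z.1)) := hφ.continuous_fderiv (by norm_num)
      have c2 : Continuous (fderiv ℝ G) := hG.continuous_fderiv (by norm_num)
      have c3 : Continuous fun p : ℝ × Plane =>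
          fderiv ℝ (fun z : Plane => f z.1) p.2 + γ p.1 • fderiv ℝ G p.2 := by fun_prop
      exact (ContinuousLinearMap.prodₗᵢ ℝ).continuous.comp (continuous_const.prodMk c3)) t₀
  exact ⟨p, h1, h2.trans (by rw [← hCA]; nlinarith), h3, h4⟩

theorem norm_cexp_neg_mul_sq_le_one {b : ℂ} (hb : 0 < b.re) (x : ℝ) :
    ‖Complex.exp (-b * (x : ℂ) ^ 2)‖ ≤ 1 := by
  rw [Complex.norm_exp, Real.exp_le_one_iff]
  have : (-b * (x : ℂ) ^ 2).re = -(b.re * x ^ 2) := by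
    rw [← Complex.ofReal_pow, Complex.re_mul_ofReal, Complex.neg_re]; ring
  rw [this]
  have : 0 ≤ b.re * x ^ 2 := by positivity
  linarith

theorem norm_gaussian_tail_le {b : ℂ} (hb : 0 < b.re) {Y : ℝ} (hY : 0 < Y) :
    ‖∫ x : ℝ in Ioi Y, Complex.exp (-b * (x : ℂ) ^ 2)‖ ≤ 1 / (‖b‖ * Y) := by
  have hb0 : b ≠ 0 := fun h => by simp [h] at hb
  have hbn : 0 < ‖b‖ := norm_pos_iff.2 hb0
  set E : ℝ → ℂ := fun x => Complex.exp (-b * (x : ℂ) ^ 2) with hE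
  have hEi : IntegrableOn E (Ioi Y) := (integrable_cexp_neg_mul_sq hb).integrableOn
  have hmaj : IntegrableOn (fun x : ℝ => 1 / (2 * ‖b‖) * x ^ (-2 : ℝ)) (Ioi Y) :=
    (integrableOn_Ioi_rpow_of_lt (by norm_num) hY).const_mul _
  have hle : ∀ x ∈ Ioi Y, ‖E x / (2 * b * (x : ℂ) ^ 2)‖ ≤ 1 / (2 * ‖b‖) * x ^ (-2 : ℝ) := by
    intro x hx
    have hx0 : 0 < x := hY.trans hx
    rw [norm_div, norm_mul, norm_mul, norm_pow, Complex.norm_real, Real.norm_of_nonneg hx0.le,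
      Complex.norm_ofNat, Real.rpow_neg hx0.le, Real.rpow_ofNat, ← one_div, div_mul_div_comm,
      one_mul]
    exact div_le_div_of_nonneg_right (norm_cexp_neg_mul_sq_le_one hb x) (by positivity)
  have hmeas : AEStronglyMeasurable (fun x : ℝ => E x / (2 * b * (x : ℂ) ^ 2))
      (volume.restrict (Ioi Y)) := by
    refine ContinuousOn.aestronglyMeasurable ?_ measurableSet_Ioi
    refine ContinuousOn.div (by fun_prop) (by fun_prop) fun x hx => ?_
    have : (x : ℂ) ≠ 0 := Complex.ofReal_ne_zero.2 (hY.trans hx).ne'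
    simp [hb0, this]
  have hi2 : IntegrableOn (fun x : ℝ => E x / (2 * b * (x : ℂ) ^ 2)) (Ioi Y) :=
    hmaj.mono' hmeas ((ae_restrict_iff' measurableSet_Ioi).2 (Eventually.of_forall hle))
  have hder : ∀ x ∈ Ici Y, HasDerivAt (fun x : ℝ => -(E x / (2 * b * (x : ℂ))))
      (E x + E x / (2 * b * (x : ℂ) ^ 2)) x := by
    intro x hx
    have hx0 : (x : ℂ) ≠ 0 := Complex.ofReal_ne_zero.2 (hY.trans_le hx).ne'
    have h1 : HasDerivAt (fun x : ℝ => (x : ℂ)) 1 x := Complex.ofRealCLM.hasDerivAt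
    have h2 := ((h1.pow 2).const_mul (-b)).cexp
    have h3 := (h2.div (h1.const_mul (2 * b)) (by simp [hb0, hx0])).neg
    refine h3.congr_deriv ?_
    simp only [hE, Pi.pow_apply]
    field_simp
    push_cast
    ring
  have hlim : Tendsto (fun x : ℝ => -(E x / (2 * b * (x : ℂ)))) atTop (𝓝 0) := by
    have h0 : Tendsto (fun x : ℝ => 1 / (2 * ‖b‖) * x⁻¹) atTop (𝓝 0) := by
      simpa using tendsto_inv_atTop_zero.const_mul (1 / (2 * ‖b‖))
    refine squeeze_zero_norm' ?_ h0
    filter_upwards [eventually_gt_atTop 0] with x hx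
    rw [norm_neg, norm_div, norm_mul, norm_mul, Complex.norm_real, Real.norm_of_nonneg hx.le,
      Complex.norm_ofNat, ← one_div, div_mul_div_comm, one_mul]
    exact div_le_div_of_nonneg_right (norm_cexp_neg_mul_sq_le_one hb x) (by positivity)
  have hFTC := integral_Ioi_of_hasDerivAt_of_tendsto' hder (hEi.add hi2) hlim
  rw [integral_add hEi hi2, zero_sub, neg_neg] at hFTC
  have h2 : ‖∫ x : ℝ in Ioi Y, E x / (2 * b * (x : ℂ) ^ 2)‖ ≤ 1 / (2 * ‖b‖ * Y) := by
    refine (norm_integral_le_of_norm_le hmaj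
      ((ae_restrict_iff' measurableSet_Ioi).2 (Eventually.of_forall hle))).trans (le_of_eq ?_)
    rw [integral_const_mul, integral_Ioi_rpow_of_lt (by norm_num) hY]
    norm_num
    rw [Real.rpow_neg_one]
    ring
  have h1 : ‖E Y / (2 * b * (Y : ℂ))‖ ≤ 1 / (2 * ‖b‖ * Y) := by
    rw [norm_div, norm_mul, norm_mul, Complex.norm_real, Real.norm_of_nonneg hY.le,
      Complex.norm_ofNat]
    exact div_le_div_of_nonneg_right (norm_cexp_neg_mul_sq_le_one hb Y) (by positivity)
  rw [eq_sub_of_add_eq hFTC]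
  refine (norm_sub_le _ _).trans ((add_le_add h1 h2).trans (le_of_eq ?_))
  field_simp
  norm_num

/-- The constant of the Fresnel integral. -/
theorem fresnel_constant {ε : ℝ} (hε : 0 < ε) :
    ((Real.pi : ℂ) / (((0 : ℝ) : ℂ) - Complex.I / (2 * ε))) ^ (1 / 2 : ℂ)
      = (Real.sqrt (2 * Real.pi * ε) : ℂ) * Complex.exp (Complex.I * (Real.pi / 4 : ℝ)) := by
  have hε' : (ε : ℂ) ≠ 0 := by exact_mod_cast hε.ne'
  have e1 : (Real.pi : ℂ) / (((0 : ℝ) : ℂ) - Complex.I / (2 * ε))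
      = ((2 * Real.pi * ε : ℝ) : ℂ) * Complex.I := by
    rw [Complex.ofReal_zero, zero_sub, div_neg, div_div_eq_mul_div, ← neg_div,
      div_eq_iff Complex.I_ne_zero]
    push_cast
    linear_combination (-2 * (Real.pi : ℂ) * ε) * Complex.I_mul_I
  have hpos : 0 < 2 * Real.pi * ε := by positivity
  have hne : ((2 * Real.pi * ε : ℝ) : ℂ) * Complex.I ≠ 0 :=
    mul_ne_zero (Complex.ofReal_ne_zero.2 hpos.ne') Complex.I_ne_zero
  rw [e1, Complex.cpow_def_of_ne_zero hne, Complex.log_ofReal_mul hpos Complex.I_ne_zero,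
    Complex.log_I, Real.sqrt_eq_rpow, Real.rpow_def_of_pos hpos, Complex.ofReal_exp,
    ← Complex.exp_add]
  congr 1
  push_cast
  ring

/-- The Fresnel integral over a bounded interval. -/
theorem norm_fresnel_sub_le {ε : ℝ} (hε : 0 < ε) {Y : ℝ} (hY : 0 < Y) :
    ‖(∫ y in (0 : ℝ)..Y, Complex.exp (Complex.I * ((y ^ 2 / (2 * ε) : ℝ) : ℂ)))
      - 1 / 2 * (Real.sqrt (2 * Real.pi * ε) * Complex.exp (Complex.I * (Real.pi / 4 : ℝ)))‖
      ≤ 2 * ε / Y := by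
  set b : ℝ → ℂ := fun d => (d : ℂ) - Complex.I / (2 * ε) with hbdef
  have hbre : ∀ d, (b d).re = d := by
    intro d
    have : Complex.I / (2 * ε) = ((1 / (2 * ε) : ℝ) : ℂ) * Complex.I := by push_cast; ring
    simp only [hbdef]
    rw [this, Complex.sub_re, Complex.ofReal_re, Complex.re_ofReal_mul, Complex.I_re]
    ring
  have hbim : ∀ d, (b d).im = -(1 / (2 * ε)) := by
    intro d
    have : Complex.I / (2 * ε) = ((1 / (2 * ε) : ℝ) : ℂ) * Complex.I := by push_cast; ring
    simp only [hbdef]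
    rw [this, Complex.sub_im, Complex.ofReal_im, Complex.im_ofReal_mul, Complex.I_im]
    ring
  have hbn : ∀ d, 1 / (2 * ε) ≤ ‖b d‖ := by
    intro d
    have := Complex.abs_im_le_norm (b d)
    rwa [hbim, abs_neg, abs_of_pos (by positivity)] at this
  have key : ∀ d : ℝ, 0 < d → ‖(∫ y in (0 : ℝ)..Y, Complex.exp (-b d * (y : ℂ) ^ 2))
      - ((Real.pi : ℂ) / b d) ^ (1 / 2 : ℂ) / 2‖ ≤ 2 * ε / Y := by
    intro d hd
    have hre : 0 < (b d).re := by rw [hbre]; exact hd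
    have hint := integrable_cexp_neg_mul_sq hre
    have h1 := intervalIntegral.integral_interval_add_Ioi (a := 0) (b := Y)
      (f := fun x : ℝ => Complex.exp (-b d * (x : ℂ) ^ 2)) hint.integrableOn hint.integrableOn
    rw [integral_gaussian_complex_Ioi hre] at h1
    rw [← h1, sub_add_cancel_left, norm_neg]
    refine (norm_gaussian_tail_le hre hY).trans ?_
    rw [div_le_div_iff₀ (mul_pos (lt_of_lt_of_le (by positivity) (hbn d)) hY) hY]
    have h2 := mul_le_mul_of_nonneg_left (hbn d) (by positivity : 0 ≤ 2 * ε * Y)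
    rw [show 2 * ε * Y * (1 / (2 * ε)) = Y by field_simp] at h2
    linarith
  have hbc : Continuous b := by fun_prop
  have hl1 : Tendsto (fun d : ℝ => ∫ y in (0 : ℝ)..Y, Complex.exp (-b d * (y : ℂ) ^ 2)) (𝓝[>] 0)
      (𝓝 (∫ y in (0 : ℝ)..Y, Complex.exp (-b 0 * (y : ℂ) ^ 2))) := by
    have : Continuous fun d : ℝ => ∫ y in (0 : ℝ)..Y, Complex.exp (-b d * (y : ℂ) ^ 2) :=
      intervalIntegral.continuous_parametric_intervalIntegral_of_continuous' (by fun_prop) 0 Y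
    exact this.continuousAt.tendsto.mono_left nhdsWithin_le_nhds
  have hb0 : b 0 ≠ 0 := fun h => by
    have := hbn 0
    rw [h, norm_zero] at this
    have h2 : 0 < 1 / (2 * ε) := by positivity
    linarith
  have hl2 : Tendsto (fun d : ℝ => ((Real.pi : ℂ) / b d) ^ (1 / 2 : ℂ) / 2) (𝓝[>] 0)
      (𝓝 (((Real.pi : ℂ) / b 0) ^ (1 / 2 : ℂ) / 2)) := by
    have hs : (Real.pi : ℂ) / b 0 ∈ Complex.slitPlane := by
      right
      rw [Complex.div_im, hbre, hbim]
      simp only [Complex.ofReal_im, Complex.ofReal_re, zero_mul, zero_div, zero_sub]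
      have : 0 < Complex.normSq (b 0) := Complex.normSq_pos.2 hb0
      have h3 : 0 < Real.pi * (1 / (2 * ε)) / Complex.normSq (b 0) := by positivity
      rw [mul_neg, neg_div, neg_neg]
      exact h3.ne'
    have h1 : ContinuousAt (fun d : ℝ => (Real.pi : ℂ) / b d) 0 :=
      continuousAt_const.div hbc.continuousAt hb0
    have h2 : Tendsto (fun z : ℂ => z ^ (1 / 2 : ℂ)) (𝓝 ((Real.pi : ℂ) / b 0))
        (𝓝 (((Real.pi : ℂ) / b 0) ^ (1 / 2 : ℂ))) := continuousAt_cpow_const hs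
    exact ((h2.comp h1.tendsto).div_const 2).mono_left nhdsWithin_le_nhds
  have hfin := le_of_tendsto (hl1.sub hl2).norm
    (by filter_upwards [self_mem_nhdsWithin] with d hd using key d hd)
  have e1 : b 0 = ((0 : ℝ) : ℂ) - Complex.I / (2 * ε) := rfl
  rw [e1, fresnel_constant hε] at hfin
  have e2 : (∫ y in (0 : ℝ)..Y, Complex.exp (Complex.I * ((y ^ 2 / (2 * ε) : ℝ) : ℂ)))
      = ∫ y in (0 : ℝ)..Y, Complex.exp (-(((0 : ℝ) : ℂ) - Complex.I / (2 * ε)) * (y : ℂ) ^ 2) := by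
    refine intervalIntegral.integral_congr fun y _ => ?_
    congr 1
    push_cast
    ring
  rw [e2, one_div_mul_eq_div]
  exact hfin

theorem abs_mul_sub_linear_le {x y β γ s B M N : ℝ} (hs0 : 0 ≤ s) (hs1 : s ≤ 1)
    (hβ : |β| ≤ B) (hγ : |γ| ≤ B) (hx : |x - (1 + β * s)| ≤ M * s ^ 2)
    (hy : |y - (1 + γ * s)| ≤ N * s ^ 2) (hM : 0 ≤ M) (hN : 0 ≤ N) :
    |x * y - (1 + (β + γ) * s)| ≤ (B ^ 2 + (1 + B) * (M + N) + M * N) * s ^ 2 := by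
  have hB : 0 ≤ B := (abs_nonneg _).trans hβ
  have hs2 : s ^ 2 ≤ 1 := pow_le_one₀ hs0 hs1
  have hlin : ∀ δ : ℝ, |δ| ≤ B → |1 + δ * s| ≤ 1 + B := by
    intro δ hδ
    refine (abs_add_le _ _).trans ?_
    rw [abs_one, abs_mul, abs_of_nonneg hs0]
    have : |δ| * s ≤ B * 1 := mul_le_mul hδ hs1 hs0 hB
    linarith
  have e : x * y - (1 + (β + γ) * s) = (1 + β * s) * (y - (1 + γ * s))
      + (x - (1 + β * s)) * (y - (1 + γ * s)) + (1 + γ * s) * (x - (1 + β * s))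
      + β * γ * s ^ 2 := by ring
  have h1 : |(1 + β * s) * (y - (1 + γ * s))| ≤ (1 + B) * (N * s ^ 2) := by
    rw [abs_mul]; exact mul_le_mul (hlin β hβ) hy (abs_nonneg _) (by positivity)
  have h2 : |(x - (1 + β * s)) * (y - (1 + γ * s))| ≤ M * N * s ^ 2 := by
    rw [abs_mul]
    calc _ ≤ (M * s ^ 2) * (N * s ^ 2) := mul_le_mul hx hy (abs_nonneg _) (by positivity)
      _ = M * N * s ^ 2 * s ^ 2 := by ring
      _ ≤ M * N * s ^ 2 := mul_le_of_le_one_right (by positivity) hs2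
  have h3 : |(1 + γ * s) * (x - (1 + β * s))| ≤ (1 + B) * (M * s ^ 2) := by
    rw [abs_mul]; exact mul_le_mul (hlin γ hγ) hx (abs_nonneg _) (by positivity)
  have h4 : |β * γ * s ^ 2| ≤ B ^ 2 * s ^ 2 := by
    rw [abs_mul, abs_mul, abs_of_nonneg (by positivity : 0 ≤ s ^ 2), sq B]
    gcongr
  rw [e]
  have h5 := abs_add_three ((1 + β * s) * (y - (1 + γ * s)))
    ((x - (1 + β * s)) * (y - (1 + γ * s))) ((1 + γ * s) * (x - (1 + β * s)))
  have h6 := abs_add_le ((1 + β * s) * (y - (1 + γ * s))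
      + (x - (1 + β * s)) * (y - (1 + γ * s)) + (1 + γ * s) * (x - (1 + β * s))) (β * γ * s ^ 2)
  linarith

/-- The square root of `1 + 2 β s + O(s²)`. -/
theorem abs_sqrt_sub_linear_le {u w β s B M : ℝ} (hβ : |β| ≤ B) (hβs : |β * s| ≤ 1 / 2)
    (hu : 1 / 2 ≤ u) (huw : u ^ 2 = w) (hw : |w - (1 + 2 * β * s)| ≤ M * s ^ 2) :
    |u - (1 + β * s)| ≤ (M + B ^ 2) * s ^ 2 := by
  have h1 : (u - (1 + β * s)) * (u + (1 + β * s)) = (w - (1 + 2 * β * s)) - β ^ 2 * s ^ 2 := by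
    rw [← huw]; ring
  have h2 : 1 ≤ u + (1 + β * s) := by have := (abs_le.1 hβs).1; linarith
  have h3 : |u - (1 + β * s)| ≤ |(u - (1 + β * s)) * (u + (1 + β * s))| := by
    rw [abs_mul, abs_of_nonneg (by linarith : 0 ≤ u + (1 + β * s))]
    exact le_mul_of_one_le_right (abs_nonneg _) h2
  rw [h1] at h3
  have h4 := abs_sub (w - (1 + 2 * β * s)) (β ^ 2 * s ^ 2)
  have h5 : |β ^ 2 * s ^ 2| ≤ B ^ 2 * s ^ 2 := by
    rw [abs_of_nonneg (by positivity), ← sq_abs β]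
    gcongr
  linarith

theorem abs_stationary_phase_remainder_le {s p u d a a' a₀ a₁ A K L : ℝ} (hs : 0 < s)
    (hK : 0 ≤ K) (hL : 0 ≤ L)
    (hp : 1 / 2 ≤ p) (hu : 1 / 2 ≤ u) (hd : |d| ≤ 2) (hpd : |p - d| ≤ K * s)
    (hdiff : |p * p * p - d * u ^ 3| ≤ L * s ^ 2) (ha : |a - a₀ - a₁ * s| ≤ A * s ^ 2)
    (ha' : |a' - a₁| ≤ A * s) (ha0 : |a₀| ≤ A) (ha1 : |a₁| ≤ A) :
    |a' * s / p - a * d / p ^ 2 + a₀ * p / u ^ 3| ≤ (10 + 4 * K + 32 * L) * A * s ^ 2 := by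
  have hA : 0 ≤ A := (abs_nonneg _).trans ha0
  have hp0 : 0 < p := by linarith
  have hu0 : 0 < u := by linarith
  have hip : p⁻¹ ≤ 2 := by rw [inv_le_comm₀ hp0 two_pos]; linarith
  have hiu : u⁻¹ ≤ 2 := by rw [inv_le_comm₀ hu0 two_pos]; linarith
  have hip2 : (p⁻¹) ^ 2 ≤ 4 := by
    calc (p⁻¹) ^ 2 ≤ 2 ^ 2 := by gcongr
      _ = 4 := by norm_num
  have hiu3 : (u⁻¹) ^ 3 ≤ 8 := by
    calc (u⁻¹) ^ 3 ≤ 2 ^ 3 := by gcongr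
      _ = 8 := by norm_num
  have e : a' * s / p - a * d / p ^ 2 + a₀ * p / u ^ 3
      = (a' - a₁) * s * p⁻¹ - (a - a₀ - a₁ * s) * d * (p⁻¹) ^ 2 + a₁ * s * (p - d) * (p⁻¹) ^ 2
        + a₀ * (p * p * p - d * u ^ 3) * (p⁻¹) ^ 2 * (u⁻¹) ^ 3 := by
    field_simp
    ring
  have t1 : |(a' - a₁) * s * p⁻¹| ≤ 2 * A * s ^ 2 := by
    rw [abs_mul, abs_mul, abs_of_pos hs, abs_of_pos (inv_pos.2 hp0)]
    calc _ ≤ A * s * s * 2 := by gcongr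
      _ = _ := by ring
  have t2 : |(a - a₀ - a₁ * s) * d * (p⁻¹) ^ 2| ≤ 8 * A * s ^ 2 := by
    rw [abs_mul, abs_mul, abs_of_nonneg (by positivity : 0 ≤ (p⁻¹) ^ 2)]
    calc _ ≤ A * s ^ 2 * 2 * 4 := by gcongr
      _ = _ := by ring
  have t3 : |a₁ * s * (p - d) * (p⁻¹) ^ 2| ≤ 4 * K * A * s ^ 2 := by
    rw [abs_mul, abs_mul, abs_mul, abs_of_pos hs, abs_of_nonneg (by positivity : 0 ≤ (p⁻¹) ^ 2)]
    calc _ ≤ A * s * (K * s) * 4 := by gcongr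
      _ = _ := by ring
  have t4 : |a₀ * (p * p * p - d * u ^ 3) * (p⁻¹) ^ 2 * (u⁻¹) ^ 3|
      ≤ 32 * L * A * s ^ 2 := by
    rw [abs_mul, abs_mul, abs_mul, abs_of_nonneg (by positivity : 0 ≤ (p⁻¹) ^ 2),
      abs_of_nonneg (by positivity : 0 ≤ (u⁻¹) ^ 3)]
    calc _ ≤ A * (L * s ^ 2) * 4 * 8 := by gcongr
      _ = _ := by ring
  rw [e]
  have h1 := abs_sub ((a' - a₁) * s * p⁻¹) ((a - a₀ - a₁ * s) * d * (p⁻¹) ^ 2)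
  have h2 := abs_add_three ((a' - a₁) * s * p⁻¹ - (a - a₀ - a₁ * s) * d * (p⁻¹) ^ 2)
    (a₁ * s * (p - d) * (p⁻¹) ^ 2) (a₀ * (p * p * p - d * u ^ 3) * (p⁻¹) ^ 2 * (u⁻¹) ^ 3)
  linarith

/-- The cancellation behind stationary phase to second order. -/
theorem exists_stationary_phase_scalar_bound {P : ℝ} (hP : 0 ≤ P) :
    ∃ C, 0 ≤ C ∧ ∀ s c p w u d a a' a₀ a₁ A : ℝ, 0 < s → s ≤ 1 → |c| ≤ P → P * s ≤ 1 / 2 →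
      |d - (1 + c * s)| ≤ P * s ^ 2 → |p - (1 + c / 2 * s)| ≤ P * s ^ 2 →
      |w - (1 + c / 3 * s)| ≤ P * s ^ 2 → 1 / 2 ≤ p → 1 / 2 ≤ u → u ^ 2 = w → |d| ≤ 2 →
      |a - a₀ - a₁ * s| ≤ A * s ^ 2 → |a' - a₁| ≤ A * s → |a₀| ≤ A → |a₁| ≤ A →
      |a' * s / p - a * d / p ^ 2 + a₀ * p / u ^ 3| ≤ C * A * s ^ 2 := by
  set Mu := P + P ^ 2 with hMu
  set M3 := P ^ 2 + (1 + P) * (P + Mu) + P * Mu with hM3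
  set M4 := P ^ 2 + (1 + P) * (P + M3) + P * M3 with hM4
  set N2 := P ^ 2 + (1 + P) * (P + P) + P * P with hN2
  set N3 := (2 * P) ^ 2 + (1 + 2 * P) * (N2 + P) + N2 * P with hN3
  have hMu0 : 0 ≤ Mu := by positivity
  have hM30 : 0 ≤ M3 := by positivity
  have hM40 : 0 ≤ M4 := by positivity
  have hN20 : 0 ≤ N2 := by positivity
  have hN30 : 0 ≤ N3 := by positivity
  clear_value Mu M3 M4 N2 N3
  refine ⟨10 + 4 * (4 * P) + 32 * (N3 + M4), by positivity, ?_⟩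
  intro s c p w u d a a' a₀ a₁ A hs hs1 hc hPs hd hp hw hp2 hu2 huw hd2 ha ha' ha0 ha1
  have hfr : ∀ θ : ℝ, 0 ≤ θ → θ ≤ 1 → |c * θ| ≤ P := by
    intro θ h0 h1
    rw [abs_mul, abs_of_nonneg h0]
    nlinarith [abs_nonneg c]
  have hc2 : |c / 2| ≤ P := hfr (2⁻¹) (by norm_num) (by norm_num)
  have hc3 : |c / 3| ≤ P := hfr (3⁻¹) (by norm_num) (by norm_num)
  have hc6 : |c / 6| ≤ P := hfr (6⁻¹) (by norm_num) (by norm_num)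
  have hu1 : |u - (1 + c / 6 * s)| ≤ Mu * s ^ 2 := by
    rw [hMu]
    refine abs_sqrt_sub_linear_le hc6 ?_ hu2 huw ?_
    · rw [abs_mul, abs_of_pos hs]
      exact (mul_le_mul_of_nonneg_right hc6 hs.le).trans hPs
    · rwa [show 2 * (c / 6) * s = c / 3 * s by ring]
  have hu3 : |u ^ 3 - (1 + c / 2 * s)| ≤ M3 * s ^ 2 := by
    have := abs_mul_sub_linear_le hs.le hs1 hc3 hc6 hw hu1 hP hMu0
    rwa [← hM3, ← huw, show u ^ 2 * u = u ^ 3 by ring, show c / 3 + c / 6 = c / 2 by ring] at this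
  have hdu : |d * u ^ 3 - (1 + 3 * c / 2 * s)| ≤ M4 * s ^ 2 := by
    have := abs_mul_sub_linear_le hs.le hs1 hc hc2 hd hu3 hP hM30
    rwa [← hM4, show c + c / 2 = 3 * c / 2 by ring] at this
  have hp22 : |p * p - (1 + c * s)| ≤ N2 * s ^ 2 := by
    have := abs_mul_sub_linear_le hs.le hs1 hc2 hc2 hp hp hP hP
    rwa [← hN2, show c / 2 + c / 2 = c by ring] at this
  have hp3 : |p * p * p - (1 + 3 * c / 2 * s)| ≤ N3 * s ^ 2 := by
    have := abs_mul_sub_linear_le (B := 2 * P) hs.le hs1 (by linarith) (by linarith) hp22 hp hN20 hP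
    rwa [← hN3, show c + c / 2 = 3 * c / 2 by ring] at this
  have hdiff : |p * p * p - d * u ^ 3| ≤ (N3 + M4) * s ^ 2 := by
    have := abs_sub_le (p * p * p) (1 + 3 * c / 2 * s) (d * u ^ 3)
    rw [abs_sub_comm (1 + 3 * c / 2 * s)] at this
    linarith
  have hpd : |p - d| ≤ 4 * P * s := by
    have e : p - d = (p - (1 + c / 2 * s)) - (d - (1 + c * s)) - c / 2 * s := by ring
    have h1 := abs_sub (p - (1 + c / 2 * s)) (d - (1 + c * s))
    have h2 := abs_sub ((p - (1 + c / 2 * s)) - (d - (1 + c * s))) (c / 2 * s)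
    have h3 : |c / 2 * s| ≤ P * s := by rw [abs_mul, abs_of_pos hs]; gcongr
    have h4 : P * s ^ 2 ≤ P * s := by
      have : s ^ 2 ≤ s := by nlinarith
      gcongr
    have h5 : 0 ≤ P * s := by positivity
    rw [e]
    linarith
  exact abs_stationary_phase_remainder_le hs (by positivity) (by positivity) hp2 hu2 hd2 hpd hdiff ha ha' ha0 ha1

theorem abs_le_mul_pow_succ {g g' : ℝ → ℝ} {b M : ℝ} {n : ℕ} (hM : 0 ≤ M)
    (hg : ∀ s, HasDerivAt g (g' s) s) (h0 : g 0 = 0)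
    (hb : ∀ s ∈ Icc 0 b, |g' s| ≤ M * s ^ n) {s : ℝ} (hs : s ∈ Icc 0 b) :
    |g s| ≤ M * s ^ (n + 1) := by
  have := norm_image_sub_le_of_norm_deriv_le_segment' (f := g) (f' := g') (C := M * s ^ n)
    (a := 0) (b := s) (fun t _ => (hg t).hasDerivWithinAt)
    (fun t ht => (hb t ⟨ht.1, ht.2.le.trans hs.2⟩).trans
      (by have := ht.1; have := ht.2.le; gcongr)) s ⟨hs.1, le_rfl⟩
  rw [h0, sub_zero, sub_zero, Real.norm_eq_abs] at this
  rw [pow_succ, ← mul_assoc]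
  exact this

/-- A phase `φ` on `[0, b]` with a nondegenerate stationary point at `0`, normalized, together with
its derivatives. -/
structure NormalizedPhase (P b : ℝ) (φ φ₁ φ₂ : ℝ → ℝ) : Prop where
  deriv₀ : ∀ s, HasDerivAt φ (φ₁ s) s
  deriv₁ : ∀ s, HasDerivAt φ₁ (φ₂ s) s
  exists_deriv₂ : ∃ φ₃ φ₄ : ℝ → ℝ, (∀ s, HasDerivAt φ₂ (φ₃ s) s) ∧ (∀ s, HasDerivAt φ₃ (φ₄ s) s) ∧
    |φ₃ 0| ≤ P ∧ ∀ s ∈ Icc 0 b, |φ₄ s| ≤ P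
  zero₀ : φ 0 = 0
  zero₁ : φ₁ 0 = 0
  one₂ : φ₂ 0 = 1

namespace NormalizedPhase

variable {P b : ℝ} {φ φ₁ φ₂ : ℝ → ℝ}

theorem taylor (h : NormalizedPhase P b φ φ₁ φ₂) (hP : 0 ≤ P) : ∃ c, |c| ≤ P ∧ ∀ s ∈ Icc 0 b,
    |φ₂ s - 1 - c * s| ≤ P * s ^ 2 ∧ |φ₁ s - s - c / 2 * s ^ 2| ≤ P * s ^ 3 ∧
    |φ s - s ^ 2 / 2 - c / 6 * s ^ 3| ≤ P * s ^ 4 := by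
  obtain ⟨φ₃, φ₄, h2, h3, h30, h4⟩ := h.exists_deriv₂
  have hid : ∀ s : ℝ, HasDerivAt (fun s : ℝ => s) 1 s := hasDerivAt_id
  have t3 : ∀ s ∈ Icc 0 b, |φ₃ s - φ₃ 0| ≤ P * s ^ 1 := fun s hs =>
    abs_le_mul_pow_succ (n := 0) hP (fun s => (h3 s).sub_const (φ₃ 0)) (sub_self _)
      (fun s hs => by rw [pow_zero, mul_one]; exact h4 s hs) hs
  have t2 : ∀ s ∈ Icc 0 b, |φ₂ s - 1 - φ₃ 0 * s| ≤ P * s ^ 2 := fun s hs =>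
    abs_le_mul_pow_succ (n := 1) (g := fun s => φ₂ s - 1 - φ₃ 0 * s) hP (fun s =>
      (((h2 s).sub_const 1).sub ((hid s).const_mul (φ₃ 0))).congr_deriv (by rw [mul_one]))
      (by simp [h.one₂]) t3 hs
  have t1 : ∀ s ∈ Icc 0 b, |φ₁ s - s - φ₃ 0 / 2 * s ^ 2| ≤ P * s ^ 3 := fun s hs =>
    abs_le_mul_pow_succ (n := 2) (g := fun s => φ₁ s - s - φ₃ 0 / 2 * s ^ 2) hP (fun s =>
      (((h.deriv₁ s).sub (hid s)).sub (((hid s).pow 2).const_mul (φ₃ 0 / 2))).congr_deriv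
        (by push_cast; ring))
      (by simp [h.zero₁]) t2 hs
  refine ⟨φ₃ 0, h30, fun s hs => ⟨t2 s hs, t1 s hs, ?_⟩⟩
  exact abs_le_mul_pow_succ (n := 3) (g := fun s => φ s - s ^ 2 / 2 - φ₃ 0 / 6 * s ^ 3) hP (fun s =>
      (((h.deriv₀ s).sub (((hid s).pow 2).div_const 2)).sub
        (((hid s).pow 3).const_mul (φ₃ 0 / 6))).congr_deriv (by push_cast; ring))
      (by simp [h.zero₀]) t1 hs

theorem bounds (h : NormalizedPhase P b φ φ₁ φ₂) (hP : 0 ≤ P) (hb1 : b ≤ 1)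
    (hPb : 2 * P * b ≤ 1 / 2) {s : ℝ} (hs : s ∈ Icc 0 b) :
    s / 2 ≤ φ₁ s ∧ s ^ 2 / 8 ≤ φ s ∧ φ s ≤ s ^ 2 ∧ |φ₂ s| ≤ 2 := by
  obtain ⟨c, hc, ht⟩ := h.taylor hP
  obtain ⟨t2, t1, t0⟩ := ht s hs
  have hs0 := hs.1
  have hs1 : s ≤ 1 := hs.2.trans hb1
  have hPs : P * s ≤ 1 / 4 := by
    have : P * s ≤ P * b := mul_le_mul_of_nonneg_left hs.2 hP
    linarith
  have hcs : |c * s| ≤ 1 / 4 := by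
    rw [abs_mul, abs_of_nonneg hs0]
    exact (mul_le_mul_of_nonneg_right hc hs0).trans hPs
  have hcs' := abs_le.1 hcs
  have hs2 : 0 ≤ s ^ 2 := sq_nonneg s
  have e2 : P * s ^ 2 ≤ 1 / 4 := by
    calc P * s ^ 2 = P * s * s := by ring
      _ ≤ 1 / 4 * 1 := mul_le_mul hPs hs1 hs0 (by norm_num)
      _ = 1 / 4 := by norm_num
  have e3 : P * s ^ 3 ≤ 1 / 4 * s := by
    calc P * s ^ 3 = (P * s ^ 2) * s := by ring
      _ ≤ _ := by gcongr
  have e4 : P * s ^ 4 ≤ 1 / 4 * s ^ 2 := by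
    calc P * s ^ 4 = (P * s ^ 2) * s ^ 2 := by ring
      _ ≤ _ := by gcongr
  have f2 : |c / 2 * s ^ 2| ≤ 1 / 8 * s := by
    rw [show c / 2 * s ^ 2 = (c * s) * (1 / 2 * s) by ring, abs_mul,
      abs_of_nonneg (by positivity : 0 ≤ 1 / 2 * s)]
    calc _ ≤ 1 / 4 * (1 / 2 * s) := by gcongr
      _ = _ := by ring
  have f3 : |c / 6 * s ^ 3| ≤ 1 / 24 * s ^ 2 := by
    rw [show c / 6 * s ^ 3 = (c * s) * (1 / 6 * s ^ 2) by ring, abs_mul,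
      abs_of_nonneg (by positivity : 0 ≤ 1 / 6 * s ^ 2)]
    calc _ ≤ 1 / 4 * (1 / 6 * s ^ 2) := by gcongr
      _ = _ := by ring
  have g0 := abs_le.1 t0
  have g1 := abs_le.1 t1
  have g2 := abs_le.1 t2
  have k2 := abs_le.1 f2
  have k3 := abs_le.1 f3
  refine ⟨by linarith, by linarith, by linarith, abs_le.2 ⟨by linarith, by linarith⟩⟩

end NormalizedPhase

theorem exists_regularized_quotient_bound {P b : ℝ} (hP : 0 ≤ P) (hb1 : b ≤ 1)
    (hPb : 2 * P * b ≤ 1 / 2) : ∃ C, 0 ≤ C ∧ ∀ (φ φ₁ φ₂ a a₁ a₂ : ℝ → ℝ) (A : ℝ),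
      NormalizedPhase P b φ φ₁ φ₂ → (∀ s, HasDerivAt a (a₁ s) s) → (∀ s, HasDerivAt a₁ (a₂ s) s) →
      |a 0| ≤ A → (∀ s ∈ Icc 0 b, |a₁ s| ≤ A) → (∀ s ∈ Icc 0 b, |a₂ s| ≤ A) → ∀ s ∈ Ioc 0 b,
      HasDerivAt (fun s => a s / φ₁ s - a 0 / Real.sqrt (2 * φ s))
        (a₁ s / φ₁ s - a s * φ₂ s / φ₁ s ^ 2 + a 0 * φ₁ s / Real.sqrt (2 * φ s) ^ 3) s ∧
      |a₁ s / φ₁ s - a s * φ₂ s / φ₁ s ^ 2 + a 0 * φ₁ s / Real.sqrt (2 * φ s) ^ 3| ≤ C * A := by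
  obtain ⟨C, hC, hCb⟩ := exists_stationary_phase_scalar_bound (P := 2 * P) (by positivity)
  refine ⟨C, hC, ?_⟩
  intro φ φ₁ φ₂ a a₁ a₂ A h ha ha1 hA0 hA1 hA2 s hs
  have hA : 0 ≤ A := (abs_nonneg _).trans hA0
  have hs' := Ioc_subset_Icc_self hs
  obtain ⟨b1, b2, b3, b4⟩ := h.bounds hP hb1 hPb hs'
  obtain ⟨c, hc, ht⟩ := h.taylor hP
  obtain ⟨t2, t1, t0⟩ := ht s hs'
  have hs0 : 0 < s := hs.1
  have hφ1 : 0 < φ₁ s := by linarith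
  have hφ : 0 < 2 * φ s := by have : 0 < s ^ 2 := by positivity
                              linarith
  set ψ := Real.sqrt (2 * φ s) with hψ
  have hψ0 : 0 < ψ := Real.sqrt_pos.2 hφ
  have hψ2 : ψ ^ 2 = 2 * φ s := Real.sq_sqrt hφ.le
  constructor
  · have d1 := (ha s).div (h.deriv₁ s) hφ1.ne'
    have d2 := (((h.deriv₀ s).const_mul 2).sqrt hφ.ne')
    have d3 := d1.sub ((hasDerivAt_const s (a 0)).div d2 (by rw [← hψ]; exact hψ0.ne'))
    refine d3.congr_deriv ?_
    rw [← hψ]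
    field_simp
    ring
  · have h0 : (0 : ℝ) ∈ Icc 0 b := ⟨le_rfl, hs.1.le.trans hs.2⟩
    have r1 : ∀ s ∈ Icc 0 b, |a₁ s - a₁ 0| ≤ A * s ^ 1 := fun s hs =>
      abs_le_mul_pow_succ (n := 0) hA (fun s => (ha1 s).sub_const (a₁ 0)) (sub_self _)
        (fun s hs => by rw [pow_zero, mul_one]; exact hA2 s hs) hs
    have r0 : |a s - a 0 - a₁ 0 * s| ≤ A * s ^ 2 :=
      abs_le_mul_pow_succ (n := 1) (g := fun s => a s - a 0 - a₁ 0 * s) hA (fun s =>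
        (((ha s).sub_const (a 0)).sub ((hasDerivAt_id s).const_mul (a₁ 0))).congr_deriv
          (by rw [mul_one])) (by simp) r1 hs'
    have hdiv : ∀ (x M : ℝ) (n : ℕ), |x| ≤ M * s ^ (n + 2) → |x / s ^ n| ≤ M * s ^ 2 := by
      intro x M n hx
      rw [abs_div, abs_of_pos (by positivity : 0 < s ^ n), div_le_iff₀ (by positivity)]
      calc _ ≤ _ := hx
        _ = _ := by ring
    have q1 : |φ₁ s / s - (1 + c / 2 * s)| ≤ 2 * P * s ^ 2 := by
      have := hdiv _ P 1 t1
      rw [show (φ₁ s - s - c / 2 * s ^ 2) / s ^ 1 = φ₁ s / s - (1 + c / 2 * s) by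
        field_simp; ring] at this
      have h5 : 0 ≤ P * s ^ 2 := by positivity
      linarith
    have q0 : |2 * φ s / s ^ 2 - (1 + c / 3 * s)| ≤ 2 * P * s ^ 2 := by
      have := hdiv (2 * (φ s - s ^ 2 / 2 - c / 6 * s ^ 3)) (2 * P) 2
        (by rw [abs_mul, abs_two]; linarith)
      rwa [show 2 * (φ s - s ^ 2 / 2 - c / 6 * s ^ 3) / s ^ 2
        = 2 * φ s / s ^ 2 - (1 + c / 3 * s) by field_simp; ring] at this
    have q2 : |φ₂ s - (1 + c * s)| ≤ 2 * P * s ^ 2 := by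
      rw [← sub_sub]
      have h5 : 0 ≤ P * s ^ 2 := by positivity
      linarith
    have hψs : s / 2 ≤ ψ := by
      rw [hψ]
      apply Real.le_sqrt_of_sq_le
      have : (s / 2) ^ 2 = s ^ 2 / 4 := by ring
      linarith
    have hfin := hCb s c (φ₁ s / s) (2 * φ s / s ^ 2) (ψ / s) (φ₂ s) (a s) (a₁ s) (a 0) (a₁ 0) A
      hs0 (hs.2.trans hb1) (by linarith)
      ((mul_le_mul_of_nonneg_left hs.2 (by positivity)).trans hPb) q2 q1 q0
      (by rw [le_div_iff₀ hs0]; linarith) (by rw [le_div_iff₀ hs0]; linarith)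
      (by rw [div_pow, hψ2]) b4 r0 (by simpa using r1 s hs') hA0 (hA1 0 h0)
    have e : a₁ s * s / (φ₁ s / s) - a s * φ₂ s / (φ₁ s / s) ^ 2 + a 0 * (φ₁ s / s) / (ψ / s) ^ 3
        = s ^ 2 * (a₁ s / φ₁ s - a s * φ₂ s / φ₁ s ^ 2 + a 0 * φ₁ s / ψ ^ 3) := by
      field_simp
    rw [e, abs_mul, abs_of_pos (by positivity : 0 < s ^ 2), mul_comm] at hfin
    exact le_of_mul_le_mul_right hfin (by positivity)

/-- Stationary phase on a half-line. -/
theorem exists_half_line_stationary_phase {P b : ℝ} (hP : 0 ≤ P) (hb : 0 < b) (hb1 : b ≤ 1)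
    (hPb : 2 * P * b ≤ 1 / 2) : ∃ C, 0 ≤ C ∧ ∀ (φ φ₁ φ₂ a a₁ a₂ : ℝ → ℝ) (A ε : ℝ),
      NormalizedPhase P b φ φ₁ φ₂ → (∀ s, HasDerivAt a (a₁ s) s) → (∀ s, HasDerivAt a₁ (a₂ s) s) →
      |a 0| ≤ A → (∀ s ∈ Icc 0 b, |a₁ s| ≤ A) → (∀ s ∈ Icc 0 b, |a₂ s| ≤ A) → a b = 0 → 0 < ε →
      ‖(∫ s in (0 : ℝ)..b, (a s : ℂ) * Complex.exp (Complex.I * ((φ s / ε : ℝ) : ℂ)))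
        - a 0 * (1 / 2 * (Real.sqrt (2 * Real.pi * ε)
          * Complex.exp (Complex.I * (Real.pi / 4 : ℝ))))‖ ≤ C * A * ε := by
  obtain ⟨C, hC, hCb⟩ := exists_regularized_quotient_bound hP hb1 hPb
  refine ⟨2 * C * b + 4 / b + 4 / b, by positivity, ?_⟩
  intro φ φ₁ φ₂ a a₁ a₂ A ε h ha ha1 hA0 hA1 hA2 hab hε
  have hA : 0 ≤ A := (abs_nonneg _).trans hA0
  have hq := hCb φ φ₁ φ₂ a a₁ a₂ A h ha ha1 hA0 hA1 hA2
  have hεC : (ε : ℂ) ≠ 0 := by exact_mod_cast hε.ne'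
  set ψ : ℝ → ℝ := fun s => Real.sqrt (2 * φ s) with hψdef
  set g : ℝ → ℝ := fun s => a s / φ₁ s - a 0 / ψ s with hgdef
  set g' : ℝ → ℝ := fun s => a₁ s / φ₁ s - a s * φ₂ s / φ₁ s ^ 2 + a 0 * φ₁ s / ψ s ^ 3 with hg'def
  set e : ℝ → ℂ := fun s => Complex.exp (Complex.I * ((φ s / ε : ℝ) : ℂ)) with hedef
  set G : ℝ → ℂ := fun y => Complex.exp (Complex.I * ((y ^ 2 / (2 * ε) : ℝ) : ℂ)) with hGdef
  have hen : ∀ s, ‖e s‖ = 1 := fun s => by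
    rw [hedef]; simp only; rw [mul_comm, Complex.norm_exp_ofReal_mul_I]
  have hpos : ∀ s ∈ Ioc 0 b, 0 < φ₁ s ∧ 0 < 2 * φ s ∧ s / 2 ≤ ψ s ∧ ψ s ≤ 2 * s := by
    intro s hs
    obtain ⟨b1, b2, b3, b4⟩ := h.bounds hP hb1 hPb (Ioc_subset_Icc_self hs)
    have hs0 := hs.1
    have hs2 : 0 < s ^ 2 := by positivity
    refine ⟨by linarith, by linarith, Real.le_sqrt_of_sq_le ?_, Real.sqrt_le_iff.2 ⟨by linarith, ?_⟩⟩
    · have : (s / 2) ^ 2 = s ^ 2 / 4 := by ring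
      linarith
    · have : (2 * s) ^ 2 = 4 * s ^ 2 := by ring
      linarith
  have hφc : Continuous φ := continuous_iff_continuousAt.2 fun s => (h.deriv₀ s).continuousAt
  have hφ1c : Continuous φ₁ := continuous_iff_continuousAt.2 fun s => (h.deriv₁ s).continuousAt
  have hφ2c : Continuous φ₂ := by
    obtain ⟨φ₃, φ₄, h2, -⟩ := h.exists_deriv₂
    exact continuous_iff_continuousAt.2 fun s => (h2 s).continuousAt
  have hac : Continuous a := continuous_iff_continuousAt.2 fun s => (ha s).continuousAt
  have ha1c : Continuous a₁ := continuous_iff_continuousAt.2 fun s => (ha1 s).continuousAt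
  have hψc : Continuous ψ := (continuous_const.mul hφc).sqrt
  have hec : Continuous e := by fun_prop
  have hGc : Continuous G := by fun_prop
  have hede : ∀ s, HasDerivAt e (Complex.I * ((φ₁ s / ε : ℝ) : ℂ) * e s) s := by
    intro s
    have := ((((h.deriv₀ s).div_const ε).ofReal_comp).const_mul Complex.I).cexp
    refine this.congr_deriv ?_
    rw [mul_comm]
  have hψd : ∀ s ∈ Ioc 0 b, HasDerivAt ψ (φ₁ s / ψ s) s := by
    intro s hs
    refine (((h.deriv₀ s).const_mul 2).sqrt (hpos s hs).2.1.ne').congr_deriv ?_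
    rw [hψdef]
    simp only
    rw [mul_div_mul_left _ _ two_ne_zero]
  have hψe : ∀ s ∈ Ioc 0 b, G (ψ s) = e s := by
    intro s hs
    simp only [hGdef, hedef, hψdef]
    rw [Real.sq_sqrt (hpos s hs).2.1.le, mul_div_mul_left _ _ two_ne_zero]
  have hbb : b ∈ Ioc 0 b := ⟨hb, le_rfl⟩
  have hψb := (hpos b hbb).2.2.1
  have hψb0 : 0 < ψ b := by linarith
  have hgb : |g b| ≤ 2 * A / b := by
    simp only [hgdef]
    rw [hab, zero_div, zero_sub, abs_neg, abs_div, abs_of_pos hψb0, div_le_div_iff₀ hψb0 hb]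
    calc |a 0| * b ≤ A * b := by gcongr
      _ = 2 * A * (b / 2) := by ring
      _ ≤ 2 * A * ψ b := by gcongr
  have hgη : ∀ η ∈ Ioc 0 b, |g η| ≤ 2 * A / b + C * A * b := by
    intro η hη
    have := (convex_Icc η b).norm_image_sub_le_of_norm_hasDerivWithin_le (f := g) (f' := g')
      (C := C * A) (x := b) (y := η)
      (fun s hs => ((hq s ⟨hη.1.trans_le hs.1, hs.2⟩).1).hasDerivWithinAt)
      (fun s hs => (hq s ⟨hη.1.trans_le hs.1, hs.2⟩).2) ⟨hη.2, le_rfl⟩ ⟨le_rfl, hη.2⟩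
    have h2 : ‖η - b‖ ≤ b := by
      rw [Real.norm_eq_abs, abs_sub_comm, abs_of_nonneg (by linarith [hη.2])]
      linarith [hη.1]
    have h3 : C * A * ‖η - b‖ ≤ C * A * b := by gcongr
    have h4 := abs_sub_abs_le_abs_sub (g η) (g b)
    rw [Real.norm_eq_abs] at this
    linarith
  have key : ∀ η ∈ Ioc 0 b, ‖(∫ s in η..b, (a s : ℂ) * e s) - a 0 * ∫ y in ψ η..ψ b, G y‖
      ≤ (2 * C * b + 4 / b) * A * ε := by
    intro η hη
    have hsub : ∀ s ∈ uIcc η b, s ∈ Ioc 0 b := fun s hs => by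
      rw [uIcc_of_le hη.2] at hs
      exact ⟨hη.1.trans_le hs.1, hs.2⟩
    have hψne : ∀ s ∈ uIcc η b, ψ s ≠ 0 := fun s hs => by
      have := (hpos s (hsub s hs)).2.2.1
      have := (hsub s hs).1
      linarith
    have hφne : ∀ s ∈ uIcc η b, φ₁ s ≠ 0 := fun s hs => (hpos s (hsub s hs)).1.ne'
    have hg'c : ContinuousOn g' (uIcc η b) := by
      refine ((ha1c.continuousOn.div hφ1c.continuousOn hφne).sub
        ((hac.mul hφ2c).continuousOn.div (hφ1c.pow 2).continuousOn
          fun s hs => pow_ne_zero _ (hφne s hs))).add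
        ((continuous_const.mul hφ1c).continuousOn.div (hψc.pow 3).continuousOn
          fun s hs => pow_ne_zero _ (hψne s hs))
    have hsubst : ∫ s in η..b, ((φ₁ s / ψ s : ℝ) : ℂ) * e s = ∫ y in ψ η..ψ b, G y := by
      rw [← intervalIntegral.integral_deriv_smul_comp (f := ψ) (f' := fun s => φ₁ s / ψ s)
        (g := G) (fun s hs => hψd s (hsub s hs)) (hφ1c.continuousOn.div hψc.continuousOn hψne) hGc]
      refine intervalIntegral.integral_congr fun s hs => ?_
      simp only [Function.comp_apply]
      rw [hψe s (hsub s hs), Complex.real_smul]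
    have hH : ∀ s ∈ uIcc η b, HasDerivAt (fun s => ε / Complex.I * ((g s : ℂ) * e s))
        (ε / Complex.I * ((g' s : ℂ) * e s) + ((a s : ℂ) * e s
          - a 0 * (((φ₁ s / ψ s : ℝ) : ℂ) * e s))) s := by
      intro s hs
      have h1 := (((hq s (hsub s hs)).1.ofReal_comp.mul (hede s)).const_mul (ε / Complex.I))
      refine h1.congr_deriv ?_
      have hφs : (φ₁ s : ℂ) ≠ 0 := by exact_mod_cast hφne s hs
      have hψs : (ψ s : ℂ) ≠ 0 := by exact_mod_cast hψne s hs
      have e1 : ((g s : ℝ) : ℂ) = a s / φ₁ s - a 0 / ψ s := by simp only [hgdef]; push_cast; rfl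
      change ε / Complex.I * ((g' s : ℂ) * e s + (g s : ℂ) * _) = _
      rw [mul_add, e1]
      congr 1
      push_cast
      field_simp [Complex.I_ne_zero]
    have ci1 : IntervalIntegrable (fun s => ε / Complex.I * ((g' s : ℂ) * e s)) volume η b :=
      (continuousOn_const.mul ((Complex.continuous_ofReal.comp_continuousOn hg'c).mul
        hec.continuousOn)).intervalIntegrable
    have ci2 : IntervalIntegrable (fun s => (a s : ℂ) * e s) volume η b :=
      (Continuous.intervalIntegrable (by fun_prop) _ _)
    have ci3 : IntervalIntegrable (fun s => a 0 * (((φ₁ s / ψ s : ℝ) : ℂ) * e s)) volume η b :=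
      (continuousOn_const.mul ((Complex.continuous_ofReal.comp_continuousOn
        (hφ1c.continuousOn.div hψc.continuousOn hψne)).mul hec.continuousOn)).intervalIntegrable
    have hFTC := intervalIntegral.integral_eq_sub_of_hasDerivAt hH (ci1.add (ci2.sub ci3))
    rw [intervalIntegral.integral_add ci1 (ci2.sub ci3), intervalIntegral.integral_sub ci2 ci3,
      intervalIntegral.integral_const_mul, intervalIntegral.integral_const_mul, hsubst] at hFTC
    rw [eq_sub_of_add_eq' hFTC]
    have hεI : ‖(ε : ℂ) / Complex.I‖ = ε := by
      rw [norm_div, Complex.norm_I, div_one, Complex.norm_real, Real.norm_of_nonneg hε.le]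
    have n1 : ‖ε / Complex.I * ((g b : ℂ) * e b)‖ ≤ ε * (2 * A / b) := by
      rw [norm_mul, norm_mul, hεI, hen, mul_one, Complex.norm_real]
      exact mul_le_mul_of_nonneg_left hgb hε.le
    have n2 : ‖ε / Complex.I * ((g η : ℂ) * e η)‖ ≤ ε * (2 * A / b + C * A * b) := by
      rw [norm_mul, norm_mul, hεI, hen, mul_one, Complex.norm_real]
      exact mul_le_mul_of_nonneg_left (hgη η hη) hε.le
    have n3 : ‖ε / Complex.I * ∫ s in η..b, (g' s : ℂ) * e s‖ ≤ ε * (C * A * b) := by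
      rw [norm_mul, hεI]
      refine mul_le_mul_of_nonneg_left ?_ hε.le
      refine (intervalIntegral.norm_integral_le_of_norm_le_const (C := C * A) fun s hs => ?_).trans ?_
      · rw [norm_mul, hen, mul_one, Complex.norm_real]
        exact (hq s (hsub s (uIoc_subset_uIcc hs))).2
      · rw [abs_of_nonneg (by linarith [hη.2])]
        have : b - η ≤ b := by linarith [hη.1]
        gcongr
    refine (norm_sub_le _ _).trans ((add_le_add ((norm_sub_le _ _).trans (add_le_add n1 n2))
      n3).trans (le_of_eq ?_))
    ring
  have hfr := norm_fresnel_sub_le hε hψb0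
  have hfull : ‖(∫ s in (0 : ℝ)..b, (a s : ℂ) * e s) - a 0 * ∫ y in (0 : ℝ)..ψ b, G y‖
      ≤ (2 * C * b + 4 / b) * A * ε := by
    have hlim : Tendsto (fun η => ‖(∫ s in η..b, (a s : ℂ) * e s) - a 0 * ∫ y in ψ η..ψ b, G y‖)
        (𝓝[>] 0) (𝓝 ‖(∫ s in (0 : ℝ)..b, (a s : ℂ) * e s) - a 0 * ∫ y in (0 : ℝ)..ψ b, G y‖) := by
      have c1 : Continuous fun η => ∫ s in η..b, (a s : ℂ) * e s := by
        have hi : Continuous fun s => (a s : ℂ) * e s := by fun_prop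
        have : (fun η => ∫ s in η..b, (a s : ℂ) * e s) = fun η => -∫ s in b..η, (a s : ℂ) * e s :=
          funext fun η => intervalIntegral.integral_symm _ _
        rw [this]
        exact (intervalIntegral.continuous_primitive (fun _ _ => hi.intervalIntegrable _ _) b).neg
      have c2 : Continuous fun η => ∫ y in ψ η..ψ b, G y := by
        have : (fun η => ∫ y in ψ η..ψ b, G y) = fun η => -∫ y in ψ b..ψ η, G y :=
          funext fun η => intervalIntegral.integral_symm _ _
        rw [this]
        exact ((intervalIntegral.continuous_primitive (fun _ _ => hGc.intervalIntegrable _ _)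
          (ψ b)).comp hψc).neg
      have h0 : ψ 0 = 0 := by simp [hψdef, h.zero₀]
      have c3 : Continuous fun η =>
          ‖(∫ s in η..b, (a s : ℂ) * e s) - a 0 * ∫ y in ψ η..ψ b, G y‖ :=
        (c1.sub (continuous_const.mul c2)).norm
      have := c3.tendsto 0
      simp only [h0] at this
      exact this.mono_left nhdsWithin_le_nhds
    refine le_of_tendsto hlim ?_
    filter_upwards [Ioc_mem_nhdsGT hb] with η hη using key η hη
  have hsplit : (∫ s in (0 : ℝ)..b, (a s : ℂ) * e s) - a 0 * (1 / 2 * (Real.sqrt (2 * Real.pi * ε)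
          * Complex.exp (Complex.I * (Real.pi / 4 : ℝ))))
      = ((∫ s in (0 : ℝ)..b, (a s : ℂ) * e s) - a 0 * ∫ y in (0 : ℝ)..ψ b, G y)
        + a 0 * ((∫ y in (0 : ℝ)..ψ b, G y) - 1 / 2 * (Real.sqrt (2 * Real.pi * ε)
          * Complex.exp (Complex.I * (Real.pi / 4 : ℝ)))) := by ring
  rw [hsplit]
  refine (norm_add_le _ _).trans ?_
  rw [norm_mul, Complex.norm_real]
  have h5 : ‖a 0‖ * ‖(∫ y in (0 : ℝ)..ψ b, G y) - 1 / 2 * (Real.sqrt (2 * Real.pi * ε)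
      * Complex.exp (Complex.I * (Real.pi / 4 : ℝ)))‖ ≤ A * (4 * ε / b) := by
    refine mul_le_mul hA0 (hfr.trans ?_) (norm_nonneg _) hA
    rw [div_le_div_iff₀ hψb0 hb]
    calc 2 * ε * b = 4 * ε * (b / 2) := by ring
      _ ≤ 4 * ε * ψ b := by gcongr
  have e6 : (2 * C * b + 4 / b + 4 / b) * A * ε = (2 * C * b + 4 / b) * A * ε + A * (4 * ε / b) := by
    ring
  rw [e6]
  exact add_le_add hfull h5

theorem NormalizedPhase.reflect {P b : ℝ} {φ φ₁ φ₂ φ₃ φ₄ : ℝ → ℝ}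
    (h0 : ∀ s, HasDerivAt φ (φ₁ s) s) (h1 : ∀ s, HasDerivAt φ₁ (φ₂ s) s)
    (h2 : ∀ s, HasDerivAt φ₂ (φ₃ s) s) (h3 : ∀ s, HasDerivAt φ₃ (φ₄ s) s)
    (hφ3 : |φ₃ 0| ≤ P) (hφ4 : ∀ s ∈ Icc (-b) b, |φ₄ s| ≤ P) (z0 : φ 0 = 0) (z1 : φ₁ 0 = 0)
    (z2 : φ₂ 0 = 1) :
    NormalizedPhase P b (fun s => φ (-s)) (fun s => -φ₁ (-s)) (fun s => φ₂ (-s)) := by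
  have hn : ∀ (g g' : ℝ → ℝ), (∀ s, HasDerivAt g (g' s) s) →
      ∀ s, HasDerivAt (fun s => g (-s)) (-g' (-s)) s := by
    intro g g' hg s
    have := (hg (-s)).comp s (hasDerivAt_neg s)
    rwa [mul_neg_one] at this
  have hn' : ∀ (g g' : ℝ → ℝ), (∀ s, HasDerivAt g (g' s) s) →
      ∀ s, HasDerivAt (fun s => -g (-s)) (g' (-s)) s := fun g g' hg s =>
    ((hn g g' hg s).neg).congr_deriv (neg_neg _)
  refine ⟨hn _ _ h0, hn' _ _ h1, ⟨fun s => -φ₃ (-s), fun s => φ₄ (-s), hn _ _ h2, hn' _ _ h3, ?_,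
    fun s hs => hφ4 _ ⟨by linarith [hs.2], by linarith [hs.1, hs.2]⟩⟩, ?_, ?_, ?_⟩
  · simpa using hφ3
  · simpa using z0
  · simpa using z1
  · simpa using z2

theorem conj_intervalIntegral (F : ℝ → ℂ) (a b : ℝ) :
    (starRingEnd ℂ) (∫ s in a..b, F s) = ∫ s in a..b, (starRingEnd ℂ) (F s) := by
  simp only [intervalIntegral, map_sub, integral_conj]

theorem conj_ofReal_mul_exp (x y : ℝ) :
    (starRingEnd ℂ) ((x : ℂ) * Complex.exp (Complex.I * (y : ℂ)))
      = (x : ℂ) * Complex.exp (Complex.I * ((-y : ℝ) : ℂ)) := by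
  rw [map_mul, Complex.conj_ofReal, ← Complex.exp_conj, map_mul, Complex.conj_I,
    Complex.conj_ofReal]
  push_cast
  ring_nf

/-- Stationary phase at a nondegenerate critical point, with amplitude of compact support. -/
theorem exists_stationary_phase {P b : ℝ} (hP : 0 ≤ P) (hb : 0 < b) (hb1 : b ≤ 1)
    (hPb : 2 * P * b ≤ 1 / 2) : ∃ C, 0 ≤ C ∧ ∀ (φ φ₁ φ₂ φ₃ φ₄ a a₁ a₂ : ℝ → ℝ) (κ A ε : ℝ),
      (∀ s, HasDerivAt φ (φ₁ s) s) → (∀ s, HasDerivAt φ₁ (φ₂ s) s) →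
      (∀ s, HasDerivAt φ₂ (φ₃ s) s) → (∀ s, HasDerivAt φ₃ (φ₄ s) s) → κ ≠ 0 → φ₁ 0 = 0 → φ₂ 0 = κ →
      |φ₃ 0| ≤ P * |κ| → (∀ s ∈ Icc (-b) b, |φ₄ s| ≤ P * |κ|) →
      (∀ s, HasDerivAt a (a₁ s) s) → (∀ s, HasDerivAt a₁ (a₂ s) s) →
      |a 0| ≤ A → (∀ s ∈ Icc (-b) b, |a₁ s| ≤ A) → (∀ s ∈ Icc (-b) b, |a₂ s| ≤ A) →
      a b = 0 → a (-b) = 0 → 0 < ε →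
      ‖(∫ s in (-b)..b, (a s : ℂ) * Complex.exp (Complex.I * ((φ s / ε : ℝ) : ℂ)))
        - a 0 * Real.sqrt (2 * Real.pi * (ε / |κ|))
          * Complex.exp (Complex.I * ((φ 0 / ε + κ / |κ| * (Real.pi / 4) : ℝ) : ℂ))‖
        ≤ C * A * (ε / |κ|) := by
  obtain ⟨C, hC, hCb⟩ := exists_half_line_stationary_phase hP hb hb1 hPb
  refine ⟨C + C, by positivity, ?_⟩
  intro φ φ₁ φ₂ φ₃ φ₄ a a₁ a₂ κ A ε h0 h1 h2 h3 hκ z1 z2 b3 b4 ha ha1 bA0 bA1 bA2 zb zb' hε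
  have hκ0 : 0 < |κ| := abs_pos.2 hκ
  set ε' := ε / |κ| with hε'
  have hε'0 : 0 < ε' := by positivity
  set σ := κ / |κ| with hσ
  have hσ1 : σ = 1 ∨ σ = -1 := by
    rcases lt_or_gt_of_ne hκ with h | h
    · right; rw [hσ, abs_of_neg h, div_neg, div_self hκ]
    · left; rw [hσ, abs_of_pos h, div_self hκ]
  have habs : ∀ y, |y| ≤ P * |κ| → |y / κ| ≤ P := fun y hy => by
    rw [abs_div, div_le_iff₀ hκ0]; exact hy
  have d0 : ∀ s, HasDerivAt (fun s => (φ s - φ 0) / κ) (φ₁ s / κ) s := fun s =>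
    ((h0 s).sub_const _).div_const κ
  have d1 : ∀ s, HasDerivAt (fun s => φ₁ s / κ) (φ₂ s / κ) s := fun s => (h1 s).div_const κ
  have d2 : ∀ s, HasDerivAt (fun s => φ₂ s / κ) (φ₃ s / κ) s := fun s => (h2 s).div_const κ
  have d3 : ∀ s, HasDerivAt (fun s => φ₃ s / κ) (φ₄ s / κ) s := fun s => (h3 s).div_const κ
  have hNr : NormalizedPhase P b (fun s => (φ s - φ 0) / κ) (fun s => φ₁ s / κ)
      (fun s => φ₂ s / κ) :=
    ⟨d0, d1, ⟨_, _, d2, d3, habs _ b3, fun s hs => habs _ (b4 s ⟨by linarith [hs.1], hs.2⟩)⟩,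
      by simp, by simp [z1], by simp [z2, hκ]⟩
  have hNl := NormalizedPhase.reflect (P := P) (b := b) d0 d1 d2 d3 (habs _ b3)
    (fun s hs => habs _ (b4 s hs)) (by simp) (by simp [z1]) (by simp [z2, hκ])
  have hsig : ∀ (ψ ψ₁ ψ₂ g g₁ g₂ : ℝ → ℝ), NormalizedPhase P b ψ ψ₁ ψ₂ →
      (∀ s, HasDerivAt g (g₁ s) s) → (∀ s, HasDerivAt g₁ (g₂ s) s) →
      |g 0| ≤ A → (∀ s ∈ Icc 0 b, |g₁ s| ≤ A) → (∀ s ∈ Icc 0 b, |g₂ s| ≤ A) → g b = 0 →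
      ‖(∫ s in (0 : ℝ)..b, (g s : ℂ) * Complex.exp (Complex.I * ((σ * (ψ s / ε') : ℝ) : ℂ)))
        - (g 0 * (1 / 2 * Real.sqrt (2 * Real.pi * ε')) : ℝ)
          * Complex.exp (Complex.I * ((σ * (Real.pi / 4) : ℝ) : ℂ))‖ ≤ C * A * ε' := by
    intro ψ ψ₁ ψ₂ g g₁ g₂ hψ hg hg1 c0 c1 c2 cb
    have := hCb ψ ψ₁ ψ₂ g g₁ g₂ A ε' hψ hg hg1 c0 c1 c2 cb hε'0
    rw [show (g 0 : ℂ) * (1 / 2 * (Real.sqrt (2 * Real.pi * ε')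
        * Complex.exp (Complex.I * (Real.pi / 4 : ℝ))))
        = ((g 0 * (1 / 2 * Real.sqrt (2 * Real.pi * ε')) : ℝ) : ℂ)
          * Complex.exp (Complex.I * (Real.pi / 4 : ℝ)) by push_cast; ring] at this
    rcases hσ1 with h | h
    · rw [h]
      simpa only [one_mul] using this
    · rw [h]
      rw [← Complex.norm_conj, map_sub, conj_intervalIntegral, conj_ofReal_mul_exp] at this
      simp only [conj_ofReal_mul_exp] at this
      simpa only [neg_one_mul] using this
  have hneg : ∀ s ∈ Icc 0 b, -s ∈ Icc (-b) b := fun s hs =>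
    ⟨by linarith [hs.2], by linarith [hs.1, hs.2]⟩
  have hright := hsig _ _ _ a a₁ a₂ hNr ha ha1 bA0 (fun s hs => bA1 s ⟨by linarith [hs.1], hs.2⟩)
    (fun s hs => bA2 s ⟨by linarith [hs.1], hs.2⟩) zb
  have hn : ∀ (g g' : ℝ → ℝ), (∀ s, HasDerivAt g (g' s) s) →
      ∀ s, HasDerivAt (fun s => g (-s)) (-g' (-s)) s := by
    intro g g' hg s
    have := (hg (-s)).comp s (hasDerivAt_neg s)
    rwa [mul_neg_one] at this
  have hleft := hsig _ _ _ (fun s => a (-s)) (fun s => -a₁ (-s)) (fun s => a₂ (-s)) hNl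
    (hn _ _ ha) (fun s => ((hn _ _ ha1 s).neg).congr_deriv (neg_neg _)) (by simpa using bA0)
    (fun s hs => by rw [abs_neg]; exact bA1 _ (hneg s hs)) (fun s hs => bA2 _ (hneg s hs)) zb'
  have hphase : ∀ s, Complex.exp (Complex.I * ((φ s / ε : ℝ) : ℂ))
      = Complex.exp (Complex.I * ((φ 0 / ε : ℝ) : ℂ))
        * Complex.exp (Complex.I * ((σ * ((φ s - φ 0) / κ / ε') : ℝ) : ℂ)) := by
    intro s
    rw [← Complex.exp_add, ← mul_add, ← Complex.ofReal_add]
    congr 3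
    rw [hσ, hε']
    field_simp
    ring
  have hφc : Continuous φ := continuous_iff_continuousAt.2 fun s => (h0 s).continuousAt
  have hac : Continuous a := continuous_iff_continuousAt.2 fun s => (ha s).continuousAt
  set E : ℝ → ℂ := fun s => (a s : ℂ)
    * Complex.exp (Complex.I * ((σ * ((φ s - φ 0) / κ / ε') : ℝ) : ℂ)) with hE
  have hEc : Continuous E := by fun_prop
  have hint : (∫ s in (-b)..b, (a s : ℂ) * Complex.exp (Complex.I * ((φ s / ε : ℝ) : ℂ)))
      = Complex.exp (Complex.I * ((φ 0 / ε : ℝ) : ℂ))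
        * ((∫ s in (0 : ℝ)..b, E (-s)) + ∫ s in (0 : ℝ)..b, E s) := by
    rw [intervalIntegral.integral_comp_neg, neg_zero,
      intervalIntegral.integral_add_adjacent_intervals (hEc.intervalIntegrable _ _)
        (hEc.intervalIntegrable _ _), ← intervalIntegral.integral_const_mul]
    refine intervalIntegral.integral_congr fun s _ => ?_
    simp only [hE]
    rw [hphase s]
    ring
  have hmain : a 0 * Real.sqrt (2 * Real.pi * ε')
        * Complex.exp (Complex.I * ((φ 0 / ε + σ * (Real.pi / 4) : ℝ) : ℂ))
      = Complex.exp (Complex.I * ((φ 0 / ε : ℝ) : ℂ))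
        * ((((a 0 * (1 / 2 * Real.sqrt (2 * Real.pi * ε')) : ℝ) : ℂ)
          * Complex.exp (Complex.I * ((σ * (Real.pi / 4) : ℝ) : ℂ)))
        + (((a 0 * (1 / 2 * Real.sqrt (2 * Real.pi * ε')) : ℝ) : ℂ)
          * Complex.exp (Complex.I * ((σ * (Real.pi / 4) : ℝ) : ℂ)))) := by
    rw [Complex.ofReal_add, mul_add, Complex.exp_add]
    push_cast
    ring
  rw [hint, hmain, ← mul_sub, norm_mul, mul_comm Complex.I, Complex.norm_exp_ofReal_mul_I, one_mul,
    add_sub_add_comm, add_mul, add_mul]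
  simp only [neg_zero] at hleft
  exact (norm_add_le _ _).trans (add_le_add hleft hright)

namespace ScalarHomoclinic

variable {f : ℝ → ℝ} {a lam : ℝ} {x v : ℝ → ℝ}

theorem exists_bound_comp (h : ScalarHomoclinic f a lam x v) {g : ℝ → ℝ} (hg : Continuous g) :
    ∃ L ≥ 0, ∀ t, |g (x t)| ≤ L := by
  obtain ⟨M, -, hM⟩ := h.bounded_x
  obtain ⟨L, hL⟩ := (isCompact_Icc (a := -M) (b := M)).exists_bound_of_continuousOn hg.continuousOn
  exact ⟨L, (norm_nonneg _).trans (hL _ (abs_le.1 (hM 0))), fun t => hL _ (abs_le.1 (hM t))⟩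

theorem continuous_deriv_deriv_f (h : ScalarHomoclinic f a lam x v) :
    Continuous (deriv (deriv f)) := by
  have h1 : ContDiff ℝ 2 (deriv f) := ((contDiff_succ_iff_deriv (n := 2)).1 h.contDiff).2.2
  exact h1.continuous_deriv (by norm_num)

theorem hasDerivAt_deriv_fx (h : ScalarHomoclinic f a lam x v) (t : ℝ) :
    HasDerivAt (fun t => deriv f (x t)) (deriv (deriv f) (x t) * v t) t := by
  have h1 : ContDiff ℝ 2 (deriv f) := ((contDiff_succ_iff_deriv (n := 2)).1 h.contDiff).2.2
  exact (h1.differentiable (by norm_num) (x t)).hasDerivAt.comp t (h.hx t)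

/-- The speed along the orbit varies by a bounded factor in unit time. -/
theorem exists_speed_comparison (h : ScalarHomoclinic f a lam x v) :
    ∃ B > 0, ∀ t s, |s| ≤ 1 → |v (t + s)| ≤ B * (|v t| + |f (x t)|) ∧
      |f (x (t + s))| ≤ B * (|v t| + |f (x t)|) := by
  obtain ⟨L, hL0, hL⟩ := h.exists_bound_comp h.continuous_deriv_f
  set N : ℝ → ℝ := fun t => v t ^ 2 + f (x t) ^ 2 with hN
  set N' : ℝ → ℝ := fun t => 2 * v t * f (x t) + 2 * f (x t) * (deriv f (x t) * v t) with hN'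
  have hNd : ∀ t, HasDerivAt N (N' t) t := fun t =>
    (((h.hv t).pow 2).add ((h.hasDerivAt_fx t).pow 2)).congr_deriv (by
      simp only [hN']; push_cast; ring)
  have hNb : ∀ t, |N' t| ≤ (1 + L) * N t := by
    intro t
    have e : N' t = 2 * (v t * f (x t)) * (1 + deriv f (x t)) := by simp only [hN']; ring
    have h1 : |2 * (v t * f (x t))| ≤ N t := by
      refine abs_le.2 ⟨?_, ?_⟩
      · have := sq_nonneg (v t + f (x t)); simp only [hN]; linarith [add_sq (v t) (f (x t))]
      · have := sq_nonneg (v t - f (x t)); simp only [hN]; linarith [sub_sq (v t) (f (x t))]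
    have h2 : |1 + deriv f (x t)| ≤ 1 + L := by
      refine (abs_add_le _ _).trans ?_
      rw [abs_one]
      linarith [hL t]
    rw [e, abs_mul, mul_comm]
    exact mul_le_mul h2 h1 (abs_nonneg _) (by positivity)
  have hcmp : ∀ σ : ℝ, (σ = 1 ∨ σ = -1) → ∀ t s, 0 ≤ s →
      N (t + σ * s) ≤ Real.exp ((1 + L) * s) * N t := by
    intro σ hσ t s hs
    have hanti : AntitoneOn (fun s => Real.exp (-(1 + L) * s) * N (t + σ * s)) (Ici 0) := by
      have hd : ∀ s, HasDerivAt (fun s => Real.exp (-(1 + L) * s) * N (t + σ * s))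
          (Real.exp (-(1 + L) * s) * (σ * N' (t + σ * s) - (1 + L) * N (t + σ * s))) s := by
        intro s
        have d1 := ((hasDerivAt_id s).const_mul (-(1 + L))).exp
        have d2 : HasDerivAt (fun s => t + σ * s) σ s :=
          (((hasDerivAt_id s).const_mul σ).const_add t).congr_deriv (mul_one σ)
        have d3 := (hNd (t + σ * s)).comp s d2
        refine (d1.mul d3).congr_deriv ?_
        simp only [Function.comp_apply, id]
        ring
      refine antitoneOn_of_deriv_nonpos (convex_Ici 0)
        (continuous_iff_continuousAt.2 fun s => (hd s).continuousAt).continuousOn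
        (fun s _ => (hd s).differentiableAt.differentiableWithinAt) fun s _ => ?_
      rw [(hd s).deriv]
      have h1 := abs_le.1 (hNb (t + σ * s))
      refine mul_nonpos_of_nonneg_of_nonpos (Real.exp_pos _).le ?_
      rcases hσ with rfl | rfl <;> linarith
    have := hanti (mem_Ici.2 le_rfl) (mem_Ici.2 hs) hs
    simp only [mul_zero, Real.exp_zero, one_mul, add_zero] at this
    calc N (t + σ * s) = Real.exp ((1 + L) * s) * (Real.exp (-(1 + L) * s) * N (t + σ * s)) := by
          rw [← mul_assoc, ← Real.exp_add, show (1 + L) * s + -(1 + L) * s = 0 by ring, Real.exp_zero,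
            one_mul]
      _ ≤ _ := by gcongr
  have hall : ∀ t s, |s| ≤ 1 → N (t + s) ≤ Real.exp (1 + L) * N t := by
    intro t s hs
    have hN0 : 0 ≤ N t := by positivity
    have hE : ∀ r, r ≤ 1 → Real.exp ((1 + L) * r) * N t ≤ Real.exp (1 + L) * N t := by
      intro r hr
      have : (1 + L) * r ≤ 1 + L := mul_le_of_le_one_right (by positivity) hr
      gcongr
    rcases le_total 0 s with h0 | h0
    · have := hcmp 1 (Or.inl rfl) t s h0
      rw [one_mul] at this
      exact this.trans (hE s (le_of_abs_le hs))
    · have := hcmp (-1) (Or.inr rfl) t (-s) (by linarith)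
      rw [neg_one_mul, neg_neg] at this
      exact this.trans (hE (-s) (neg_le_of_abs_le hs |> fun h => by linarith))
  refine ⟨Real.sqrt (Real.exp (1 + L)), by positivity, fun t s hs => ?_⟩
  have h1 := hall t s hs
  have h2 : N t ≤ (|v t| + |f (x t)|) ^ 2 := by
    simp only [hN]
    rw [← sq_abs (v t), ← sq_abs (f (x t))]
    nlinarith [mul_nonneg (abs_nonneg (v t)) (abs_nonneg (f (x t)))]
  have h3 : N (t + s) ≤ (Real.sqrt (Real.exp (1 + L)) * (|v t| + |f (x t)|)) ^ 2 := by
    rw [mul_pow, Real.sq_sqrt (by positivity)]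
    exact h1.trans (by gcongr)
  have h4 : 0 ≤ Real.sqrt (Real.exp (1 + L)) * (|v t| + |f (x t)|) := by positivity
  constructor
  · refine abs_le_of_sq_le_sq (le_trans ?_ h3) h4
    have := sq_nonneg (f (x (t + s)))
    simp only [hN]; linarith
  · refine abs_le_of_sq_le_sq (le_trans ?_ h3) h4
    have := sq_nonneg (v (t + s))
    simp only [hN]; linarith

/-- Constants that control the phases `k x - t` near all their critical points, uniformly in
`k`. -/
structure PhaseConstants (f x v : ℝ → ℝ) (c m P b : ℝ) : Prop where
  c_pos : 0 < c
  m_pos : 0 < m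
  P_nonneg : 0 ≤ P
  b_pos : 0 < b
  b_le : b ≤ 1
  P_mul_b : 2 * P * b ≤ 1 / 2
  lower : ∀ k : ℤ, k ≠ 0 → ∀ t, |k * v t - 1| ≤ c → m ≤ |k * f (x t)|
  third : ∀ k : ℤ, k ≠ 0 → ∀ t, |k * v t - 1| ≤ c → ∀ s ∈ Icc (-b) b,
    |k * (deriv f (x (t + s)) * v (t + s))| ≤ P * |k * f (x t)|
  fourth : ∀ k : ℤ, k ≠ 0 → ∀ t, |k * v t - 1| ≤ c → ∀ s ∈ Icc (-b) b,
    |k * (deriv (deriv f) (x (t + s)) * v (t + s) * v (t + s)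
      + deriv f (x (t + s)) * f (x (t + s)))| ≤ P * |k * f (x t)|

theorem exists_phaseConstants (h : ScalarHomoclinic f a lam x v)
    (hnd : ∀ k : ℤ, k ≠ 0 → ∀ t, v t = 1 / (k : ℝ) → f (x t) ≠ 0) :
    ∃ c m P b, PhaseConstants f x v c m P b := by
  obtain ⟨c, hc, m, hm, hlow⟩ := h.exists_uniform_nondegenerate hnd
  obtain ⟨B, hB, hcmp⟩ := h.exists_speed_comparison
  obtain ⟨L, hL0, hL⟩ := h.exists_bound_comp h.continuous_deriv_f
  obtain ⟨L₂, hL₂0, hL₂⟩ := h.exists_bound_comp h.continuous_deriv_deriv_f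
  obtain ⟨V, hV, hVb⟩ := h.bounded_v
  set Q := B * (2 / m + 1) with hQ
  have hQ0 : 0 < Q := by positivity
  set P := L * Q + (L₂ * V + L) * Q with hP
  have hP0 : 0 ≤ P := by positivity
  have key : ∀ k : ℤ, k ≠ 0 → ∀ t, |k * v t - 1| ≤ min c 1 → ∀ s, |s| ≤ 1 →
      |k * v (t + s)| ≤ Q * |k * f (x t)| ∧ |k * f (x (t + s))| ≤ Q * |k * f (x t)| := by
    intro k hk t ht s hs
    have h1 := hlow k hk t (ht.trans (min_le_left _ _))
    have h2 : |(k : ℝ) * v t| ≤ 2 := by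
      have := abs_sub_abs_le_abs_sub (k * v t) 1
      rw [abs_one] at this
      linarith [ht.trans (min_le_right _ _)]
    have h3 : (2 : ℝ) ≤ 2 / m * |k * f (x t)| := by
      rw [div_mul_eq_mul_div, le_div_iff₀ hm]
      linarith
    have h4 : B * (|(k : ℝ) * v t| + |k * f (x t)|) ≤ Q * |k * f (x t)| := by
      rw [hQ, mul_assoc]
      refine mul_le_mul_of_nonneg_left ?_ hB.le
      rw [add_mul, one_mul]
      linarith
    obtain ⟨e1, e2⟩ := hcmp t s hs
    have h5 : |(k : ℝ)| * (B * (|v t| + |f (x t)|)) = B * (|(k : ℝ) * v t| + |k * f (x t)|) := by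
      rw [abs_mul, abs_mul]; ring
    constructor
    · rw [abs_mul]
      calc _ ≤ |(k : ℝ)| * (B * (|v t| + |f (x t)|)) := by gcongr
        _ ≤ _ := by rw [h5]; exact h4
    · rw [abs_mul]
      calc _ ≤ |(k : ℝ)| * (B * (|v t| + |f (x t)|)) := by gcongr
        _ ≤ _ := by rw [h5]; exact h4
  have hbP : 2 * P * min 1 (1 / (4 * (P + 1))) ≤ 1 / 2 := by
    calc 2 * P * min 1 (1 / (4 * (P + 1))) ≤ 2 * (P + 1) * (1 / (4 * (P + 1))) := by
          gcongr
          · linarith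
          · exact min_le_right _ _
      _ = 1 / 2 := by field_simp; norm_num
  refine ⟨min c 1, m, P, min 1 (1 / (4 * (P + 1))), by positivity, hm, hP0,
    by positivity, min_le_left _ _, hbP,
    fun k hk t ht => hlow k hk t (ht.trans (min_le_left _ _)), fun k hk t ht s hs => ?_,
    fun k hk t ht s hs => ?_⟩
  · obtain ⟨e1, e2⟩ := key k hk t ht s ((abs_le.2 hs).trans (min_le_left _ _))
    have : (k : ℝ) * (deriv f (x (t + s)) * v (t + s)) = deriv f (x (t + s)) * (k * v (t + s)) := by
      ring
    rw [this, abs_mul]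
    calc _ ≤ L * (Q * |k * f (x t)|) := by gcongr; exact hL _
      _ ≤ P * |k * f (x t)| := by
        rw [← mul_assoc]
        refine mul_le_mul_of_nonneg_right ?_ (abs_nonneg _)
        have : 0 ≤ (L₂ * V + L) * Q := by positivity
        linarith
  · obtain ⟨e1, e2⟩ := key k hk t ht s ((abs_le.2 hs).trans (min_le_left _ _))
    have : (k : ℝ) * (deriv (deriv f) (x (t + s)) * v (t + s) * v (t + s)
        + deriv f (x (t + s)) * f (x (t + s)))
        = deriv (deriv f) (x (t + s)) * v (t + s) * (k * v (t + s))
          + deriv f (x (t + s)) * (k * f (x (t + s))) := by ring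
    rw [this]
    refine (abs_add_le _ _).trans ?_
    rw [abs_mul, abs_mul, abs_mul (deriv f (x (t + s)))]
    calc _ ≤ L₂ * V * (Q * |k * f (x t)|) + L * (Q * |k * f (x t)|) := by
          gcongr
          · exact hL₂ _
          · exact hVb _
          · exact hL _
      _ ≤ P * |k * f (x t)| := by
        have : 0 ≤ L * Q * |k * f (x t)| := by positivity
        rw [hP]; linarith

namespace PhaseConstants

variable {c m P b : ℝ}

/-- Near points where the phase is almost stationary, its derivative is almost linear. -/
theorem abs_increment_le (hp : PhaseConstants f x v c m P b) (h : ScalarHomoclinic f a lam x v)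
    {k : ℤ} (hk : k ≠ 0) {t : ℝ} (ht : |k * v t - 1| ≤ c) {s : ℝ} (hs : s ∈ Icc (-b) b) :
    |k * v (t + s) - k * v t - k * f (x t) * s| ≤ |k * f (x t)| / 4 * |s| := by
  have hb := hp.b_pos
  have h0 : (0 : ℝ) ∈ Icc (-b) b := ⟨by linarith, hb.le⟩
  have hadd : ∀ s, HasDerivAt (fun s => t + s) 1 s := fun s => (hasDerivAt_id s).const_add t
  have d2 : ∀ s, HasDerivAt (fun s => k * f (x (t + s))) (k * (deriv f (x (t + s)) * v (t + s))) s :=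
    fun s => (((h.hasDerivAt_fx (t + s)).comp s (hadd s)).congr_deriv (mul_one _)).const_mul (k : ℝ)
  have d1 : ∀ s, HasDerivAt (fun s => k * v (t + s) - k * f (x t) * s)
      (k * f (x (t + s)) - k * f (x t)) s := fun s =>
    ((((h.hv (t + s)).comp s (hadd s)).congr_deriv (mul_one _)).const_mul (k : ℝ)).sub
      (((hasDerivAt_id s).const_mul (k * f (x t))).congr_deriv (mul_one _))
  have b2 : ∀ s ∈ Icc (-b) b, |k * f (x (t + s)) - k * f (x t)| ≤ |k * f (x t)| / 4 := by
    intro s hs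
    have := (convex_Icc (-b) b).norm_image_sub_le_of_norm_hasDerivWithin_le (𝕜 := ℝ)
      (fun s _ => (d2 s).hasDerivWithinAt) (hp.third k hk t ht) h0 hs
    rw [Real.norm_eq_abs, Real.norm_eq_abs, add_zero, sub_zero] at this
    have h1 : |s| ≤ b := abs_le.2 hs
    calc _ ≤ _ := this
      _ ≤ P * |k * f (x t)| * b := by have := hp.P_nonneg; gcongr
      _ = (2 * P * b) * (|k * f (x t)| / 2) := by ring
      _ ≤ 1 / 2 * (|k * f (x t)| / 2) := by gcongr; exact hp.P_mul_b
      _ = _ := by ring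
  have := (convex_Icc (-b) b).norm_image_sub_le_of_norm_hasDerivWithin_le (𝕜 := ℝ)
    (fun s _ => (d1 s).hasDerivWithinAt) b2 h0 hs
  rw [Real.norm_eq_abs, Real.norm_eq_abs, add_zero, sub_zero, mul_zero, sub_zero] at this
  rwa [sub_right_comm]

/-- Distinct critical points are at a distance larger than `b`. -/
theorem eq_of_critical (hp : PhaseConstants f x v c m P b) (h : ScalarHomoclinic f a lam x v)
    {k : ℤ} (hk : k ≠ 0) {t t' : ℝ} (ht : k * v t = 1) (ht' : k * v t' = 1)
    (hd : |t' - t| ≤ b) : t' = t := by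
  have hc : |k * v t - 1| ≤ c := by rw [ht, sub_self, abs_zero]; exact hp.c_pos.le
  have h1 := hp.abs_increment_le h hk hc (s := t' - t) (abs_le.1 hd)
  have h2 := hp.lower k hk t hc
  rw [add_sub_cancel, ht, ht', sub_self, zero_sub, abs_neg, abs_mul] at h1
  by_contra hne
  have h3 : 0 < |t' - t| := abs_pos.2 (sub_ne_zero.2 hne)
  have h4 : 0 < |k * f (x t)| := hp.m_pos.trans_le h2
  have h5 : 0 < |k * f (x t)| * |t' - t| := mul_pos h4 h3
  linarith

/-- Where the phase is almost stationary there is a critical point nearby. -/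
theorem exists_critical_near (hp : PhaseConstants f x v c m P b)
    (h : ScalarHomoclinic f a lam x v) {k : ℤ} (hk : k ≠ 0) {t : ℝ} (ht : |k * v t - 1| ≤ c)
    (ht' : |k * v t - 1| ≤ m * b / 8) : ∃ t', |t - t'| ≤ b / 4 ∧ k * v t' = 1 := by
  have hb := hp.b_pos
  have hm := hp.m_pos
  set κ := k * f (x t) with hκ
  have hκm : m ≤ |κ| := hp.lower k hk t ht
  have hκb : m * b ≤ |κ| * b := by gcongr
  have hq := abs_le.1 ht'
  have r1 := hp.abs_increment_le h hk ht (s := b / 4) ⟨by linarith, by linarith⟩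
  have r2 := hp.abs_increment_le h hk ht (s := -(b / 4)) ⟨by linarith, by linarith⟩
  rw [← hκ, abs_of_pos (by positivity : 0 < b / 4)] at r1
  rw [← hκ, abs_neg, abs_of_pos (by positivity : 0 < b / 4)] at r2
  have r1' := abs_le.1 r1
  have r2' := abs_le.1 r2
  have hcont : Continuous fun s => k * v (t + s) := by
    have := h.cont_v
    fun_prop
  have hle : -(b / 4) ≤ b / 4 := by linarith
  obtain ⟨s, hs, hs'⟩ : ∃ s ∈ Icc (-(b / 4)) (b / 4), (k : ℝ) * v (t + s) = 1 := by
    rcases le_total 0 κ with h0 | h0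
    · rw [abs_of_nonneg h0] at hκb r1' r2'
      exact intermediate_value_Icc hle hcont.continuousOn ⟨by linarith, by linarith⟩
    · rw [abs_of_nonpos h0] at hκb r1' r2'
      exact intermediate_value_Icc' hle hcont.continuousOn ⟨by linarith, by linarith⟩
  exact ⟨t + s, by rw [sub_add_cancel_left, abs_neg]; exact abs_le.2 hs, hs'⟩

end PhaseConstants
end ScalarHomoclinic

/-- Integration by parts in an oscillatory integral over the line. -/
theorem norm_integral_oscillatory_le {φ φ₁ w : ℝ → ℝ} {G G' : ℝ → ℂ} {ε : ℝ} (hε : 0 < ε)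
    (hφ : ∀ t, HasDerivAt φ (φ₁ t) t) (hG : ∀ t, HasDerivAt G (G' t) t)
    (htop : Tendsto G atTop (𝓝 0)) (hbot : Tendsto G atBot (𝓝 0)) (hw : Integrable w)
    (hG' : ∀ t, ‖G' t‖ ≤ w t) (hint : Integrable fun t => (φ₁ t : ℂ) * G t) :
    ‖∫ t, (φ₁ t : ℂ) * G t * Complex.exp (Complex.I * ((φ t / ε : ℝ) : ℂ))‖
      ≤ ε * ∫ t, w t := by
  set e : ℝ → ℂ := fun t => Complex.exp (Complex.I * ((φ t / ε : ℝ) : ℂ)) with hedef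
  have hen : ∀ t, ‖e t‖ = 1 := fun t => by
    rw [hedef]; simp only; rw [mul_comm, Complex.norm_exp_ofReal_mul_I]
  have hφc : Continuous φ := continuous_iff_continuousAt.2 fun t => (hφ t).continuousAt
  have hec : Continuous e := by fun_prop
  have hεC : (ε : ℂ) ≠ 0 := by exact_mod_cast hε.ne'
  have hede : ∀ t, HasDerivAt e (Complex.I * ((φ₁ t / ε : ℝ) : ℂ) * e t) t := by
    intro t
    refine ((((hφ t).div_const ε).ofReal_comp).const_mul Complex.I).cexp.congr_deriv ?_
    rw [mul_comm]
  have hG'm : AEStronglyMeasurable G' volume := by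
    have : G' = deriv G := funext fun t => (hG t).deriv.symm
    rw [this]
    exact aestronglyMeasurable_deriv G volume
  have hG'i : Integrable G' := hw.mono' hG'm (Eventually.of_forall hG')
  have hG'e : Integrable fun t => G' t * e t :=
    hG'i.mul_bdd (c := 1) hec.aestronglyMeasurable (Eventually.of_forall fun t => (hen t).le)
  have hφG : Integrable fun t => (φ₁ t : ℂ) * G t * e t :=
    hint.mul_bdd (c := 1) hec.aestronglyMeasurable (Eventually.of_forall fun t => (hen t).le)
  have hd : ∀ t, HasDerivAt (fun t => ε / Complex.I * (G t * e t))
      (ε / Complex.I * (G' t * e t) + (φ₁ t : ℂ) * G t * e t) t := by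
    intro t
    refine (((hG t).mul (hede t)).const_mul (ε / Complex.I)).congr_deriv ?_
    push_cast
    field_simp [Complex.I_ne_zero]
  have hlim : ∀ l : Filter ℝ, Tendsto G l (𝓝 0) →
      Tendsto (fun t => ε / Complex.I * (G t * e t)) l (𝓝 0) := by
    intro l hl
    refine squeeze_zero_norm (a := fun t => ‖(ε : ℂ) / Complex.I‖ * ‖G t‖) (fun t => ?_) ?_
    · rw [norm_mul, norm_mul, hen, mul_one]
    · simpa using hl.norm.const_mul ‖(ε : ℂ) / Complex.I‖
  have hFTC := integral_of_hasDerivAt_of_tendsto hd ((hG'e.const_mul _).add hφG) (hlim _ hbot)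
    (hlim _ htop)
  rw [integral_add (hG'e.const_mul _) hφG, integral_const_mul, sub_zero] at hFTC
  rw [eq_neg_of_add_eq_zero_right hFTC, norm_neg, norm_mul, norm_div, Complex.norm_I, div_one,
    Complex.norm_real, Real.norm_of_nonneg hε.le]
  refine mul_le_mul_of_nonneg_left (norm_integral_le_of_norm_le hw
    (Eventually.of_forall fun t => ?_)) hε.le
  rw [norm_mul, hen, mul_one]
  exact hG' t

namespace ScalarHomoclinic

variable {f : ℝ → ℝ} {a lam : ℝ} {x v : ℝ → ℝ} {c m P b : ℝ}

theorem exists_acceleration_ne_zero (h : ScalarHomoclinic f a lam x v) :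
    ∃ R, ∀ t, R ≤ t → f (x t) ≠ 0 := by
  obtain ⟨R, -, hR⟩ := h.tail
  refine ⟨R, fun t ht hf => ?_⟩
  obtain ⟨-, h1, h2, -, -⟩ := hR t ht
  have hlam := h.pos
  have hs := h.speed_pos t
  rw [hf, abs_zero] at h2
  have h3 : |x t - a| = 0 := by
    by_contra h0
    have h4 := lt_of_le_of_ne (abs_nonneg (x t - a)) (Ne.symm h0)
    have : 0 < lam ^ 2 / 2 * |x t - a| := by positivity
    linarith
  rw [h3, mul_zero] at h1
  have hv : v t = 0 := abs_eq_zero.1 (le_antisymm h1 (abs_nonneg _))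
  rw [hv, hf] at hs
  simp at hs

theorem injOn_of_acceleration_ne_zero (h : ScalarHomoclinic f a lam x v) {I : Set ℝ}
    (hI : I.OrdConnected) (hne : ∀ t ∈ I, f (x t) ≠ 0) : InjOn v I := by
  have key : ∀ s ∈ I, ∀ t ∈ I, s < t → v s ≠ v t := by
    intro s hs t ht hst hv
    obtain ⟨τ, hτ, hz⟩ := exists_hasDerivAt_eq_zero hst h.cont_v.continuousOn hv
      (fun τ _ => h.hv τ)
    exact hne τ (hI.out hs ht ⟨hτ.1.le, hτ.2.le⟩) hz
  intro s hs t ht hv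
  rcases lt_trichotomy s t with hlt | heq | hgt
  · exact absurd hv (key s hs t ht hlt)
  · exact heq
  · exact absurd hv.symm (key t ht s hs hgt)

theorem PhaseConstants.exists_encard_le (hp : PhaseConstants f x v c m P b)
    (h : ScalarHomoclinic f a lam x v) :
    ∃ N : ℕ, ∀ k : ℤ, k ≠ 0 → {t | v t = 1 / (k : ℝ)}.encard ≤ N := by
  obtain ⟨R, hR⟩ := h.exists_acceleration_ne_zero
  obtain ⟨S, hS⟩ := h.reverse.exists_acceleration_ne_zero
  have hb := hp.b_pos
  refine ⟨1 + (Finset.Icc ⌊-S / b⌋ ⌊R / b⌋).card + 1, fun k hk => ?_⟩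
  have hkR : (k : ℝ) ≠ 0 := Int.cast_ne_zero.2 hk
  set C : Set ℝ := {t | v t = 1 / (k : ℝ)} with hC
  have hcover : C ⊆ (C ∩ Iic (-S) ∪ C ∩ Icc (-S) R) ∪ C ∩ Ici R := by
    intro t ht
    rcases le_total t (-S) with h1 | h1
    · exact Or.inl (Or.inl ⟨ht, h1⟩)
    · rcases le_total t R with h2 | h2
      · exact Or.inl (Or.inr ⟨ht, h1, h2⟩)
      · exact Or.inr ⟨ht, h2⟩
  have hL : (C ∩ Iic (-S)).encard ≤ 1 := encard_le_one_iff.2 fun s t hs ht =>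
    h.injOn_of_acceleration_ne_zero ordConnected_Iic (fun t ht => by
      have := hS (-t) (by linarith [mem_Iic.1 ht])
      rwa [neg_neg] at this) hs.2 ht.2 (hs.1.trans ht.1.symm)
  have hRr : (C ∩ Ici R).encard ≤ 1 := encard_le_one_iff.2 fun s t hs ht =>
    h.injOn_of_acceleration_ne_zero ordConnected_Ici (fun t ht => hR t ht) hs.2 ht.2
      (hs.1.trans ht.1.symm)
  have hmid : (C ∩ Icc (-S) R).encard ≤ (Finset.Icc ⌊-S / b⌋ ⌊R / b⌋).card := by
    rw [← Set.encard_coe_eq_coe_finsetCard]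
    refine Set.encard_le_encard_of_injOn (f := fun t => ⌊t / b⌋) (fun t ht => ?_) fun s hs t ht hst => ?_
    · rw [Finset.coe_Icc]
      exact ⟨Int.floor_le_floor (by have := ht.2.1; gcongr),
        Int.floor_le_floor (by have := ht.2.2; gcongr)⟩
    · have h1 := Int.abs_sub_lt_one_of_floor_eq_floor hst
      rw [← sub_div, abs_div, abs_of_pos hb, div_lt_one hb] at h1
      have e : ∀ t ∈ C, k * v t = 1 := fun t ht => by
        rw [show v t = 1 / (k : ℝ) from ht, mul_one_div_cancel hkR]
      exact hp.eq_of_critical h hk (e t ht.1) (e s hs.1) h1.le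
  calc C.encard ≤ ((C ∩ Iic (-S) ∪ C ∩ Icc (-S) R) ∪ C ∩ Ici R).encard := encard_le_encard hcover
    _ ≤ (C ∩ Iic (-S)).encard + (C ∩ Icc (-S) R).encard + (C ∩ Ici R).encard :=
        (encard_union_le _ _).trans (by gcongr; exact encard_union_le _ _)
    _ ≤ 1 + ((Finset.Icc ⌊-S / b⌋ ⌊R / b⌋).card : ℕ∞) + 1 := by gcongr
    _ = _ := by push_cast; rfl

end ScalarHomoclinic

theorem exists_cutoff {b : ℝ} (hb : 0 < b) : ∃ (χ χ₁ χ₂ : ℝ → ℝ) (X : ℝ),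
    (∀ s, HasDerivAt χ (χ₁ s) s) ∧ (∀ s, HasDerivAt χ₁ (χ₂ s) s) ∧ 0 ≤ X ∧
    (∀ s, |χ s| ≤ 1) ∧ (∀ s, |χ₁ s| ≤ X) ∧ (∀ s, |χ₂ s| ≤ X) ∧ (∀ s, |s| ≤ b / 4 → χ s = 1) ∧
    ∀ s, b / 2 ≤ |s| → χ s = 0 := by
  set χ : ContDiffBump (0 : ℝ) := ⟨b / 4, b / 2, by positivity, by linarith⟩ with hχ
  have hc : ContDiff ℝ 2 (χ : ℝ → ℝ) := χ.contDiff
  have hc1 : ContDiff ℝ 1 (deriv (χ : ℝ → ℝ)) := ((contDiff_succ_iff_deriv (n := 1)).1 hc).2.2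
  have hs : HasCompactSupport (χ : ℝ → ℝ) := χ.hasCompactSupport
  obtain ⟨X₁, hX₁⟩ := hs.deriv.exists_bound_of_continuous hc1.continuous
  obtain ⟨X₂, hX₂⟩ := hs.deriv.deriv.exists_bound_of_continuous (hc1.continuous_deriv le_rfl)
  refine ⟨χ, deriv χ, deriv (deriv χ), max X₁ X₂,
    fun s => (hc.differentiable (by norm_num) s).hasDerivAt,
    fun s => (hc1.differentiable (by norm_num) s).hasDerivAt,
    ((norm_nonneg _).trans (hX₁ 0)).trans (le_max_left _ _), fun s => ?_,
    fun s => (hX₁ s).trans (le_max_left _ _), fun s => (hX₂ s).trans (le_max_right _ _),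
    fun s hs => ?_, fun s hs => ?_⟩
  · rw [abs_of_nonneg χ.nonneg]
    exact χ.le_one
  · exact χ.one_of_mem_closedBall (by simpa [hχ] using hs)
  · exact χ.zero_of_le_dist (by simpa [hχ] using hs)

namespace ScalarHomoclinic

variable {f : ℝ → ℝ} {a lam : ℝ} {x v : ℝ → ℝ} {c m P b : ℝ}

theorem hasDerivAt_phase (h : ScalarHomoclinic f a lam x v) (k t : ℝ) :
    HasDerivAt (fun t => k * x t - t) (k * v t - 1) t :=
  ((h.hx t).const_mul k).sub (hasDerivAt_id t)

/-- The leading contribution of a critical point to `∫ v exp (i (k x - t) / ε)`. -/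
noncomputable def criticalTerm (f x : ℝ → ℝ) (ε : ℝ) (k : ℤ) (t : ℝ) : ℂ :=
  Complex.exp (Complex.I * (((k * x t - t) / ε + k * f (x t) / |k * f (x t)| * (Real.pi / 4) : ℝ)
    : ℂ)) / ((k * Real.sqrt |(k : ℝ)| * Real.sqrt |f (x t)| : ℝ) : ℂ)

theorem PhaseConstants.exists_local_asymptotics (hp : PhaseConstants f x v c m P b)
    (h : ScalarHomoclinic f a lam x v) {χ χ₁ χ₂ : ℝ → ℝ} {X : ℝ}
    (hχ₁ : ∀ s, HasDerivAt χ (χ₁ s) s) (hχ₂ : ∀ s, HasDerivAt χ₁ (χ₂ s) s) (hX : 0 ≤ X)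
    (bχ : ∀ s, |χ s| ≤ 1) (bχ₁ : ∀ s, |χ₁ s| ≤ X) (bχ₂ : ∀ s, |χ₂ s| ≤ X)
    (hone : ∀ s, |s| ≤ b / 4 → χ s = 1) (hzero : ∀ s, b / 2 ≤ |s| → χ s = 0) :
    ∃ C, 0 ≤ C ∧ ∀ k : ℤ, k ≠ 0 → ∀ t : ℝ, v t = 1 / (k : ℝ) → ∀ ε, 0 < ε →
      ‖(∫ s, ((χ (s - t) * v s : ℝ) : ℂ)
          * Complex.exp (Complex.I * (((k * x s - s) / ε : ℝ) : ℂ)))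
        - Real.sqrt (2 * Real.pi * ε) * criticalTerm f x ε k t‖ ≤ C * ε := by
  have hb := hp.b_pos
  have hm := hp.m_pos
  obtain ⟨C, hC, hCb⟩ := exists_stationary_phase hp.P_nonneg hb hp.b_le hp.P_mul_b
  obtain ⟨V, hV, hVb⟩ := h.bounded_v
  obtain ⟨F, hF, hFb⟩ := h.exists_bound_comp h.differentiable_f.continuous
  obtain ⟨L, hL, hLb⟩ := h.exists_bound_comp h.continuous_deriv_f
  set A := V + (X * V + F) + (X * V + 2 * (X * F) + L * V) with hA
  have hXV : 0 ≤ X * V := by positivity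
  have hXF : 0 ≤ X * F := by positivity
  have hLV : 0 ≤ L * V := by positivity
  have hA0 : 0 ≤ A := by rw [hA]; linarith
  refine ⟨C * A / m, by positivity, ?_⟩
  intro k hk t ht ε hε
  have hkR : (k : ℝ) ≠ 0 := Int.cast_ne_zero.2 hk
  have hkv : k * v t = 1 := by rw [ht, mul_one_div_cancel hkR]
  have hφ0 : |k * v t - 1| ≤ c := by rw [hkv, sub_self, abs_zero]; exact hp.c_pos.le
  have hκm := hp.lower k hk t hφ0
  have hκ0 : 0 < |k * f (x t)| := hm.trans_le hκm
  have hadd : ∀ s, HasDerivAt (fun s => t + s) 1 s := fun s => (hasDerivAt_id s).const_add t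
  have sh : ∀ (g g' : ℝ → ℝ), (∀ s, HasDerivAt g (g' s) s) →
      ∀ s, HasDerivAt (fun s => g (t + s)) (g' (t + s)) s := fun g g' hg s =>
    ((hg (t + s)).comp s (hadd s)).congr_deriv (mul_one _)
  have hv' := sh _ _ h.hv
  have hf' := sh _ _ h.hasDerivAt_fx
  have h0b : (0 : ℝ) ∈ Icc (-b) b := ⟨by linarith, hb.le⟩
  have hmain := hCb (fun s => k * x (t + s) - (t + s)) (fun s => k * v (t + s) - 1)
    (fun s => k * f (x (t + s))) (fun s => k * (deriv f (x (t + s)) * v (t + s)))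
    (fun s => k * (deriv (deriv f) (x (t + s)) * v (t + s) * v (t + s)
      + deriv f (x (t + s)) * f (x (t + s))))
    (fun s => χ s * v (t + s)) (fun s => χ₁ s * v (t + s) + χ s * f (x (t + s)))
    (fun s => χ₂ s * v (t + s) + 2 * (χ₁ s * f (x (t + s)))
      + χ s * (deriv f (x (t + s)) * v (t + s)))
    (k * f (x t)) A ε (sh _ _ (h.hasDerivAt_phase k)) (fun s => ((hv' s).const_mul (k : ℝ)).sub_const 1)
    (fun s => (hf' s).const_mul (k : ℝ))
    (fun s => ((sh _ _ h.hasDerivAt_deriv_fx s).mul (hv' s)).const_mul (k : ℝ))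
    (abs_pos.1 hκ0) (by simp [hkv]) (by simp) (by simpa using hp.third k hk t hφ0 0 h0b)
    (hp.fourth k hk t hφ0) (fun s => (hχ₁ s).mul (hv' s))
    (fun s => (((hχ₂ s).mul (hv' s)).add ((hχ₁ s).mul (hf' s))).congr_deriv (by ring))
    (by
      rw [abs_mul]
      calc _ ≤ 1 * V := mul_le_mul (bχ 0) (hVb _) (abs_nonneg _) zero_le_one
        _ ≤ A := by rw [hA]; linarith)
    (fun s _ => by
      refine (abs_add_le _ _).trans ?_
      rw [abs_mul, abs_mul]
      have e1 : |χ₁ s| * |v (t + s)| ≤ X * V := mul_le_mul (bχ₁ s) (hVb _) (abs_nonneg _) hX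
      have e2 : |χ s| * |f (x (t + s))| ≤ 1 * F := mul_le_mul (bχ s) (hFb _) (abs_nonneg _) zero_le_one
      rw [hA]; linarith)
    (fun s _ => by
      refine (abs_add_three _ _ _).trans ?_
      rw [abs_mul, abs_mul 2, abs_mul (χ₁ s), abs_mul (χ s), abs_mul (deriv f _), abs_two]
      have e1 : |χ₂ s| * |v (t + s)| ≤ X * V := mul_le_mul (bχ₂ s) (hVb _) (abs_nonneg _) hX
      have e2 : |χ₁ s| * |f (x (t + s))| ≤ X * F := mul_le_mul (bχ₁ s) (hFb _) (abs_nonneg _) hX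
      have e3 : |deriv f (x (t + s))| * |v (t + s)| ≤ L * V :=
        mul_le_mul (hLb _) (hVb _) (abs_nonneg _) hL
      have e4 : |χ s| * (|deriv f (x (t + s))| * |v (t + s)|) ≤ 1 * (L * V) :=
        mul_le_mul (bχ s) e3 (by positivity) zero_le_one
      rw [hA]; linarith)
    (by rw [hzero b (by rw [abs_of_pos hb]; linarith), zero_mul])
    (by rw [hzero (-b) (by rw [abs_neg, abs_of_pos hb]; linarith), zero_mul]) hε
  simp only [add_zero] at hmain
  have hint : (∫ s, ((χ (s - t) * v s : ℝ) : ℂ)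
        * Complex.exp (Complex.I * (((k * x s - s) / ε : ℝ) : ℂ)))
      = ∫ s in (-b)..b, ((χ s * v (t + s) : ℝ) : ℂ)
        * Complex.exp (Complex.I * (((k * x (t + s) - (t + s)) / ε : ℝ) : ℂ)) := by
    rw [← integral_add_left_eq_self _ t]
    simp only [add_sub_cancel_left]
    refine (intervalIntegral.integral_eq_integral_of_support_subset fun s hs => ?_).symm
    have hχ0 : χ s ≠ 0 := fun h0 => hs (by simp [h0])
    have hlt : |s| < b / 2 := lt_of_not_ge fun hge => hχ0 (hzero s hge)
    have := abs_lt.1 hlt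
    exact ⟨by linarith, by linarith⟩
  have hT : (Real.sqrt (2 * Real.pi * ε) : ℂ) * criticalTerm f x ε k t
      = ((χ 0 * v t : ℝ) : ℂ) * Real.sqrt (2 * Real.pi * (ε / |k * f (x t)|))
          * Complex.exp (Complex.I * (((k * x t - t) / ε
            + k * f (x t) / |k * f (x t)| * (Real.pi / 4) : ℝ) : ℂ)) := by
    have e1 : Real.sqrt (2 * Real.pi * (ε / |k * f (x t)|))
        = Real.sqrt (2 * Real.pi * ε) / (Real.sqrt |(k : ℝ)| * Real.sqrt |f (x t)|) := by
      rw [← mul_div_assoc, Real.sqrt_div (by positivity), abs_mul, Real.sqrt_mul (abs_nonneg _)]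
    rw [hone 0 (by rw [abs_zero]; positivity), ht, e1, criticalTerm]
    push_cast
    rw [one_mul]
    ring
  rw [hint, hT]
  refine hmain.trans ?_
  rw [mul_div_assoc', div_mul_eq_mul_div]
  exact div_le_div_of_nonneg_left (by positivity) hm hκm

theorem PhaseConstants.exists_rest_bound (hp : PhaseConstants f x v c m P b)
    (h : ScalarHomoclinic f a lam x v) {χ χ₁ : ℝ → ℝ} {X : ℝ}
    (hχ₁ : ∀ s, HasDerivAt χ (χ₁ s) s) (hX : 0 ≤ X)
    (bχ : ∀ s, |χ s| ≤ 1) (bχ₁ : ∀ s, |χ₁ s| ≤ X)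
    (hone : ∀ s, |s| ≤ b / 4 → χ s = 1) (hzero : ∀ s, b / 2 ≤ |s| → χ s = 0) (N : ℕ) :
    ∃ C, 0 ≤ C ∧ ∀ k : ℤ, k ≠ 0 → ∀ S : Finset ℝ, (∀ t, t ∈ S ↔ v t = 1 / (k : ℝ)) → S.card ≤ N →
      ∀ ε, 0 < ε → ‖∫ s, (((1 - ∑ t ∈ S, χ (s - t)) * v s : ℝ) : ℂ)
          * Complex.exp (Complex.I * (((k * x s - s) / ε : ℝ) : ℂ))‖ ≤ C * ε := by
  have hb := hp.b_pos
  have hm := hp.m_pos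
  set c' := min c (m * b / 8) with hc'
  have hc'0 : 0 < c' := lt_min hp.c_pos (by positivity)
  set K := (1 + N) * (X + 1) * (2 / c' + 1 / c' ^ 2) with hK
  have hK0 : 0 ≤ K := by positivity
  have hw : Integrable fun s => K * (|v s| + |f (x s)|) :=
    (h.integrable_v.abs.add h.integrable_fx.abs).const_mul K
  refine ⟨∫ s, K * (|v s| + |f (x s)|), integral_nonneg fun s => by positivity, ?_⟩
  intro k hk S hS hSN ε hε
  have hkR : (k : ℝ) ≠ 0 := Int.cast_ne_zero.2 hk
  have hkv : ∀ t, t ∈ S ↔ k * v t = 1 := fun t => by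
    rw [hS, eq_div_iff hkR, mul_comm]
  set θ : ℝ → ℝ := fun s => 1 - ∑ t ∈ S, χ (s - t) with hθ
  set θ₁ : ℝ → ℝ := fun s => -∑ t ∈ S, χ₁ (s - t) with hθ₁
  have hθd : ∀ s, HasDerivAt θ (θ₁ s) s := fun s =>
    (HasDerivAt.fun_sum fun t _ => ((hχ₁ (s - t)).comp s ((hasDerivAt_id s).sub_const t)).congr_deriv
      (mul_one _)).const_sub 1
  have hθb : ∀ s, |θ s| ≤ 1 + N := by
    intro s
    refine (abs_sub _ _).trans ?_
    rw [abs_one]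
    gcongr
    refine (Finset.abs_sum_le_sum_abs _ _).trans ((Finset.sum_le_card_nsmul _ _ 1
      fun t _ => bχ _).trans ?_)
    rw [nsmul_eq_mul, mul_one]
    exact_mod_cast hSN
  have hθ₁b : ∀ s, |θ₁ s| ≤ N * X := by
    intro s
    rw [hθ₁]
    simp only
    rw [abs_neg]
    refine (Finset.abs_sum_le_sum_abs _ _).trans ((Finset.sum_le_card_nsmul _ _ X
      fun t _ => bχ₁ _).trans ?_)
    rw [nsmul_eq_mul]
    gcongr
  have hθ0 : ∀ s, |k * v s - 1| ≤ c' → θ s = 0 := by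
    intro s hs
    obtain ⟨t, ht, htc⟩ := hp.exists_critical_near h hk (hs.trans (min_le_left _ _))
      (hs.trans (min_le_right _ _))
    have htS := (hkv t).2 htc
    simp only [hθ]
    rw [Finset.sum_eq_single_of_mem t htS fun t' ht' hne => ?_, hone _ ht, sub_self]
    refine hzero _ (le_of_not_gt fun hlt => hne ?_)
    refine hp.eq_of_critical h hk htc ((hkv t').1 ht') ?_
    have := abs_sub_le t' s t
    rw [abs_sub_comm t' s] at this
    linarith
  have hθev : ∀ s, |k * v s - 1| < c' → θ =ᶠ[𝓝 s] fun _ => 0 := by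
    intro s hs
    have hc : Continuous fun s => |k * v s - 1| := by have := h.cont_v; fun_prop
    filter_upwards [hc.continuousAt.eventually (gt_mem_nhds hs)] with s' hs'
    exact hθ0 s' hs'.le
  have hθ₁0 : ∀ s, |k * v s - 1| < c' → θ₁ s = 0 := fun s hs =>
    (hθd s).unique ((hasDerivAt_const s (0 : ℝ)).congr_of_eventuallyEq (hθev s hs))
  set g : ℝ → ℝ := fun s => θ s * v s / (k * v s - 1) with hg
  set g' : ℝ → ℝ := fun s => ((θ₁ s * v s + θ s * f (x s)) * (k * v s - 1)
    - θ s * v s * (k * f (x s))) / (k * v s - 1) ^ 2 with hg'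
  have hgd : ∀ s, HasDerivAt g (g' s) s := by
    intro s
    rcases lt_or_ge |k * v s - 1| c' with hs | hs
    · have e1 : g' s = 0 := by
        simp only [hg']
        rw [hθ₁0 s hs, hθ0 s hs.le]
        simp
      rw [e1]
      refine (hasDerivAt_const s (0 : ℝ)).congr_of_eventuallyEq ?_
      filter_upwards [hθev s hs] with s' hs'
      simp [hg, hs']
    · exact ((hθd s).mul (h.hv s)).div (((h.hv s).const_mul (k : ℝ)).sub_const 1)
        (abs_pos.1 (hc'0.trans_le hs))
  have hgb : ∀ s, |g s| ≤ (1 + N) / c' * |v s| := by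
    intro s
    rcases lt_or_ge |k * v s - 1| c' with hs | hs
    · have : g s = 0 := by simp [hg, hθ0 s hs.le]
      rw [this, abs_zero]
      positivity
    · simp only [hg]
      rw [abs_div, abs_mul, div_mul_eq_mul_div]
      gcongr
      exact hθb s
  have hg'b : ∀ s, |g' s| ≤ K * (|v s| + |f (x s)|) := by
    intro s
    rcases lt_or_ge |k * v s - 1| c' with hs | hs
    · have e1 : g' s = 0 := by
        simp only [hg']
        rw [hθ₁0 s hs, hθ0 s hs.le]
        simp
      rw [e1, abs_zero]
      positivity
    · have hy0 : 0 < |k * v s - 1| := hc'0.trans_le hs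
      have hy : k * v s - 1 ≠ 0 := abs_pos.1 hy0
      set y := k * v s - 1 with hydef
      have hi : |y⁻¹| ≤ 1 / c' := by rw [abs_inv, ← one_div]; exact one_div_le_one_div_of_le hc'0 hs
      have e : g' s = (θ₁ s * v s + θ s * f (x s)) * y⁻¹ - θ s * f (x s) * y⁻¹
          - θ s * f (x s) * (y⁻¹) ^ 2 := by
        simp only [hg']
        have : θ s * v s * (k * f (x s)) = θ s * f (x s) * (y + 1) := by rw [hydef]; ring
        rw [this, ← hydef]
        field_simp
        ring
      have hab : |θ₁ s * v s + θ s * f (x s)| ≤ (1 + N) * (X + 1) * (|v s| + |f (x s)|) := by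
        refine (abs_add_le _ _).trans ?_
        rw [abs_mul, abs_mul]
        have e1 : |θ₁ s| * |v s| ≤ (1 + N) * (X + 1) * |v s| := by
          gcongr
          refine (hθ₁b s).trans ?_
          have : (0 : ℝ) ≤ N := Nat.cast_nonneg N
          nlinarith
        have e2 : |θ s| * |f (x s)| ≤ (1 + N) * (X + 1) * |f (x s)| := by
          gcongr
          refine (hθb s).trans ?_
          have : (0 : ℝ) ≤ N := Nat.cast_nonneg N
          nlinarith
        rw [mul_add]
        exact add_le_add e1 e2
      have hbb : |θ s * f (x s)| ≤ (1 + N) * (X + 1) * (|v s| + |f (x s)|) := by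
        rw [abs_mul]
        have e2 : |θ s| ≤ (1 + N) * (X + 1) := by
          refine (hθb s).trans ?_
          have : (0 : ℝ) ≤ N := Nat.cast_nonneg N
          nlinarith
        have e3 : |f (x s)| ≤ |v s| + |f (x s)| := le_add_of_nonneg_left (abs_nonneg _)
        exact mul_le_mul e2 e3 (abs_nonneg _) (by positivity)
      set Z := (1 + N) * (X + 1) * (|v s| + |f (x s)|) with hZ
      have hZ0 : 0 ≤ Z := by positivity
      rw [e]
      refine (abs_sub _ _).trans ((add_le_add_left (abs_sub _ _) _).trans ?_)
      rw [abs_mul _ y⁻¹, abs_mul _ y⁻¹, abs_mul _ (y⁻¹ ^ 2), abs_pow]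
      calc _ ≤ Z * (1 / c') + Z * (1 / c') + Z * (1 / c') ^ 2 := by gcongr
        _ = K * (|v s| + |f (x s)|) := by rw [hZ, hK]; ring
  have hGd : ∀ s, HasDerivAt (fun s => (g s : ℂ)) (g' s : ℂ) s := fun s => (hgd s).ofReal_comp
  have hlim : ∀ l : Filter ℝ, Tendsto v l (𝓝 0) → Tendsto (fun s => (g s : ℂ)) l (𝓝 0) := by
    intro l hl
    refine squeeze_zero_norm (a := fun s => (1 + N) / c' * |v s|) (fun s => ?_) ?_
    · rw [Complex.norm_real]; exact hgb s
    · simpa using hl.abs.const_mul ((1 + N) / c')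
  have hφg : ∀ s, ((k * v s - 1 : ℝ) : ℂ) * (g s : ℂ) = ((θ s * v s : ℝ) : ℂ) := by
    intro s
    rw [← Complex.ofReal_mul]
    congr 1
    by_cases hy : k * v s - 1 = 0
    · rw [hy, zero_mul, hθ0 s (by rw [hy, abs_zero]; exact hc'0.le), zero_mul]
    · simp only [hg]
      field_simp
  have hθc : Continuous θ := continuous_iff_continuousAt.2 fun s => (hθd s).continuousAt
  have hint : Integrable fun s => ((θ s * v s : ℝ) : ℂ) :=
    (h.integrable_v.bdd_mul (c := 1 + N) hθc.aestronglyMeasurable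
      (Eventually.of_forall hθb)).ofReal
  have := norm_integral_oscillatory_le hε (h.hasDerivAt_phase k) hGd (hlim _ h.v_top)
    (hlim _ h.v_bot) hw (fun s => by rw [Complex.norm_real]; exact hg'b s)
    (by simpa only [hφg] using hint)
  simp only [hφg] at this
  rw [mul_comm] at this
  exact this

theorem PhaseConstants.exists_integral_asymptotics (hp : PhaseConstants f x v c m P b)
    (h : ScalarHomoclinic f a lam x v) : ∃ C, 0 ≤ C ∧ ∀ k : ℤ, k ≠ 0 → ∀ ε, 0 < ε →
      ‖(∫ s, (v s : ℂ) * Complex.exp (Complex.I * (((k * x s - s) / ε : ℝ) : ℂ)))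
        - Real.sqrt (2 * Real.pi * ε) * ∑ᶠ t ∈ {t | v t = 1 / (k : ℝ)}, criticalTerm f x ε k t‖
        ≤ C * ε := by
  obtain ⟨N, hN⟩ := hp.exists_encard_le h
  obtain ⟨χ, χ₁, χ₂, X, hχ₁, hχ₂, hX, bχ, bχ₁, bχ₂, hone, hzero⟩ := exists_cutoff hp.b_pos
  obtain ⟨C₁, hC₁, h1⟩ := hp.exists_local_asymptotics h hχ₁ hχ₂ hX bχ bχ₁ bχ₂ hone hzero
  obtain ⟨C₂, hC₂, h2⟩ := hp.exists_rest_bound h hχ₁ hX bχ bχ₁ hone hzero N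
  refine ⟨N * C₁ + C₂, by positivity, ?_⟩
  intro k hk ε hε
  have hfin := Set.finite_of_encard_le_coe (hN k hk)
  set S := hfin.toFinset with hS
  have hmem : ∀ t, t ∈ S ↔ v t = 1 / (k : ℝ) := fun t => hfin.mem_toFinset
  have hcard : S.card ≤ N := by
    have := hN k hk
    rw [hfin.encard_eq_coe_toFinset_card, ← hS] at this
    exact_mod_cast this
  set e : ℝ → ℂ := fun s => Complex.exp (Complex.I * (((k * x s - s) / ε : ℝ) : ℂ)) with he
  have hec : Continuous e := by have := h.cont_x; fun_prop
  have hen : ∀ s, ‖e s‖ ≤ 1 := fun s => by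
    rw [he]; simp only; rw [mul_comm, Complex.norm_exp_ofReal_mul_I]
  have hχc : Continuous χ := continuous_iff_continuousAt.2 fun s => (hχ₁ s).continuousAt
  have hi : ∀ g : ℝ → ℝ, Continuous g → (∃ B, ∀ s, |g s| ≤ B) →
      Integrable fun s => ((g s * v s : ℝ) : ℂ) * e s := by
    rintro g hg ⟨B, hB⟩
    have : Integrable fun s => ((g s * v s : ℝ) : ℂ) :=
      (h.integrable_v.bdd_mul (c := B) hg.aestronglyMeasurable (Eventually.of_forall hB)).ofReal
    exact this.mul_bdd (c := 1) hec.aestronglyMeasurable (Eventually.of_forall hen)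
  have hiS : ∀ t ∈ S, Integrable fun s => ((χ (s - t) * v s : ℝ) : ℂ) * e s := fun t _ =>
    hi (fun s => χ (s - t)) (by fun_prop) ⟨1, fun s => bχ _⟩
  have hsplit : (∫ s, (v s : ℂ) * e s) = (∑ t ∈ S, ∫ s, ((χ (s - t) * v s : ℝ) : ℂ) * e s)
      + ∫ s, (((1 - ∑ t ∈ S, χ (s - t)) * v s : ℝ) : ℂ) * e s := by
    rw [← integral_finsetSum _ hiS, ← integral_add (integrable_finsetSum _ hiS)
      (hi (fun s => 1 - ∑ t ∈ S, χ (s - t)) (by fun_prop) ⟨1 + S.card, fun s => by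
        refine (abs_sub _ _).trans ?_
        rw [abs_one]
        gcongr
        refine (Finset.abs_sum_le_sum_abs _ _).trans ((Finset.sum_le_card_nsmul _ _ 1
          fun t _ => bχ _).trans ?_)
        rw [nsmul_eq_mul, mul_one]⟩)]
    refine integral_congr_ae (Eventually.of_forall fun s => ?_)
    simp only
    rw [← Finset.sum_mul, ← add_mul]
    congr 1
    push_cast
    rw [← Finset.sum_mul]
    ring
  rw [finsum_mem_eq_finite_toFinset_sum _ hfin, ← hS, hsplit, Finset.mul_sum, add_sub_right_comm,
    ← Finset.sum_sub_distrib, add_mul]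
  refine (norm_add_le _ _).trans (add_le_add ?_ (h2 k hk S hmem hcard ε hε))
  refine (norm_sum_le_of_le S fun t ht => h1 k hk t ((hmem t).1 ht) ε hε).trans ?_
  rw [Finset.sum_const, nsmul_eq_mul, mul_assoc]
  gcongr

end ScalarHomoclinic

theorem hasDerivAt_intervalIntegral_of_continuous {H H' : ℝ → ℝ → ℂ} {a b : ℝ}
    (hH : ∀ v, Continuous (H v)) (hH' : Continuous (Function.uncurry H'))
    (hd : ∀ v ξ, HasDerivAt (fun v => H v ξ) (H' v ξ) v) (v : ℝ) :
    HasDerivAt (fun v => ∫ ξ in a..b, H v ξ) (∫ ξ in a..b, H' v ξ) v := by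
  obtain ⟨B, hB⟩ := ((isCompact_closedBall v 1).prod
    (isCompact_uIcc (a := a) (b := b))).exists_bound_of_continuousOn hH'.continuousOn
  refine (intervalIntegral.hasDerivAt_integral_of_dominated_loc_of_deriv_le
    (bound := fun _ => B) (Metric.closedBall_mem_nhds v one_pos)
    (Eventually.of_forall fun v => (hH v).aestronglyMeasurable)
    ((hH v).intervalIntegrable _ _) ?_ (Eventually.of_forall fun ξ hξ w hw => ?_)
    intervalIntegrable_const (Eventually.of_forall fun ξ _ w _ => hd w ξ)).2
  · exact Continuous.aestronglyMeasurable (hH'.comp (by fun_prop : Continuous fun ξ : ℝ => (v, ξ)))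
  · exact hB (w, ξ) ⟨hw, uIoc_subset_uIcc hξ⟩

/-- Fourier coefficients in the first variable. -/
noncomputable def fourierFst (G : ℝ × ℝ → ℝ) (k : ℤ) (v : ℝ) : ℂ :=
  (1 / (2 * Real.pi) : ℂ) *
    ∫ ξ in (0 : ℝ)..(2 * Real.pi), (G (ξ, v) : ℂ) * Complex.exp (-(Complex.I * k * ξ))

/-- Partial derivatives of a function in the plane. -/
noncomputable def partialFst (G : ℝ × ℝ → ℝ) (p : ℝ × ℝ) : ℝ := fderiv ℝ G p (1, 0)

noncomputable def partialSnd (G : ℝ × ℝ → ℝ) (p : ℝ × ℝ) : ℝ := fderiv ℝ G p (0, 1)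

section partialDerivatives

variable {G : ℝ × ℝ → ℝ}

theorem contDiff_partialFst {n : ℕ} (hG : ContDiff ℝ (n + 1) G) : ContDiff ℝ n (partialFst G) :=
  (hG.fderiv_right le_rfl).clm_apply contDiff_const

theorem contDiff_partialSnd {n : ℕ} (hG : ContDiff ℝ (n + 1) G) : ContDiff ℝ n (partialSnd G) :=
  (hG.fderiv_right le_rfl).clm_apply contDiff_const

theorem hasDerivAt_partialFst (hG : ContDiff ℝ 1 G) (ξ v : ℝ) :
    HasDerivAt (fun ξ => G (ξ, v)) (partialFst G (ξ, v)) ξ :=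
  ((hG.differentiable one_ne_zero (ξ, v)).hasFDerivAt.comp_hasDerivAt ξ
    ((hasDerivAt_id ξ).prodMk (hasDerivAt_const ξ v)))

theorem hasDerivAt_partialSnd (hG : ContDiff ℝ 1 G) (ξ v : ℝ) :
    HasDerivAt (fun v => G (ξ, v)) (partialSnd G (ξ, v)) v :=
  ((hG.differentiable one_ne_zero (ξ, v)).hasFDerivAt.comp_hasDerivAt v
    ((hasDerivAt_const v ξ).prodMk (hasDerivAt_id v)))

theorem fderiv_add_period {T : ℝ} (hper : ∀ ξ v, G (ξ + T, v) = G (ξ, v)) (ξ v : ℝ) :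
    fderiv ℝ G (ξ + T, v) = fderiv ℝ G (ξ, v) := by
  have h1 : (fun p : ℝ × ℝ => G (p + (T, 0))) = G := by
    funext p
    obtain ⟨ξ, v⟩ := p
    rw [Prod.mk_add_mk, add_zero, hper]
  have h2 := fderiv_comp_add_right (𝕜 := ℝ) (f := G) (x := (ξ, v)) ((T, 0) : ℝ × ℝ)
  rw [h1, Prod.mk_add_mk, add_zero] at h2
  exact h2.symm

theorem continuous_exp_fourier (k : ℤ) :
    Continuous fun ξ : ℝ => Complex.exp (-(Complex.I * k * ξ)) := by fun_prop

theorem hasDerivAt_fourierFst (hG : ContDiff ℝ 1 G) (k : ℤ) (v : ℝ) :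
    HasDerivAt (fourierFst G k) (fourierFst (partialSnd G) k v) v := by
  have hc : Continuous (partialSnd G) := (contDiff_partialSnd (n := 0) (by simpa using hG)).continuous
  refine (hasDerivAt_intervalIntegral_of_continuous
    (H := fun v ξ => (G (ξ, v) : ℂ) * Complex.exp (-(Complex.I * k * ξ)))
    (H' := fun v ξ => (partialSnd G (ξ, v) : ℂ) * Complex.exp (-(Complex.I * k * ξ)))
    (fun v => ?_) ?_ (fun v ξ => ?_) v).const_mul _
  · have := hG.continuous
    fun_prop
  · have := continuous_exp_fourier k
    simp only [Function.uncurry_def]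
    fun_prop
  · exact (hasDerivAt_partialSnd hG ξ v).ofReal_comp.mul_const _

theorem fourierFst_partialFst (hG : ContDiff ℝ 1 G)
    (hper : ∀ ξ v, G (ξ + 2 * Real.pi, v) = G (ξ, v)) (k : ℤ) (v : ℝ) :
    fourierFst (partialFst G) k v = Complex.I * k * fourierFst G k v := by
  have hc : Continuous (partialFst G) := (contDiff_partialFst (n := 0) (by simpa using hG)).continuous
  have hd : ∀ ξ : ℝ, HasDerivAt (fun ξ : ℝ => Complex.exp (-(Complex.I * k * ξ)))
      (-(Complex.I * k) * Complex.exp (-(Complex.I * k * ξ))) ξ := by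
    intro ξ
    have h1 : HasDerivAt (fun ξ : ℝ => (ξ : ℂ)) 1 ξ := Complex.ofRealCLM.hasDerivAt
    refine ((h1.const_mul (Complex.I * k)).fun_neg).cexp.congr_deriv ?_
    ring
  have hibp := intervalIntegral.integral_mul_deriv_eq_deriv_mul (a := 0) (b := 2 * Real.pi)
    (u := fun ξ : ℝ => Complex.exp (-(Complex.I * k * ξ))) (v := fun ξ => (G (ξ, v) : ℂ))
    (u' := fun ξ : ℝ => -(Complex.I * k) * Complex.exp (-(Complex.I * k * ξ)))
    (v' := fun ξ => (partialFst G (ξ, v) : ℂ)) (fun ξ _ => hd ξ)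
    (fun ξ _ => (hasDerivAt_partialFst hG ξ v).ofReal_comp)
    ((Continuous.intervalIntegrable (by fun_prop)) _ _)
    ((Continuous.intervalIntegrable (by fun_prop)) _ _)
  have hb : Complex.exp (-(Complex.I * k * ((2 * Real.pi : ℝ) : ℂ))) = 1 := by
    rw [Complex.exp_eq_one_iff]
    exact ⟨-k, by push_cast; ring⟩
  have hG0 : G (2 * Real.pi, v) = G (0, v) := by have := hper 0 v; rwa [zero_add] at this
  rw [hb, hG0, Complex.ofReal_zero, mul_zero, neg_zero, Complex.exp_zero, sub_self, zero_sub] at hibp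
  unfold fourierFst
  have e1 : (∫ ξ in (0 : ℝ)..(2 * Real.pi), (partialFst G (ξ, v) : ℂ)
      * Complex.exp (-(Complex.I * k * ξ)))
      = ∫ ξ in (0 : ℝ)..(2 * Real.pi), Complex.exp (-(Complex.I * k * ξ))
        * (partialFst G (ξ, v) : ℂ) := by simp only [mul_comm]
  rw [e1, hibp, ← intervalIntegral.integral_neg]
  have e2 : (fun ξ : ℝ => -(-(Complex.I * k) * Complex.exp (-(Complex.I * k * ξ)) * (G (ξ, v) : ℂ)))
      = fun ξ : ℝ => (Complex.I * k) * ((G (ξ, v) : ℂ) * Complex.exp (-(Complex.I * k * ξ))) := by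
    funext ξ; ring
  rw [e2, intervalIntegral.integral_const_mul]
  ring

theorem exists_norm_fourierFst_le (hG : Continuous G) (V : ℝ) :
    ∃ B, 0 ≤ B ∧ ∀ (k : ℤ) (v : ℝ), |v| ≤ V → ‖fourierFst G k v‖ ≤ B := by
  obtain ⟨B, hB⟩ := ((isCompact_Icc (a := 0) (b := 2 * Real.pi)).prod
    (isCompact_Icc (a := -V) (b := V))).exists_bound_of_continuousOn hG.continuousOn
  refine ⟨max B 0, le_max_right _ _, fun k v hv => ?_⟩
  have h2 : 0 < 2 * Real.pi := Real.two_pi_pos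
  have hint : ‖∫ ξ in (0 : ℝ)..(2 * Real.pi), (G (ξ, v) : ℂ) * Complex.exp (-(Complex.I * k * ξ))‖
      ≤ max B 0 * |2 * Real.pi - 0| := by
    refine intervalIntegral.norm_integral_le_of_norm_le_const fun ξ hξ => ?_
    rw [uIoc_of_le h2.le] at hξ
    have e : -(Complex.I * k * (ξ : ℂ)) = ((-(k * ξ) : ℝ) : ℂ) * Complex.I := by push_cast; ring
    rw [norm_mul, e, Complex.norm_exp_ofReal_mul_I, mul_one, Complex.norm_real]
    exact (hB (ξ, v) ⟨⟨hξ.1.le, hξ.2⟩, abs_le.1 hv⟩).trans (le_max_left _ _)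
  rw [sub_zero, abs_of_pos h2] at hint
  unfold fourierFst
  have e3 : ‖(1 / (2 * Real.pi) : ℂ)‖ = 1 / (2 * Real.pi) := by
    rw [show (1 / (2 * Real.pi) : ℂ) = ((1 / (2 * Real.pi) : ℝ) : ℂ) by push_cast; rfl,
      Complex.norm_real, Real.norm_of_nonneg (by positivity)]
  rw [norm_mul, e3, one_div, inv_mul_le_iff₀ h2]
  linarith

/-- Decay of the Fourier coefficients and of their first two derivatives. -/
theorem exists_fourierFst_decay (hG : ContDiff ℝ 3 G)
    (hper : ∀ ξ v, G (ξ + 2 * Real.pi, v) = G (ξ, v)) (V : ℝ) :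
    ∃ B, 0 ≤ B ∧ ∀ (k : ℤ), k ≠ 0 → ∀ v : ℝ, |v| ≤ V →
      ‖fourierFst G k v‖ ≤ B / (k : ℝ) ^ 2 ∧ ‖fourierFst (partialSnd G) k v‖ ≤ B / |(k : ℝ)| ∧
      ‖fourierFst (partialSnd (partialSnd G)) k v‖ ≤ B / |(k : ℝ)| := by
  have h1 : ContDiff ℝ 2 (partialFst G) := contDiff_partialFst (n := 2) (by norm_num; exact hG)
  have h2 : ContDiff ℝ 2 (partialSnd G) := contDiff_partialSnd (n := 2) (by norm_num; exact hG)
  have h3 : ContDiff ℝ 1 (partialSnd (partialSnd G)) :=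
    contDiff_partialSnd (n := 1) (by norm_num; exact h2)
  have c1 : Continuous (partialFst (partialFst G)) :=
    (contDiff_partialFst (n := 1) (by norm_num; exact h1)).continuous
  have c2 : Continuous (partialFst (partialSnd G)) :=
    (contDiff_partialFst (n := 1) (by norm_num; exact h2)).continuous
  have c3 : Continuous (partialFst (partialSnd (partialSnd G))) :=
    (contDiff_partialFst (n := 0) (by norm_num; exact h3)).continuous
  have p1 : ∀ ξ v, partialFst G (ξ + 2 * Real.pi, v) = partialFst G (ξ, v) := fun ξ v => by
    unfold partialFst; rw [fderiv_add_period hper]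
  have p2 : ∀ ξ v, partialSnd G (ξ + 2 * Real.pi, v) = partialSnd G (ξ, v) := fun ξ v => by
    unfold partialSnd; rw [fderiv_add_period hper]
  have p3 : ∀ ξ v, partialSnd (partialSnd G) (ξ + 2 * Real.pi, v)
      = partialSnd (partialSnd G) (ξ, v) := fun ξ v => by
    rw [partialSnd, fderiv_add_period p2, ← partialSnd]
  obtain ⟨B₁, hB₁, b₁⟩ := exists_norm_fourierFst_le c1 V
  obtain ⟨B₂, hB₂, b₂⟩ := exists_norm_fourierFst_le c2 V
  obtain ⟨B₃, hB₃, b₃⟩ := exists_norm_fourierFst_le c3 V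
  refine ⟨B₁ + B₂ + B₃, by positivity, fun k hk v hv => ?_⟩
  have hk0 : 0 < |(k : ℝ)| := abs_pos.2 (Int.cast_ne_zero.2 hk)
  have hnk : ‖Complex.I * (k : ℂ)‖ = |(k : ℝ)| := by
    rw [norm_mul, Complex.norm_I, one_mul, Complex.norm_intCast]
  refine ⟨?_, ?_, ?_⟩
  · have := b₁ k v hv
    rw [fourierFst_partialFst (h1.of_le (by norm_num)) p1,
      fourierFst_partialFst (hG.of_le (by norm_num)) hper, norm_mul, hnk, norm_mul, hnk] at this
    rw [← sq_abs, le_div_iff₀ (by positivity)]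
    linarith [sq |(k : ℝ)|]
  · have := b₂ k v hv
    rw [fourierFst_partialFst (h2.of_le (by norm_num)) p2, norm_mul, hnk] at this
    rw [le_div_iff₀ hk0]
    linarith
  · have := b₃ k v hv
    rw [fourierFst_partialFst h3 p3, norm_mul, hnk] at this
    rw [le_div_iff₀ hk0]
    linarith

theorem summable_one_div_int_sq : Summable fun k : ℤ => 1 / (k : ℝ) ^ 2 :=
  Real.summable_one_div_int_pow.2 one_lt_two

/-- The Fourier series converges pointwise. -/
theorem hasSum_fourierFst (hG : ContDiff ℝ 3 G)
    (hper : ∀ ξ v, G (ξ + 2 * Real.pi, v) = G (ξ, v)) (ξ v : ℝ) :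
    HasSum (fun k : ℤ => fourierFst G k v * Complex.exp (Complex.I * k * ξ)) (G (ξ, v) : ℂ) := by
  have : Fact (0 < 2 * Real.pi) := ⟨Real.two_pi_pos⟩
  have hp : Function.Periodic (fun ξ : ℝ => (G (ξ, v) : ℂ)) (2 * Real.pi) := fun ξ => by
    simp only [hper]
  have hGc : Continuous fun ξ : ℝ => (G (ξ, v) : ℂ) := by
    have := hG.continuous
    fun_prop
  set F : C(AddCircle (2 * Real.pi), ℂ) := ⟨hp.lift, hGc.quotient_lift _⟩ with hF
  have hFv : ∀ ξ : ℝ, F (ξ : AddCircle (2 * Real.pi)) = (G (ξ, v) : ℂ) := fun ξ => hp.lift_coe ξ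
  have hexp : ∀ (k : ℤ) (ξ : ℝ), (fourier k (ξ : AddCircle (2 * Real.pi)) : ℂ)
      = Complex.exp (Complex.I * k * ξ) := by
    intro k ξ
    rw [fourier_coe_apply]
    congr 1
    have : (Real.pi : ℂ) ≠ 0 := by exact_mod_cast Real.pi_ne_zero
    push_cast
    field_simp
  have hcoef : ∀ k : ℤ, fourierCoeff F k = fourierFst G k v := by
    intro k
    rw [fourierCoeff_eq_intervalIntegral _ _ 0, zero_add, fourierFst, Complex.real_smul]
    congr 1
    · push_cast; rfl
    · refine intervalIntegral.integral_congr fun ξ _ => ?_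
      rw [hexp, hFv, smul_eq_mul, mul_comm]
      congr 2
      push_cast
      ring
  have hsum : Summable (fourierCoeff F) := by
    obtain ⟨B, hB, hb⟩ := exists_fourierFst_decay hG hper |v|
    refine Summable.of_norm_bounded_eventually (g := fun k : ℤ => B * (1 / (k : ℝ) ^ 2))
      (summable_one_div_int_sq.mul_left B) ?_
    filter_upwards [(finite_singleton (0 : ℤ)).compl_mem_cofinite] with k hk
    rw [hcoef]
    have := (hb k hk v le_rfl).1
    rwa [mul_one_div]
  have := has_pointwise_sum_fourier_series_of_summable hsum (ξ : AddCircle (2 * Real.pi))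
  rw [hFv] at this
  refine this.congr_fun fun k => ?_
  rw [hcoef, hexp, smul_eq_mul]

end partialDerivatives

/-- Division of `g w - g c` by `w - c`. -/
theorem exists_linear_quotient {g g' g'' : ℝ → ℂ} (hg : ∀ w, HasDerivAt g (g' w) w)
    (hg' : ∀ w, HasDerivAt g' (g'' w) w) (hc : Continuous g'') (c : ℝ) :
    ∃ Q Q' : ℝ → ℂ, (∀ w, g w = g c + (w - c : ℝ) * Q w) ∧ (∀ w, HasDerivAt Q (Q' w) w) ∧
      ∀ V B B' : ℝ, |c| ≤ V → (∀ w, |w| ≤ V → ‖g' w‖ ≤ B) → (∀ w, |w| ≤ V → ‖g'' w‖ ≤ B') →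
        ∀ w, |w| ≤ V → ‖Q w‖ ≤ B ∧ ‖Q' w‖ ≤ B' := by
  have hg'c : Continuous g' := continuous_iff_continuousAt.2 fun w => (hg' w).continuousAt
  have haff : ∀ w τ : ℝ, HasDerivAt (fun w => c + τ * (w - c)) τ w := fun w τ =>
    ((((hasDerivAt_id w).sub_const c).const_mul τ).const_add c).congr_deriv (mul_one τ)
  refine ⟨fun w => ∫ τ in (0 : ℝ)..1, g' (c + τ * (w - c)),
    fun w => ∫ τ in (0 : ℝ)..1, τ • g'' (c + τ * (w - c)), fun w => ?_, fun w => ?_,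
    fun V B B' hcV hB hB' w hw => ?_⟩
  · have hd : ∀ τ ∈ uIcc (0 : ℝ) 1, HasDerivAt (fun τ : ℝ => g (c + τ * (w - c)))
        ((w - c : ℝ) • g' (c + τ * (w - c))) τ := fun τ _ => by
      have h1 : HasDerivAt (fun τ : ℝ => c + τ * (w - c)) (w - c) τ :=
        (((hasDerivAt_id τ).mul_const (w - c)).const_add c).congr_deriv (one_mul _)
      exact (hg _).scomp τ h1
    have := intervalIntegral.integral_eq_sub_of_hasDerivAt hd
      ((Continuous.intervalIntegrable (by fun_prop)) _ _)
    rw [intervalIntegral.integral_smul, Complex.real_smul, one_mul, zero_mul, add_zero,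
      add_sub_cancel] at this
    rw [this]
    ring
  · refine hasDerivAt_intervalIntegral_of_continuous
      (H := fun w τ => g' (c + τ * (w - c))) (H' := fun w τ => τ • g'' (c + τ * (w - c)))
      (fun w => by fun_prop) ?_ (fun w τ => (hg' _).scomp w (haff w τ)) w
    simp only [Function.uncurry_def]
    fun_prop
  · have hseg : ∀ τ ∈ uIoc (0 : ℝ) 1, |c + τ * (w - c)| ≤ V ∧ |τ| ≤ 1 := by
      intro τ hτ
      rw [uIoc_of_le zero_le_one] at hτ
      refine ⟨?_, by rw [abs_of_pos hτ.1]; exact hτ.2⟩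
      have e : c + τ * (w - c) = (1 - τ) * c + τ * w := by ring
      rw [e]
      refine (abs_add_le _ _).trans ?_
      rw [abs_mul, abs_mul, abs_of_pos hτ.1, abs_of_nonneg (sub_nonneg.2 hτ.2)]
      nlinarith [mul_le_mul_of_nonneg_left hw hτ.1.le,
        mul_le_mul_of_nonneg_left hcV (sub_nonneg.2 hτ.2)]
    constructor
    · have := intervalIntegral.norm_integral_le_of_norm_le_const
        (f := fun τ : ℝ => g' (c + τ * (w - c))) (a := 0) (b := 1) (C := B)
        fun τ hτ => hB _ (hseg τ hτ).1
      simpa using this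
    · have := intervalIntegral.norm_integral_le_of_norm_le_const
        (f := fun τ : ℝ => τ • g'' (c + τ * (w - c))) (a := 0) (b := 1) (C := B')
        fun τ hτ => by
          rw [norm_smul]
          exact (mul_le_of_le_one_left (norm_nonneg _) (hseg τ hτ).2).trans (hB' _ (hseg τ hτ).1)
      simpa using this

theorem norm_finsum_mem_le {α : Type*} {S : Set α} {N : ℕ} (hS : S.encard ≤ N) {g : α → ℂ} {D : ℝ}
    (hD : 0 ≤ D) (hg : ∀ t ∈ S, ‖g t‖ ≤ D) : ‖∑ᶠ t ∈ S, g t‖ ≤ N * D := by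
  have hfin := Set.finite_of_encard_le_coe hS
  have hcard : hfin.toFinset.card ≤ N := by
    rw [hfin.encard_eq_coe_toFinset_card] at hS
    exact_mod_cast hS
  rw [finsum_mem_eq_finite_toFinset_sum _ hfin]
  refine (norm_sum_le_of_le _ fun t ht => hg t (hfin.mem_toFinset.1 ht)).trans ?_
  rw [Finset.sum_const, nsmul_eq_mul]
  gcongr

namespace ScalarHomoclinic

variable {f : ℝ → ℝ} {a lam : ℝ} {x v : ℝ → ℝ} {c m P b : ℝ} {G : ℝ × ℝ → ℝ}

theorem PhaseConstants.norm_criticalTerm_le (hp : PhaseConstants f x v c m P b) {k : ℤ}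
    (hk : k ≠ 0) {t : ℝ} (ht : v t = 1 / (k : ℝ)) (ε : ℝ) :
    ‖criticalTerm f x ε k t‖ ≤ 1 / Real.sqrt m := by
  have hk0 : (k : ℝ) ≠ 0 := Int.cast_ne_zero.2 hk
  have hk1 : 1 ≤ |(k : ℝ)| := by exact_mod_cast Int.one_le_abs hk
  have h1 : |(k : ℝ) * v t - 1| ≤ c := by
    rw [ht, mul_one_div_cancel hk0, sub_self, abs_zero]; exact hp.c_pos.le
  have h2 := hp.lower k hk t h1
  have hm : 0 < Real.sqrt m := Real.sqrt_pos.2 hp.m_pos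
  unfold criticalTerm
  rw [norm_div, mul_comm Complex.I, Complex.norm_exp_ofReal_mul_I, Complex.norm_real,
    Real.norm_eq_abs, mul_assoc, ← Real.sqrt_mul (abs_nonneg _), ← abs_mul, abs_mul,
    abs_of_nonneg (Real.sqrt_nonneg _)]
  refine one_div_le_one_div_of_le hm ?_
  have := Real.sqrt_le_sqrt h2
  nlinarith [Real.sqrt_nonneg |(k : ℝ) * f (x t)|]

/-- The `k`-th Fourier mode of the Melnikov integral. -/
noncomputable def modeIntegral (G : ℝ × ℝ → ℝ) (x v : ℝ → ℝ) (ε : ℝ) (k : ℤ) : ℂ :=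
  ∫ s, (v s : ℂ) * fourierFst G k (v s) * Complex.exp (Complex.I * (((k * x s - s) / ε : ℝ) : ℂ))

/-- The leading part of the `k`-th Fourier mode of the Melnikov integral. -/
noncomputable def modeSum (G : ℝ × ℝ → ℝ) (f x v : ℝ → ℝ) (ε : ℝ) (k : ℤ) : ℂ :=
  fourierFst G k (1 / (k : ℝ)) * ∑ᶠ t ∈ {t | v t = 1 / (k : ℝ)}, criticalTerm f x ε k t

theorem PhaseConstants.exists_norm_modeSum_le (hp : PhaseConstants f x v c m P b)
    (h : ScalarHomoclinic f a lam x v) (hG : ContDiff ℝ 3 G)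
    (hper : ∀ ξ v, G (ξ + 2 * Real.pi, v) = G (ξ, v)) :
    ∃ B, 0 ≤ B ∧ ∀ k : ℤ, k ≠ 0 → ∀ ε, ‖modeSum G f x v ε k‖ ≤ B / (k : ℝ) ^ 2 := by
  obtain ⟨N, hN⟩ := hp.exists_encard_le h
  obtain ⟨B, hB, hb⟩ := exists_fourierFst_decay hG hper 1
  refine ⟨B * (N * (1 / Real.sqrt m)), by positivity, fun k hk ε => ?_⟩
  have hk1 : 1 ≤ |(k : ℝ)| := by exact_mod_cast Int.one_le_abs hk
  have h1 : |1 / (k : ℝ)| ≤ 1 := by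
    rw [abs_div, abs_one]; exact div_le_one_of_le₀ hk1 (abs_nonneg _)
  rw [modeSum, norm_mul, mul_div_right_comm]
  gcongr
  · exact (hb k hk _ h1).1
  · exact norm_finsum_mem_le (hN k hk) (by positivity) fun t ht => hp.norm_criticalTerm_le hk ht ε

theorem continuous_fourierFst (hG : ContDiff ℝ 1 G) (k : ℤ) : Continuous (fourierFst G k) :=
  continuous_iff_continuousAt.2 fun w => (hasDerivAt_fourierFst hG k w).continuousAt

theorem tendsto_ofReal_mul_zero {l : Filter ℝ} {v : ℝ → ℝ} {w : ℝ → ℂ} {B : ℝ}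
    (hv : Tendsto v l (𝓝 0)) (hw : ∀ t, ‖w t‖ ≤ B) :
    Tendsto (fun t => (v t : ℂ) * w t) l (𝓝 0) := by
  refine squeeze_zero_norm (a := fun t => |v t| * B) (fun t => ?_) ?_
  · rw [norm_mul, Complex.norm_real]
    exact mul_le_mul_of_nonneg_left (hw t) (abs_nonneg _)
  · simpa using hv.abs.mul_const B

/-- Oscillatory integrals with amplitude `v Q(v)`. -/
theorem norm_integral_amplitude_le (h : ScalarHomoclinic f a lam x v) {V : ℝ}
    (hV : ∀ t, |v t| ≤ V) {Q Q' : ℝ → ℂ} {B B' : ℝ} (hQ : ∀ w, HasDerivAt Q (Q' w) w)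
    (hB : ∀ w, |w| ≤ V → ‖Q w‖ ≤ B) (hB' : ∀ w, |w| ≤ V → ‖Q' w‖ ≤ B') (k : ℝ) {ε : ℝ}
    (hε : 0 < ε) :
    ‖∫ s, ((k * v s - 1 : ℝ) : ℂ) * ((v s : ℂ) * Q (v s))
        * Complex.exp (Complex.I * (((k * x s - s) / ε : ℝ) : ℂ))‖
      ≤ ε * ((B + V * B') * ∫ s, |f (x s)|) := by
  have hQc : Continuous Q := continuous_iff_continuousAt.2 fun w => (hQ w).continuousAt
  have hv := h.cont_v
  have hV0 : 0 ≤ V := (abs_nonneg _).trans (hV 0)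
  have hlim : ∀ l, Tendsto v l (𝓝 0) → Tendsto (fun t => (v t : ℂ) * Q (v t)) l (𝓝 0) :=
    fun l hl => tendsto_ofReal_mul_zero hl fun t => hB _ (hV t)
  have hB'0 : 0 ≤ B' := (norm_nonneg _).trans (hB' _ (hV 0))
  have := norm_integral_oscillatory_le (φ := fun t => k * x t - t) (φ₁ := fun t => k * v t - 1)
    (w := fun t => (B + V * B') * |f (x t)|) (G := fun t => (v t : ℂ) * Q (v t))
    (G' := fun t => (f (x t) : ℂ) * Q (v t) + (v t : ℂ) * (f (x t) • Q' (v t))) hε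
    (h.hasDerivAt_phase k) (fun t => (h.hv t).ofReal_comp.mul ((hQ (v t)).scomp t (h.hv t)))
    (hlim _ h.v_top) (hlim _ h.v_bot) (h.integrable_fx.abs.const_mul _) (fun t => ?_) ?_
  · rwa [integral_const_mul] at this
  · refine (norm_add_le _ _).trans ?_
    rw [norm_mul, norm_mul, norm_smul, Complex.norm_real, Complex.norm_real, Real.norm_eq_abs,
      Real.norm_eq_abs]
    have h1 := mul_le_mul_of_nonneg_left (hB _ (hV t)) (abs_nonneg (f (x t)))
    have h2 : |v t| * (|f (x t)| * ‖Q' (v t)‖) ≤ V * (|f (x t)| * B') := by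
      gcongr
      · exact hV t
      · exact hB' _ (hV t)
    linarith
  · have e : (fun t => ((k * v t - 1 : ℝ) : ℂ) * ((v t : ℂ) * Q (v t)))
        = fun t => (v t : ℂ) * (((k * v t - 1 : ℝ) : ℂ) * Q (v t)) := by funext t; ring
    rw [e]
    refine h.integrable_v.ofReal.mul_bdd (c := (|k| * V + 1) * B)
      (Continuous.aestronglyMeasurable (by fun_prop)) (Eventually.of_forall fun t => ?_)
    rw [norm_mul, Complex.norm_real, Real.norm_eq_abs]
    have h1 : |k * v t - 1| ≤ |k| * V + 1 := by
      refine (abs_sub _ _).trans ?_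
      rw [abs_mul, abs_one]
      gcongr
      exact hV t
    have h0 : 0 ≤ |k| * V + 1 := by positivity
    exact mul_le_mul h1 (hB _ (hV t)) (norm_nonneg _) h0

theorem integrable_amplitude (h : ScalarHomoclinic f a lam x v) {V : ℝ}
    (hV : ∀ t, |v t| ≤ V) {Q : ℝ → ℂ} {B : ℝ} (hQ : Continuous Q)
    (hB : ∀ w, |w| ≤ V → ‖Q w‖ ≤ B) (k ε : ℝ) :
    Integrable (fun s => (v s : ℂ) * Q (v s)
        * Complex.exp (Complex.I * (((k * x s - s) / ε : ℝ) : ℂ))) := by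
  have hv := h.cont_v
  have hx := h.cont_x
  simp only [mul_assoc]
  refine h.integrable_v.ofReal.mul_bdd (c := B)
      (Continuous.aestronglyMeasurable (by fun_prop)) (Eventually.of_forall fun t => ?_)
  rw [norm_mul, mul_comm Complex.I, Complex.norm_exp_ofReal_mul_I, mul_one]
  exact hB _ (hV t)

theorem PhaseConstants.exists_modeIntegral_asymptotics (hp : PhaseConstants f x v c m P b)
    (h : ScalarHomoclinic f a lam x v) (hG : ContDiff ℝ 3 G)
    (hper : ∀ ξ v, G (ξ + 2 * Real.pi, v) = G (ξ, v)) :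
    ∃ C, 0 ≤ C ∧ ∀ k : ℤ, k ≠ 0 → ∀ ε, 0 < ε →
      ‖modeIntegral G x v ε k - Real.sqrt (2 * Real.pi * ε) * modeSum G f x v ε k‖
        ≤ C * ε / (k : ℝ) ^ 2 := by
  obtain ⟨V₀, hV₀, hV₀b⟩ := h.bounded_v
  set V := max V₀ 1 with hVdef
  have hV : ∀ t, |v t| ≤ V := fun t => (hV₀b t).trans (le_max_left _ _)
  have hV1 : 1 ≤ V := le_max_right _ _
  obtain ⟨B, hB, hb⟩ := exists_fourierFst_decay hG hper V
  obtain ⟨C, hC, hE⟩ := hp.exists_integral_asymptotics h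
  have hI : 0 ≤ ∫ s, |f (x s)| := integral_nonneg fun s => abs_nonneg _
  have hG2 : ContDiff ℝ 2 (partialSnd G) := contDiff_partialSnd (n := 2) (by norm_num; exact hG)
  have hG1 : ContDiff ℝ 1 (partialSnd (partialSnd G)) :=
    contDiff_partialSnd (n := 1) (by norm_num; exact hG2)
  refine ⟨B * C + B * (1 + V) * ∫ s, |f (x s)|, by positivity, fun k hk ε hε => ?_⟩
  have hk0 : (k : ℝ) ≠ 0 := Int.cast_ne_zero.2 hk
  have hk1 : 1 ≤ |(k : ℝ)| := by exact_mod_cast Int.one_le_abs hk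
  have hkV : |1 / (k : ℝ)| ≤ V := by
    rw [abs_div, abs_one]; exact (div_le_one_of_le₀ hk1 (abs_nonneg _)).trans hV1
  obtain ⟨Q, Q', hQ, hQd, hQb⟩ := exists_linear_quotient
    (hasDerivAt_fourierFst (hG.of_le (by norm_num)) k)
    (hasDerivAt_fourierFst (hG2.of_le (by norm_num)) k) (continuous_fourierFst hG1 k) (1 / (k : ℝ))
  have hQb' := hQb V (B / |(k : ℝ)|) (B / |(k : ℝ)|) hkV (fun w hw => (hb k hk w hw).2.1)
    (fun w hw => (hb k hk w hw).2.2)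
  have hJ := h.norm_integral_amplitude_le hV hQd (fun w hw => (hQb' w hw).1)
    (fun w hw => (hQb' w hw).2) k hε
  have hEk := hE k hk ε hε
  set E := ∫ s, (v s : ℂ) * Complex.exp (Complex.I * (((k * x s - s) / ε : ℝ) : ℂ)) with hEdef
  set J := ∫ s, ((k * v s - 1 : ℝ) : ℂ) * ((v s : ℂ) * Q (v s))
        * Complex.exp (Complex.I * (((k * x s - s) / ε : ℝ) : ℂ)) with hJdef
  set S := ∑ᶠ t ∈ {t | v t = 1 / (k : ℝ)}, criticalTerm f x ε k t with hS
  have hkC : (k : ℂ) ≠ 0 := Int.cast_ne_zero.2 hk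
  have hQc : Continuous Q := continuous_iff_continuousAt.2 fun w => (hQd w).continuousAt
  have hsplit : modeIntegral G x v ε k = fourierFst G k (1 / (k : ℝ)) * E + (1 / (k : ℂ)) * J := by
    have e : ∀ s, (v s : ℂ) * fourierFst G k (v s)
        * Complex.exp (Complex.I * (((k * x s - s) / ε : ℝ) : ℂ))
        = fourierFst G k (1 / (k : ℝ)) * ((v s : ℂ)
          * Complex.exp (Complex.I * (((k * x s - s) / ε : ℝ) : ℂ)))
        + (1 / (k : ℂ)) * (((k * v s - 1 : ℝ) : ℂ) * ((v s : ℂ) * Q (v s))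
        * Complex.exp (Complex.I * (((k * x s - s) / ε : ℝ) : ℂ))) := by
      intro s
      rw [hQ (v s)]
      push_cast
      field_simp
    unfold modeIntegral
    simp only [e]
    rw [integral_add, integral_const_mul, integral_const_mul]
    · refine Integrable.const_mul ?_ _
      simpa using h.integrable_amplitude hV (Q := fun _ => 1) (B := 1) continuous_const
        (fun w _ => by simp) k ε
    · refine Integrable.const_mul ?_ _
      have hv0 : 0 ≤ V := by linarith
      refine (h.integrable_amplitude hV (Q := fun w => ((k * w - 1 : ℝ) : ℂ) * Q w)
        (B := (|(k : ℝ)| * V + 1) * (B / |(k : ℝ)|)) (by fun_prop) (fun w hw => ?_) k ε).congr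
        (Eventually.of_forall fun s => by simp only; ring)
      rw [norm_mul, Complex.norm_real, Real.norm_eq_abs]
      have h1 : |k * w - 1| ≤ |(k : ℝ)| * V + 1 := by
        refine (abs_sub _ _).trans ?_
        rw [abs_mul, abs_one]
        gcongr
      exact mul_le_mul h1 (hQb' w hw).1 (norm_nonneg _) (by positivity)
  have e2 : modeIntegral G x v ε k - Real.sqrt (2 * Real.pi * ε) * modeSum G f x v ε k
      = fourierFst G k (1 / (k : ℝ)) * (E - Real.sqrt (2 * Real.pi * ε) * S)
        + (1 / (k : ℂ)) * J := by
    rw [hsplit, modeSum]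
    ring
  rw [e2]
  refine (norm_add_le _ _).trans ?_
  have h1 : ‖fourierFst G k (1 / (k : ℝ)) * (E - Real.sqrt (2 * Real.pi * ε) * S)‖
      ≤ B / (k : ℝ) ^ 2 * (C * ε) := by
    rw [norm_mul]
    exact mul_le_mul (hb k hk _ hkV).1 hEk (norm_nonneg _) (by positivity)
  have h2 : ‖(1 / (k : ℂ)) * J‖ ≤ 1 / |(k : ℝ)|
      * (ε * ((B / |(k : ℝ)| + V * (B / |(k : ℝ)|)) * ∫ s, |f (x s)|)) := by
    rw [norm_mul, norm_div, norm_one, Complex.norm_intCast]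
    gcongr
  refine (add_le_add h1 h2).trans (le_of_eq ?_)
  rw [← sq_abs (k : ℝ)]
  have : |(k : ℝ)| ≠ 0 := by positivity
  field_simp

theorem exists_norm_modeIntegral_zero_le
    (h : ScalarHomoclinic f a lam x v) (hG : ContDiff ℝ 3 G) :
    ∃ C, 0 ≤ C ∧ ∀ ε, 0 < ε → ‖modeIntegral G x v ε 0‖ ≤ C * ε := by
  obtain ⟨V, hV₀, hV⟩ := h.bounded_v
  have hG2 : ContDiff ℝ 2 (partialSnd G) := contDiff_partialSnd (n := 2) (by norm_num; exact hG)
  obtain ⟨B, hB, hb⟩ := exists_norm_fourierFst_le hG.continuous V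
  obtain ⟨B', hB', hb'⟩ := exists_norm_fourierFst_le hG2.continuous V
  have hI : 0 ≤ ∫ s, |f (x s)| := integral_nonneg fun s => abs_nonneg _
  refine ⟨(B + V * B') * ∫ s, |f (x s)|, by positivity, fun ε hε => ?_⟩
  have := h.norm_integral_amplitude_le hV (hasDerivAt_fourierFst (hG.of_le (by norm_num)) 0)
    (hb 0) (hb' 0) 0 hε
  have e : modeIntegral G x v ε 0 = -∫ s, ((0 * v s - 1 : ℝ) : ℂ) * ((v s : ℂ) *
      fourierFst G 0 (v s)) * Complex.exp (Complex.I * (((0 * x s - s) / ε : ℝ) : ℂ)) := by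
    rw [modeIntegral, ← integral_neg]
    congr 1
    funext s
    push_cast
    ring
  rw [e, norm_neg]
  linarith

/-- Asymptotics of the Melnikov integral. -/
theorem PhaseConstants.exists_melnikov_asymptotics (hp : PhaseConstants f x v c m P b)
    (h : ScalarHomoclinic f a lam x v) (hG : ContDiff ℝ 3 G)
    (hper : ∀ ξ v, G (ξ + 2 * Real.pi, v) = G (ξ, v)) :
    ∃ C, 0 ≤ C ∧ ∀ ε t₀ : ℝ, 0 < ε →
      |(∫ s, v s * (G (x s / ε, v s) * Real.cos ((s + t₀) / ε)))
        - Real.sqrt (2 * Real.pi * ε) *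
          ((∑' k : {k : ℤ // k ≠ 0}, modeSum G f x v ε k).re * Real.cos (t₀ / ε)
            + (∑' k : {k : ℤ // k ≠ 0}, modeSum G f x v ε k).im * Real.sin (t₀ / ε))|
        ≤ C * ε := by
  obtain ⟨C₀, hC₀, h0⟩ := h.exists_norm_modeIntegral_zero_le hG
  obtain ⟨C₁, hC₁, h1⟩ := hp.exists_modeIntegral_asymptotics h hG hper
  obtain ⟨B₂, hB₂, h2⟩ := hp.exists_norm_modeSum_le h hG hper
  obtain ⟨V, hV₀, hV⟩ := h.bounded_v
  obtain ⟨B, hB, hb⟩ := exists_fourierFst_decay hG hper V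
  obtain ⟨B₀, hB₀, hb₀⟩ := exists_norm_fourierFst_le hG.continuous V
  have hsq : Summable fun k : {k : ℤ // k ≠ 0} => 1 / ((k : ℤ) : ℝ) ^ 2 :=
    summable_one_div_int_sq.subtype _
  have hx := h.cont_x
  have hv := h.cont_v
  have hGc := hG.continuous
  set Z := ∑' k : {k : ℤ // k ≠ 0}, 1 / ((k : ℤ) : ℝ) ^ 2 with hZ
  have hZ0 : 0 ≤ Z := tsum_nonneg fun k => by positivity
  refine ⟨C₀ + C₁ * Z, by positivity, fun ε t₀ hε => ?_⟩
  have hFint : ∀ k : ℤ, Integrable fun s => (v s : ℂ) * fourierFst G k (v s)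
      * Complex.exp (Complex.I * (((k * x s - s) / ε : ℝ) : ℂ)) := fun k =>
    h.integrable_amplitude hV (continuous_fourierFst (hG.of_le (by norm_num)) k) (hb₀ k) k ε
  have hFnorm : ∀ (k : ℤ) (s : ℝ), ‖(v s : ℂ) * fourierFst G k (v s)
      * Complex.exp (Complex.I * (((k * x s - s) / ε : ℝ) : ℂ))‖ = |v s| * ‖fourierFst G k (v s)‖ :=
    fun k s => by
      rw [norm_mul, norm_mul, mul_comm Complex.I, Complex.norm_exp_ofReal_mul_I, mul_one,
        Complex.norm_real, Real.norm_eq_abs]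
  have hsum : Summable fun k : ℤ => ∫ s, ‖(v s : ℂ) * fourierFst G k (v s)
      * Complex.exp (Complex.I * (((k * x s - s) / ε : ℝ) : ℂ))‖ := by
    refine Summable.of_norm_bounded_eventually
      (g := fun k : ℤ => (∫ s, |v s|) * B * (1 / (k : ℝ) ^ 2))
      (summable_one_div_int_sq.mul_left _) ?_
    filter_upwards [(finite_singleton (0 : ℤ)).compl_mem_cofinite] with k hk
    rw [Real.norm_of_nonneg (integral_nonneg fun s => norm_nonneg _)]
    have : ∀ s, ‖(v s : ℂ) * fourierFst G k (v s)
      * Complex.exp (Complex.I * (((k * x s - s) / ε : ℝ) : ℂ))‖ ≤ |v s| * (B / (k : ℝ) ^ 2) := by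
      intro s
      rw [hFnorm]
      exact mul_le_mul_of_nonneg_left (hb k hk _ (hV s)).1 (abs_nonneg _)
    refine (integral_mono (hFint k).norm (h.integrable_v.abs.mul_const _) this).trans ?_
    rw [integral_mul_const, mul_assoc, mul_one_div]
  have hHS := hasSum_integral_of_summable_integral_norm hFint hsum
  have hpt : ∀ s, ∑' k : ℤ, (v s : ℂ) * fourierFst G k (v s)
      * Complex.exp (Complex.I * (((k * x s - s) / ε : ℝ) : ℂ))
      = (v s : ℂ) * (G (x s / ε, v s) : ℂ) * Complex.exp (-(Complex.I * ((s / ε : ℝ) : ℂ))) := by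
    intro s
    have := ((hasSum_fourierFst hG hper (x s / ε) (v s)).mul_left (v s : ℂ)).mul_right
      (Complex.exp (-(Complex.I * ((s / ε : ℝ) : ℂ))))
    refine HasSum.tsum_eq (this.congr_fun fun k => ?_)
    rw [mul_assoc, mul_assoc, mul_assoc, ← Complex.exp_add]
    congr 3
    push_cast
    ring
  simp only [hpt] at hHS
  change HasSum (modeIntegral G x v ε) _ at hHS
  set J := ∫ s, (v s : ℂ) * (G (x s / ε, v s) : ℂ) * Complex.exp (-(Complex.I * ((s / ε : ℝ) : ℂ)))
    with hJ
  have hJint : Integrable fun s => (v s : ℂ) * (G (x s / ε, v s) : ℂ)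
      * Complex.exp (-(Complex.I * ((s / ε : ℝ) : ℂ))) := by
    obtain ⟨L, hL⟩ : ∃ L, ∀ s, |G (x s / ε, v s)| ≤ L := by
      have htop : ∀ l, Tendsto x l (𝓝 a) → Tendsto v l (𝓝 0) →
          Tendsto (fun s => G (x s / ε, v s)) l (𝓝 (G (a / ε, 0))) := fun l hx hv =>
        (hGc.tendsto _).comp ((hx.div_const ε).prodMk_nhds hv)
      obtain ⟨L, -, hL⟩ := exists_forall_abs_le_of_tendsto (φ := fun s => G (x s / ε, v s))
        (by fun_prop) (htop _ h.x_top h.v_top) (htop _ h.x_bot h.v_bot)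
      exact ⟨L, hL⟩
    simp only [mul_assoc]
    refine h.integrable_v.ofReal.mul_bdd (c := L)
      (Continuous.aestronglyMeasurable (by fun_prop)) (Eventually.of_forall fun s => ?_)
    have e : -(Complex.I * ((s / ε : ℝ) : ℂ)) = ((-(s / ε) : ℝ) : ℂ) * Complex.I := by
      push_cast; ring
    rw [norm_mul, e, Complex.norm_exp_ofReal_mul_I, mul_one, Complex.norm_real]
    exact hL s
  have hre : (∫ s, v s * (G (x s / ε, v s) * Real.cos ((s + t₀) / ε)))
      = (Complex.exp (-(Complex.I * ((t₀ / ε : ℝ) : ℂ))) * J).re := by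
    rw [hJ, ← integral_const_mul]
    refine (Eq.trans ?_ (integral_re (hJint.const_mul _)))
    congr 1
    funext s
    have e : Complex.exp (-(Complex.I * ((t₀ / ε : ℝ) : ℂ))) * ((v s : ℂ) * (G (x s / ε, v s) : ℂ)
        * Complex.exp (-(Complex.I * ((s / ε : ℝ) : ℂ))))
        = ((v s * G (x s / ε, v s) : ℝ) : ℂ)
          * Complex.exp (((-((s + t₀) / ε) : ℝ) : ℂ) * Complex.I) := by
      have : (((-((s + t₀) / ε) : ℝ) : ℂ) * Complex.I)
        = -(Complex.I * ((t₀ / ε : ℝ) : ℂ)) + -(Complex.I * ((s / ε : ℝ) : ℂ)) := by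
        push_cast; ring
      rw [this, Complex.exp_add]
      push_cast
      ring
    rw [e]
    change _ = (((v s * G (x s / ε, v s) : ℝ) : ℂ)
          * Complex.exp (((-((s + t₀) / ε) : ℝ) : ℂ) * Complex.I)).re
    rw [Complex.re_ofReal_mul, Complex.exp_ofReal_mul_I_re, Real.cos_neg, mul_assoc]
  set S := ∑' k : {k : ℤ // k ≠ 0}, modeSum G f x v ε k with hS
  have hrot : S.re * Real.cos (t₀ / ε) + S.im * Real.sin (t₀ / ε)
      = (Complex.exp (-(Complex.I * ((t₀ / ε : ℝ) : ℂ))) * S).re := by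
    have e : -(Complex.I * ((t₀ / ε : ℝ) : ℂ)) = ((-(t₀ / ε) : ℝ) : ℂ) * Complex.I := by
      push_cast; ring
    rw [e, Complex.mul_re, Complex.exp_ofReal_mul_I_re, Complex.exp_ofReal_mul_I_im, Real.cos_neg,
      Real.sin_neg]
    ring
  have hSsum : Summable fun k : {k : ℤ // k ≠ 0} => modeSum G f x v ε k :=
    Summable.of_norm_bounded (g := fun k : {k : ℤ // k ≠ 0} => B₂ * (1 / ((k : ℤ) : ℝ) ^ 2))
      (hsq.mul_left _) fun k => by rw [mul_one_div]; exact h2 k k.2 ε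
  have hIsum : Summable fun k : {k : ℤ // k ≠ 0} => modeIntegral G x v ε k :=
    hHS.summable.subtype _
  have hJsplit : J = modeIntegral G x v ε 0 + ∑' k : {k : ℤ // k ≠ 0}, modeIntegral G x v ε k := by
    have := hHS.summable.tsum_subtype_add_tsum_subtype_compl {0}
    rw [hHS.tsum_eq, tsum_singleton] at this
    exact this.symm
  have hdiff : ‖J - Real.sqrt (2 * Real.pi * ε) * S‖ ≤ (C₀ + C₁ * Z) * ε := by
    rw [hJsplit, hS, ← tsum_mul_left, add_sub_assoc,
      ← hIsum.tsum_sub (hSsum.mul_left _)]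
    refine (norm_add_le _ _).trans ?_
    have h3 := tsum_of_norm_bounded (f := fun k : {k : ℤ // k ≠ 0} => modeIntegral G x v ε k
      - Real.sqrt (2 * Real.pi * ε) * modeSum G f x v ε k)
      (hsq.hasSum.mul_left (C₁ * ε)) fun k => by rw [mul_one_div]; exact h1 k k.2 ε hε
    linarith [h0 ε hε]
  rw [hre, hrot, ← Complex.re_ofReal_mul, ← Complex.sub_re]
  refine (Complex.abs_re_le_norm _).trans ?_
  have e : Complex.exp (-(Complex.I * ((t₀ / ε : ℝ) : ℂ))) * J - ((Real.sqrt (2 * Real.pi * ε) : ℝ)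
      : ℂ) * (Complex.exp (-(Complex.I * ((t₀ / ε : ℝ) : ℂ))) * S)
      = Complex.exp (((-(t₀ / ε) : ℝ) : ℂ) * Complex.I)
        * (J - Real.sqrt (2 * Real.pi * ε) * S) := by
    have : -(Complex.I * ((t₀ / ε : ℝ) : ℂ)) = ((-(t₀ / ε) : ℝ) : ℂ) * Complex.I := by
      push_cast; ring
    rw [this]; ring
  rw [e, norm_mul, Complex.norm_exp_ofReal_mul_I, one_mul]
  exact hdiff

end ScalarHomoclinic

/-- A hyperbolic equilibrium with a homoclinic connection is a saddle. -/
theorem IsHomoclinic.scalarHomoclinic {f : ℝ → ℝ} (hf : ContDiff ℝ 3 f) {e : Plane}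
    (he : IsHyperbolicEquilibrium (unperturbed f) e) {z₀ : ℝ → Plane}
    (hz₀ : IsHomoclinic (unperturbed f) e z₀) :
    e.2 = 0 ∧ ∃ lam, ScalarHomoclinic f e.1 lam (fun t => (z₀ t).1) (fun t => (z₀ t).2) := by
  obtain ⟨h0, A, hA, hspec⟩ := he
  obtain ⟨hd, hne, htop, hbot⟩ := hz₀
  rw [unperturbed, Prod.mk_eq_zero] at h0
  obtain ⟨he2, hfe⟩ := h0
  have hfd := (hf.differentiable (by norm_num) e.1).hasDerivAt
  have hA' : HasFDerivAt (unperturbed f) ((ContinuousLinearMap.snd ℝ ℝ ℝ).prod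
      (deriv f e.1 • ContinuousLinearMap.fst ℝ ℝ ℝ)) e :=
    hasFDerivAt_snd.prodMk (hfd.comp_hasFDerivAt e hasFDerivAt_fst)
  have hAe := hA.unique hA'
  have hpos : 0 < deriv f e.1 := by
    by_contra hcon
    push Not at hcon
    refine hspec (Complex.I * Real.sqrt (-deriv f e.1)) (by simp) ?_
    have hs : ((Real.sqrt (-deriv f e.1) : ℝ) : ℂ) ^ 2 = ((-deriv f e.1 : ℝ) : ℂ) := by
      exact_mod_cast Real.sq_sqrt (by linarith)
    rw [aeval_charpoly_plane, hAe]
    simp only [ContinuousLinearMap.prod_apply, ContinuousLinearMap.coe_snd', smul_apply,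
      ContinuousLinearMap.coe_fst', smul_eq_mul, mul_one, mul_zero, Complex.ofReal_zero, sub_zero,
      Complex.ofReal_one, one_mul]
    have hI : Complex.I * ((Real.sqrt (-deriv f e.1) : ℝ) : ℂ)
        * (Complex.I * ((Real.sqrt (-deriv f e.1) : ℝ) : ℂ))
        = Complex.I ^ 2 * ((Real.sqrt (-deriv f e.1) : ℝ) : ℂ) ^ 2 := by ring
    rw [hI, hs, Complex.I_sq]
    push_cast
    ring
  refine ⟨he2, Real.sqrt (deriv f e.1), hf, Real.sqrt_pos.2 hpos, hfe,
    (Real.sq_sqrt hpos.le).symm, fun t => ?_, fun t => ?_, ?_, ?_, ?_, ?_, ?_⟩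
  · exact (hasFDerivAt_fst (p := z₀ t)).comp_hasDerivAt t (hd t)
  · exact (hasFDerivAt_snd (p := z₀ t)).comp_hasDerivAt t (hd t)
  · exact (continuous_fst.tendsto e).comp htop
  · exact (continuous_fst.tendsto e).comp hbot
  · exact he2 ▸ (continuous_snd.tendsto e).comp htop
  · exact he2 ▸ (continuous_snd.tendsto e).comp hbot
  · obtain ⟨t, ht⟩ := hne
    exact ⟨t, fun hc => ht (Prod.ext hc.1 (hc.2.trans he2.symm))⟩

/-- Bounds for the amplitude `q`, uniform in the small parameter. -/
structure AmplitudeBounds (q : ℝ → ℝ → ℝ → ℝ) (M L ε₂ : ℝ) : Prop where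
  pos : 0 < ε₂
  nonneg : 0 ≤ L
  cont : ∀ ε ∈ Icc 0 ε₂, Continuous fun p : ℝ × ℝ => q p.1 p.2 ε
  lip : ∀ ε ∈ Icc 0 ε₂, ∀ ξ ξ' v v', |v| ≤ M → |v'| ≤ M →
    |q ξ v ε - q ξ' v' ε| ≤ L * max |ξ - ξ'| |v - v'|
  bound : ∀ ε ∈ Icc 0 ε₂, ∀ ξ v, |v| ≤ M → |q ξ v ε| ≤ L
  sub_zero : ∀ ε ∈ Icc 0 ε₂, ∀ ξ v, |v| ≤ M → |q ξ v ε - q ξ v 0| ≤ L * ε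

theorem AmplitudeBounds.reflect {q : ℝ → ℝ → ℝ → ℝ} {M L ε₂ : ℝ} (h : AmplitudeBounds q M L ε₂) :
    AmplitudeBounds (fun ξ v => q ξ (-v)) M L ε₂ where
  pos := h.pos
  nonneg := h.nonneg
  cont ε hε := (h.cont ε hε).comp (by fun_prop : Continuous fun p : ℝ × ℝ => (p.1, -p.2))
  lip ε hε ξ ξ' v v' hv hv' := by
    have := h.lip ε hε ξ ξ' (-v) (-v') (by rwa [abs_neg]) (by rwa [abs_neg])
    rwa [neg_sub_neg, abs_sub_comm v' v] at this
  bound ε hε ξ v hv := h.bound ε hε ξ (-v) (by rwa [abs_neg])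
  sub_zero ε hε ξ v hv := h.sub_zero ε hε ξ (-v) (by rwa [abs_neg])

theorem exists_amplitudeBounds {q : ℝ → ℝ → ℝ → ℝ} {ε₁ : ℝ} (hε₁ : 0 < ε₁)
    (hq : ContDiffOn ℝ 1 (fun p : ℝ × ℝ × ℝ => q p.1 p.2.1 p.2.2) {p | p.2.2 ∈ Set.Ico 0 ε₁})
    (hq3 : ∀ ε ∈ Set.Ico 0 ε₁, ContDiff ℝ 3 (fun p : ℝ × ℝ => q p.1 p.2 ε))
    (hper : ∀ ε ∈ Set.Ico 0 ε₁, ∀ ξ v : ℝ, q (ξ + 2 * Real.pi) v ε = q ξ v ε) (M : ℝ) :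
    ∃ L, AmplitudeBounds q M L (ε₁ / 2) := by
  have h2π := Real.two_pi_pos
  set K : Set (ℝ × ℝ × ℝ) := Icc (-(2 * Real.pi)) (2 * (2 * Real.pi)) ×ˢ Icc (-M) M ×ˢ Icc 0 (ε₁ / 2)
    with hK
  have hKsub : K ⊆ {p : ℝ × ℝ × ℝ | p.2.2 ∈ Set.Ico 0 ε₁} := fun p hp =>
    ⟨hp.2.2.1, hp.2.2.2.trans_lt (half_lt_self hε₁)⟩
  have hKc : IsCompact K := isCompact_Icc.prod (isCompact_Icc.prod isCompact_Icc)
  have hKconv : Convex ℝ K := (convex_Icc _ _).prod ((convex_Icc _ _).prod (convex_Icc _ _))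
  obtain ⟨L₁, hL₁⟩ := (hq.mono hKsub).exists_lipschitzOnWith one_ne_zero hKconv hKc
  obtain ⟨L₂, hL₂⟩ := hKc.exists_bound_of_continuousOn (hq.continuousOn.mono hKsub)
  have hdom : ∀ ε ∈ Icc 0 (ε₁ / 2), ε ∈ Ico 0 ε₁ := fun ε hε =>
    ⟨hε.1, hε.2.trans_lt (half_lt_self hε₁)⟩
  have hshift : ∀ ξ : ℝ, ∃ n : ℤ, 0 ≤ ξ - n * (2 * Real.pi) ∧ ξ - n * (2 * Real.pi) ≤ 2 * Real.pi ∧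
      ∀ ε ∈ Icc 0 (ε₁ / 2), ∀ ξ v, q (ξ - n * (2 * Real.pi)) v ε = q ξ v ε := by
    intro ξ
    obtain ⟨n, hn, -⟩ := existsUnique_sub_zsmul_mem_Ico h2π ξ 0
    rw [zsmul_eq_mul, zero_add] at hn
    refine ⟨n, hn.1, hn.2.le, fun ε hε ξ v => ?_⟩
    exact Function.Periodic.sub_int_mul_eq (f := fun ξ => q ξ v ε)
      (fun ξ => hper ε (hdom ε hε) ξ v) n
  set L := max (L₁ : ℝ) L₂ with hL
  have hL0 : 0 ≤ L := L₁.2.trans (le_max_left _ _)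
  have hlip : ∀ p ∈ K, ∀ p' ∈ K, |q p.1 p.2.1 p.2.2 - q p'.1 p'.2.1 p'.2.2| ≤ L * ‖p - p'‖ := by
    intro p hp p' hp'
    have := hL₁.dist_le_mul p hp p' hp'
    rw [Real.dist_eq, dist_eq_norm] at this
    exact this.trans (mul_le_mul_of_nonneg_right (le_max_left _ _) (norm_nonneg _))
  have hclose : ∀ ε ∈ Icc 0 (ε₁ / 2), ∀ ξ ξ' v v', 0 ≤ ξ → ξ ≤ 2 * Real.pi →
      |ξ - ξ'| ≤ 2 * Real.pi → |v| ≤ M → |v'| ≤ M →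
      |q ξ v ε - q ξ' v' ε| ≤ L * max |ξ - ξ'| |v - v'| := by
    intro ε hε ξ ξ' v v' h0 h1 h2 hv hv'
    rw [abs_le] at h2
    have := hlip (ξ, v, ε) ⟨⟨by linarith, by linarith⟩, abs_le.1 hv, hε⟩ (ξ', v', ε)
      ⟨⟨by linarith, by linarith⟩, abs_le.1 hv', hε⟩
    rw [Prod.mk_sub_mk, Prod.mk_sub_mk, Prod.norm_mk, Prod.norm_mk, sub_self, norm_zero,
      max_eq_left (norm_nonneg (v - v'))] at this
    exact this
  refine ⟨L, half_pos hε₁, hL0, fun ε hε => (hq3 ε (hdom ε hε)).continuous, ?_, ?_, ?_⟩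
  · intro ε hε ξ ξ' v v' hv hv'
    obtain ⟨n, hn0, hn1, hn⟩ := hshift ξ
    rcases le_total |ξ - ξ'| (2 * Real.pi) with hc | hc
    · have := hclose ε hε (ξ - n * (2 * Real.pi)) (ξ' - n * (2 * Real.pi)) v v' hn0 hn1
        (by rwa [sub_sub_sub_cancel_right]) hv hv'
      rwa [sub_sub_sub_cancel_right, hn ε hε, hn ε hε] at this
    · obtain ⟨n', hn0', hn1', hn'⟩ := hshift ξ'
      have hd : |(ξ - n * (2 * Real.pi)) - (ξ' - n' * (2 * Real.pi))| ≤ 2 * Real.pi :=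
        abs_le.2 ⟨by linarith, by linarith⟩
      have := hclose ε hε (ξ - n * (2 * Real.pi)) (ξ' - n' * (2 * Real.pi)) v v' hn0 hn1 hd hv hv'
      rw [hn ε hε, hn' ε hε] at this
      exact this.trans (mul_le_mul_of_nonneg_left (max_le_max_right _ (hd.trans hc)) hL0)
  · intro ε hε ξ v hv
    obtain ⟨n, hn0, hn1, hn⟩ := hshift ξ
    have := hL₂ (ξ - n * (2 * Real.pi), v, ε) ⟨⟨by linarith, by linarith⟩, abs_le.1 hv, hε⟩
    simp only [hn ε hε] at this
    exact this.trans (le_max_right _ _)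
  · intro ε hε ξ v hv
    obtain ⟨n, hn0, hn1, hn⟩ := hshift ξ
    have h00 : (0 : ℝ) ∈ Icc 0 (ε₁ / 2) := ⟨le_rfl, by positivity⟩
    have := hlip (ξ - n * (2 * Real.pi), v, ε) ⟨⟨by linarith, by linarith⟩, abs_le.1 hv, hε⟩
      (ξ - n * (2 * Real.pi), v, 0) ⟨⟨by linarith, by linarith⟩, abs_le.1 hv, h00⟩
    rw [Prod.mk_sub_mk, Prod.mk_sub_mk, Prod.norm_mk, Prod.norm_mk, sub_self, sub_self, norm_zero,
      sub_zero, max_eq_right (norm_nonneg ε), max_eq_right (norm_nonneg ε), Real.norm_of_nonneg hε.1]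
      at this
    simpa only [hn ε hε, hn 0 h00] using this

/-- The perturbation, with time counted from `t₀`. -/
noncomputable def forcing (q : ℝ → ℝ → ℝ → ℝ) (r ε t₀ s : ℝ) (z : Plane) : ℝ :=
  ε ^ r * (q (z.1 / ε) z.2 ε * Real.cos ((s + t₀) / ε))

section forcing

variable {q : ℝ → ℝ → ℝ → ℝ} {M L ε₂ r ε : ℝ}

theorem AmplitudeBounds.continuous_forcing (hb : AmplitudeBounds q M L ε₂) (hε : 0 < ε)
    (hε₂ : ε ≤ ε₂) (r t₀ : ℝ) : Continuous fun p : ℝ × Plane => forcing q r ε t₀ p.1 p.2 := by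
  have h1 := (hb.cont ε ⟨hε.le, hε₂⟩).comp
    (by fun_prop : Continuous fun p : ℝ × Plane => (p.2.1 / ε, p.2.2))
  exact continuous_const.mul (h1.mul (by fun_prop))

theorem AmplitudeBounds.abs_amplitude_sub_le (hb : AmplitudeBounds q M L ε₂) (hε : 0 < ε)
    (hε1 : ε ≤ 1) (hε₂ : ε ≤ ε₂) (r : ℝ) {z z' : Plane} (hz : |z.2| ≤ M) (hz' : |z'.2| ≤ M) :
    |ε ^ r * q (z.1 / ε) z.2 ε - ε ^ r * q (z'.1 / ε) z'.2 ε| ≤ ε ^ (r - 1) * L * ‖z - z'‖ := by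
  have h1 := hb.lip ε ⟨hε.le, hε₂⟩ (z.1 / ε) (z'.1 / ε) z.2 z'.2 hz hz'
  have h2 : max |z.1 / ε - z'.1 / ε| |z.2 - z'.2| ≤ ‖z - z'‖ / ε := by
    refine max_le ?_ ?_
    · rw [← sub_div, abs_div, abs_of_pos hε]
      exact div_le_div_of_nonneg_right (norm_fst_le (z - z')) hε.le
    · exact (norm_snd_le (z - z')).trans (le_div_self (norm_nonneg _) hε hε1)
  rw [← mul_sub, abs_mul, abs_of_pos (Real.rpow_pos_of_pos hε r), Real.rpow_sub_one hε.ne']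
  calc ε ^ r * |q (z.1 / ε) z.2 ε - q (z'.1 / ε) z'.2 ε|
      ≤ ε ^ r * (L * (‖z - z'‖ / ε)) := by
        have := hb.nonneg
        gcongr
        exact h1.trans (by gcongr)
    _ = _ := by ring

theorem AmplitudeBounds.abs_forcing_sub_le (hb : AmplitudeBounds q M L ε₂) (hε : 0 < ε)
    (hε1 : ε ≤ 1) (hε₂ : ε ≤ ε₂) (r t₀ s : ℝ) {z z' : Plane} (hz : |z.2| ≤ M) (hz' : |z'.2| ≤ M) :
    |forcing q r ε t₀ s z - forcing q r ε t₀ s z'| ≤ ε ^ (r - 1) * L * ‖z - z'‖ := by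
  have h1 := hb.abs_amplitude_sub_le hε hε1 hε₂ r hz hz'
  have e : forcing q r ε t₀ s z - forcing q r ε t₀ s z'
      = (ε ^ r * q (z.1 / ε) z.2 ε - ε ^ r * q (z'.1 / ε) z'.2 ε) * Real.cos ((s + t₀) / ε) := by
    unfold forcing; ring
  rw [e, abs_mul]
  exact (mul_le_of_le_one_right (abs_nonneg _) (Real.abs_cos_le_one _)).trans h1

theorem AmplitudeBounds.abs_forcing_le (hb : AmplitudeBounds q M L ε₂) (hε : 0 < ε)
    (hε₂ : ε ≤ ε₂) (r t₀ s : ℝ) {z : Plane} (hz : |z.2| ≤ M) :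
    |forcing q r ε t₀ s z| ≤ ε ^ r * L := by
  unfold forcing
  rw [abs_mul, abs_mul, abs_of_pos (Real.rpow_pos_of_pos hε r)]
  gcongr
  exact (mul_le_of_le_one_right (abs_nonneg _) (Real.abs_cos_le_one _)).trans
    (hb.bound ε ⟨hε.le, hε₂⟩ _ _ hz)

end forcing

/-- The orbit of `ẋ = v`, `v̇ = f x + g t (x, v)` through `w` stays `δ`-close to the orbit `(x, v)`
at positive times without meeting again the normal segment through `(x 0, v 0)`, and `w` is the
only point of the normal line whose orbit stays `δ`-close to `(x, v)`. -/
structure IsFollowingPoint (f x v : ℝ → ℝ) (g : ℝ → ℝ × ℝ → ℝ) (δ : ℝ) (w : ℝ × ℝ) : Prop where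
  exists_sol : ∃ u : ℝ → ℝ × ℝ, (∀ t, 0 ≤ t → HasDerivAt u ((u t).2, f (u t).1 + g t (u t)) t) ∧
    u 0 = w ∧ (∃ s : ℝ, |s| ≤ δ ∧ w - (x 0, v 0) = s • (-f (x 0), v 0)) ∧
    (∀ t, 0 ≤ t → ‖u t - (x t, v t)‖ ≤ δ) ∧
    ∀ t, 0 < t → ∀ s : ℝ, |s| ≤ δ → u t - (x 0, v 0) ≠ s • (-f (x 0), v 0)
  unique : ∀ u' : ℝ → ℝ × ℝ,
    (∀ t, 0 ≤ t → HasDerivWithinAt u' ((u' t).2, f (u' t).1 + g t (u' t)) (Ici 0) t) →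
    (∀ t, 0 < t → ‖u' t - (x t, v t)‖ ≤ δ) →
    (∃ s : ℝ, u' 0 - (x 0, v 0) = s • (-f (x 0), v 0)) → u' 0 = w

namespace ScalarHomoclinic

variable {f : ℝ → ℝ} {a lam : ℝ} {x v : ℝ → ℝ}

/-- The point of the normal segment whose forward orbit follows the homoclinic orbit. -/
theorem exists_stable_point (h : ScalarHomoclinic f a lam x v) :
    ∃ R > 0, ∃ δ₁ > 0, ∃ κ > 0, ∃ C > 0, ∀ (g : ℝ → ℝ × ℝ → ℝ) (ℓ m : ℝ),
      Continuous (fun p : ℝ × ℝ × ℝ => g p.1 p.2) → 0 ≤ ℓ → ℓ ≤ κ →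
      (∀ t z z', ‖z - (x t, v t)‖ ≤ R → ‖z' - (x t, v t)‖ ≤ R →
        |g t z - g t z'| ≤ ℓ * ‖z - z'‖) →
      (∀ t z, ‖z - (x t, v t)‖ ≤ R → |g t z| ≤ m) → m ≤ κ →
      ∃ w : ℝ × ℝ, |(v 0 * (w - (x 0, v 0)).2 - f (x 0) * (w - (x 0, v 0)).1)
          + ∫ t in Ioi 0, v t * g t (x t, v t)| ≤ C * (m ^ 2 + ℓ * m) ∧
        ∀ δ, 0 < δ → δ ≤ δ₁ → m ≤ κ * δ → IsFollowingPoint f x v g δ w := by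
  obtain ⟨δ₀, hδ₀, ℓ₀, hℓ₀, C, hC, hstab⟩ := h.exists_stable
  obtain ⟨δ₁, hδ₁, m₁, hm₁, hseg⟩ := h.exists_notMem_segment
  set n := ‖((-f (x 0), v 0) : ℝ × ℝ)‖ with hn
  have hn0 : 0 < n := by
    refine norm_pos_iff.2 fun h0 => ?_
    rw [Prod.mk_eq_zero, neg_eq_zero] at h0
    have := h.speed_pos 0
    rw [h0.1, h0.2] at this
    norm_num at this
  have hκ : 0 < min (min ℓ₀ m₁) (min (δ₀ / C) (min (1 / C) (n / C))) := by positivity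
  refine ⟨δ₀, hδ₀, min δ₀ δ₁, by positivity, _, hκ, C, hC, ?_⟩
  set κ := min (min ℓ₀ m₁) (min (δ₀ / C) (min (1 / C) (n / C))) with hκdef
  have k1 : κ ≤ ℓ₀ := (min_le_left _ _).trans (min_le_left _ _)
  have k2 : κ ≤ m₁ := (min_le_left _ _).trans (min_le_right _ _)
  have k3 : C * κ ≤ δ₀ := by
    rw [← le_div_iff₀' hC]; exact (min_le_right _ _).trans (min_le_left _ _)
  have k4 : C * κ ≤ 1 := by
    rw [← le_div_iff₀' hC]
    exact (min_le_right _ _).trans ((min_le_right _ _).trans (min_le_left _ _))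
  have k5 : C * κ ≤ n := by
    rw [← le_div_iff₀' hC]
    exact (min_le_right _ _).trans ((min_le_right _ _).trans (min_le_right _ _))
  clear_value κ
  intro g ℓ m hgc hℓ0 hℓ hgL hgm hm
  have hzero : ∀ t, ‖((x t, v t) : ℝ × ℝ) - (x t, v t)‖ ≤ δ₀ := fun t => by
    rw [sub_self, norm_zero]; exact hδ₀.le
  obtain ⟨u, hu, hub, ⟨s, hs⟩, hmel, huniq⟩ := hstab g ℓ m hgc hℓ0 (hℓ.trans k1) hgL
    (fun t => hgm t _ (hzero t)) ((mul_le_mul_of_nonneg_left hm hC.le).trans k3)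
  refine ⟨u 0, hmel, fun δ hδ hδ₁' hmδ => ⟨⟨u, hu, rfl, ⟨s, ?_, hs⟩, ?_, ?_⟩, ?_⟩⟩
  · have h1 := hub 0 le_rfl
    rw [hs, norm_smul, Real.norm_eq_abs, ← hn] at h1
    have h2 : |s| * n ≤ δ * n := by
      refine h1.trans ((mul_le_mul_of_nonneg_left hmδ hC.le).trans ?_)
      nlinarith
    exact le_of_mul_le_mul_right h2 hn0
  · intro t ht
    refine (hub t ht).trans ((mul_le_mul_of_nonneg_left hmδ hC.le).trans ?_)
    nlinarith
  · have hclose : ∀ t, 0 ≤ t → ‖u t - (x t, v t)‖ ≤ δ := fun t ht => by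
      refine (hub t ht).trans ((mul_le_mul_of_nonneg_left hmδ hC.le).trans ?_)
      nlinarith
    exact hseg g u δ hδ.le (hδ₁'.trans (min_le_right _ _)) hu
      (fun t ht => (hgm t _ ((hclose t ht).trans (hδ₁'.trans (min_le_left _ _)))).trans (hm.trans k2))
      hclose ⟨s, hs⟩
  · intro u' hu' hu'b hs'
    refine huniq u' hu' (fun t ht => ?_) hs' 0 le_rfl
    have hδ' : δ ≤ δ₀ := hδ₁'.trans (min_le_left _ _)
    rcases ht.eq_or_lt with rfl | ht
    · have hc : ContinuousWithinAt (fun t => ‖u' t - (x t, v t)‖) (Ioi 0) 0 :=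
        (((hu' 0 le_rfl).continuousWithinAt.mono Ioi_subset_Ici_self).sub
          (h.cont_x.prodMk h.cont_v).continuousWithinAt).norm
      exact le_of_tendsto hc (eventually_nhdsWithin_of_forall fun t ht => (hu'b t ht).trans hδ')
    · exact (hu'b t ht).trans hδ'

end ScalarHomoclinic

theorem mem_normalSegment_iff {f : ℝ → ℝ} {Z w : Plane} {δ : ℝ} :
    w ∈ normalSegment (unperturbed f) Z δ ↔ ∃ s : ℝ, |s| ≤ δ ∧ w - Z = s • (-f Z.1, Z.2) := by
  simp only [sub_eq_iff_eq_add']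
  rfl

theorem norm_neg_snd (z : Plane) : ‖((z.1, -z.2) : Plane)‖ = ‖z‖ := by
  rw [Prod.norm_mk, norm_neg, Prod.norm_def]

section sides

variable {f : ℝ → ℝ} {q : ℝ → ℝ → ℝ → ℝ} {r ε t₀ δ : ℝ} {z₀ : ℝ → Plane} {w e : Plane}

theorem IsFollowingPoint.isFirstStablePoint
    (hw : IsFollowingPoint f (fun t => (z₀ t).1) (fun t => (z₀ t).2) (forcing q r ε t₀) δ w)
    (he : Tendsto z₀ atTop (𝓝 e)) {ρ T : ℝ} (hρ : 0 < ρ) (hδ : δ ≤ ρ / 4) {p : Plane}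
    (hp : ∀ u, IsSolOn (perturbed f q r ε) u (Ici t₀) →
      (∀ᶠ t in atTop, u t ∈ Metric.closedBall e (ρ / 2)) →
      Tendsto (fun n : ℕ => u (t₀ + n * T)) atTop (𝓝 p)) :
    IsFirstStablePoint (perturbed f q r ε) T z₀ (normalSegment (unperturbed f) (z₀ 0) δ) δ t₀ p
      w := by
  obtain ⟨u, hu, hu0, hseg, hclose, hmiss⟩ := hw.exists_sol
  have hsol : IsSolOn (perturbed f q r ε) (fun t => u (t - t₀)) (Ici t₀) := by
    intro t ht
    have h1 := (hu (t - t₀) (sub_nonneg.2 ht)).comp_sub_const t t₀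
    rw [forcing, sub_add_cancel] at h1
    exact h1.hasDerivWithinAt
  have h0 : u (t₀ - t₀) = w := by rw [sub_self, hu0]
  refine ⟨mem_normalSegment_iff.2 hseg, ⟨_, hsol, h0, hp _ hsol ?_⟩, _, hsol, h0, fun t ht =>
    ⟨hclose _ (sub_nonneg.2 ht.le), fun hmem => ?_⟩⟩
  · have h1 : Tendsto (fun t => z₀ (t - t₀)) atTop (𝓝 e) :=
      he.comp (tendsto_atTop_add_const_right _ (-t₀) tendsto_id)
    filter_upwards [h1.eventually (Metric.closedBall_mem_nhds e (by positivity : 0 < ρ / 4)),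
      eventually_ge_atTop t₀] with t ht1 ht2
    have h2 := hclose (t - t₀) (sub_nonneg.2 ht2)
    rw [dist_eq_norm] at ht1
    rw [Metric.mem_closedBall, dist_eq_norm]
    have h3 := norm_sub_le_norm_sub_add_norm_sub (u (t - t₀)) (z₀ (t - t₀)) e
    change ‖u (t - t₀) - z₀ (t - t₀)‖ ≤ δ at h2
    linarith
  · obtain ⟨s, hs, hs'⟩ := mem_normalSegment_iff.1 hmem
    exact hmiss _ (sub_pos.2 ht) s hs hs'

theorem IsFollowingPoint.eq_of_isFirstStablePoint
    (hw : IsFollowingPoint f (fun t => (z₀ t).1) (fun t => (z₀ t).2) (forcing q r ε t₀) δ w)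
    {T : ℝ} {p w' : Plane}
    (h : IsFirstStablePoint (perturbed f q r ε) T z₀ (normalSegment (unperturbed f) (z₀ 0) δ) δ t₀ p
      w') : w' = w := by
  obtain ⟨hS, -, u, hu, hu0, hclose⟩ := h
  obtain ⟨s, -, hs⟩ := mem_normalSegment_iff.1 hS
  have h0 : u (0 + t₀) = w' := by rw [zero_add, hu0]
  rw [← h0]
  refine hw.unique (fun t => u (t + t₀)) (fun t ht => ?_) (fun t ht => ?_) ⟨s, ?_⟩
  · have h1 := hu (t + t₀) (le_add_of_nonneg_left ht)
    have h2 : HasDerivWithinAt (fun t : ℝ => t + t₀) 1 (Ici 0) t :=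
      ((hasDerivAt_id t).add_const t₀).hasDerivWithinAt
    have h3 := HasDerivWithinAt.scomp (h := fun t => t + t₀) t h1 h2
      fun s hs => le_add_of_nonneg_left (mem_Ici.1 hs)
    rwa [one_smul] at h3
  · have := (hclose (t + t₀) (lt_add_of_pos_left _ ht)).1
    rwa [add_sub_cancel_right] at this
  · change u (0 + t₀) - z₀ 0 = _
    rw [h0, hs]

theorem IsFollowingPoint.isFirstUnstablePoint
    (hw : IsFollowingPoint f (fun t => (z₀ (-t)).1) (fun t => -(z₀ (-t)).2)
      (forcing (fun ξ v => q ξ (-v)) r ε (-t₀)) δ w)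
    (he : Tendsto z₀ atBot (𝓝 e)) {ρ T : ℝ} (hρ : 0 < ρ) (hδ : δ ≤ ρ / 4) {p : Plane}
    (hp : ∀ u, IsSolOn (perturbed f q r ε) u (Iic t₀) →
      (∀ᶠ t in atBot, u t ∈ Metric.closedBall e (ρ / 2)) →
      Tendsto (fun n : ℕ => u (t₀ - n * T)) atTop (𝓝 p)) :
    IsFirstUnstablePoint (perturbed f q r ε) T z₀ (normalSegment (unperturbed f) (z₀ 0) δ) δ t₀ p
      (w.1, -w.2) := by
  obtain ⟨y, hy, hy0, hseg, hclose, hmiss⟩ := hw.exists_sol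
  set u : ℝ → Plane := fun t => ((y (t₀ - t)).1, -(y (t₀ - t)).2) with hu
  have hsol : IsSolOn (perturbed f q r ε) u (Iic t₀) := by
    intro t ht
    have h1 := (hy (t₀ - t) (sub_nonneg.2 ht)).scomp t ((hasDerivAt_id t).const_sub t₀)
    have h2 := (hasFDerivAt_fst (𝕜 := ℝ) (p := y (t₀ - t))).comp_hasDerivAt t h1
    have h3 := ((hasFDerivAt_snd (𝕜 := ℝ) (p := y (t₀ - t))).comp_hasDerivAt t h1).neg
    refine ((h2.prodMk h3).congr_deriv ?_).hasDerivWithinAt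
    have e1 : (t₀ - t + -t₀) / ε = -(t / ε) := by ring
    simp [perturbed, forcing, hu, e1]
  have hdiff : ∀ t, u t - z₀ (t - t₀) = ((y (t₀ - t) - ((z₀ (-(t₀ - t))).1,
      -(z₀ (-(t₀ - t))).2)).1, -(y (t₀ - t) - ((z₀ (-(t₀ - t))).1, -(z₀ (-(t₀ - t))).2)).2) := by
    intro t
    rw [neg_sub]
    ext
    · rfl
    · simp [hu]; ring
  have hcl : ∀ t, t ≤ t₀ → ‖u t - z₀ (t - t₀)‖ ≤ δ := fun t ht => by
    rw [hdiff, norm_neg_snd]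
    exact hclose _ (sub_nonneg.2 ht)
  have h0 : u t₀ = (w.1, -w.2) := by simp only [hu, sub_self, hy0]
  simp only [neg_zero] at hseg hmiss
  refine ⟨mem_normalSegment_iff.2 ?_, ⟨_, hsol, h0, hp _ hsol ?_⟩, _, hsol, h0, fun t ht =>
    ⟨hcl t ht.le, fun hmem => ?_⟩⟩
  · obtain ⟨s, hs, hs'⟩ := hseg
    refine ⟨s, hs, ?_⟩
    rw [Prod.ext_iff] at hs' ⊢
    simp only [Prod.fst_sub, Prod.snd_sub, Prod.smul_fst, Prod.smul_snd, smul_eq_mul] at hs' ⊢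
    exact ⟨hs'.1, by linarith [hs'.2]⟩
  · have h1 : Tendsto (fun t => z₀ (t - t₀)) atBot (𝓝 e) :=
      he.comp (tendsto_atBot_add_const_right _ (-t₀) tendsto_id)
    filter_upwards [h1.eventually (Metric.closedBall_mem_nhds e (by positivity : 0 < ρ / 4)),
      eventually_le_atBot t₀] with t ht1 ht2
    have h2 := hcl t ht2
    rw [dist_eq_norm] at ht1
    rw [Metric.mem_closedBall, dist_eq_norm]
    have h3 := norm_sub_le_norm_sub_add_norm_sub (u t) (z₀ (t - t₀)) e
    linarith
  · obtain ⟨s, hs, hs'⟩ := mem_normalSegment_iff.1 hmem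
    refine hmiss _ (sub_pos.2 ht) s hs ?_
    rw [Prod.ext_iff] at hs' ⊢
    simp only [hu, Prod.fst_sub, Prod.snd_sub, Prod.smul_fst, Prod.smul_snd, smul_eq_mul] at hs' ⊢
    exact ⟨hs'.1, by linarith [hs'.2]⟩

theorem IsFollowingPoint.eq_of_isFirstUnstablePoint
    (hw : IsFollowingPoint f (fun t => (z₀ (-t)).1) (fun t => -(z₀ (-t)).2)
      (forcing (fun ξ v => q ξ (-v)) r ε (-t₀)) δ w)
    {T : ℝ} {p w' : Plane}
    (h : IsFirstUnstablePoint (perturbed f q r ε) T z₀ (normalSegment (unperturbed f) (z₀ 0) δ) δ t₀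
      p w') : w' = (w.1, -w.2) := by
  obtain ⟨hS, -, u, hu, hu0, hclose⟩ := h
  obtain ⟨s, -, hs⟩ := mem_normalSegment_iff.1 hS
  have h0 : u (t₀ - 0) = w' := by rw [sub_zero, hu0]
  have hmain := hw.unique (fun t => ((u (t₀ - t)).1, -(u (t₀ - t)).2)) (fun t ht => ?_)
    (fun t ht => ?_) ⟨s, ?_⟩
  · simp only [h0] at hmain
    rw [← hmain]
    ext <;> simp
  · have h1 := hu (t₀ - t) (sub_le_self _ ht)
    have h2 : HasDerivWithinAt (fun t : ℝ => t₀ - t) (-1) (Ici 0) t :=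
      ((hasDerivAt_id t).const_sub t₀).hasDerivWithinAt
    have h3 := HasDerivWithinAt.scomp (h := fun t => t₀ - t) t h1 h2
      fun s hs => sub_le_self _ (mem_Ici.1 hs)
    have h4 := (hasFDerivAt_fst (𝕜 := ℝ) (p := u (t₀ - t))).comp_hasDerivWithinAt t h3
    have h5 := ((hasFDerivAt_snd (𝕜 := ℝ) (p := u (t₀ - t))).comp_hasDerivWithinAt t h3).neg
    refine (h4.prodMk h5).congr_deriv ?_
    have e1 : (t + -t₀) / ε = -((t₀ - t) / ε) := by ring
    simp [perturbed, forcing, e1]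
  · have h1 := (hclose (t₀ - t) (sub_lt_self _ ht)).1
    rw [sub_sub_cancel_left] at h1
    rw [← norm_neg_snd] at h1
    refine le_trans (le_of_eq (congrArg norm ?_)) h1
    ext
    · rfl
    · simp; ring
  · simp only [neg_zero, h0]
    rw [Prod.ext_iff] at hs ⊢
    simp only [Prod.fst_sub, Prod.snd_sub, Prod.smul_fst, Prod.smul_snd, smul_eq_mul] at hs ⊢
    exact ⟨hs.1, by linarith [hs.2]⟩

end sides

namespace ScalarHomoclinic

variable {f : ℝ → ℝ} {a lam : ℝ} {x v : ℝ → ℝ} {q : ℝ → ℝ → ℝ → ℝ} {M L ε₂ r ε : ℝ}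

theorem integrable_mul_bounded (h : ScalarHomoclinic f a lam x v) {w : ℝ → ℝ} (hw : Continuous w)
    {B : ℝ} (hB : ∀ t, |w t| ≤ B) : Integrable fun t => v t * w t :=
  h.integrable_v.mul_bdd (c := B) hw.aestronglyMeasurable (Eventually.of_forall hB)

theorem continuous_forcing_orbit (h : ScalarHomoclinic f a lam x v)
    (hb : AmplitudeBounds q M L ε₂) (hε : 0 < ε) (hε₂ : ε ≤ ε₂) (r t₀ : ℝ) :
    Continuous fun s => forcing q r ε t₀ s (x s, v s) := by
  have hx := h.cont_x
  have hv := h.cont_v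
  exact (hb.continuous_forcing hε hε₂ r t₀).comp
    (by fun_prop : Continuous fun s => ((s, x s, v s) : ℝ × Plane))

/-- Replacing `q (·, ·; ε)` by `q (·, ·; 0)` in the Melnikov integral. -/
theorem abs_integral_forcing_sub_le (h : ScalarHomoclinic f a lam x v)
    (hb : AmplitudeBounds q M L ε₂) (hvM : ∀ t, |v t| ≤ M) (hε : 0 < ε) (hε₂ : ε ≤ ε₂) (r t₀ : ℝ) :
    |(∫ s, v s * forcing q r ε t₀ s (x s, v s))
      - ε ^ r * ∫ s, v s * (q (x s / ε) (v s) 0 * Real.cos ((s + t₀) / ε))|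
      ≤ ε ^ r * (L * ε * ∫ s, |v s|) := by
  have hx := h.cont_x
  have hv := h.cont_v
  have hm0 : (0 : ℝ) ∈ Icc 0 ε₂ := ⟨le_rfl, hb.pos.le⟩
  have hr : 0 < ε ^ r := Real.rpow_pos_of_pos hε r
  have hi1 : Integrable fun s => v s * forcing q r ε t₀ s (x s, v s) :=
    h.integrable_mul_bounded (h.continuous_forcing_orbit hb hε hε₂ r t₀)
      fun t => hb.abs_forcing_le hε hε₂ r t₀ t (hvM t)
  have hc2 : Continuous fun s => q (x s / ε) (v s) 0 * Real.cos ((s + t₀) / ε) := by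
    have := (hb.cont 0 hm0).comp (by fun_prop : Continuous fun s => ((x s / ε, v s) : ℝ × ℝ))
    exact this.mul (by fun_prop)
  have hi2 : Integrable fun s => v s * (q (x s / ε) (v s) 0 * Real.cos ((s + t₀) / ε)) := by
    refine h.integrable_mul_bounded hc2 (B := L) fun t => ?_
    rw [abs_mul]
    exact (mul_le_of_le_one_right (abs_nonneg _) (Real.abs_cos_le_one _)).trans
      (hb.bound 0 hm0 _ _ (hvM t))
  rw [← integral_const_mul, ← integral_sub hi1 (hi2.const_mul _), ← integral_const_mul,
    ← integral_const_mul]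
  refine abs_integral_le_integral_abs.trans (integral_mono (hi1.sub (hi2.const_mul _)).abs
    ((h.integrable_v.abs.const_mul _).const_mul _) fun s => ?_)
  have e : v s * forcing q r ε t₀ s (x s, v s)
      - ε ^ r * (v s * (q (x s / ε) (v s) 0 * Real.cos ((s + t₀) / ε)))
      = ε ^ r * (v s * ((q (x s / ε) (v s) ε - q (x s / ε) (v s) 0)
        * Real.cos ((s + t₀) / ε))) := by
    unfold forcing; ring
  change |v s * forcing q r ε t₀ s (x s, v s)
      - ε ^ r * (v s * (q (x s / ε) (v s) 0 * Real.cos ((s + t₀) / ε)))| ≤ _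
  rw [e, abs_mul, abs_of_pos hr, abs_mul, abs_mul, mul_comm |v s|]
  refine mul_le_mul_of_nonneg_left (mul_le_mul_of_nonneg_right ?_ (abs_nonneg _)) hr.le
  exact (mul_le_of_le_one_right (abs_nonneg _) (Real.abs_cos_le_one _)).trans
    (hb.sub_zero ε ⟨hε.le, hε₂⟩ _ _ (hvM s))

end ScalarHomoclinic

theorem phaseSum_eq_modeSum {f : ℝ → ℝ} {q : ℝ → ℝ → ℝ → ℝ} {z₀ : ℝ → Plane} {k : ℤ}
    (ε : ℝ) :
    phaseSum f q z₀ ε k = ScalarHomoclinic.modeSum (fun p => q p.1 p.2 0) f (fun t => (z₀ t).1)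
      (fun t => (z₀ t).2) ε k := by
  unfold phaseSum ScalarHomoclinic.modeSum
  change _ = _ * ∑ᶠ t ∈ criticalSet z₀ k, _
  rw [mul_finsum_mem]
  refine finsum_mem_congr rfl fun t _ => ?_
  rw [phaseTerm, ScalarHomoclinic.criticalTerm, mul_div_assoc]
  rfl

/-- For small `ε` the displacement function is well defined and close to the Melnikov integral. -/
theorem exists_displacement {r ε₁ : ℝ} {f : ℝ → ℝ} {q : ℝ → ℝ → ℝ → ℝ} (hε₁ : 0 < ε₁)
    (hq : ContDiffOn ℝ 1 (fun p : ℝ × ℝ × ℝ => q p.1 p.2.1 p.2.2) {p | p.2.2 ∈ Set.Ico 0 ε₁})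
    (hq3 : ∀ ε ∈ Set.Ico 0 ε₁, ContDiff ℝ 3 (fun p : ℝ × ℝ => q p.1 p.2 ε))
    (hper : ∀ ε ∈ Set.Ico 0 ε₁, ∀ ξ v : ℝ, q (ξ + 2 * Real.pi) v ε = q ξ v ε)
    {e : Plane} {z₀ : ℝ → Plane} {lam : ℝ} (he2 : e.2 = 0)
    (h : ScalarHomoclinic f e.1 lam (fun t => (z₀ t).1) (fun t => (z₀ t).2)) :
    ∃ M L, AmplitudeBounds q M L (ε₁ / 2) ∧ (∀ t, |(z₀ t).2| ≤ M) ∧ ∃ δ₀ > 0, ∃ κ > 0, ∃ ε₃ > 0,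
      ∃ C > 0, ∀ ε, 0 < ε → ε ≤ ε₃ → ε ^ (r - 1) * L ≤ κ → ε ^ r * L ≤ κ → ∀ t₀, ∃ d,
        |d - ∫ s, (z₀ s).2 * forcing q r ε t₀ s (z₀ s)|
          ≤ C * ((ε ^ r * L) ^ 2 + ε ^ (r - 1) * L * (ε ^ r * L)) ∧
        ∀ δ, 0 < δ → δ ≤ δ₀ → ε ^ r * L ≤ κ * δ →
          ∀ d', IsDisplacement f q r e z₀ δ ε t₀ d' ↔ d' = d := by
  obtain ⟨R, hR, δ₁, hδ₁, κ₁, hκ₁, C₁, hC₁, hst⟩ := h.exists_stable_point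
  obtain ⟨R', hR', δ₂, hδ₂, κ₂, hκ₂, C₂, hC₂, hun⟩ := h.reverse.exists_stable_point
  obtain ⟨ρ, hρ, κ₃, hκ₃, T₀, hT₀, C₃, hC₃, hfix⟩ :=
    exists_hyperbolicFixedPoint_near_saddle h.contDiff h.pos h.zero h.deriv_eq
  obtain ⟨V, hV0, hV⟩ := h.bounded_v
  obtain ⟨L, hb⟩ := exists_amplitudeBounds hε₁ hq hq3 hper (V + R + R' + ρ)
  set M := V + R + R' + ρ with hM
  have hee : ((e.1, 0) : Plane) = e := by rw [← he2]
  rw [hee] at hfix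
  have htop : Tendsto z₀ atTop (𝓝 e) := by
    have := h.x_top.prodMk_nhds h.v_top
    rwa [hee] at this
  have hbot : Tendsto z₀ atBot (𝓝 e) := by
    have := h.x_bot.prodMk_nhds h.v_bot
    rwa [hee] at this
  have hvM : ∀ t, |(z₀ t).2| ≤ M := fun t => (hV t).trans (by rw [hM]; linarith)
  have hκ : 0 < min (min κ₁ κ₂) (min κ₃ (min (ρ / C₃) (1 / C₃))) := by positivity
  have hε₃ : 0 < min 1 (min (ε₁ / 2) (T₀ / (2 * Real.pi))) := by
    have := Real.pi_pos
    positivity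
  refine ⟨M, L, hb, hvM, min (min δ₁ δ₂) (ρ / 4), by positivity, _, hκ, _, hε₃, C₁ + C₂,
    by positivity, ?_⟩
  set κ := min (min κ₁ κ₂) (min κ₃ (min (ρ / C₃) (1 / C₃))) with hκdef
  have k1 : κ ≤ κ₁ := (min_le_left _ _).trans (min_le_left _ _)
  have k2 : κ ≤ κ₂ := (min_le_left _ _).trans (min_le_right _ _)
  have k3 : κ ≤ κ₃ := (min_le_right _ _).trans (min_le_left _ _)
  have k4 : C₃ * κ ≤ ρ := by
    rw [← le_div_iff₀' hC₃]
    exact (min_le_right _ _).trans ((min_le_right _ _).trans (min_le_left _ _))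
  have k5 : C₃ * κ ≤ 1 := by
    rw [← le_div_iff₀' hC₃]
    exact (min_le_right _ _).trans ((min_le_right _ _).trans (min_le_right _ _))
  clear_value κ
  intro ε hε hε3 hℓ hm t₀
  have hε1 : ε ≤ 1 := hε3.trans (min_le_left _ _)
  have hε2 : ε ≤ ε₁ / 2 := hε3.trans ((min_le_right _ _).trans (min_le_left _ _))
  have hεT : 2 * Real.pi * ε ≤ T₀ := by
    rw [← le_div_iff₀' Real.two_pi_pos]
    exact hε3.trans ((min_le_right _ _).trans (min_le_right _ _))
  have hr0 : 0 < ε ^ r := Real.rpow_pos_of_pos hε r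
  have hr1 : 0 < ε ^ (r - 1) := Real.rpow_pos_of_pos hε _
  have hL0 := hb.nonneg
  have hm0 : 0 ≤ ε ^ r * L := by positivity
  have hℓ0 : 0 ≤ ε ^ (r - 1) * L := by positivity
  have htube : ∀ {R₀ : ℝ} {c z : Plane}, R₀ ≤ R + R' + ρ → |c.2| ≤ V → ‖z - c‖ ≤ R₀ → |z.2| ≤ M := by
    intro R₀ c z hR₀ hc hz
    have h1 : |z.2 - c.2| ≤ R₀ := (norm_snd_le (z - c)).trans hz
    have h2 := abs_sub_abs_le_abs_sub z.2 c.2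
    rw [hM]
    linarith
  have hRle : R ≤ R + R' + ρ := by linarith
  have hRle' : R' ≤ R + R' + ρ := by linarith
  obtain ⟨ws, hws, hws'⟩ := hst (forcing q r ε t₀) _ _ (hb.continuous_forcing hε hε2 r t₀) hℓ0
    (hℓ.trans k1) (fun t z z' hz hz' => hb.abs_forcing_sub_le hε hε1 hε2 r t₀ t
      (htube hRle (hV t) hz) (htube hRle (hV t) hz'))
    (fun t z hz => hb.abs_forcing_le hε hε2 r t₀ t (htube hRle (hV t) hz)) (hm.trans k1)
  have hV' : ∀ t, |-(z₀ (-t)).2| ≤ V := fun t => by rw [abs_neg]; exact hV _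
  obtain ⟨wu, hwu, hwu'⟩ := hun (forcing (fun ξ v => q ξ (-v)) r ε (-t₀)) _ _
    (hb.reflect.continuous_forcing hε hε2 r (-t₀)) hℓ0
    (hℓ.trans k2) (fun t z z' hz hz' => hb.reflect.abs_forcing_sub_le hε hε1 hε2 r (-t₀) t
      (htube hRle' (hV' t) hz) (htube hRle' (hV' t) hz'))
    (fun t z hz => hb.reflect.abs_forcing_le hε hε2 r (-t₀) t (htube hRle' (hV' t) hz)) (hm.trans k2)
  refine ⟨cross (unperturbed f (z₀ 0)) ((wu.1, -wu.2) - ws), ?_, ?_⟩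
  · have hint : Integrable fun s => (z₀ s).2 * forcing q r ε t₀ s (z₀ s) :=
      h.integrable_mul_bounded (h.continuous_forcing_orbit hb hε hε2 r t₀)
        fun t => hb.abs_forcing_le hε hε2 r t₀ t (hvM t)
    have hrefl : (∫ t in Ioi (0 : ℝ), -(z₀ (-t)).2 * forcing (fun ξ v => q ξ (-v)) r ε (-t₀) t
        ((z₀ (-t)).1, -(z₀ (-t)).2)) = -∫ t in Iic (0 : ℝ), (z₀ t).2 * forcing q r ε t₀ t (z₀ t) := by
      have h1 := integral_comp_neg_Ioi (0 : ℝ) fun t => (z₀ t).2 * forcing q r ε t₀ t (z₀ t)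
      rw [neg_zero] at h1
      rw [← h1, ← integral_neg]
      congr 1
      funext t
      have e1 : (t + -t₀) / ε = -((-t + t₀) / ε) := by ring
      simp only [forcing, neg_neg, e1, Real.cos_neg]
      ring
    rw [hrefl] at hwu
    simp only [neg_zero] at hwu
    have hsplit := intervalIntegral.integral_Iic_add_Ioi (b := (0 : ℝ)) hint.integrableOn
      hint.integrableOn
    change |(z₀ 0).2 * (ws - z₀ 0).2 - f (z₀ 0).1 * (ws - z₀ 0).1
      + ∫ t in Ioi (0 : ℝ), (z₀ t).2 * forcing q r ε t₀ t (z₀ t)| ≤ _ at hws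
    rw [← hsplit]
    set I₁ := ∫ t in Ioi (0 : ℝ), (z₀ t).2 * forcing q r ε t₀ t (z₀ t)
    set I₂ := ∫ t in Iic (0 : ℝ), (z₀ t).2 * forcing q r ε t₀ t (z₀ t)
    clear_value I₁ I₂
    simp only [cross, unperturbed, Prod.fst_sub, Prod.snd_sub] at hws hwu ⊢
    rw [add_mul]
    rw [abs_le] at hws hwu ⊢
    constructor <;> nlinarith [hws.1, hws.2, hwu.1, hwu.2]
  · intro δ hδ hδ₀ hmδ d'
    have d1 : δ ≤ δ₁ := hδ₀.trans ((min_le_left _ _).trans (min_le_left _ _))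
    have d2 : δ ≤ δ₂ := hδ₀.trans ((min_le_left _ _).trans (min_le_right _ _))
    have d3 : δ ≤ ρ / 4 := hδ₀.trans (min_le_right _ _)
    have hfs := hws' δ hδ d1 (hmδ.trans (mul_le_mul_of_nonneg_right k1 hδ.le))
    have hfu := hwu' δ hδ d2 (hmδ.trans (mul_le_mul_of_nonneg_right k2 hδ.le))
    constructor
    · rintro ⟨p, zs, zu, -, -, hzs, hzu, rfl⟩
      rw [hfs.eq_of_isFirstStablePoint hzs, hfu.eq_of_isFirstUnstablePoint hzu]
    · rintro rfl
      have hεd : ε ∈ Ico 0 ε₁ := ⟨hε.le, hε2.trans_lt (half_lt_self hε₁)⟩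
      have hball : ∀ z ∈ Metric.closedBall e ρ, |z.2| ≤ M := fun z hz => by
        rw [Metric.mem_closedBall, dist_eq_norm] at hz
        exact htube (c := e) (by linarith) (by rw [he2, abs_zero]; exact hV0.le) hz
      obtain ⟨p, hp, hpe, hps, hpu⟩ := hfix (fun t => Real.cos (t / ε))
        (fun z => ε ^ r * q (z.1 / ε) z.2 ε) (2 * Real.pi * ε) (ε ^ (r - 1) * L) (ε ^ r * L)
        (by fun_prop) (fun t => Real.abs_cos_le_one _)
        (fun t => by
          have : (t + 2 * Real.pi * ε) / ε = t / ε + 2 * Real.pi := by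
            field_simp
          simp only [this, Real.cos_add_two_pi])
        (contDiff_const.mul (((hq3 ε hεd).of_le (by norm_num)).comp
          ((contDiff_fst.div_const ε).prodMk contDiff_snd)))
        (fun z hz w hw => hb.abs_amplitude_sub_le hε hε1 hε2 r (hball z hz) (hball w hw))
        (hℓ.trans k3) (by
          rw [abs_mul, abs_of_pos hr0]
          gcongr
          exact hb.bound ε ⟨hε.le, hε2⟩ _ _ (hball e (Metric.mem_closedBall_self hρ.le)))
        (by have := Real.pi_pos; positivity) hεT
        ((mul_le_mul_of_nonneg_left hm hC₃.le).trans k4) (perturbed f q r ε)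
        (fun t z => by simp only [perturbed]; ring_nf) t₀
      refine ⟨p, ws, (wu.1, -wu.2), hp, ?_, hfs.isFirstStablePoint htop hρ d3 hps,
        hfu.isFirstUnstablePoint hbot hρ d3 hpu, rfl⟩
      refine hpe.trans ((mul_le_mul_of_nonneg_left hmδ hC₃.le).trans ?_)
      rw [← mul_assoc]
      exact mul_le_of_le_one_left hδ.le k5

end Melnikov

theorem theorem1 (r : ℝ) (hr : 5 / 2 < r)
    (f : ℝ → ℝ) (hf : ContDiff ℝ 3 f)
    (q : ℝ → ℝ → ℝ → ℝ) (ε₁ : ℝ) (hε₁ : 0 < ε₁)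
    (hq : ContDiffOn ℝ 1 (fun p : ℝ × ℝ × ℝ => q p.1 p.2.1 p.2.2) {p | p.2.2 ∈ Set.Ico 0 ε₁})
    (hq3 : ∀ ε ∈ Set.Ico 0 ε₁, ContDiff ℝ 3 (fun p : ℝ × ℝ => q p.1 p.2 ε))
    (hper : ∀ ε ∈ Set.Ico 0 ε₁, ∀ ξ v : ℝ, q (ξ + 2 * Real.pi) v ε = q ξ v ε)
    (e : Melnikov.Plane)
    (he : Melnikov.IsHyperbolicEquilibrium (Melnikov.unperturbed f) e)
    (z₀ : ℝ → Melnikov.Plane)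
    (hz₀ : Melnikov.IsHomoclinic (Melnikov.unperturbed f) e z₀)
    (hnd : ∀ k : ℤ, k ≠ 0 → ∀ t ∈ Melnikov.criticalSet z₀ k, f (z₀ t).1 ≠ 0) :
    (∃ N : ℕ, ∀ k : ℤ, k ≠ 0 → (Melnikov.criticalSet z₀ k).encard ≤ N) ∧
    (∀ ε : ℝ, 0 < ε →
      Summable (fun k : {k : ℤ // k ≠ 0} => Melnikov.phaseSum f q z₀ ε k)) ∧
    ∃ (D : ℝ → ℝ → ℝ) (C δ₀ : ℝ), 0 < δ₀ ∧ ∀ δ : ℝ, 0 < δ → δ ≤ δ₀ →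
      ∃ ε₀ : ℝ, 0 < ε₀ ∧ ε₀ ≤ ε₁ ∧ ∀ ε : ℝ, 0 < ε → ε < ε₀ → ∀ t₀ : ℝ,
        (∀ d : ℝ, Melnikov.IsDisplacement f q r e z₀ δ ε t₀ d ↔ d = D ε t₀) ∧
        |D ε t₀ - ε ^ (r + 1 / 2) * (Melnikov.coeffA f q z₀ ε * Real.cos (t₀ / ε)
            + Melnikov.coeffB f q z₀ ε * Real.sin (t₀ / ε))|
          ≤ C * (ε ^ (r + 1) + ε ^ (2 * r - 2)) := by
  obtain ⟨he2, lam, h⟩ := hz₀.scalarHomoclinic hf he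
  obtain ⟨c, m, P, b, hp⟩ := h.exists_phaseConstants hnd
  have h0 : (0 : ℝ) ∈ Ico 0 ε₁ := ⟨le_rfl, hε₁⟩
  have hsum := hp.exists_norm_modeSum_le h (hq3 0 h0) (hper 0 h0)
  obtain ⟨C₁, hC₁, hmel⟩ := hp.exists_melnikov_asymptotics h (hq3 0 h0) (hper 0 h0)
  simp only [← Melnikov.phaseSum_eq_modeSum] at hsum hmel
  refine ⟨hp.exists_encard_le h, fun ε hε => ?_, ?_⟩
  · obtain ⟨B, -, hB⟩ := hsum
    exact Summable.of_norm_bounded (g := fun k : {k : ℤ // k ≠ 0} => B * (1 / ((k : ℤ) : ℝ) ^ 2))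
      ((Melnikov.summable_one_div_int_sq.subtype _).mul_left _)
      fun k => by rw [mul_one_div]; exact hB k k.2 ε
  obtain ⟨M, L, hb, hvM, δ₀, hδ₀, κ, hκ, ε₃, hε₃, C₂, hC₂, hdis⟩ :=
    Melnikov.exists_displacement (r := r) hε₁ hq hq3 hper he2 h
  have hL := hb.nonneg
  have hI : 0 ≤ ∫ s, |(z₀ s).2| := integral_nonneg fun _ => abs_nonneg _
  have hchoice : ∀ ε t₀ : ℝ, ∃ d : ℝ, 0 < ε → ε ≤ ε₃ → ε ^ (r - 1) * L ≤ κ → ε ^ r * L ≤ κ →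
      |d - ∫ s, (z₀ s).2 * Melnikov.forcing q r ε t₀ s (z₀ s)|
          ≤ C₂ * ((ε ^ r * L) ^ 2 + ε ^ (r - 1) * L * (ε ^ r * L)) ∧
        ∀ δ, 0 < δ → δ ≤ δ₀ → ε ^ r * L ≤ κ * δ →
          ∀ d', Melnikov.IsDisplacement f q r e z₀ δ ε t₀ d' ↔ d' = d := by
    intro ε t₀
    by_cases hc : 0 < ε ∧ ε ≤ ε₃ ∧ ε ^ (r - 1) * L ≤ κ ∧ ε ^ r * L ≤ κ
    · obtain ⟨d, hd⟩ := hdis ε hc.1 hc.2.1 hc.2.2.1 hc.2.2.2 t₀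
      exact ⟨d, fun _ _ _ _ => hd⟩
    · exact ⟨0, fun h1 h2 h3 h4 => absurd ⟨h1, h2, h3, h4⟩ hc⟩
  choose D hD using hchoice
  refine ⟨D, 2 * C₂ * L ^ 2 + L * (∫ s, |(z₀ s).2|) + C₁, δ₀, hδ₀, fun δ hδ hδδ => ?_⟩
  have hsmall : ∀ s : ℝ, 0 < s → ∀ η : ℝ, 0 < η → ∀ᶠ ε in 𝓝[>] (0 : ℝ), ε ^ s * L ≤ η := by
    intro s hs η hη
    have h1 : Tendsto (fun ε : ℝ => ε ^ s * L) (𝓝[>] 0) (𝓝 0) := by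
      have h2 := (Real.continuousAt_rpow_const 0 s (Or.inr hs.le)).tendsto.mono_left
        (nhdsWithin_le_nhds (s := Ioi 0))
      rw [Real.zero_rpow hs.ne'] at h2
      simpa using h2.mul_const L
    filter_upwards [h1.eventually (gt_mem_nhds hη)] with ε hε using hε.le
  have hev := ((hsmall (r - 1) (by linarith) κ hκ).and (hsmall r (by linarith) κ hκ)).and
    (hsmall r (by linarith) (κ * δ) (by positivity))
  obtain ⟨ε₄, hε₄, hεs⟩ := mem_nhdsGT_iff_exists_Ioo_subset.1 hev
  refine ⟨min (min ε₁ 1) (min (ε₁ / 2) (min ε₃ ε₄)), by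
    have := mem_Ioi.1 hε₄
    positivity, (min_le_left _ _).trans (min_le_left _ _), fun ε hε hlt t₀ => ?_⟩
  rw [lt_min_iff, lt_min_iff, lt_min_iff, lt_min_iff] at hlt
  obtain ⟨⟨-, hε1⟩, hε2, hε3, hε4⟩ := hlt
  obtain ⟨⟨hs1, hs2⟩, hs3⟩ := hεs ⟨hε, hε4⟩
  obtain ⟨hd1, hd2⟩ := hD ε t₀ hε hε3.le hs1 hs2
  refine ⟨hd2 δ hδ hδδ hs3, ?_⟩
  have e1 := h.abs_integral_forcing_sub_le hb hvM hε hε2.le r t₀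
  have e2 := hmel ε t₀ hε
  set J := ∫ s, (z₀ s).2 * (q ((z₀ s).1 / ε) (z₀ s).2 0 * Real.cos ((s + t₀) / ε))
  set S := ∑' k : {k : ℤ // k ≠ 0}, Melnikov.phaseSum f q z₀ ε k with hS
  change |(∫ s, (z₀ s).2 * Melnikov.forcing q r ε t₀ s (z₀ s)) - ε ^ r * J| ≤ _ at e1
  set I := ∫ s, (z₀ s).2 * Melnikov.forcing q r ε t₀ s (z₀ s)
  set N := ∫ s, |(z₀ s).2|
  have hr0 : 0 < ε ^ r := Real.rpow_pos_of_pos hε r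
  have p1 : ε ^ (r + 1) = ε ^ r * ε := Real.rpow_add_one hε.ne' r
  have p2 : ε ^ (r + 1 / 2) = ε ^ r * Real.sqrt ε := by
    rw [Real.rpow_add hε, Real.sqrt_eq_rpow]
  have p3 : (ε ^ r) ^ 2 ≤ ε ^ (2 * r - 2) := by
    rw [← Real.rpow_natCast, ← Real.rpow_mul hε.le]
    exact Real.rpow_le_rpow_of_exponent_ge hε hε1.le (by push_cast; linarith)
  have p4 : ε ^ (r - 1) * ε ^ r ≤ ε ^ (2 * r - 2) := by
    rw [← Real.rpow_add hε]
    exact Real.rpow_le_rpow_of_exponent_ge hε hε1.le (by linarith)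
  have e3 : |ε ^ r * J - ε ^ (r + 1 / 2) * (Melnikov.coeffA f q z₀ ε * Real.cos (t₀ / ε)
      + Melnikov.coeffB f q z₀ ε * Real.sin (t₀ / ε))| ≤ C₁ * ε ^ (r + 1) := by
    have e4 : ε ^ r * J - ε ^ (r + 1 / 2) * (Melnikov.coeffA f q z₀ ε * Real.cos (t₀ / ε)
      + Melnikov.coeffB f q z₀ ε * Real.sin (t₀ / ε)) = ε ^ r * (J - Real.sqrt (2 * Real.pi * ε) *
        (S.re * Real.cos (t₀ / ε) + S.im * Real.sin (t₀ / ε))) := by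
      rw [p2, Melnikov.coeffA, Melnikov.coeffB, ← hS, Real.sqrt_mul Real.two_pi_pos.le]
      ring
    rw [e4, abs_mul, abs_of_pos hr0, p1]
    calc _ ≤ ε ^ r * (C₁ * ε) := mul_le_mul_of_nonneg_left e2 hr0.le
      _ = _ := by ring
  have e5 : C₂ * ((ε ^ r * L) ^ 2 + ε ^ (r - 1) * L * (ε ^ r * L))
      ≤ 2 * C₂ * L ^ 2 * ε ^ (2 * r - 2) := by
    calc _ = C₂ * L ^ 2 * ((ε ^ r) ^ 2 + ε ^ (r - 1) * ε ^ r) := by ring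
      _ ≤ C₂ * L ^ 2 * (ε ^ (2 * r - 2) + ε ^ (2 * r - 2)) := by gcongr
      _ = _ := by ring
  have e6 : ε ^ r * (L * ε * N) = L * N * ε ^ (r + 1) := by rw [p1]; ring
  rw [e6] at e1
  have q1 : 0 ≤ ε ^ (r + 1) := Real.rpow_nonneg hε.le _
  have q2 : 0 ≤ ε ^ (2 * r - 2) := Real.rpow_nonneg hε.le _
  have s1 := abs_sub_le (D ε t₀) I (ε ^ (r + 1 / 2) * (Melnikov.coeffA f q z₀ ε * Real.cos (t₀ / ε)
      + Melnikov.coeffB f q z₀ ε * Real.sin (t₀ / ε)))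
  have s2 := abs_sub_le I (ε ^ r * J) (ε ^ (r + 1 / 2) * (Melnikov.coeffA f q z₀ ε
      * Real.cos (t₀ / ε) + Melnikov.coeffB f q z₀ ε * Real.sin (t₀ / ε)))
  have t1 : 0 ≤ 2 * C₂ * L ^ 2 * ε ^ (r + 1) := by positivity
  have t2 : 0 ≤ (L * N + C₁) * ε ^ (2 * r - 2) := by positivity
  linarith
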